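/- **Setting.** Let $n\ge 3$, let $\Omega\subset\mathbb R^n$ be a bounded domain (open, connected) with $C^2$ boundary, let $N$ be the outward unit normal on $\partial\Omega$, and let $dQ$ be surface measure on $\partial\Omega$. Put $$E(x)=-\frac{1}{(n-2)\,\omega_n\,|x|^{n-2}},\qquad \Gamma(x,t)=\begin{cases}(2\pi t)^{-n/2}e^{-|x|^2/(2t)},&t>0,\\0,&t\le 0,\end{cases}$$ where $\omega_n$ is the area of the unit sphere of $\mathbb R^n$. For $Q\in\partial\Omega$, $x\in\Omega$ and $t>0$, let $$\kappa_Q(x,t)=\int_{\partial\Omega}\frac{\partial}{\partial N(P)}\Gamma(x-P,t)\,E(P-Q)\,dP$$ (the normal derivative is taken with respect to $P$), and define the single layer potential and the surface potential $$\mathbf S(f)(x,t)=\int_{\partial\Omega}E(x-Q)f(Q,t)\,dQ,\qquad \mathbf T(f)(x,t)=\int_0^t\!\!\int_{\partial\Omega}\kappa_Q(x,t-s)f(Q,s)\,dQ\,ds .$$ For $x\in\Omega$ let $P_x\in\partial\Omega$ be a nearest boundary point of $x$, and let $v_T=v-(v\cdot N(P_x))N(P_x)$ be the tangential part of a vector $v$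 at $x$. Fix $r_0>0$. For $0<T\le\infty$ and $f:\mathbb R\to\mathbb R$ let $$\|f\|_{logDini}=\int_0^{r_0}\sup_{0<t<T}\omega(f)(r,t)\,\frac{|\ln r|}{r}\,dr,\qquad \omega(f)(r,t)=\sup\{|f(s)-f(t)|:\ |s-t|<r,\ s<T\}.$$ **Theorem.** There is a constant $C$ depending only on $\Omega$ (and on the fixed $r_0$) such that the following holds for every $0<T\le\infty$. Let $g$ be a bounded measurable $\mathbb R^n$-valued function on $\partial\Omega\times(0,T)$, let $g_N(Q,t)=g(Q,t)\cdot N(Q)$ for $0<t<T$ and $g_N(Q,t)=0$ for $t\le0$, and suppose that $\|g_N(Q,\cdot)\|_{logDini}<\infty$ for every $Q\in\partial\Omega$. Then $\mathbf S(g_N)(\cdot,t)$ and $\mathbf T(g_N)(\cdot,t)$ are differentiable in $\Omega$ for every $t\in(0,T)$, and for all $(x,t)\in\Omega\times(0,T)$ and every nearest boundary point $P_x$ of $x$, $$\big|\nabla\mathbf S(g_N)_T(x,t)+\nabla\mathbf T(g_N)_T(x,t)\big|\le C\Big(\|g_N\|_{L^\infty(\partial\Omega\times(0,T))}+\sup_{Q\in\partial\Omega}\|g_N(Q,\cdot)\|_{logDini}\Big).$$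 -/

import Mathlib

open Set MeasureTheory Filter Topology
open scoped ENNReal NNReal RealInnerProductSpace

noncomputable section

/-- The Euclidean space `ℝⁿ`. -/
abbrev Space (n : ℕ) := EuclideanSpace ℝ (Fin n)

namespace Stokes

variable {n : ℕ}

/-! ### Bounded `C²` domains -/

/-- The boundary of `Ω` is of class `C²`: near each boundary point `P`, there is a unit vector `ν`
such that `Ω` is the set of points lying strictly above (in the direction `ν`) the graph of a
`C²` function of the component orthogonal to `ν`. -/
def HasC2Boundary (Ω : Set (Space n)) : Prop :=
  ∀ P ∈ frontier Ω, ∃ r : ℝ, 0 < r ∧ ∃ ν : Space n, ‖ν‖ = 1 ∧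
    ∃ Φ : Space n → ℝ, ContDiff ℝ 2 Φ ∧
      ∀ y ∈ Metric.ball P r, (y ∈ Ω ↔ Φ (y - ⟪ν, y⟫ • ν) < ⟪ν, y⟫)

/-- A bounded `C²` domain: a bounded connected (in particular nonempty) open set
with `C²` boundary. -/
structure IsBoundedC2Domain (Ω : Set (Space n)) : Prop where
  isOpen : IsOpen Ω
  isConnected : IsConnected Ω
  isBounded : Bornology.IsBounded Ω
  c2 : HasC2Boundary Ω

/-- `v` is the outward unit normal to `Ω` at `P`: it has length one and, to first order at `P`,
`Ω` lies in the half space `{y | ⟪y - P, v⟫ ≤ 0}` and the complement of `Ω` in the half space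
`{y | 0 ≤ ⟪y - P, v⟫}`. -/
def IsOutwardUnitNormal (Ω : Set (Space n)) (P v : Space n) : Prop :=
  ‖v‖ = 1 ∧ ∀ ε : ℝ, 0 < ε → ∀ᶠ y in 𝓝 P,
    (y ∈ Ω → ⟪y - P, v⟫ ≤ ε * ‖y - P‖) ∧ (y ∉ Ω → -(ε * ‖y - P‖) ≤ ⟪y - P, v⟫)

open Classical in
/-- The outward unit normal field `N` of `Ω` (see `existsUnique_isOutwardUnitNormal`; the value
at points without a normal is irrelevant and set to `0`). -/
def outwardNormal (Ω : Set (Space n)) (P : Space n) : Space n :=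
  if h : ∃ v, IsOutwardUnitNormal Ω P v then h.choose else 0

/-- A set with a `C¹` defining function of nonvanishing gradient has a unique outward normal. -/
theorem existsUnique_of_definingFunction {Ω : Set (Space n)} {P G : Space n} {ψ : Space n → ℝ}
    (hψ : HasGradientAt ψ G P) (hG : G ≠ 0) (h0 : ψ P = 0)
    (hΩ : ∀ᶠ y in 𝓝 P, (y ∈ Ω ↔ ψ y < 0)) : ∃! v, IsOutwardUnitNormal Ω P v := by
  have hGn : 0 < ‖G‖ := norm_pos_iff.mpr hG
  refine ⟨‖G‖⁻¹ • G, ⟨by rw [norm_smul, norm_inv, norm_norm, inv_mul_cancel₀ hGn.ne'], ?_⟩, ?_⟩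
  · intro ε hε
    have h1 := (hasGradientAt_iff_isLittleO.mp hψ).def (mul_pos hε hGn)
    filter_upwards [h1, hΩ] with y hy hy2
    rw [h0, sub_zero, Real.norm_eq_abs, abs_le] at hy
    rw [inner_smul_right, real_inner_comm]
    have e : ∀ a : ℝ, ‖G‖⁻¹ * (‖G‖ * a) = a := fun a => inv_mul_cancel_left₀ hGn.ne' a
    constructor
    · intro hyΩ
      have := hy2.mp hyΩ
      rw [← e (ε * ‖y - P‖)]
      refine mul_le_mul_of_nonneg_left ?_ (inv_nonneg.mpr hGn.le)
      linarith [hy.1, hy.2]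
    · intro hyΩ
      have := not_lt.mp (fun h => hyΩ (hy2.mpr h))
      rw [← e (ε * ‖y - P‖), ← mul_neg]
      refine mul_le_mul_of_nonneg_left ?_ (inv_nonneg.mpr hGn.le)
      linarith [hy.1, hy.2]
  · rintro v ⟨hv1, hv⟩
    -- the values of `ψ` along a line through `P`
    have line : ∀ d : Space n, HasDerivAt (fun t : ℝ => ψ (P + t • d)) ⟪G, d⟫ 0 := by
      intro d
      have hf : HasFDerivAt ψ (InnerProductSpace.toDual ℝ (Space n) G) (P + (0 : ℝ) • d) := by
        simpa using hψ.hasFDerivAt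
      have hl : HasDerivAt (fun t : ℝ => P + t • d) d 0 := by
        simpa using ((hasDerivAt_id (0 : ℝ)).smul_const d).const_add P
      have h := hf.comp_hasDerivAt (0 : ℝ) hl
      rw [InnerProductSpace.toDual_apply_apply] at h
      exact h
    have tend : ∀ d : Space n, Tendsto (fun t : ℝ => P + t • d) (𝓝[>] 0) (𝓝 P) := by
      intro d
      have : Continuous (fun t : ℝ => P + t • d) := by fun_prop
      have := this.tendsto 0
      simp only [zero_smul, add_zero] at this
      exact this.mono_left nhdsWithin_le_nhds
    have neg : ∀ d : Space n, ⟪G, d⟫ < 0 → ⟪d, v⟫ ≤ 0 := by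
      intro d hd
      refine le_of_forall_pos_le_add fun δ hδ => ?_
      have hs := ((hasDerivAt_iff_tendsto_slope.mp (line d)).mono_left
        (nhdsWithin_mono 0 (fun t (ht : t ∈ Ioi (0 : ℝ)) => (mem_Ioi.mp ht).ne'))).eventually (gt_mem_nhds hd)
      have hε : 0 < δ / (‖d‖ + 1) := by positivity
      obtain ⟨t, ⟨⟨h1, h2⟩, h3⟩, ht⟩ := ((hs.and ((tend d).eventually hΩ)).and
        ((tend d).eventually (hv _ hε))).and (self_mem_nhdsWithin (s := Ioi (0 : ℝ))) |>.exists
      have ht' : (0 : ℝ) < t := ht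
      have hneg : ψ (P + t • d) < 0 := by
        simp only [slope_def_field, zero_smul, add_zero, h0, sub_zero] at h1
        by_contra hc
        exact absurd (div_nonneg (not_lt.mp hc) ht'.le) (not_le.mpr h1)
      have h4 := h3.1 (h2.mpr hneg)
      rw [add_sub_cancel_left, real_inner_smul_left, norm_smul, Real.norm_of_nonneg ht'.le] at h4
      have h5 : ⟪d, v⟫ ≤ δ / (‖d‖ + 1) * ‖d‖ := by
        refine le_of_mul_le_mul_left ?_ ht'
        linarith
      have h6 : δ / (‖d‖ + 1) * ‖d‖ ≤ δ := by
        rw [div_mul_eq_mul_div, div_le_iff₀ (by positivity)]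
        nlinarith [norm_nonneg d]
      linarith
    have pos : ∀ d : Space n, 0 < ⟪G, d⟫ → 0 ≤ ⟪d, v⟫ := by
      intro d hd
      refine le_of_forall_pos_le_add fun δ hδ => ?_
      have hs := ((hasDerivAt_iff_tendsto_slope.mp (line d)).mono_left
        (nhdsWithin_mono 0 (fun t (ht : t ∈ Ioi (0 : ℝ)) => (mem_Ioi.mp ht).ne'))).eventually (lt_mem_nhds hd)
      have hε : 0 < δ / (‖d‖ + 1) := by positivity
      obtain ⟨t, ⟨⟨h1, h2⟩, h3⟩, ht⟩ := ((hs.and ((tend d).eventually hΩ)).and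
        ((tend d).eventually (hv _ hε))).and (self_mem_nhdsWithin (s := Ioi (0 : ℝ))) |>.exists
      have ht' : (0 : ℝ) < t := ht
      have hpos : ¬ ψ (P + t • d) < 0 := by
        simp only [slope_def_field, zero_smul, add_zero, h0, sub_zero] at h1
        intro hc
        exact absurd (div_neg_of_neg_of_pos hc ht') (not_lt.mpr h1.le)
      have h4 := h3.2 (fun h => hpos (h2.mp h))
      rw [add_sub_cancel_left, real_inner_smul_left, norm_smul, Real.norm_of_nonneg ht'.le] at h4
      have h5 : -(δ / (‖d‖ + 1) * ‖d‖) ≤ ⟪d, v⟫ := by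
        refine le_of_mul_le_mul_left ?_ ht'
        linarith
      have h6 : δ / (‖d‖ + 1) * ‖d‖ ≤ δ := by
        rw [div_mul_eq_mul_div, div_le_iff₀ (by positivity)]
        nlinarith [norm_nonneg d]
      linarith
    -- `v` is orthogonal to `Gᗮ`
    have hGG : ⟪G, G⟫ = ‖G‖ ^ 2 := real_inner_self_eq_norm_sq G
    have hG2 : 0 < ‖G‖ ^ 2 := by positivity
    have le0 : ∀ d : Space n, ⟪G, d⟫ = 0 → ⟪d, v⟫ ≤ 0 := by
      intro d hd
      refine le_of_forall_pos_le_add fun δ hδ => ?_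
      have hk : 0 < δ / (|⟪G, v⟫| + 1) := by positivity
      have h1 := neg (d - (δ / (|⟪G, v⟫| + 1)) • G) (by
        rw [inner_sub_right, real_inner_smul_right, hd, hGG]
        have := mul_pos hk hG2
        linarith)
      rw [inner_sub_left, real_inner_smul_left] at h1
      have h2 : δ / (|⟪G, v⟫| + 1) * ⟪G, v⟫ ≤ δ := by
        rw [div_mul_eq_mul_div, div_le_iff₀ (by positivity)]
        nlinarith [le_abs_self ⟪G, v⟫]
      linarith
    have eq0 : ∀ d : Space n, ⟪G, d⟫ = 0 → ⟪d, v⟫ = 0 := by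
      intro d hd
      have h1 := le0 d hd
      have h2 := le0 (-d) (by rw [inner_neg_right, hd, neg_zero])
      rw [inner_neg_left] at h2
      linarith
    set c : ℝ := ⟪G, v⟫ / ‖G‖ ^ 2 with hc
    have hw : ⟪G, v - c • G⟫ = 0 := by
      rw [inner_sub_right, real_inner_smul_right, hGG, hc, div_mul_cancel₀ _ hG2.ne', sub_self]
    have hw2 : v - c • G = 0 := by
      have h1 := eq0 _ hw
      rw [← inner_self_eq_zero (𝕜 := ℝ), inner_sub_right, real_inner_smul_right, h1,
        real_inner_comm, hw]
      simp
    have hv2 : v = c • G := sub_eq_zero.mp hw2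
    have hc0 : 0 ≤ c := div_nonneg (pos G (by rw [hGG]; exact hG2)) hG2.le
    have hc1 : c * ‖G‖ = 1 := by
      rw [← hv1, hv2, norm_smul, Real.norm_of_nonneg hc0]
    rw [hv2, eq_inv_of_mul_eq_one_left hc1]

/-- A `C²` domain has exactly one outward unit normal at each boundary point. -/
theorem existsUnique_isOutwardUnitNormal {Ω : Set (Space n)} (hΩ : IsBoundedC2Domain Ω)
    {P : Space n} (hP : P ∈ frontier Ω) : ∃! v, IsOutwardUnitNormal Ω P v := by
  obtain ⟨r, hr, ν, hν, Φ, hΦ, hrep⟩ := hΩ.c2 P hP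
  set ψ : Space n → ℝ := fun y => Φ (y - ⟪ν, y⟫ • ν) - ⟪ν, y⟫ with hψ
  have hdΦ : Differentiable ℝ Φ := hΦ.differentiable (by norm_num)
  have hd : Differentiable ℝ ψ := by
    have : Differentiable ℝ (fun y : Space n => ⟪ν, y⟫) := (innerSL ℝ ν).differentiable
    exact (hdΦ.comp (differentiable_id.sub (this.smul_const ν))).sub this
  have hrep' : ∀ᶠ y in 𝓝 P, (y ∈ Ω ↔ ψ y < 0) := by
    filter_upwards [Metric.ball_mem_nhds P hr] with y hy
    rw [hrep y hy, hψ, sub_neg]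
  have hPΩ : P ∉ Ω := fun h => by
    rw [hΩ.isOpen.frontier_eq] at hP
    exact hP.2 h
  have h0 : ψ P = 0 := by
    refine le_antisymm ?_ (not_lt.mp fun h => hPΩ (hrep'.self_of_nhds.mpr h))
    by_contra hc
    have h1 : ∀ᶠ y in 𝓝 P, 0 < ψ y := hd.continuous.continuousAt.eventually
      (lt_mem_nhds (not_le.mp hc))
    have h2 : ∃ᶠ y in 𝓝 P, y ∈ Ω := mem_closure_iff_frequently.mp hP.1
    obtain ⟨y, hy, hy1, hy2⟩ := (h2.and_eventually (h1.and hrep')).exists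
    exact absurd (hy2.mp hy) (not_lt.mpr hy1.le)
  refine existsUnique_of_definingFunction (hd P).hasGradientAt (fun hG => ?_) h0 hrep'
  have hνν : ⟪ν, ν⟫ = (1 : ℝ) := by rw [real_inner_self_eq_norm_sq, hν, one_pow]
  have hl : HasDerivAt (fun t : ℝ => P + t • ν) ν 0 := by
    simpa using ((hasDerivAt_id (0 : ℝ)).smul_const ν).const_add P
  have hf : HasFDerivAt ψ (fderiv ℝ ψ P) (P + (0 : ℝ) • ν) := by
    simpa using (hd P).hasFDerivAt
  have h1 := hf.comp_hasDerivAt (0 : ℝ) hl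
  have h2 : (ψ ∘ fun t : ℝ => P + t • ν) = fun t => ψ P - t := by
    funext t
    simp only [hψ, Function.comp, inner_add_right, real_inner_smul_right, hνν, mul_one, add_smul]
    rw [add_sub_add_right_eq_sub]
    ring
  rw [h2] at h1
  have h3 : HasDerivAt (fun t : ℝ => ψ P - t) (-1) 0 := by
    simpa using (hasDerivAt_id (0 : ℝ)).const_sub (ψ P)
  have h4 := h1.unique h3
  have h5 : ⟪gradient ψ P, ν⟫ = fderiv ℝ ψ P ν := by
    rw [gradient, InnerProductSpace.toDual_symm_apply]
  rw [hG, inner_zero_left, h4] at h5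
  norm_num at h5

/-- The surface measure on `∂Ω`: the `(n-1)`-dimensional Hausdorff measure, normalised so that it
agrees with Lebesgue measure on hyperplanes, restricted to `∂Ω`. -/
def surfaceMeasure (Ω : Set (Space n)) : Measure (Space n) :=
  (μHE[n - 1] : Measure (Space n)).restrict (frontier Ω)

/-- The time interval `(0, T)`, where `T = ∞` is allowed. -/
def timeInterval (T : EReal) : Set ℝ := {t | 0 < t ∧ (t : EReal) < T}

/-- The product of surface measure and Lebesgue measure on the lateral boundary `∂Ω × (0, T)`. -/
def lateralMeasure (Ω : Set (Space n)) (T : EReal) : Measure (Space n × ℝ) :=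
  (surfaceMeasure Ω).prod (volume.restrict (timeInterval T))

/-! ### Kernels and potentials -/

/-- The fundamental solution `E(x) = -1 / ((n - 2) ω_n |x|^(n-2))` of the Laplace equation, where
`ω_n = n |B_1|` is the area of the unit sphere. -/
def laplaceKernel (x : Space n) : ℝ :=
  -(1 / (((n : ℝ) - 2) * (n * volume.real (Metric.ball (0 : Space n) 1)) * ‖x‖ ^ (n - 2)))

/-- The Gaussian kernel `Γ(x,t) = (2πt)^(-n/2) exp(-|x|²/(2t))` for `t > 0`, and `0` otherwise. -/
def heatKernel (x : Space n) (t : ℝ) : ℝ :=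
  if 0 < t then (1 / √(2 * Real.pi * t) ^ n) * Real.exp (-‖x‖ ^ 2 / (2 * t)) else 0

/-- The composite kernel with pole `Q ∈ ∂Ω`:
`κ_Q(x,t) = ∫_{∂Ω} (∂/∂N(P)) Γ(x - P, t) E(P - Q) dP`, the normal derivative being taken
with respect to `P`. -/
def compositeKernel (Ω : Set (Space n)) (Q x : Space n) (t : ℝ) : ℝ :=
  ∫ P, fderiv ℝ (fun P' => heatKernel (x - P') t) P (outwardNormal Ω P) * laplaceKernel (P - Q)
    ∂(surfaceMeasure Ω)

/-- The single layer potential `S(f)(x) = ∫_{∂Ω} E(x - Q) f(Q) dQ`. -/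
def singleLayer (Ω : Set (Space n)) (f : Space n → ℝ) (x : Space n) : ℝ :=
  ∫ Q, laplaceKernel (x - Q) * f Q ∂(surfaceMeasure Ω)

/-- The surface potential `T(f)(x,t) = ∫_0^t ∫_{∂Ω} κ_Q(x, t - s) f(Q,s) dQ ds`. -/
def heatPotential (Ω : Set (Space n)) (f : Space n → ℝ → ℝ) (x : Space n) (t : ℝ) : ℝ :=
  ∫ s in (0 : ℝ)..t, ∫ Q, compositeKernel Ω Q x (t - s) * f Q s ∂(surfaceMeasure Ω)

/-! ### Boundary data and norms -/

/-- The normal component `g_N = g · N` of the boundary data, extended by `0` to `t ≤ 0`. -/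
def normalData (Ω : Set (Space n)) (g : Space n → ℝ → Space n) (Q : Space n) (t : ℝ) : ℝ :=
  if 0 < t then ⟪g Q t, outwardNormal Ω Q⟫ else 0

/-- The component of the vector `v` orthogonal to the unit vector `ν`. -/
def tangentialPart (ν v : Space n) : Space n := v - ⟪v, ν⟫ • ν

/-- The modulus of continuity `ω(f)(r,t) = sup {|f(s) - f(t)| : |s - t| < r, s < T}`. -/
def timeModulus (T : EReal) (f : ℝ → ℝ) (r t : ℝ) : ℝ≥0∞ :=
  ⨆ s ∈ {s : ℝ | |s - t| < r ∧ (s : EReal) < T}, ‖f s - f t‖ₑ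

/-- The log-Dini seminorm `∫_0^{r₀} sup_{0 < t < T} ω(f)(r,t) |ln r| / r dr ∈ [0,∞]`. -/
def logDini (r₀ : ℝ) (T : EReal) (f : ℝ → ℝ) : ℝ≥0∞ :=
  ∫⁻ r in Ioo 0 r₀, (⨆ t ∈ timeInterval T, timeModulus T f r t) * ENNReal.ofReal (|Real.log r| / r)

end Stokes

end

/-!
Let `f = g_N` and let `V_s` be the single layer potential on `∂Ω` of the density `f(·, s)`. By
Fubini, `T(f)(x, t) = ∫₀ᵗ ∫_{∂Ω} ∂Γ(x - P, t - s)/∂N(P) V_s(P) dP ds`, so that, for a direction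
`e`, `∂_e T(f)(x, t) = ∫₀^∞ ∫_{∂Ω} A_τ(x, P) V_{t-τ}(P) dP dτ`, where
`A_τ(x, P) = ∂_e ∂Γ(x - P, τ)/∂N(P)` (`heatHess`) and `V_s = 0` for `s ≤ 0`. Off the boundary all
kernels are bounded, which gives differentiability and also the estimate at a positive distance
from the boundary. Near the boundary let `x = p - d N(p)`, let `e` be tangential at `p`, and split
`V_{t-τ} = V_t + (V_{t-τ} - V_t)`.

* The stationary part. The time integral of `A_τ` is twice the mixed second derivative
  `∂_e ∂_{N(P)} E` of the Laplace kernel at `x - P` (`setIntegral_heatHess`), so the contribution of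
  `V_t` is, up to sign, twice the derivative of a double layer potential with density `V_t`. It
  cancels `∂_e S(f)` up to bounded terms (`IsBoundedC2Domain.exists_stationary_le`), as the jump
  relations suggest. To see this without jump relations, the kernel at `x` is compared with the
  kernel at the reflected point `x' = p + d N(p)`. Green's representation formula, applied to
  `E(· - q)` with `q` outside the closed domain and tending to the boundary, evaluates the difference
  of the two double layers. Their sum is small because the mixed tangential-normal derivatives of
  `E` are almost odd under the reflection (`IsBoundedC2Domain.exists_reflection_le`), and `V_t` is
  log-Lipschitz (`IsBoundedC2Domain.exists_singleLayer_sub_le`).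
* The time-dependent part. `V_{t-τ} - V_t` is the single layer of `f(·, t - τ) - f(·, t)`, which the
  log-Dini condition bounds by a multiple of `1 / ln² τ` (`abs_sub_le_of_logDini_le`). The single
  layer of a density bounded by `B` is log-Lipschitz; subtracting its value at `p` gains almost half
  a power of the time, and the mean of `A_τ` is of order `1 / τ` since it only involves the
  tangential component of the normal. The result is `B / τ`, up to a term which is harmless after
  integration in time (`IsBoundedC2Domain.exists_heatHess_singleLayer_le`). As `1 / (τ ln² τ)` is
  integrable at `0`, the estimate follows (`IsBoundedC2Domain.exists_timeVariation_le`).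

All integral identities rest on the divergence theorem for `C²` domains
(`IsBoundedC2Domain.gauss_green`), which is obtained from the area formula for graphs and a
partition of unity.
-/


namespace Stokes

/-! ### The area formula for graphs -/

/-- If `g` is `K`-Lipschitz with respect to `f` on `A`, the Hausdorff measure of `g '' A` is at
most `K ^ m` times that of `f '' A`. -/
theorem euclideanHausdorffMeasure_image_le {X Y Z : Type*} [MetricSpace Y] [MeasurableSpace Y]
    [BorelSpace Y] [MetricSpace Z] [MeasurableSpace Z] [BorelSpace Z] {f : X → Y} {g : X → Z}
    {K : ℝ≥0} {A : Set X} (h : ∀ u ∈ A, ∀ v ∈ A, dist (g u) (g v) ≤ K * dist (f u) (f v)) (m : ℕ) :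
    (μHE[m] : Measure Z) (g '' A) ≤ K ^ m * (μHE[m] : Measure Y) (f '' A) := by
  rcases A.eq_empty_or_nonempty with rfl | ⟨x0, hx0⟩
  · simp
  have : Nonempty X := ⟨x0⟩
  have hinv : ∀ u ∈ A, Function.invFunOn f A (f u) ∈ A ∧ f (Function.invFunOn f A (f u)) = f u :=
    fun u hu => ⟨Function.invFunOn_mem ⟨u, hu, rfl⟩, Function.invFunOn_eq ⟨u, hu, rfl⟩⟩
  have hg : ∀ u ∈ A, g (Function.invFunOn f A (f u)) = g u := fun u hu => by
    have := h _ (hinv u hu).1 u hu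
    rw [(hinv u hu).2, dist_self, mul_zero] at this
    exact dist_le_zero.mp this
  have hL : LipschitzOnWith K (g ∘ Function.invFunOn f A) (f '' A) := by
    refine LipschitzOnWith.of_dist_le_mul ?_
    rintro _ ⟨u, hu, rfl⟩ _ ⟨v, hv, rfl⟩
    simp only [Function.comp, hg u hu, hg v hv]
    exact h u hu v hv
  have himg : (g ∘ Function.invFunOn f A) '' (f '' A) = g '' A := by
    rw [image_image]
    exact image_congr hg
  have := hL.hausdorffMeasure_image_le (d := m) (Nat.cast_nonneg m)
  rw [himg, ENNReal.rpow_natCast] at this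
  simp only [Measure.euclideanHausdorffMeasure_def, Measure.smul_apply, ENNReal.smul_def,
    smul_eq_mul]
  rw [mul_left_comm]
  gcongr

/-- A linear map with `‖S w‖² = ‖w‖² + ⟪a, w⟫²`: it has the metric distortion of the graph of
`⟪a, ·⟫`, but maps the base space to itself, so that its determinant is the area factor. -/
noncomputable def graphStretch {H : Type*} [NormedAddCommGroup H] [InnerProductSpace ℝ H]
    (a : H) : H →ₗ[ℝ] H :=
  LinearMap.transvection (((√(1 + ‖a‖ ^ 2) - 1) / ‖a‖ ^ 2) • (innerSL ℝ a).toLinearMap) a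

section Area

variable {H E : Type*} [NormedAddCommGroup H] [InnerProductSpace ℝ H]
  [NormedAddCommGroup E] [InnerProductSpace ℝ E]

theorem graphStretch_apply (a w : H) :
    graphStretch a w = w + ((√(1 + ‖a‖ ^ 2) - 1) / ‖a‖ ^ 2 * ⟪a, w⟫) • a := by
  simp [graphStretch, LinearMap.transvection.apply]

theorem det_graphStretch [FiniteDimensional ℝ H] (a : H) : LinearMap.det (graphStretch a) =
    √(1 + ‖a‖ ^ 2) := by
  rw [graphStretch, LinearMap.transvection.det]
  rcases eq_or_ne a 0 with rfl | ha
  · simp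
  · have : ‖a‖ ^ 2 ≠ 0 := by positivity
    simp
    field_simp
    ring

theorem norm_graphStretch_sq (a w : H) : ‖graphStretch a w‖ ^ 2 = ‖w‖ ^ 2 + ⟪a, w⟫ ^ 2 := by
  rw [graphStretch_apply, norm_add_sq_real, norm_smul, real_inner_smul_right, mul_pow,
    Real.norm_eq_abs, sq_abs, real_inner_comm]
  rcases eq_or_ne a 0 with rfl | ha
  · simp
  · have h2 : ‖a‖ ^ 2 ≠ 0 := by positivity
    have hs : √(1 + ‖a‖ ^ 2) ^ 2 = 1 + ‖a‖ ^ 2 := Real.sq_sqrt (by positivity)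
    set k := √(1 + ‖a‖ ^ 2)
    have : ‖a‖ ^ 2 = k ^ 2 - 1 := by linarith
    rw [this] at h2 ⊢
    field_simp
    ring

/-- A measure bounded by a multiple of another one near every point is bounded by it. -/
theorem measure_le_smul_of_locally {X : Type*} [TopologicalSpace X] [SecondCountableTopology X]
    [MeasurableSpace X] [OpensMeasurableSpace X] {μ₁ μ₂ : Measure X} {c : ℝ≥0∞}
    (h : ∀ x, ∃ U ∈ 𝓝 x, ∀ A ⊆ U, MeasurableSet A → μ₁ A ≤ c * μ₂ A) : μ₁ ≤ c • μ₂ := by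
  choose U hU hA using h
  obtain ⟨s, hs, hcov⟩ := TopologicalSpace.countable_cover_nhds
    (fun x => interior_mem_nhds.mpr (hU x))
  rcases s.eq_empty_or_nonempty with rfl | hne
  · simp only [mem_empty_iff_false, iUnion_of_empty, iUnion_empty] at hcov
    refine Measure.le_iff.mpr fun A _ => ?_
    rw [show A = ∅ from eq_empty_of_subset_empty ((subset_univ A).trans hcov.symm.subset)]
    simp
  obtain ⟨e, rfl⟩ := hs.exists_eq_range hne
  set V : ℕ → Set X := disjointed fun k => interior (U (e k)) with hV
  have hVm : ∀ k, MeasurableSet (V k) :=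
    fun k => MeasurableSet.disjointed (fun k => isOpen_interior.measurableSet) k
  have hVU : ⋃ k, V k = univ := by
    rw [hV, iUnion_disjointed]
    simpa using hcov
  refine Measure.le_iff.mpr fun A hAm => ?_
  have hdec : A = ⋃ k, A ∩ V k := by rw [← inter_iUnion, hVU, inter_univ]
  have hdisj : Pairwise (Function.onFun Disjoint fun k => A ∩ V k) := fun i j hij =>
    (disjoint_disjointed _ hij).mono inter_subset_right inter_subset_right
  rw [Measure.smul_apply, smul_eq_mul, hdec, measure_iUnion hdisj fun k => hAm.inter (hVm k),
    measure_iUnion hdisj fun k => hAm.inter (hVm k), ← ENNReal.tsum_mul_left]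
  refine ENNReal.tsum_le_tsum fun k => hA (e k) _ ?_ (hAm.inter (hVm k))
  exact inter_subset_right.trans ((disjointed_subset _ k).trans interior_subset)

/-- The graph map `u ↦ j u + Φ u • ν` of `Φ` in the direction `ν`. -/
noncomputable def graphMap (j : H →ₗᵢ[ℝ] E) (ν : E) (Φ : H → ℝ) (u : H) : E := j u + Φ u • ν

/-- The area density `√(1 + |∇Φ|²)` of the graph of `Φ`. -/
noncomputable def graphDensity [CompleteSpace H] (Φ : H → ℝ) (u : H) :
    ℝ := √(1 + ‖gradient Φ u‖ ^ 2)

theorem dist_graphMap_sq {j : H →ₗᵢ[ℝ] E} {ν : E} (hν : ‖ν‖ = 1) (hj : ∀ u, ⟪j u, ν⟫ = 0)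
    (Φ : H → ℝ) (u v : H) :
    dist (graphMap j ν Φ u) (graphMap j ν Φ v) ^ 2 = ‖u - v‖ ^ 2 + (Φ u - Φ v) ^ 2 := by
  have : graphMap j ν Φ u - graphMap j ν Φ v = j (u - v) + (Φ u - Φ v) • ν := by
    simp only [graphMap, map_sub, sub_smul]; abel
  rw [dist_eq_norm, this, norm_add_sq_real, real_inner_smul_right, hj, norm_smul, hν,
    j.norm_map, Real.norm_eq_abs]
  simp

variable [FiniteDimensional ℝ H]

/-- Near `u₀`, the graph map distorts distances like the linear map `graphStretch (∇Φ(u₀))`. -/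
theorem graphMap_dist_approx {j : H →ₗᵢ[ℝ] E} {ν : E} (hν : ‖ν‖ = 1) (hj : ∀ u, ⟪j u, ν⟫ = 0)
    {Φ : H → ℝ} (hΦ : ContDiff ℝ 1 Φ) (u₀ : H) {ε : ℝ} (hε : 0 < ε) :
    ∀ᶠ r in 𝓝[>] (0 : ℝ), ∀ u ∈ Metric.ball u₀ r, ∀ v ∈ Metric.ball u₀ r,
      |dist (graphMap j ν Φ u) (graphMap j ν Φ v)
        - dist (graphStretch (gradient Φ u₀) u) (graphStretch (gradient Φ u₀) v)| ≤
        ε * dist u v := by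
  have hst : HasStrictFDerivAt Φ (fderiv ℝ Φ u₀) u₀ :=
    hΦ.contDiffAt.hasStrictFDerivAt (by norm_num)
  have h1 := hst.isLittleO.def hε
  rw [Metric.eventually_nhds_iff] at h1
  obtain ⟨r₁, hr₁, h1⟩ := h1
  filter_upwards [Ioo_mem_nhdsGT hr₁] with r hr u hu v hv
  have hb := h1 (y := (u, v)) (max_lt (lt_trans (Metric.mem_ball.mp hu) hr.2)
    (lt_trans (Metric.mem_ball.mp hv) hr.2))
  set a := gradient Φ u₀ with ha
  have hfa : fderiv ℝ Φ u₀ (u - v) = ⟪a, u - v⟫ := by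
    rw [ha, gradient, InnerProductSpace.toDual_symm_apply]
  simp only [Real.norm_eq_abs] at hb
  rw [hfa] at hb
  have hd1 := dist_graphMap_sq hν hj Φ u v
  have hd2 : dist (graphStretch a u) (graphStretch a v) ^ 2 = ‖u - v‖ ^ 2 + ⟪a, u - v⟫ ^ 2 := by
    rw [dist_eq_norm, ← map_sub, norm_graphStretch_sq]
  set D1 := dist (graphMap j ν Φ u) (graphMap j ν Φ v)
  set D2 := dist (graphStretch a u) (graphStretch a v)
  have hD1 : 0 ≤ D1 := dist_nonneg
  have hD2 : 0 ≤ D2 := dist_nonneg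
  rw [dist_eq_norm]
  set s := Φ u - Φ v
  set t := ⟪a, u - v⟫
  have e1 : |s| ≤ D1 := abs_le_of_sq_le_sq (by nlinarith [sq_nonneg ‖u - v‖]) hD1
  have e2 : |t| ≤ D2 := abs_le_of_sq_le_sq (by nlinarith [sq_nonneg ‖u - v‖]) hD2
  rcases (add_nonneg hD1 hD2).eq_or_lt with h0 | h0
  · have : D1 - D2 = 0 := by linarith
    rw [this, abs_zero]; positivity
  · refine le_of_mul_le_mul_right ?_ h0
    have : |D1 - D2| * (D1 + D2) = |s - t| * |s + t| := by
      have h5 : D1 + D2 = |D1 + D2| := (abs_of_nonneg h0.le).symm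
      rw [← abs_mul]
      conv_lhs => rw [h5, ← abs_mul]
      congr 1
      nlinarith
    rw [this]
    have h3 : |s + t| ≤ D1 + D2 := (abs_add_le _ _).trans (add_le_add e1 e2)
    exact mul_le_mul hb h3 (abs_nonneg _) (by positivity)

theorem continuous_graphDensity {Φ : H → ℝ} (hΦ : ContDiff ℝ 1 Φ) :
    Continuous (graphDensity Φ) := by
  have h1 : Continuous (gradient Φ) :=
    (InnerProductSpace.toDual ℝ H).symm.continuous.comp (hΦ.continuous_fderiv (by norm_num))
  exact Real.continuous_sqrt.comp (continuous_const.add (h1.norm.pow 2))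

theorem one_le_graphDensity (Φ : H → ℝ) (u : H) : 1 ≤ graphDensity Φ u := by
  rw [graphDensity, Real.one_le_sqrt]
  nlinarith [sq_nonneg ‖gradient Φ u‖]

theorem isClosedEmbedding_graphMap [FiniteDimensional ℝ E] {j : H →ₗᵢ[ℝ] E} {ν : E}
    (hj : ∀ u, ⟪j u, ν⟫ = 0) {Φ : H → ℝ} (hΦ : Continuous Φ) :
    IsClosedEmbedding (graphMap j ν Φ) := by
  have hc : Continuous (graphMap j ν Φ) := by unfold graphMap; fun_prop
  have hl : Function.LeftInverse (ContinuousLinearMap.adjoint j.toContinuousLinearMap)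
      (graphMap j ν Φ) := fun u => by
    refine ext_inner_right ℝ fun w => ?_
    have h1 : ⟪ν, j w⟫ = 0 := by rw [real_inner_comm, hj]
    rw [ContinuousLinearMap.adjoint_inner_left, graphMap, inner_add_left, real_inner_smul_left]
    simp [h1]
  exact hl.isClosedEmbedding (ContinuousLinearMap.continuous _) hc

variable [FiniteDimensional ℝ E] [MeasurableSpace H] [BorelSpace H] [MeasurableSpace E]
  [BorelSpace E]

/-- **Area formula for a graph**: the Hausdorff measure pulled back by the graph map of a `C¹`
function `Φ` has density `√(1 + |∇Φ|²)` with respect to Lebesgue measure. -/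
theorem comap_graphMap_euclideanHausdorffMeasure {j : H →ₗᵢ[ℝ] E} {ν : E} (hν : ‖ν‖ = 1)
    (hj : ∀ u, ⟪j u, ν⟫ = 0) {Φ : H → ℝ} (hΦ : ContDiff ℝ 1 Φ) :
    (μHE[Module.finrank ℝ H] : Measure E).comap (graphMap j ν Φ) =
      volume.withDensity fun u => ENNReal.ofReal (graphDensity Φ u) := by
  set m := Module.finrank ℝ H with hm
  have hemb := (isClosedEmbedding_graphMap hj hΦ.continuous).measurableEmbedding
  set μ₁ := (μHE[m] : Measure E).comap (graphMap j ν Φ) with hμ₁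
  set μ₂ := (volume : Measure H).withDensity fun u => ENNReal.ofReal (graphDensity Φ u) with hμ₂
  have hμ₁A : ∀ A, μ₁ A = μHE[m] (graphMap j ν Φ '' A) := fun A => hemb.comap_apply _ _
  -- the distortion by at most `1 + ε` near each point
  have key : ∀ ε : ℝ≥0, 0 < ε → ε < 1 → ∀ u₀ : H, ∃ U ∈ 𝓝 u₀, ∀ A ⊆ U, MeasurableSet A →
      μ₁ A ≤ (1 + ε) ^ (m + 1) * μ₂ A ∧ μ₂ A ≤ (1 + ε) ^ (m + 1) * μ₁ A := by
    intro ε hε hε1 u₀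
    set a := gradient Φ u₀ with ha
    have hε' : (0 : ℝ) < ε / 2 := by positivity
    have hJ0 : 0 < graphDensity Φ u₀ := one_pos.trans_le (one_le_graphDensity _ _)
    have hcont : ∀ᶠ u in 𝓝 u₀, graphDensity Φ u < (1 + ε) * graphDensity Φ u₀ ∧
        graphDensity Φ u₀ < (1 + ε) * graphDensity Φ u := by
      have hc := (continuous_graphDensity hΦ).continuousAt (x := u₀)
      have hlt : graphDensity Φ u₀ < (1 + ε) * graphDensity Φ u₀ := by
        have : (0 : ℝ) < ε := hε
        nlinarith
      exact (hc.eventually (gt_mem_nhds hlt)).and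
        ((hc.const_mul (1 + (ε : ℝ))).eventually (lt_mem_nhds hlt))
    obtain ⟨r, hr, hr0⟩ := ((graphMap_dist_approx hν hj hΦ u₀ hε').and self_mem_nhdsWithin).exists
    refine ⟨Metric.ball u₀ r ∩ {u | graphDensity Φ u < (1 + ε) * graphDensity Φ u₀ ∧
        graphDensity Φ u₀ < (1 + ε) * graphDensity Φ u},
      inter_mem (Metric.ball_mem_nhds _ hr0) hcont, fun A hA hAm => ?_⟩
    have hS : ∀ u v : H, dist u v ≤ dist (graphStretch a u) (graphStretch a v) := fun u v => by
      rw [dist_eq_norm, dist_eq_norm, ← map_sub]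
      refine abs_le_of_sq_le_sq' ?_ (norm_nonneg _) |>.2
      rw [norm_graphStretch_sq]
      nlinarith [sq_nonneg ⟪a, u - v⟫]
    have h1 : μHE[m] (graphMap j ν Φ '' A) ≤ ((1 + ε : ℝ≥0) : ℝ≥0∞) ^ m *
        (μHE[m] : Measure H) (graphStretch a '' A) := by
      refine euclideanHausdorffMeasure_image_le (fun u hu v hv => ?_) m
      have h := (abs_le.mp (hr u (hA hu).1 v (hA hv).1)).2
      have h' := hS u v
      push_cast
      nlinarith [dist_nonneg (x := u) (y := v)]
    have h2 : (μHE[m] : Measure H) (graphStretch a '' A) ≤ ((1 + ε : ℝ≥0) : ℝ≥0∞) ^ m *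
        μHE[m] (graphMap j ν Φ '' A) := by
      refine euclideanHausdorffMeasure_image_le (fun u hu v hv => ?_) m
      have h := (abs_le.mp (hr u (hA hu).1 v (hA hv).1)).1
      have h' := hS u v
      have hε1' : (ε : ℝ) < 1 := hε1
      have hε0 : (0 : ℝ) < ε := hε
      push_cast
      have h3 : (1 - (ε : ℝ) / 2) * dist (graphStretch a u) (graphStretch a v) ≤
          dist (graphMap j ν Φ u) (graphMap j ν Φ v) := by nlinarith
      have h4 : 1 ≤ (1 + (ε : ℝ)) * (1 - ε / 2) := by nlinarith
      nlinarith [dist_nonneg (x := graphStretch a u) (y := graphStretch a v)]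
    have hvol : (μHE[m] : Measure H) (graphStretch a '' A) =
        ENNReal.ofReal (graphDensity Φ u₀) * volume A := by
      rw [hm, InnerProductSpace.euclideanHausdorffMeasure_eq_volume,
        Measure.addHaar_image_linearMap, det_graphStretch, abs_of_nonneg (Real.sqrt_nonneg _)]
      rfl
    have hofR : ((1 + ε : ℝ≥0) : ℝ≥0∞) = ENNReal.ofReal (1 + ε) := by
      rw [← ENNReal.ofReal_coe_nnreal]; simp
    have h3 : ENNReal.ofReal (graphDensity Φ u₀) * volume A ≤ (1 + ε : ℝ≥0) * μ₂ A := by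
      rw [hμ₂, withDensity_apply _ hAm, ← lintegral_const_mul' _ _ ENNReal.coe_ne_top,
        ← setLIntegral_const]
      refine setLIntegral_mono' hAm fun u hu => ?_
      rw [hofR, ← ENNReal.ofReal_mul (by positivity)]
      exact ENNReal.ofReal_le_ofReal (hA hu).2.2.le
    have h4 : μ₂ A ≤ (1 + ε : ℝ≥0) * (ENNReal.ofReal (graphDensity Φ u₀) * volume A) := by
      rw [hμ₂, withDensity_apply _ hAm, ← mul_assoc, ← setLIntegral_const]
      refine setLIntegral_mono' hAm fun u hu => ?_
      rw [hofR, ← ENNReal.ofReal_mul (by positivity)]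
      exact ENNReal.ofReal_le_ofReal (hA hu).2.1.le
    rw [hμ₁A]
    rw [hvol] at h1 h2
    push_cast at h1 h2 h3 h4
    constructor
    · calc _ ≤ _ := h1
        _ ≤ (1 + (ε : ℝ≥0∞)) ^ m * ((1 + ε) * μ₂ A) := by gcongr
        _ = _ := by ring
    · calc _ ≤ _ := h4
        _ ≤ (1 + (ε : ℝ≥0∞)) * ((1 + ε) ^ m * μHE[m] (graphMap j ν Φ '' A)) := by gcongr
        _ = _ := by ring
  have glob : ∀ ε : ℝ≥0, 0 < ε → ε < 1 → ∀ A, μ₁ A ≤ (1 + ε) ^ (m + 1) * μ₂ A ∧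
      μ₂ A ≤ (1 + ε) ^ (m + 1) * μ₁ A := fun ε h0 h1 A => by
    have e1 := measure_le_smul_of_locally (μ₁ := μ₁) (μ₂ := μ₂) (c := (1 + ε) ^ (m + 1))
      (fun x => by
        obtain ⟨U, hU, h⟩ := key ε h0 h1 x
        exact ⟨U, hU, fun A hA hAm => (h A hA hAm).1⟩)
    have e2 := measure_le_smul_of_locally (μ₁ := μ₂) (μ₂ := μ₁) (c := (1 + ε) ^ (m + 1))
      (fun x => by
        obtain ⟨U, hU, h⟩ := key ε h0 h1 x
        exact ⟨U, hU, fun A hA hAm => (h A hA hAm).2⟩)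
    exact ⟨e1 A, e2 A⟩
  have lim : ∀ b : ℝ≥0∞, Tendsto (fun ε : ℝ≥0 => (1 + (ε : ℝ≥0∞)) ^ (m + 1) * b) (𝓝[>] 0)
      (𝓝 b) := fun b => by
    have h1 : Tendsto (fun ε : ℝ≥0 => (1 + (ε : ℝ≥0∞)) ^ (m + 1)) (𝓝 0) (𝓝 1) := by
      have : Continuous fun ε : ℝ≥0 => (1 + ε) ^ (m + 1) := by fun_prop
      have h := ENNReal.tendsto_coe.mpr (this.tendsto 0)
      simpa using h
    have := ENNReal.Tendsto.mul_const (b := b) h1 (Or.inl one_ne_zero)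
    rw [one_mul] at this
    exact this.mono_left nhdsWithin_le_nhds
  have ev : ∀ᶠ ε : ℝ≥0 in 𝓝[>] 0, 0 < ε ∧ ε < 1 := Ioo_mem_nhdsGT one_pos
  refine Measure.ext fun A _ => le_antisymm ?_ ?_
  · exact ge_of_tendsto (lim _) (ev.mono fun ε h => (glob ε h.1 h.2 A).1)
  · exact ge_of_tendsto (lim _) (ev.mono fun ε h => (glob ε h.1 h.2 A).2)

end Area

end Stokes

namespace Stokes

/-! ### Boundary charts and the normal field -/

section Chart

variable {n : ℕ}

/-- The defining function `y ↦ Φ (y') - y_ν` of the epigraph of `Φ` in the direction `ν`, where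
`y'` is the component of `y` orthogonal to `ν` and `y_ν = ⟪ν, y⟫`. -/
noncomputable def chartFun (ν : Space n) (Φ : Space n → ℝ) (y : Space n) : ℝ :=
  Φ (y - ⟪ν, y⟫ • ν) - ⟪ν, y⟫

/-- The graph map of `Φ` over the hyperplane orthogonal to `ν`. -/
noncomputable def chartGraph (ν : Space n) (Φ : Space n → ℝ) : (ℝ ∙ ν)ᗮ → Space n :=
  graphMap (ℝ ∙ ν)ᗮ.subtypeₗᵢ ν fun u => Φ u

/-- `Ω` is, in the ball `B(P, r)`, the epigraph of the `C²` function `Φ` in the direction `ν`. -/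
structure IsChart (Ω : Set (Space n)) (P : Space n) (r : ℝ) (ν : Space n) (Φ : Space n → ℝ) :
    Prop where
  pos : 0 < r
  norm_eq : ‖ν‖ = 1
  contDiff : ContDiff ℝ 2 Φ
  mem_iff : ∀ y ∈ Metric.ball P r, (y ∈ Ω ↔ chartFun ν Φ y < 0)

theorem IsBoundedC2Domain.exists_isChart {Ω : Set (Space n)} (hΩ : IsBoundedC2Domain Ω)
    {P : Space n} (hP : P ∈ frontier Ω) : ∃ r ν Φ, IsChart Ω P r ν Φ := by
  obtain ⟨r, hr, ν, hν, Φ, hΦ, h⟩ := hΩ.c2 P hP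
  exact ⟨r, ν, Φ, hr, hν, hΦ, fun y hy => by rw [h y hy, chartFun, sub_neg]⟩

variable {ν : Space n} {Φ : Space n → ℝ}

theorem inner_self_of_norm_one (hν : ‖ν‖ = 1) : ⟪ν, ν⟫ = 1 := by
  rw [real_inner_self_eq_norm_sq, hν, one_pow]

theorem inner_coe_orthogonal (u : (ℝ ∙ ν)ᗮ) : ⟪(u : Space n), ν⟫ = 0 := by
  rw [real_inner_comm]
  exact Submodule.mem_orthogonal_singleton_iff_inner_right.mp u.2

theorem contDiff_chartFun (hΦ : ContDiff ℝ 2 Φ) : ContDiff ℝ 2 (chartFun ν Φ) := by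
  unfold chartFun
  have : ContDiff ℝ 2 fun y : Space n => ⟪ν, y⟫ := (innerSL ℝ ν).contDiff
  exact (hΦ.comp (contDiff_id.sub (this.smul contDiff_const))).sub this

theorem chartFun_add_smul (hν : ‖ν‖ = 1) (y : Space n) (s : ℝ) :
    chartFun ν Φ (y + s • ν) = chartFun ν Φ y - s := by
  simp only [chartFun, inner_add_right, real_inner_smul_right, inner_self_of_norm_one hν, mul_one,
    add_smul]
  rw [add_sub_add_right_eq_sub]
  ring

theorem fderiv_chartFun (hν : ‖ν‖ = 1) (hΦ : ContDiff ℝ 2 Φ) (y : Space n) :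
    fderiv ℝ (chartFun ν Φ) y ν = -1 := by
  have hl : HasDerivAt (fun t : ℝ => y + t • ν) ν 0 := by
    simpa using ((hasDerivAt_id (0 : ℝ)).smul_const ν).const_add y
  have hf : HasFDerivAt (chartFun ν Φ) (fderiv ℝ (chartFun ν Φ) y) (y + (0 : ℝ) • ν) := by
    simpa using ((contDiff_chartFun hΦ).differentiable (by norm_num) y).hasFDerivAt
  have h1 := hf.comp_hasDerivAt (0 : ℝ) hl
  have h2 : (chartFun ν Φ ∘ fun t : ℝ => y + t • ν) = fun t => chartFun ν Φ y - t := by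
    funext t
    exact chartFun_add_smul hν y t
  rw [h2] at h1
  exact h1.unique (by simpa using (hasDerivAt_id (0 : ℝ)).const_sub (chartFun ν Φ y))

theorem inner_gradient_left' (f : Space n → ℝ) (y v : Space n) :
    ⟪gradient f y, v⟫ = fderiv ℝ f y v := by
  rw [gradient, InnerProductSpace.toDual_symm_apply]

theorem gradient_chartFun_ne_zero (hν : ‖ν‖ = 1) (hΦ : ContDiff ℝ 2 Φ) (y : Space n) :
    gradient (chartFun ν Φ) y ≠ 0 := fun h => by
  have := inner_gradient_left' (chartFun ν Φ) y ν
  rw [h, inner_zero_left, fderiv_chartFun hν hΦ] at this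
  norm_num at this

theorem chartGraph_apply (u : (ℝ ∙ ν)ᗮ) : chartGraph ν Φ u = u + Φ u • ν := rfl

theorem chartFun_chartGraph_add (hν : ‖ν‖ = 1) (u : (ℝ ∙ ν)ᗮ) (s : ℝ) :
    chartFun ν Φ (u + s • ν) = Φ u - s := by
  rw [chartFun_add_smul hν, chartFun, real_inner_comm, inner_coe_orthogonal]
  simp

/-- Points on the zero set of `chartFun` are on the graph over their orthogonal component. -/
theorem exists_chartGraph_eq (hν : ‖ν‖ = 1) {y : Space n} (hy : chartFun ν Φ y = 0) :
    ∃ u : (ℝ ∙ ν)ᗮ, (u : Space n) = y - ⟪ν, y⟫ • ν ∧ chartGraph ν Φ u = y := by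
  refine ⟨⟨y - ⟪ν, y⟫ • ν, ?_⟩, rfl, ?_⟩
  · rw [Submodule.mem_orthogonal_singleton_iff_inner_right, inner_sub_right,
      real_inner_smul_right, inner_self_of_norm_one hν, mul_one, sub_self]
  · rw [chartGraph_apply]
    have : Φ (y - ⟪ν, y⟫ • ν) = ⟪ν, y⟫ := sub_eq_zero.mp hy
    simp [this]

/-- The area density of the chart graph is the length of the gradient of its defining function. -/
theorem graphDensity_eq_norm_gradient (hν : ‖ν‖ = 1) (hΦ : ContDiff ℝ 2 Φ) (u : (ℝ ∙ ν)ᗮ) (s : ℝ) :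
    graphDensity (fun u : (ℝ ∙ ν)ᗮ => Φ u) u = ‖gradient (chartFun ν Φ) (u + s • ν)‖ := by
  set w := gradient (fun u : (ℝ ∙ ν)ᗮ => Φ u) u with hw
  have hcoe : ∀ y : Space n, chartFun ν Φ y =
      Φ ((ℝ ∙ ν)ᗮ.orthogonalProjectionOnto y) - ⟪ν, y⟫ := fun y => by
    rw [chartFun]
    congr 2
    rw [← Submodule.starProjection_apply, Submodule.starProjection_orthogonal_val,
      Submodule.starProjection_unit_singleton _ hν]
  have hproj : (ℝ ∙ ν)ᗮ.orthogonalProjectionOnto ((u : Space n) + s • ν) = u := by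
    rw [map_add, map_smul, Submodule.orthogonalProjectionOnto_mem_subspace_eq_self,
      Submodule.orthogonalProjectionOnto_orthogonalComplement_singleton_eq_zero, smul_zero,
          add_zero]
  have hG : gradient (chartFun ν Φ) (u + s • ν) = w - ν := by
    refine ext_inner_right ℝ fun v => ?_
    rw [inner_gradient_left']
    have hd : DifferentiableAt ℝ (fun u : (ℝ ∙ ν)ᗮ => Φ u) u :=
      ((hΦ.differentiable (by norm_num)).comp (ℝ ∙ ν)ᗮ.subtypeL.differentiable) u
    have h1 : HasFDerivAt (fun u : (ℝ ∙ ν)ᗮ => Φ u) (fderiv ℝ (fun u : (ℝ ∙ ν)ᗮ => Φ u) u)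
        ((ℝ ∙ ν)ᗮ.orthogonalProjectionOnto ((u : Space n) + s • ν)) := by
      rw [hproj]; exact hd.hasFDerivAt
    have h2 := (h1.comp ((u : Space n) + s • ν)
      ((ℝ ∙ ν)ᗮ.orthogonalProjectionOnto).hasFDerivAt).sub ((innerSL ℝ ν).hasFDerivAt)
    have h3 : chartFun ν Φ = ((fun u : (ℝ ∙ ν)ᗮ => Φ u) ∘ (ℝ ∙ ν)ᗮ.orthogonalProjectionOnto) -
        innerSL ℝ ν := by
      funext y; rw [hcoe]; rfl
    rw [h3, h2.fderiv, inner_sub_left]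
    simp only [sub_apply, ContinuousLinearMap.comp_apply, innerSL_apply_apply]
    congr 1
    rw [← InnerProductSpace.toDual_symm_apply (𝕜 := ℝ), ← gradient, ← hw]
    exact Submodule.inner_orthogonalProjectionOnto_eq_of_mem_left _ _
  rw [hG, graphDensity, ← hw, ← Real.sqrt_sq (norm_nonneg ((w : Space n) - ν)), norm_sub_sq_real,
    inner_coe_orthogonal, hν]
  congr 1
  simp [add_comm]

variable {Ω : Set (Space n)} {P : Space n} {r : ℝ}

theorem IsChart.mem_frontier_iff (hc : IsChart Ω P r ν Φ) (hO : IsOpen Ω) {y : Space n}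
    (hy : y ∈ Metric.ball P r) : y ∈ frontier Ω ↔ chartFun ν Φ y = 0 := by
  have hcont : Continuous (chartFun ν Φ) := (contDiff_chartFun hc.contDiff).continuous
  rw [hO.frontier_eq, Set.mem_sdiff]
  constructor
  · rintro ⟨h1, h2⟩
    rw [hc.mem_iff y hy, not_lt] at h2
    refine le_antisymm ?_ h2
    by_contra hneg
    have h3 : ∀ᶠ z in 𝓝 y, 0 < chartFun ν Φ z ∧ z ∈ Metric.ball P r :=
      (hcont.continuousAt.eventually (lt_mem_nhds (not_le.mp hneg))).and
        (Metric.isOpen_ball.mem_nhds hy)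
    obtain ⟨z, hz, hz1, hz2⟩ := ((mem_closure_iff_frequently.mp h1).and_eventually h3).exists
    exact absurd ((hc.mem_iff z hz2).mp hz) (not_lt.mpr hz1.le)
  · intro h
    refine ⟨?_, by rw [hc.mem_iff y hy, h]; exact lt_irrefl 0⟩
    have ht : Tendsto (fun s : ℝ => y + s • ν) (𝓝[>] 0) (𝓝 y) := by
      have : Continuous (fun s : ℝ => y + s • ν) := by fun_prop
      have := this.tendsto 0
      simp only [zero_smul, add_zero] at this
      exact this.mono_left nhdsWithin_le_nhds
    refine mem_closure_of_tendsto ht ?_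
    filter_upwards [ht.eventually (Metric.isOpen_ball.mem_nhds hy),
        self_mem_nhdsWithin] with s h1 h2
    rw [hc.mem_iff _ h1, chartFun_add_smul hc.norm_eq, h]
    linarith [mem_Ioi.mp h2]

theorem isOutwardUnitNormal_of_definingFunction {G : Space n} {ψ : Space n → ℝ}
    (hψ : HasGradientAt ψ G P) (hG : G ≠ 0) (h0 : ψ P = 0)
    (hΩ : ∀ᶠ y in 𝓝 P, (y ∈ Ω ↔ ψ y < 0)) : IsOutwardUnitNormal Ω P (‖G‖⁻¹ • G) := by
  have hGn : 0 < ‖G‖ := norm_pos_iff.mpr hG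
  refine ⟨by rw [norm_smul, norm_inv, norm_norm, inv_mul_cancel₀ hGn.ne'], fun ε hε => ?_⟩
  have h1 := (hasGradientAt_iff_isLittleO.mp hψ).def (mul_pos hε hGn)
  filter_upwards [h1, hΩ] with y hy hy2
  rw [h0, sub_zero, Real.norm_eq_abs, abs_le] at hy
  rw [inner_smul_right, real_inner_comm, ← inv_mul_cancel_left₀ hGn.ne' (ε * ‖y - P‖), ← mul_neg]
  refine ⟨fun h => ?_, fun h => ?_⟩
  · refine mul_le_mul_of_nonneg_left ?_ (inv_nonneg.mpr hGn.le)
    linarith [hy.1, hy.2, hy2.mp h]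
  · refine mul_le_mul_of_nonneg_left ?_ (inv_nonneg.mpr hGn.le)
    linarith [hy.1, hy.2, not_lt.mp (fun h' => h (hy2.mpr h'))]

theorem IsBoundedC2Domain.isOutwardUnitNormal (hΩ : IsBoundedC2Domain Ω) (hP : P ∈ frontier Ω) :
    IsOutwardUnitNormal Ω P (outwardNormal Ω P) := by
  have h := (existsUnique_isOutwardUnitNormal hΩ hP).exists
  rw [outwardNormal, dif_pos h]
  exact h.choose_spec

theorem IsBoundedC2Domain.norm_outwardNormal (hΩ : IsBoundedC2Domain Ω) (hP : P ∈ frontier Ω) :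
    ‖outwardNormal Ω P‖ = 1 := (hΩ.isOutwardUnitNormal hP).1

theorem norm_outwardNormal_le (Ω : Set (Space n)) (P : Space n) : ‖outwardNormal Ω P‖ ≤ 1 := by
  rw [outwardNormal]
  split_ifs with h
  · exact h.choose_spec.1.le
  · simp

theorem IsChart.outwardNormal_eq (hc : IsChart Ω P r ν Φ) (hΩ : IsBoundedC2Domain Ω) {y : Space n}
    (hy : y ∈ Metric.ball P r) (hyf : y ∈ frontier Ω) :
    outwardNormal Ω y = ‖gradient (chartFun ν Φ) y‖⁻¹ • gradient (chartFun ν Φ) y := by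
  refine (existsUnique_isOutwardUnitNormal hΩ hyf).unique (hΩ.isOutwardUnitNormal hyf) ?_
  refine isOutwardUnitNormal_of_definingFunction
    (((contDiff_chartFun hc.contDiff).differentiable (by norm_num)) y).hasGradientAt
    (gradient_chartFun_ne_zero hc.norm_eq hc.contDiff y)
    ((hc.mem_frontier_iff hΩ.isOpen hy).mp hyf) ?_
  filter_upwards [Metric.isOpen_ball.mem_nhds hy] with z hz using hc.mem_iff z hz

end Chart

end Stokes

namespace Stokes

/-! ### Uniform geometry of the boundary -/

/-- A bounded quantity that is locally `O(dist ^ k)` on a compact set is `O(dist ^ k)` on it. -/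
theorem exists_le_mul_dist_pow_of_local {X : Type*} [MetricSpace X] {K : Set X} (hK : IsCompact K)
    (k : ℕ) (a : X → X → ℝ) {D : ℝ} (hD : ∀ P ∈ K, ∀ P' ∈ K, a P P' ≤ D)
    (hloc : ∀ P₀ ∈ K, ∃ C r : ℝ, 0 < r ∧ ∀ P ∈ K ∩ Metric.ball P₀ r, ∀ P' ∈ K ∩ Metric.ball P₀ r,
      a P P' ≤ C * dist P P' ^ k) :
    ∃ C : ℝ, 0 < C ∧ ∀ P ∈ K, ∀ P' ∈ K, a P P' ≤ C * dist P P' ^ k := by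
  have h : ∃ C δ : ℝ, 0 < δ ∧ ∀ P ∈ K, ∀ P' ∈ K, dist P P' < δ → a P P' ≤ C * dist P P' ^ k := by
    refine hK.induction_on (p := fun S => ∃ C δ : ℝ, 0 < δ ∧ ∀ P ∈ S, ∀ P' ∈ K, dist P P' < δ →
      a P P' ≤ C * dist P P' ^ k) ⟨0, 1, one_pos, by simp⟩ ?_ ?_ ?_
    · rintro s t hst ⟨C, δ, hδ, h⟩
      exact ⟨C, δ, hδ, fun P hP => h P (hst hP)⟩
    · rintro s t ⟨C, δ, hδ, h⟩ ⟨C', δ', hδ', h'⟩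
      refine ⟨max C C', min δ δ', lt_min hδ hδ', fun P hP P' hP' hd => ?_⟩
      have hk : 0 ≤ dist P P' ^ k := by positivity
      rcases hP with hP | hP
      · exact (h P hP P' hP' (hd.trans_le (min_le_left _ _))).trans
          (mul_le_mul_of_nonneg_right (le_max_left _ _) hk)
      · exact (h' P hP P' hP' (hd.trans_le (min_le_right _ _))).trans
          (mul_le_mul_of_nonneg_right (le_max_right _ _) hk)
    · intro P₀ hP₀
      obtain ⟨C, r, hr, h⟩ := hloc P₀ hP₀
      refine ⟨K ∩ Metric.ball P₀ (r / 2),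
        inter_mem self_mem_nhdsWithin
            (mem_nhdsWithin_of_mem_nhds (Metric.ball_mem_nhds _ (by positivity))),
        C, r / 2, by positivity, fun P hP P' hP' hd => ?_⟩
      refine h P ⟨hP.1, Metric.ball_subset_ball (by linarith) hP.2⟩ P' ⟨hP', ?_⟩
      have h1 := Metric.mem_ball.mp hP.2
      have h2 := dist_triangle P' P P₀
      rw [dist_comm P' P] at h2
      exact Metric.mem_ball.mpr (by linarith)
  obtain ⟨C, δ, hδ, h⟩ := h
  refine ⟨max (max C 1) (|D| / δ ^ k), lt_max_of_lt_left (lt_max_of_lt_right one_pos),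
    fun P hP P' hP' => ?_⟩
  rcases lt_or_ge (dist P P') δ with hd | hd
  · refine (h P hP P' hP' hd).trans (mul_le_mul_of_nonneg_right ?_ (by positivity))
    exact (le_max_left _ _).trans (le_max_left _ _)
  · calc a P P' ≤ |D| := (hD P hP P' hP').trans (le_abs_self D)
      _ = |D| / δ ^ k * δ ^ k := by field_simp
      _ ≤ max (max C 1) (|D| / δ ^ k) * dist P P' ^ k := by
        gcongr
        exact le_max_right _ _

variable {n : ℕ} {Ω : Set (Space n)}

theorem IsBoundedC2Domain.isCompact_frontier (hΩ : IsBoundedC2Domain Ω) :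
    IsCompact (frontier Ω) :=
  Metric.isCompact_of_isClosed_isBounded isClosed_frontier
    (hΩ.isBounded.closure.subset frontier_subset_closure)

theorem IsBoundedC2Domain.frontier_bounded (hΩ : IsBoundedC2Domain Ω) :
    ∃ D : ℝ, 1 ≤ D ∧ ∀ P ∈ closure Ω, ∀ P' ∈ closure Ω, dist P P' ≤ D := by
  obtain ⟨D, hD⟩ := Metric.isBounded_iff.mp hΩ.isBounded.closure
  exact ⟨max D 1, le_max_right _ _, fun P hP P' hP' => (hD hP hP').trans (le_max_left _ _)⟩

/-- The normal field of a bounded `C²` domain is Lipschitz. -/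
theorem IsBoundedC2Domain.exists_lipschitz_normal (hΩ : IsBoundedC2Domain Ω) :
    ∃ C : ℝ, 0 < C ∧ ∀ P ∈ frontier Ω, ∀ P' ∈ frontier Ω,
      ‖outwardNormal Ω P - outwardNormal Ω P'‖ ≤ C * dist P P' := by
  obtain ⟨C, hC, h⟩ := exists_le_mul_dist_pow_of_local hΩ.isCompact_frontier 1
    (fun P P' => ‖outwardNormal Ω P - outwardNormal Ω P'‖) (D := 2) (fun P _ P' _ =>
      (norm_sub_le _ _).trans (by linarith [norm_outwardNormal_le Ω P, norm_outwardNormal_le Ω P']))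
    (fun P₀ hP₀ => by
      obtain ⟨r, ν, Φ, hc⟩ := hΩ.exists_isChart hP₀
      have hG : ContDiff ℝ 1 (gradient (chartFun ν Φ)) :=
        (InnerProductSpace.toDual ℝ (Space n)).symm.contDiff.comp
          ((contDiff_chartFun hc.contDiff).fderiv_right (m := 1) (by norm_num))
      have hN : ContDiffAt ℝ 1 (fun y => ‖gradient (chartFun ν Φ) y‖⁻¹ • gradient (chartFun ν Φ) y)
          P₀ := by
        have h0 := gradient_chartFun_ne_zero hc.norm_eq hc.contDiff P₀
        exact ((hG.contDiffAt.norm ℝ h0).inv (norm_ne_zero_iff.mpr h0)).smul hG.contDiffAt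
      obtain ⟨K, t, ht, hL⟩ := hN.exists_lipschitzOnWith
      obtain ⟨r', hr', ht'⟩ := Metric.mem_nhds_iff.mp ht
      refine ⟨K, min r r', lt_min hc.pos hr', fun P hP P' hP' => ?_⟩
      have hb : ∀ {Q}, Q ∈ frontier Ω ∩ Metric.ball P₀ (min r r') → outwardNormal Ω Q =
          ‖gradient (chartFun ν Φ) Q‖⁻¹ • gradient (chartFun ν Φ) Q ∧ Q ∈ t := fun hQ =>
        ⟨hc.outwardNormal_eq hΩ (Metric.ball_subset_ball (min_le_left _ _) hQ.2) hQ.1,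
          ht' (Metric.ball_subset_ball (min_le_right _ _) hQ.2)⟩
      rw [(hb hP).1, (hb hP').1, ← dist_eq_norm, pow_one]
      exact hL.dist_le_mul P (hb hP).2 P' (hb hP').2)
  exact ⟨C, hC, by simpa using h⟩

/-- Since the boundary is `C²`, boundary points near `P` lie close to the tangent plane at `P`. -/
theorem IsBoundedC2Domain.exists_inner_normal_le (hΩ : IsBoundedC2Domain Ω) :
    ∃ C : ℝ, 0 < C ∧ ∀ P ∈ frontier Ω, ∀ P' ∈ frontier Ω,
      |⟪P' - P, outwardNormal Ω P⟫| ≤ C * dist P P' ^ 2 := by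
  obtain ⟨D, hD1, hD⟩ := hΩ.frontier_bounded
  refine exists_le_mul_dist_pow_of_local hΩ.isCompact_frontier 2 _ (D := D)
    (fun P hP P' hP' => ?_) fun P₀ hP₀ => ?_
  · refine (abs_real_inner_le_norm _ _).trans ?_
    rw [hΩ.norm_outwardNormal hP, mul_one, ← dist_eq_norm]
    exact hD _ (frontier_subset_closure hP') _ (frontier_subset_closure hP)
  · obtain ⟨r, ν, Φ, hc⟩ := hΩ.exists_isChart hP₀
    set ψ := chartFun ν Φ with hψ
    have hψ2 : ContDiff ℝ 2 ψ := contDiff_chartFun hc.contDiff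
    have hG : ContDiff ℝ 1 (fderiv ℝ ψ) := hψ2.fderiv_right (m := 1) (by norm_num)
    obtain ⟨K, t, ht, hL⟩ := hG.contDiffAt (x := P₀) |>.exists_lipschitzOnWith
    obtain ⟨r', hr', ht'⟩ := Metric.mem_nhds_iff.mp ht
    refine ⟨K, min r r', lt_min hc.pos hr', fun P hP P' hP' => ?_⟩
    have hb : ∀ {Q}, Q ∈ Metric.ball P₀ (min r r') → Q ∈ Metric.ball P₀ r ∧ Q ∈ t := fun hQ =>
        ⟨Metric.ball_subset_ball (min_le_left _ _) hQ,
          ht' (Metric.ball_subset_ball (min_le_right _ _) hQ)⟩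
    have hP0 : ψ P = 0 := (hc.mem_frontier_iff hΩ.isOpen (hb hP.2).1).mp hP.1
    have hP0' : ψ P' = 0 := (hc.mem_frontier_iff hΩ.isOpen (hb hP'.2).1).mp hP'.1
    rw [hc.outwardNormal_eq hΩ (hb hP.2).1 hP.1, real_inner_smul_right, real_inner_comm,
      inner_gradient_left', abs_mul, abs_of_nonneg (inv_nonneg.mpr (norm_nonneg _))]
    have h1 : 1 ≤ ‖gradient ψ P‖ := by
      have h2 := abs_real_inner_le_norm (gradient ψ P) ν
      rw [inner_gradient_left', fderiv_chartFun hc.norm_eq hc.contDiff, hc.norm_eq] at h2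
      simpa using h2
    have hseg : ∀ z ∈ segment ℝ P P', z ∈ Metric.ball P₀ (min r r') ∧ dist z P ≤ dist P P' :=
      fun z hz => ⟨(convex_ball _ _).segment_subset hP.2 hP'.2 hz, by
        have := (convex_closedBall P (dist P P')).segment_subset
          (Metric.mem_closedBall_self dist_nonneg)
          (by rw [Metric.mem_closedBall, dist_comm]) hz
        exact Metric.mem_closedBall.mp this⟩
    have h3 := (convex_segment P P').norm_image_sub_le_of_norm_hasFDerivWithin_le' (f := ψ)
      (f' := fderiv ℝ ψ) (φ := fderiv ℝ ψ P) (C := K * dist P P')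
      (fun z _ => ((hψ2.differentiable (by norm_num)) z).hasFDerivAt.hasFDerivWithinAt)
      (fun z hz => by
        rw [← dist_eq_norm]
        refine (hL.dist_le_mul z (hb (hseg z hz).1).2 P (hb hP.2).2).trans ?_
        gcongr
        exact (hseg z hz).2) (left_mem_segment ℝ P P') (right_mem_segment ℝ P P')
    rw [hP0, hP0', sub_self, zero_sub, norm_neg, Real.norm_eq_abs, ← dist_eq_norm,
      dist_comm P' P] at h3
    calc ‖gradient ψ P‖⁻¹ * |fderiv ℝ ψ P (P' - P)| ≤ 1 * |fderiv ℝ ψ P (P' - P)| := by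
          gcongr
          exact inv_le_one_of_one_le₀ h1
      _ ≤ K * dist P P' ^ 2 := by rw [one_mul]; nlinarith

theorem finrank_orthogonal_singleton {ν : Space n} (hν : ‖ν‖ = 1) :
    Module.finrank ℝ (ℝ ∙ ν)ᗮ = n - 1 := by
  have h := (ℝ ∙ ν).finrank_add_finrank_orthogonal
  rw [finrank_span_singleton (norm_ne_zero_iff.mp (by rw [hν]; exact one_ne_zero)),
    finrank_euclideanSpace_fin] at h
  omega

/-- The Hausdorff measure of a piece of a chart graph, as an integral over the hyperplane. -/
theorem euclideanHausdorffMeasure_chartGraph_image {ν : Space n} {Φ : Space n → ℝ} (hν : ‖ν‖ = 1)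
    (hΦ : ContDiff ℝ 2 Φ) {A : Set (ℝ ∙ ν)ᗮ} (hA : MeasurableSet A) :
    (μHE[n - 1] : Measure (Space n)) (chartGraph ν Φ '' A) =
      ∫⁻ u in A, ENNReal.ofReal (graphDensity (fun u : (ℝ ∙ ν)ᗮ => Φ u) u) := by
  have hΦ' : ContDiff ℝ 1 fun u : (ℝ ∙ ν)ᗮ => Φ u :=
    (hΦ.of_le (by norm_num)).comp (ℝ ∙ ν)ᗮ.subtypeL.contDiff
  have hj : ∀ u : (ℝ ∙ ν)ᗮ, ⟪(ℝ ∙ ν)ᗮ.subtypeₗᵢ u, ν⟫ = 0 := inner_coe_orthogonal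
  have h := comap_graphMap_euclideanHausdorffMeasure hν hj hΦ'
  rw [finrank_orthogonal_singleton hν] at h
  rw [← withDensity_apply _ hA, ← h,
    (isClosedEmbedding_graphMap hj hΦ'.continuous).measurableEmbedding.comap_apply]
  rfl

theorem isClosedEmbedding_chartGraph {ν : Space n} {Φ : Space n → ℝ} (hΦ : ContDiff ℝ 2 Φ) :
    IsClosedEmbedding (chartGraph ν Φ) :=
  isClosedEmbedding_graphMap (j := (ℝ ∙ ν)ᗮ.subtypeₗᵢ) inner_coe_orthogonal
    (hΦ.continuous.comp continuous_subtype_val)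

theorem surfaceMeasure_apply (Ω : Set (Space n)) {A : Set (Space n)} (hA : MeasurableSet A) :
    surfaceMeasure Ω A = μHE[n - 1] (A ∩ frontier Ω) := by
  rw [surfaceMeasure, Measure.restrict_apply hA]

/-- Small boundary balls around points near `P₀` have measure `O(ρ ^ (n - 1))`. -/
theorem IsBoundedC2Domain.local_ahlfors (hΩ : IsBoundedC2Domain Ω) {P₀ : Space n}
    (hP₀ : P₀ ∈ frontier Ω) : ∃ C δ : ℝ, 0 < C ∧ 0 < δ ∧
      ∀ P ∈ Metric.ball P₀ δ, ∀ ρ, 0 < ρ → ρ < δ →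
      surfaceMeasure Ω (Metric.ball P ρ) ≤ ENNReal.ofReal (C * ρ ^ (n - 1)) := by
  obtain ⟨r, ν, Φ, hc⟩ := hΩ.exists_isChart hP₀
  obtain ⟨u₀, -, hu₀⟩ := exists_chartGraph_eq hc.norm_eq
    ((hc.mem_frontier_iff hΩ.isOpen (Metric.mem_ball_self hc.pos)).mp hP₀)
  have hΦ' : ContDiff ℝ 1 fun u : (ℝ ∙ ν)ᗮ => Φ u :=
    (hc.contDiff.of_le (by norm_num)).comp (ℝ ∙ ν)ᗮ.subtypeL.contDiff
  set J := graphDensity (fun u : (ℝ ∙ ν)ᗮ => Φ u) with hJ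
  have hJ0 : 1 ≤ J u₀ := one_le_graphDensity _ _
  have hev : ∀ᶠ u in 𝓝 u₀, J u < J u₀ + 1 :=
    (continuous_graphDensity hΦ').continuousAt.eventually (gt_mem_nhds (by linarith))
  obtain ⟨δ, hδ, hball⟩ := Metric.mem_nhds_iff.mp hev
  set V := (volume (Metric.ball (0 : (ℝ ∙ ν)ᗮ) 1)).toReal with hV
  have hVpos : 0 < V := ENNReal.toReal_pos (Metric.measure_ball_pos _ _ one_pos).ne'
    measure_ball_lt_top.ne
  refine ⟨(J u₀ + 1) * (2 ^ (n - 1) * V), min (r / 2) (δ / 4), by positivity,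
    lt_min (by linarith [hc.pos]) (by positivity), fun P hP ρ hρ hρ' => ?_⟩
  rw [surfaceMeasure_apply _ Metric.isOpen_ball.measurableSet]
  have hPb := Metric.mem_ball.mp hP
  have hr1 := min_le_left (r / 2) (δ / 4)
  have hr2 := min_le_right (r / 2) (δ / 4)
  -- the projection to the hyperplane does not increase distances
  have hproj : ∀ u v : (ℝ ∙ ν)ᗮ, dist u v ≤ dist (chartGraph ν Φ u) (chartGraph ν Φ v) :=
    fun u v => by
      refine abs_le_of_sq_le_sq' ?_ dist_nonneg |>.2
      rw [chartGraph, dist_graphMap_sq hc.norm_eq inner_coe_orthogonal, dist_eq_norm u v]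
      nlinarith [sq_nonneg (Φ u - Φ v)]
  rcases (Metric.ball P ρ ∩ frontier Ω).eq_empty_or_nonempty with he | ⟨Q, hQ, hQf⟩
  · simp [he]
  have inball : ∀ y ∈ Metric.ball P ρ, y ∈ Metric.ball P₀ r ∧ dist y P₀ < δ / 2 := fun y hy => by
    have h1 := dist_triangle y P P₀
    have h2 := Metric.mem_ball.mp hy
    exact ⟨Metric.mem_ball.mpr (by linarith), by linarith⟩
  have pre : ∀ y ∈ Metric.ball P ρ ∩ frontier Ω, ∃ u, chartGraph ν Φ u = y ∧ dist u u₀ < δ :=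
    fun y hy => by
      obtain ⟨u, -, hu⟩ := exists_chartGraph_eq hc.norm_eq
        ((hc.mem_frontier_iff hΩ.isOpen (inball y hy.1).1).mp hy.2)
      refine ⟨u, hu, (hproj u u₀).trans_lt ?_⟩
      rw [hu, hu₀]
      linarith [(inball y hy.1).2]
  obtain ⟨w, hw, hwδ⟩ := pre Q ⟨hQ, hQf⟩
  have hsub : Metric.ball P ρ ∩ frontier Ω ⊆
      chartGraph ν Φ '' (Metric.ball w (2 * ρ) ∩ Metric.ball u₀ δ) := fun y hy => by
    obtain ⟨u, hu, huδ⟩ := pre y hy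
    refine ⟨u, ⟨Metric.mem_ball.mpr ((hproj u w).trans_lt ?_), huδ⟩, hu⟩
    rw [hu, hw]
    have h1 := dist_triangle_right y Q P
    linarith [Metric.mem_ball.mp hy.1, Metric.mem_ball.mp hQ]
  have hmeas : MeasurableSet (Metric.ball w (2 * ρ) ∩ Metric.ball u₀ δ) :=
    Metric.isOpen_ball.measurableSet.inter Metric.isOpen_ball.measurableSet
  refine (measure_mono hsub).trans ?_
  rw [euclideanHausdorffMeasure_chartGraph_image hc.norm_eq hc.contDiff hmeas]
  calc ∫⁻ u in Metric.ball w (2 * ρ) ∩ Metric.ball u₀ δ, ENNReal.ofReal (J u)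
      ≤ ∫⁻ u in Metric.ball w (2 * ρ) ∩ Metric.ball u₀ δ, ENNReal.ofReal (J u₀ + 1) :=
        setLIntegral_mono' hmeas fun u hu => ENNReal.ofReal_le_ofReal (hball hu.2).le
    _ ≤ ENNReal.ofReal (J u₀ + 1) * volume (Metric.ball w (2 * ρ)) := by
        rw [setLIntegral_const]
        gcongr
        exact inter_subset_left
    _ = ENNReal.ofReal ((J u₀ + 1) * (2 ^ (n - 1) * V) * ρ ^ (n - 1)) := by
        rw [Measure.addHaar_ball_of_pos _ _ (by positivity),
            finrank_orthogonal_singleton hc.norm_eq,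
          ← ENNReal.ofReal_toReal (measure_ball_lt_top (μ := volume) (x := (0 : (ℝ ∙ ν)ᗮ))
            (r := 1)).ne, ← hV, ← ENNReal.ofReal_mul (by positivity),
          ← ENNReal.ofReal_mul (by positivity)]
        congr 1
        rw [mul_pow]
        ring

theorem surfaceMeasure_compl_frontier (Ω : Set (Space n)) :
    surfaceMeasure Ω (frontier Ω)ᶜ = 0 := by
  rw [surfaceMeasure_apply _ isClosed_frontier.measurableSet.compl, compl_inter_self,
    measure_empty]

theorem ae_mem_frontier (Ω : Set (Space n)) : ∀ᵐ P ∂surfaceMeasure Ω, P ∈ frontier Ω :=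
  surfaceMeasure_compl_frontier Ω

theorem IsBoundedC2Domain.isFiniteMeasure (hΩ : IsBoundedC2Domain Ω) :
    IsFiniteMeasure (surfaceMeasure Ω) := by
  refine ⟨?_⟩
  have h1 : surfaceMeasure Ω (frontier Ω) < ∞ := by
    refine hΩ.isCompact_frontier.measure_lt_top_of_nhdsWithin fun P hP => ?_
    obtain ⟨C, δ, hC, hδ, h⟩ := hΩ.local_ahlfors hP
    refine ⟨Metric.ball P (δ / 2), mem_nhdsWithin_of_mem_nhds
      (Metric.ball_mem_nhds _ (by positivity)), ?_⟩
    exact (h P (Metric.mem_ball_self hδ) _ (by positivity) (by linarith)).trans_lt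
      ENNReal.ofReal_lt_top
  rw [← union_compl_self (frontier Ω)]
  refine (measure_union_le _ _).trans_lt ?_
  rwa [surfaceMeasure_compl_frontier, add_zero]

/-- Upper Ahlfors regularity of the surface measure. -/
theorem IsBoundedC2Domain.exists_ahlfors (hΩ : IsBoundedC2Domain Ω) :
    ∃ C : ℝ, 0 < C ∧ ∀ (P : Space n) (ρ : ℝ), 0 < ρ →
      surfaceMeasure Ω (Metric.ball P ρ) ≤ ENNReal.ofReal (C * ρ ^ (n - 1)) := by
  have hfin := hΩ.isFiniteMeasure
  have h : ∃ C δ : ℝ, 0 < C ∧ 0 < δ ∧ ∀ P ∈ frontier Ω, ∀ ρ, 0 < ρ → ρ < δ →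
      surfaceMeasure Ω (Metric.ball P ρ) ≤ ENNReal.ofReal (C * ρ ^ (n - 1)) := by
    refine hΩ.isCompact_frontier.induction_on (p := fun S => ∃ C δ : ℝ, 0 < C ∧ 0 < δ ∧ ∀ P ∈ S,
      ∀ ρ, 0 < ρ → ρ < δ → surfaceMeasure Ω (Metric.ball P ρ) ≤ ENNReal.ofReal (C * ρ ^ (n - 1)))
      ⟨1, 1, one_pos, one_pos, by simp⟩ ?_ ?_ ?_
    · rintro s t hst ⟨C, δ, hC, hδ, h⟩
      exact ⟨C, δ, hC, hδ, fun P hP => h P (hst hP)⟩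
    · rintro s t ⟨C, δ, hC, hδ, h⟩ ⟨C', δ', hC', hδ', h'⟩
      refine ⟨max C C', min δ δ', lt_max_of_lt_left hC, lt_min hδ hδ', fun P hP ρ hρ hρ' => ?_⟩
      have hk : 0 ≤ ρ ^ (n - 1) := by positivity
      rcases hP with hP | hP
      · exact (h P hP ρ hρ (hρ'.trans_le (min_le_left _ _))).trans
          (ENNReal.ofReal_le_ofReal (mul_le_mul_of_nonneg_right (le_max_left _ _) hk))
      · exact (h' P hP ρ hρ (hρ'.trans_le (min_le_right _ _))).trans
          (ENNReal.ofReal_le_ofReal (mul_le_mul_of_nonneg_right (le_max_right _ _) hk))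
    · intro P₀ hP₀
      obtain ⟨C, δ, hC, hδ, h⟩ := hΩ.local_ahlfors hP₀
      exact ⟨Metric.ball P₀ δ, mem_nhdsWithin_of_mem_nhds (Metric.ball_mem_nhds _ hδ), C, δ, hC, hδ,
        h⟩
  obtain ⟨C, δ, hC, hδ, h⟩ := h
  set S := (surfaceMeasure Ω).real univ with hS
  have hS0 : 0 ≤ S := measureReal_nonneg
  set C' := max C (S / δ ^ (n - 1)) with hC'
  have hC'0 : 0 < C' := lt_max_of_lt_left hC
  have hfr : ∀ P ∈ frontier Ω, ∀ ρ, 0 < ρ →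
      surfaceMeasure Ω (Metric.ball P ρ) ≤ ENNReal.ofReal (C' * ρ ^ (n - 1)) := by
    intro P hP ρ hρ
    rcases lt_or_ge ρ δ with hd | hd
    · refine (h P hP ρ hρ hd).trans (ENNReal.ofReal_le_ofReal ?_)
      gcongr
      exact le_max_left _ _
    · calc surfaceMeasure Ω (Metric.ball P ρ) ≤ surfaceMeasure Ω univ :=
            measure_mono (subset_univ _)
        _ = ENNReal.ofReal S := by rw [hS, ofReal_measureReal]
        _ ≤ ENNReal.ofReal (C' * ρ ^ (n - 1)) := by
          refine ENNReal.ofReal_le_ofReal ?_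
          calc S = S / δ ^ (n - 1) * δ ^ (n - 1) := by field_simp
            _ ≤ C' * ρ ^ (n - 1) := by
              gcongr
              exact le_max_right _ _
  refine ⟨C' * 2 ^ (n - 1), by positivity, fun P ρ hρ => ?_⟩
  rcases (Metric.ball P ρ ∩ frontier Ω).eq_empty_or_nonempty with he | ⟨Q, hQ, hQf⟩
  · rw [surfaceMeasure_apply _ Metric.isOpen_ball.measurableSet, he]
    simp
  · calc surfaceMeasure Ω (Metric.ball P ρ) ≤ surfaceMeasure Ω (Metric.ball Q (2 * ρ)) := by
          refine measure_mono (Metric.ball_subset_ball' ?_)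
          rw [dist_comm]
          linarith [Metric.mem_ball.mp hQ]
      _ ≤ ENNReal.ofReal (C' * (2 * ρ) ^ (n - 1)) := hfr Q hQf _ (by positivity)
      _ = _ := by rw [mul_pow]; ring_nf

theorem IsBoundedC2Domain.surfaceMeasure_singleton (hΩ : IsBoundedC2Domain Ω) (hn : 3 ≤ n)
    (P : Space n) : surfaceMeasure Ω {P} = 0 := by
  obtain ⟨C, hC, h⟩ := hΩ.exists_ahlfors
  have hlim : Tendsto (fun ρ : ℝ => ENNReal.ofReal (C * ρ ^ (n - 1))) (𝓝[>] 0) (𝓝 0) := by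
    have hc : Continuous fun ρ : ℝ => ENNReal.ofReal (C * ρ ^ (n - 1)) :=
      ENNReal.continuous_ofReal.comp (by fun_prop)
    have := hc.tendsto 0
    rw [zero_pow (by omega), mul_zero, ENNReal.ofReal_zero] at this
    exact this.mono_left nhdsWithin_le_nhds
  refine le_antisymm (ge_of_tendsto hlim ?_) zero_le
  filter_upwards [self_mem_nhdsWithin] with ρ hρ
  exact (measure_mono (singleton_subset_iff.mpr (Metric.mem_ball_self hρ))).trans (h P ρ hρ)

theorem IsBoundedC2Domain.aestronglyMeasurable_normal (hΩ : IsBoundedC2Domain Ω) :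
    AEStronglyMeasurable (outwardNormal Ω) (surfaceMeasure Ω) := by
  obtain ⟨C, hC, h⟩ := hΩ.exists_lipschitz_normal
  have hL : LipschitzOnWith C.toNNReal (outwardNormal Ω) (frontier Ω) :=
    LipschitzOnWith.of_dist_le_mul fun P hP P' hP' => by
      rw [Real.coe_toNNReal _ hC.le, dist_eq_norm]
      exact h P hP P' hP'
  exact hL.continuousOn.aestronglyMeasurable isClosed_frontier.measurableSet

/-- Boundary points pushed a little way along the normal are uniformly far from the boundary,
on either side. -/
theorem IsBoundedC2Domain.exists_norm_sub_normal (hΩ : IsBoundedC2Domain Ω) :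
    ∃ δ₀ : ℝ, 0 < δ₀ ∧ ∀ P ∈ frontier Ω, ∀ Q ∈ frontier Ω, ∀ s : ℝ, |s| ≤ δ₀ →
      (‖P - Q‖ ^ 2 + s ^ 2) / 2 ≤ ‖P - (Q + s • outwardNormal Ω Q)‖ ^ 2 := by
  obtain ⟨C, hC, h⟩ := hΩ.exists_inner_normal_le
  refine ⟨1 / (4 * C), by positivity, fun P hP Q hQ s hs => ?_⟩
  have h1 := h Q hQ P hP
  rw [← sub_sub, norm_sub_sq_real (P - Q), real_inner_smul_right, norm_smul,
    hΩ.norm_outwardNormal hQ, mul_one, Real.norm_eq_abs, sq_abs]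
  rw [dist_comm, dist_eq_norm] at h1
  have h2 : s * ⟪P - Q, outwardNormal Ω Q⟫ ≤ 1 / (4 * C) * (C * ‖P - Q‖ ^ 2) := by
    refine (le_abs_self _).trans ?_
    rw [abs_mul]
    gcongr
  have h3 : 1 / (4 * C) * (C * ‖P - Q‖ ^ 2) = ‖P - Q‖ ^ 2 / 4 := by field_simp
  nlinarith [sq_nonneg s]

theorem inter_frontier_nonempty_of_isPreconnected {A : Set (Space n)} (hA : IsPreconnected A)
    (hO : IsOpen Ω) (h1 : (A ∩ Ω).Nonempty) (h2 : (A ∩ Ωᶜ).Nonempty) :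
    ∃ z ∈ A, z ∈ frontier Ω := by
  by_contra! hno
  have hcl : ∀ z ∈ A, z ∉ Ω → z ∈ (closure Ω)ᶜ := fun z hz hzΩ hc =>
    hno z hz (by rw [hO.frontier_eq]; exact ⟨hc, hzΩ⟩)
  obtain ⟨z, -, hz, hz'⟩ := hA Ω (closure Ω)ᶜ hO isClosed_closure.isOpen_compl
    (fun z hz => (em (z ∈ Ω)).imp_right (hcl z hz)) h1
    (h2.imp fun z hz => ⟨hz.1, hcl z hz.1 hz.2⟩)
  exact hz' (subset_closure hz)

/-- Boundary points pushed a little way along the outward normal lie outside `Ω`. -/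
theorem IsBoundedC2Domain.exists_notMem_closure (hΩ : IsBoundedC2Domain Ω) :
    ∃ δ₀ : ℝ, 0 < δ₀ ∧ ∀ Q ∈ frontier Ω, ∀ s : ℝ, 0 < s → s ≤ δ₀ →
      Q + s • outwardNormal Ω Q ∉ closure Ω := by
  obtain ⟨δ₀, hδ₀, h⟩ := hΩ.exists_norm_sub_normal
  refine ⟨δ₀, hδ₀, fun Q hQ s hs hsδ => ?_⟩
  set N := outwardNormal Ω Q with hN
  have hN1 : ‖N‖ = 1 := hΩ.norm_outwardNormal hQ
  have hcont : Continuous fun s : ℝ => Q + s • N := by fun_prop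
  have hnf : ∀ s' : ℝ, 0 < s' → s' ≤ δ₀ → Q + s' • N ∉ frontier Ω := fun s' h0 h1 hf => by
    have h2 := h _ hf Q hQ s' (by rwa [abs_of_pos h0])
    rw [sub_self, norm_zero] at h2
    nlinarith [sq_nonneg ‖Q + s' • N - Q‖, sq_pos_of_pos h0]
  have hev : ∀ᶠ s' : ℝ in 𝓝[>] 0, Q + s' • N ∉ Ω := by
    have ht : Tendsto (fun s : ℝ => Q + s • N) (𝓝[>] 0) (𝓝 Q) := by
      have := hcont.tendsto 0
      simp only [zero_smul, add_zero] at this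
      exact this.mono_left nhdsWithin_le_nhds
    filter_upwards [ht.eventually ((hΩ.isOutwardUnitNormal hQ).2 (1 / 2) (by norm_num)),
      self_mem_nhdsWithin] with s' h1 h2 h3
    have h4 := h1.1 h3
    have h2' : (0 : ℝ) < s' := h2
    rw [add_sub_cancel_left, real_inner_smul_left, ← hN, inner_self_of_norm_one hN1, norm_smul, hN1,
      Real.norm_of_nonneg h2'.le] at h4
    linarith
  obtain ⟨s₁, hs₁, hs₁'⟩ := (hev.and (Ioo_mem_nhdsGT hs)).exists
  intro hcl
  have hΩs : Q + s • N ∈ Ω := by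
    by_contra hno
    exact hnf s hs hsδ (by rw [hΩ.isOpen.frontier_eq]; exact ⟨hcl, hno⟩)
  -- the segment from the exterior point to the interior point meets the boundary
  have hconn : IsPreconnected ((fun s : ℝ => Q + s • N) '' Icc s₁ s) :=
    isPreconnected_Icc.image _ hcont.continuousOn
  obtain ⟨_, ⟨s', hs', rfl⟩, hf⟩ := inter_frontier_nonempty_of_isPreconnected hconn hΩ.isOpen
    ⟨_, ⟨s, right_mem_Icc.mpr hs₁'.2.le, rfl⟩, hΩs⟩ ⟨_, ⟨s₁, left_mem_Icc.mpr hs₁'.2.le, rfl⟩, hs₁⟩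
  exact hnf s' (hs₁'.1.trans_le hs'.1) (hs'.2.trans hsδ) hf

/-- The ball around an interior point with radius the distance to the boundary is in `Ω`. -/
theorem ball_infDist_subset (hO : IsOpen Ω) {x : Space n} (hx : x ∈ Ω) :
    Metric.ball x (Metric.infDist x (frontier Ω)) ⊆ Ω := by
  intro y hy
  by_contra hno
  obtain ⟨z, hz, hzf⟩ := inter_frontier_nonempty_of_isPreconnected
    (convex_ball x (Metric.infDist x (frontier Ω))).isPreconnected hO
    ⟨x, Metric.mem_ball_self (dist_nonneg.trans_lt hy), hx⟩ ⟨y, hy, hno⟩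
  have h1 := Metric.infDist_le_dist_of_mem (x := x) hzf
  rw [dist_comm] at h1
  exact absurd (Metric.mem_ball.mp hz) (not_lt.mpr h1)

/-- An interior point lies on the inner normal through its nearest boundary point. -/
theorem IsBoundedC2Domain.sub_eq_smul_normal (hΩ : IsBoundedC2Domain Ω) {x P : Space n} (hx : x ∈ Ω)
    (hP : P ∈ frontier Ω) (hd : dist x P = Metric.infDist x (frontier Ω)) :
    x = P - dist x P • outwardNormal Ω P := by
  set v := outwardNormal Ω P with hv
  have hv1 : ‖v‖ = 1 := hΩ.norm_outwardNormal hP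
  have hPΩ : P ∉ Ω := fun h => by
    rw [hΩ.isOpen.frontier_eq] at hP
    exact hP.2 h
  have hne : x - P ≠ 0 := fun h => hPΩ (sub_eq_zero.mp h ▸ hx)
  have hball := ball_infDist_subset hΩ.isOpen hx
  rw [← hd] at hball
  -- directions pointing into the ball make an obtuse angle with the normal
  have key : ∀ w : Space n, 0 < ⟪w, x - P⟫ → ⟪w, v⟫ ≤ 0 := by
    intro w hw
    have ht : Tendsto (fun s : ℝ => P + s • w) (𝓝[>] 0) (𝓝 P) := by
      have : Continuous (fun s : ℝ => P + s • w) := by fun_prop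
      have := this.tendsto 0
      simp only [zero_smul, add_zero] at this
      exact this.mono_left nhdsWithin_le_nhds
    have hmem : ∀ᶠ s : ℝ in 𝓝[>] 0, P + s • w ∈ Ω := by
      have hpos : 0 < 2 * ⟪w, x - P⟫ / (‖w‖ ^ 2 + 1) := by positivity
      filter_upwards [Ioo_mem_nhdsGT hpos] with s hs
      refine hball (Metric.mem_ball.mpr ?_)
      rw [dist_eq_norm, dist_eq_norm, show P + s • w - x = s • w - (x - P) by abel]
      refine lt_of_pow_lt_pow_left₀ 2 (norm_nonneg _) ?_
      rw [norm_sub_sq_real, real_inner_smul_left, norm_smul, mul_pow, Real.norm_eq_abs, sq_abs]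
      have h1 := hs.1
      have h2 := (lt_div_iff₀ (by positivity)).mp hs.2
      nlinarith [sq_nonneg ‖w‖]
    refine le_of_forall_pos_le_add fun ε hε => ?_
    have hε' : 0 < ε / (‖w‖ + 1) := by positivity
    obtain ⟨s, ⟨h1, h2⟩, h3⟩ := ((hmem.and (ht.eventually
      ((hΩ.isOutwardUnitNormal hP).2 _ hε'))).and self_mem_nhdsWithin).exists
    have h3' : (0 : ℝ) < s := h3
    have h4 := h2.1 h1
    rw [add_sub_cancel_left, real_inner_smul_left, norm_smul, Real.norm_of_nonneg h3'.le,
      ← hv] at h4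
    have h5 : ⟪w, v⟫ ≤ ε / (‖w‖ + 1) * ‖w‖ := by
      refine le_of_mul_le_mul_left ?_ h3'
      linarith
    have h6 : ε / (‖w‖ + 1) * ‖w‖ ≤ ε := by
      rw [div_mul_eq_mul_div, div_le_iff₀ (by positivity)]
      nlinarith [norm_nonneg w]
    linarith
  have hpos : 0 < ‖x - P‖ := norm_pos_iff.mpr hne
  -- the component of the normal orthogonal to `x - P` vanishes
  have hcs : ‖x - P‖ ≤ -⟪x - P, v⟫ := by
    refine le_of_forall_pos_le_add fun ε hε => ?_
    have h1 := key (‖x - P‖ • v + (1 + ε / ‖x - P‖) • (x - P)) (by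
      rw [inner_add_left, real_inner_smul_left, real_inner_smul_left, real_inner_self_eq_norm_sq]
      have h2 := abs_le.mp (abs_real_inner_le_norm v (x - P))
      rw [hv1, one_mul] at h2
      have h3 : (1 + ε / ‖x - P‖) * ‖x - P‖ ^ 2 = ‖x - P‖ ^ 2 + ε * ‖x - P‖ := by field_simp
      nlinarith [mul_pos hε hpos, h2.1])
    rw [inner_add_left, real_inner_smul_left, real_inner_smul_left, inner_self_of_norm_one hv1,
      mul_one] at h1
    have h2 := (abs_le.mp (abs_real_inner_le_norm (x - P) v)).1
    rw [hv1, mul_one] at h2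
    have h3 : ε / ‖x - P‖ * (-⟪x - P, v⟫) ≤ ε := by
      rw [div_mul_eq_mul_div, div_le_iff₀ hpos]
      nlinarith
    linarith
  rw [dist_eq_norm]
  have : ‖(x - P) + ‖x - P‖ • v‖ ^ 2 ≤ 0 := by
    rw [norm_add_sq_real, real_inner_smul_right, norm_smul, hv1, norm_norm]
    nlinarith
  have h0 : (x - P) + ‖x - P‖ • v = 0 := by
    rw [← norm_eq_zero]
    exact pow_eq_zero_iff (two_ne_zero) |>.mp (le_antisymm this (sq_nonneg _))
  rw [eq_sub_iff_add_eq, ← sub_eq_zero]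
  rw [← h0]; abel

end Stokes

namespace Stokes

/-! ### The Gauss–Green formula -/

section GaussGreen

variable {n : ℕ} {Ω : Set (Space n)}

/-- Coordinates straightening the graph of `Φ`: the point at height `s` above the graph over `u`. -/
noncomputable def chartCoord (ν : Space n) (Φ : Space n → ℝ) (z : (ℝ ∙ ν)ᗮ × ℝ) : Space n :=
  z.1 + (Φ z.1 + z.2) • ν

variable {ν : Space n} {Φ : Space n → ℝ}

theorem chartFun_chartCoord (hν : ‖ν‖ = 1) (z : (ℝ ∙ ν)ᗮ × ℝ) :
    chartFun ν Φ (chartCoord ν Φ z) = -z.2 := by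
  rw [chartCoord, chartFun_chartGraph_add hν]
  ring

theorem isClosedEmbedding_chartCoord (hν : ‖ν‖ = 1) (hΦ : Continuous Φ) :
    IsClosedEmbedding (chartCoord ν Φ) := by
  have hl : Function.LeftInverse (fun y : Space n => (((ℝ ∙ ν)ᗮ.orthogonalProjectionOnto y,
      ⟪ν, y⟫ - Φ ((ℝ ∙ ν)ᗮ.orthogonalProjectionOnto y)) : (ℝ ∙ ν)ᗮ × ℝ)) (chartCoord ν Φ) := by
    rintro ⟨u, s⟩
    have h1 : (ℝ ∙ ν)ᗮ.orthogonalProjectionOnto ((u : Space n) + (Φ u + s) • ν) = u := by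
      rw [map_add, map_smul, Submodule.orthogonalProjectionOnto_mem_subspace_eq_self,
        Submodule.orthogonalProjectionOnto_orthogonalComplement_singleton_eq_zero, smul_zero,
        add_zero]
    have h2 : ⟪ν, (u : Space n) + (Φ u + s) • ν⟫ = Φ u + s := by
      rw [inner_add_right, real_inner_smul_right, inner_self_of_norm_one hν, real_inner_comm,
        inner_coe_orthogonal]
      ring
    simp only [chartCoord, h1, h2]
    simp
  refine hl.isClosedEmbedding ?_ ?_
  · fun_prop
  · unfold chartCoord; fun_prop

theorem measurePreserving_chartCoord (hν : ‖ν‖ = 1) (hΦ : Continuous Φ) :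
    MeasurePreserving (chartCoord ν Φ) := by
  have h1 := ((ℝ ∙ ν).measurePreserving_measurableEquivProd (0 : Space n)).symm
  rw [InnerProductSpace.euclideanHausdorffMeasure_eq_volume] at h1
  have h2 : MeasurePreserving (LinearIsometryEquiv.toSpanUnitSingleton (𝕜 := ℝ) ν hν) :=
    LinearIsometryEquiv.measurePreserving _
  have h3 : MeasurePreserving (fun z : (ℝ ∙ ν)ᗮ × ℝ => ((z.1, Φ z.1 + z.2) : (ℝ ∙ ν)ᗮ × ℝ)) := by
    refine MeasurePreserving.skew_product (g := fun (u : (ℝ ∙ ν)ᗮ) (s : ℝ) => Φ u + s)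
      (MeasurePreserving.id _) ?_ (ae_of_all _ fun u => ?_)
    · exact Continuous.measurable (by fun_prop)
    · exact (measurePreserving_add_left volume (Φ u)).map_eq
  have h4 := h1.comp ((h2.prod (MeasurePreserving.id (volume : Measure (ℝ ∙ ν)ᗮ))).comp
    (Measure.measurePreserving_swap.comp h3))
  convert h4 using 1
  funext z
  simp [chartCoord, LinearIsometryEquiv.toSpanUnitSingleton, add_comm]

theorem fderiv_chartFun_apply (hΦ : ContDiff ℝ 2 Φ) (y a : Space n) :
    fderiv ℝ (chartFun ν Φ) y a =
      fderiv ℝ Φ (y - ⟪ν, y⟫ • ν) (a - ⟪ν, a⟫ • ν) - ⟪ν, a⟫ := by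
  have h1 : HasFDerivAt (fun y : Space n => ⟪ν, y⟫) (innerSL ℝ ν) y := (innerSL ℝ ν).hasFDerivAt
  have h2 : HasFDerivAt Φ (fderiv ℝ Φ (y - ⟪ν, y⟫ • ν)) (y - ⟪ν, y⟫ • ν) :=
    (hΦ.differentiable (by norm_num) _).hasFDerivAt
  have h3 := (h2.comp y ((hasFDerivAt_id y).sub (h1.smul_const ν))).sub h1
  have h4 : fderiv ℝ (chartFun ν Φ) y = _ := h3.fderiv
  rw [h4]
  simp

theorem integral_fderiv_eq_zero_of_hasCompactSupport {V : Type*} [NormedAddCommGroup V]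
    [NormedSpace ℝ V] [FiniteDimensional ℝ V] [MeasurableSpace V] [BorelSpace V]
    (μ : Measure V) [μ.IsAddHaarMeasure] {G : V → ℝ} (hG : ContDiff ℝ 1 G)
    (hs : HasCompactSupport G) (w : V) : ∫ u, fderiv ℝ G u w ∂μ = 0 := by
  have hc : Continuous fun u => fderiv ℝ G u w :=
    (hG.continuous_fderiv (by norm_num)).clm_apply continuous_const
  have h := integral_mul_fderiv_eq_neg_fderiv_mul_of_integrable (𝕜 := ℝ) (μ := μ)
    (f := fun _ : V => (1 : ℝ)) (g := G) (v := w) (by simp)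
    (by simpa using hc.integrable_of_hasCompactSupport (hs.fderiv_apply ℝ w))
    (by simpa using hG.continuous.integrable_of_hasCompactSupport hs)
    (fun _ _ => differentiableAt_const _) (fun _ _ => (hG.differentiable (by norm_num)) _)
  simpa using h

/-- The surface integral of a function supported in a chart, in graph coordinates. -/
theorem IsChart.integral_surface {P : Space n} {r : ℝ} (hc : IsChart Ω P r ν Φ)
    (hΩ : IsBoundedC2Domain Ω) {F : Space n → ℝ}
    (hs : tsupport F ⊆ Metric.ball P r) (a : Space n) :
    ∫ y, F y * ⟪outwardNormal Ω y, a⟫ ∂surfaceMeasure Ω =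
      ∫ u, F (chartGraph ν Φ u) * fderiv ℝ (chartFun ν Φ) (chartGraph ν Φ u) a := by
  set ψ := chartFun ν Φ with hψ
  have hψ2 : ContDiff ℝ 2 ψ := contDiff_chartFun hc.contDiff
  have hout : ∀ y, y ∉ Metric.ball P r → F y = 0 := fun y hy =>
    image_eq_zero_of_notMem_tsupport fun h => hy (hs h)
  have hemb := (isClosedEmbedding_chartGraph (ν := ν) hc.contDiff).measurableEmbedding
  have hΦ' : ContDiff ℝ 1 fun u : (ℝ ∙ ν)ᗮ => Φ u :=
    (hc.contDiff.of_le (by norm_num)).comp (ℝ ∙ ν)ᗮ.subtypeL.contDiff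
  set k : Space n → ℝ := fun y => F y * (‖gradient ψ y‖⁻¹ * fderiv ℝ ψ y a) with hk
  have hgraph : ∀ u, ψ (chartGraph ν Φ u) = 0 := fun u => by
    rw [chartGraph_apply, hψ, chartFun_chartGraph_add hc.norm_eq, sub_self]
  have hmap : (μHE[n - 1] : Measure (Space n)).restrict (range (chartGraph ν Φ)) =
      ((volume : Measure (ℝ ∙ ν)ᗮ).withDensity fun u =>
        ENNReal.ofReal (graphDensity (fun u : (ℝ ∙ ν)ᗮ => Φ u) u)).map (chartGraph ν Φ) := by
    have h := comap_graphMap_euclideanHausdorffMeasure (j := (ℝ ∙ ν)ᗮ.subtypeₗᵢ) hc.norm_eq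
      inner_coe_orthogonal hΦ'
    rw [finrank_orthogonal_singleton hc.norm_eq] at h
    rw [← h]
    exact (hemb.map_comap _).symm
  calc ∫ y, F y * ⟪outwardNormal Ω y, a⟫ ∂surfaceMeasure Ω
      = ∫ y in frontier Ω, k y ∂μHE[n - 1] := by
        refine setIntegral_congr_fun isClosed_frontier.measurableSet fun y hy => ?_
        by_cases hyb : y ∈ Metric.ball P r
        · change F y * ⟪outwardNormal Ω y, a⟫ = F y * (‖gradient ψ y‖⁻¹ * fderiv ℝ ψ y a)
          rw [hc.outwardNormal_eq hΩ hyb hy, real_inner_smul_left, inner_gradient_left']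
        · simp [hk, hout y hyb]
    _ = ∫ y in range (chartGraph ν Φ), k y ∂μHE[n - 1] := by
        rw [← integral_indicator isClosed_frontier.measurableSet,
          ← integral_indicator hemb.measurableSet_range]
        congr 1
        funext y
        by_cases hyb : y ∈ Metric.ball P r
        · have : y ∈ frontier Ω ↔ y ∈ range (chartGraph ν Φ) := by
            rw [hc.mem_frontier_iff hΩ.isOpen hyb]
            refine ⟨fun h => ?_, ?_⟩
            · obtain ⟨u, -, hu⟩ := exists_chartGraph_eq hc.norm_eq h
              exact ⟨u, hu⟩
            · rintro ⟨u, rfl⟩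
              exact hgraph u
          by_cases h : y ∈ frontier Ω
          · rw [indicator_of_mem h, indicator_of_mem (this.mp h)]
          · rw [indicator_of_notMem h, indicator_of_notMem (fun h' => h (this.mpr h'))]
        · have h0 : k y = 0 := by simp [hk, hout y hyb]
          have hz : ∀ s : Set (Space n), s.indicator k y = 0 := fun s => by
            by_cases h : y ∈ s
            · rw [indicator_of_mem h, h0]
            · rw [indicator_of_notMem h]
          exact (hz _).trans (hz _).symm
    _ = ∫ u, (graphDensity (fun u : (ℝ ∙ ν)ᗮ => Φ u) u) * k (chartGraph ν Φ u) := by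
        rw [hmap, hemb.integral_map, integral_withDensity_eq_integral_toReal_smul
          (continuous_graphDensity hΦ').measurable.ennreal_ofReal (ae_of_all _ fun _ =>
            ENNReal.ofReal_lt_top)]
        congr 1
        funext u
        rw [ENNReal.toReal_ofReal (zero_le_one.trans (one_le_graphDensity _ _)), smul_eq_mul]
    _ = _ := by
        congr 1
        funext u
        rw [graphDensity_eq_norm_gradient hc.norm_eq hc.contDiff u (Φ u), ← chartGraph_apply, ← hψ]
        have h0 : ‖gradient ψ (chartGraph ν Φ u)‖ ≠ 0 :=
          norm_ne_zero_iff.mpr (gradient_chartFun_ne_zero hc.norm_eq hc.contDiff _)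
        simp only [hk]
        field_simp

/-- The Gauss–Green formula for functions supported in a chart. -/
theorem IsChart.gauss_green {P : Space n} {r : ℝ} (hc : IsChart Ω P r ν Φ)
    (hΩ : IsBoundedC2Domain Ω) {F : Space n → ℝ} (hF : ContDiff ℝ 1 F)
    (hs : tsupport F ⊆ Metric.ball P r) (a : Space n) :
    ∫ y, F y * ⟪outwardNormal Ω y, a⟫ ∂surfaceMeasure Ω = ∫ y in Ω, fderiv ℝ F y a := by
  have hcs : HasCompactSupport F :=
    Metric.isCompact_of_isClosed_isBounded (isClosed_tsupport F) (Metric.isBounded_ball.subset hs)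
  rw [hc.integral_surface hΩ hs]
  set ψ := chartFun ν Φ with hψ
  have hν := hc.norm_eq
  have hΦ := hc.contDiff
  have hψ2 : ContDiff ℝ 2 ψ := contDiff_chartFun hΦ
  have hout : ∀ y, y ∉ Metric.ball P r → fderiv ℝ F y a = 0 := fun y hy => by
    have : y ∉ tsupport (fderiv ℝ F) := fun h => hy (hs (tsupport_fderiv_subset ℝ h))
    rw [image_eq_zero_of_notMem_tsupport this]; rfl
  set Θ := chartCoord ν Φ with hΘ
  have hΘe := isClosedEmbedding_chartCoord hν hΦ.continuous
  have hΘm := measurePreserving_chartCoord hν hΦ.continuous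
  set c := ⟪ν, a⟫ with hcdef
  set w : (ℝ ∙ ν)ᗮ := ⟨a - c • ν, by
    rw [Submodule.mem_orthogonal_singleton_iff_inner_right, inner_sub_right,
      real_inner_smul_right, inner_self_of_norm_one hν, mul_one, sub_self]⟩ with hw
  set q : (ℝ ∙ ν)ᗮ → ℝ := fun u => fderiv ℝ Φ u w - c with hq
  have hqψ : ∀ u, fderiv ℝ ψ (chartGraph ν Φ u) a = q u := fun u => by
    rw [hψ, fderiv_chartFun_apply hΦ, chartGraph_apply]
    have : ⟪ν, (u : Space n) + Φ u • ν⟫ = Φ u := by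
      rw [inner_add_right, real_inner_smul_right, inner_self_of_norm_one hν, real_inner_comm,
        inner_coe_orthogonal]
      ring
    rw [this, add_sub_cancel_right]
  have hqc : Continuous q := by
    have := hΦ.continuous_fderiv (by norm_num)
    simp only [hq]
    fun_prop
  -- the vertical derivative
  set K : (ℝ ∙ ν)ᗮ × ℝ → ℝ := fun z => fderiv ℝ F (Θ z) ν with hK
  have hdF : Continuous (fderiv ℝ F) := hF.continuous_fderiv (by norm_num)
  have hKc : Continuous K := (hdF.comp hΘe.continuous).clm_apply continuous_const
  have hKs : HasCompactSupport K := (hcs.fderiv_apply ℝ ν).comp_isClosedEmbedding hΘe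
  -- the horizontal derivative at fixed height above the graph
  set G : ℝ → (ℝ ∙ ν)ᗮ → ℝ := fun s u => F (Θ (u, s)) with hG
  have hΘd : ∀ s, ContDiff ℝ 1 fun u : (ℝ ∙ ν)ᗮ => Θ (u, s) := fun s => by
    have h1 : ContDiff ℝ 1 fun u : (ℝ ∙ ν)ᗮ => Φ u :=
      (hΦ.of_le (by norm_num)).comp (ℝ ∙ ν)ᗮ.subtypeL.contDiff
    have h2 : ContDiff ℝ 1 fun u : (ℝ ∙ ν)ᗮ => (u : Space n) := (ℝ ∙ ν)ᗮ.subtypeL.contDiff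
    exact h2.add ((h1.add contDiff_const).smul contDiff_const)
  have hGd : ∀ s, ContDiff ℝ 1 (G s) := fun s => hF.comp (hΘd s)
  have hGs : ∀ s, HasCompactSupport (G s) := fun s =>
    (hcs.comp_isClosedEmbedding hΘe).comp_isClosedEmbedding
      (Function.LeftInverse.isClosedEmbedding (f := Prod.fst) (g := fun u : (ℝ ∙ ν)ᗮ => (u, s))
        (fun _ => rfl) continuous_fst (by fun_prop))
  have hdG : ∀ s u, fderiv ℝ (G s) u w = fderiv ℝ F (Θ (u, s)) a + q u * K (u, s) := by
    intro s u
    have h1 : HasFDerivAt (fun u : (ℝ ∙ ν)ᗮ => Θ (u, s))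
        ((ℝ ∙ ν)ᗮ.subtypeL + ((fderiv ℝ Φ u).comp (ℝ ∙ ν)ᗮ.subtypeL).smulRight ν) u := by
      have h2 : HasFDerivAt (fun u : (ℝ ∙ ν)ᗮ => Φ u) ((fderiv ℝ Φ u).comp (ℝ ∙ ν)ᗮ.subtypeL) u :=
        ((hΦ.differentiable (by norm_num)) (u : Space n)).hasFDerivAt.comp u
          (ℝ ∙ ν)ᗮ.subtypeL.hasFDerivAt
      exact (ℝ ∙ ν)ᗮ.subtypeL.hasFDerivAt.add ((h2.add_const s).smul_const ν)
    have h3 := ((hF.differentiable (by norm_num)) (Θ (u, s))).hasFDerivAt.comp u h1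
    have h4 : fderiv ℝ (G s) u = _ := h3.fderiv
    rw [h4]
    have h5 : (w : Space n) = a - c • ν := rfl
    simp only [ContinuousLinearMap.comp_apply, add_apply, Submodule.subtypeL_apply,
      ContinuousLinearMap.smulRight_apply, map_add, map_smul, smul_eq_mul, hK, hq]
    rw [h5, map_sub, map_smul]
    simp only [smul_eq_mul, map_sub, map_smul]
    ring
  have hac : Continuous fun z => fderiv ℝ F (Θ z) a :=
    (hdF.comp hΘe.continuous).clm_apply continuous_const
  have hai : Integrable fun z => fderiv ℝ F (Θ z) a :=
    hac.integrable_of_hasCompactSupport ((hcs.fderiv_apply ℝ a).comp_isClosedEmbedding hΘe)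
  have hqKi : Integrable fun z : (ℝ ∙ ν)ᗮ × ℝ => q z.1 * K z :=
    ((hqc.comp continuous_fst).mul hKc).integrable_of_hasCompactSupport hKs.mul_left
  have hres : (volume : Measure ((ℝ ∙ ν)ᗮ × ℝ)).restrict (univ ×ˢ Ioi 0) =
      (volume : Measure (ℝ ∙ ν)ᗮ).prod (volume.restrict (Ioi 0)) := by
    rw [Measure.volume_eq_prod, ← Measure.prod_restrict, Measure.restrict_univ]
  have hvol : ∫ y in Ω, fderiv ℝ F y a = ∫ z in univ ×ˢ Ioi 0, fderiv ℝ F (Θ z) a := by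
    have hsm : MeasurableSet {y | ψ y < 0} := measurableSet_lt hψ2.continuous.measurable
      measurable_const
    calc ∫ y in Ω, fderiv ℝ F y a = ∫ y in {y | ψ y < 0}, fderiv ℝ F y a := by
          rw [← integral_indicator hΩ.isOpen.measurableSet, ← integral_indicator hsm]
          congr 1
          funext y
          by_cases hyb : y ∈ Metric.ball P r
          · have : y ∈ Ω ↔ y ∈ {y | ψ y < 0} := hc.mem_iff y hyb
            by_cases h : y ∈ Ω
            · rw [indicator_of_mem h, indicator_of_mem (this.mp h)]
            · rw [indicator_of_notMem h, indicator_of_notMem (fun h' => h (this.mpr h'))]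
          · simp [indicator_apply, hout y hyb]
      _ = ∫ z in Θ ⁻¹' {y | ψ y < 0}, fderiv ℝ F (Θ z) a :=
          (hΘm.setIntegral_preimage_emb hΘe.measurableEmbedding _ _).symm
      _ = _ := by
          congr 2
          ext z
          simp [hψ, hΘ, chartFun_chartCoord hν]
  rw [hvol]
  have hsplit : ∫ z in univ ×ˢ Ioi 0, fderiv ℝ F (Θ z) a =
      (∫ z in univ ×ˢ Ioi 0, (fderiv ℝ F (Θ z) a + q z.1 * K z)) -
        ∫ z in univ ×ˢ Ioi 0, q z.1 * K z := by
    rw [integral_add hai.integrableOn hqKi.integrableOn]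
    ring
  have hzero : ∫ z in univ ×ˢ Ioi 0, (fderiv ℝ F (Θ z) a + q z.1 * K z) = 0 := by
    have hi : Integrable (fun z : (ℝ ∙ ν)ᗮ × ℝ => fderiv ℝ F (Θ z) a + q z.1 * K z)
        ((volume : Measure (ℝ ∙ ν)ᗮ).prod (volume.restrict (Ioi 0))) := by
      rw [← hres]
      exact (hai.add hqKi).integrableOn
    rw [hres, integral_prod_symm _ hi]
    simp only [← hdG]
    simp [fun s => integral_fderiv_eq_zero_of_hasCompactSupport volume (hGd s) (hGs s) w]
  have hvert : ∫ z in univ ×ˢ Ioi 0, q z.1 * K z = -∫ u, q u * F (Θ (u, 0)) := by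
    have hi : Integrable (fun z : (ℝ ∙ ν)ᗮ × ℝ => q z.1 * K z)
        ((volume : Measure (ℝ ∙ ν)ᗮ).prod (volume.restrict (Ioi 0))) := by
      rw [← hres]
      exact hqKi.integrableOn
    rw [hres, integral_prod _ hi, ← integral_neg]
    congr 1
    funext u
    simp only
    rw [integral_const_mul, ← mul_neg]
    congr 1
    have hl : ∀ s, HasDerivAt (fun s : ℝ => Θ (u, s)) ν s := fun s => by
      have : HasDerivAt (fun s : ℝ => (u : Space n) + (Φ u + s) • ν) ((1 : ℝ) • ν) s :=
        (((hasDerivAt_id s).const_add (Φ u)).smul_const ν).const_add _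
      rwa [one_smul] at this
    have hd : ∀ s, deriv (fun s : ℝ => F (Θ (u, s))) s = K (u, s) := fun s =>
      (((hF.differentiable (by norm_num)) (Θ (u, s))).hasFDerivAt.comp_hasDerivAt s (hl s)).deriv
    have hcd : ContDiff ℝ 1 fun s : ℝ => F (Θ (u, s)) := by
      have : ContDiff ℝ 1 fun s : ℝ => (u : Space n) + (Φ u + s) • ν := by fun_prop
      exact hF.comp this
    have hcs' : HasCompactSupport fun s : ℝ => F (Θ (u, s)) :=
      (hcs.comp_isClosedEmbedding hΘe).comp_isClosedEmbedding
        (Function.LeftInverse.isClosedEmbedding (f := Prod.snd) (g := fun s : ℝ => (u, s))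
          (fun _ => rfl) continuous_snd (by fun_prop))
    rw [← hcs'.integral_Ioi_deriv_eq hcd 0]
    simp only [hd]
  rw [hsplit, hzero, hvert, zero_sub, neg_neg]
  congr 1
  funext u
  rw [hqψ, mul_comm]
  simp [hΘ, chartCoord, chartGraph_apply]

/-- The Gauss–Green formula for functions supported inside the domain. -/
theorem gauss_green_of_tsupport_subset (hΩ : IsBoundedC2Domain Ω) {F : Space n → ℝ}
    (hF : ContDiff ℝ 1 F) (hs : tsupport F ⊆ Ω) (a : Space n) :
    ∫ y, F y * ⟪outwardNormal Ω y, a⟫ ∂surfaceMeasure Ω = ∫ y in Ω, fderiv ℝ F y a := by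
  have hcs : HasCompactSupport F :=
    Metric.isCompact_of_isClosed_isBounded (isClosed_tsupport F) (hΩ.isBounded.subset hs)
  have h1 : ∫ y in Ω, fderiv ℝ F y a = 0 := by
    rw [setIntegral_eq_integral_of_forall_compl_eq_zero,
      integral_fderiv_eq_zero_of_hasCompactSupport volume hF hcs]
    intro y hy
    have : y ∉ tsupport (fderiv ℝ F) := fun h => hy (hs (tsupport_fderiv_subset ℝ h))
    rw [image_eq_zero_of_notMem_tsupport this]; rfl
  rw [h1]
  refine integral_eq_zero_of_ae ?_
  filter_upwards [ae_mem_frontier Ω] with y hy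
  have : F y = 0 := image_eq_zero_of_notMem_tsupport fun h => by
    rw [hΩ.isOpen.frontier_eq] at hy
    exact hy.2 (hs h)
  simp [this]

/-- **Gauss–Green formula** on a bounded `C²` domain. -/
theorem IsBoundedC2Domain.gauss_green (hΩ : IsBoundedC2Domain Ω) {F : Space n → ℝ}
    (hF : ContDiff ℝ 1 F) (a : Space n) :
    ∫ y, F y * ⟪outwardNormal Ω y, a⟫ ∂surfaceMeasure Ω = ∫ y in Ω, fderiv ℝ F y a := by
  have hfin := hΩ.isFiniteMeasure
  have hK : IsCompact (closure Ω) := hΩ.isBounded.isCompact_closure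
  -- every function supported in a suitable neighbourhood of a point satisfies the formula
  have hloc : ∀ P : Space n, ∃ U : Set (Space n), IsOpen U ∧ (P ∈ closure Ω → P ∈ U) ∧
      ∀ G : Space n → ℝ, ContDiff ℝ 1 G → tsupport G ⊆ U →
        ∫ y, G y * ⟪outwardNormal Ω y, a⟫ ∂surfaceMeasure Ω = ∫ y in Ω, fderiv ℝ G y a := by
    intro P
    by_cases hP : P ∈ frontier Ω
    · obtain ⟨r, ν, Φ, hc⟩ := hΩ.exists_isChart hP
      exact ⟨Metric.ball P r, Metric.isOpen_ball, fun _ => Metric.mem_ball_self hc.pos,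
        fun G hG hs => hc.gauss_green hΩ hG hs a⟩
    · refine ⟨Ω, hΩ.isOpen, fun h => ?_, fun G hG hs => gauss_green_of_tsupport_subset hΩ hG hs a⟩
      by_contra hno
      exact hP (by rw [hΩ.isOpen.frontier_eq]; exact ⟨h, hno⟩)
  choose U hUo hUm hU using hloc
  obtain ⟨t, ht⟩ := hK.elim_finite_subcover U hUo fun P hP => mem_iUnion.mpr ⟨P, hUm P hP⟩
  obtain ⟨f, hf⟩ := SmoothPartitionOfUnity.exists_isSubordinate (modelWithCornersSelf ℝ (Space n))
    (isClosed_closure (s := Ω)) (fun i : t => U i) (fun i => hUo i) (by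
      intro P hP
      obtain ⟨i, hi, hPi⟩ := mem_iUnion₂.mp (ht hP)
      exact mem_iUnion.mpr ⟨⟨i, hi⟩, hPi⟩)
  have hfs : ∀ i, ContDiff ℝ 1 (f i) := fun i =>
    ((f i).contMDiff.contDiff).of_le (by exact_mod_cast le_top)
  have hsum : ∀ y ∈ closure Ω, ∑ i, f i y = 1 := fun y hy => by
    rw [← finsum_eq_sum_of_fintype]
    exact f.sum_eq_one hy
  have hfF : ∀ i, ContDiff ℝ 1 fun y => f i y * F y := fun i => (hfs i).mul hF
  have hi := fun i : t => hU (i : Space n) (fun y => f i y * F y) (hfF i)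
    ((closure_mono (fun y hy => left_ne_zero_of_mul hy)).trans (hf i))
  have hNm := hΩ.aestronglyMeasurable_normal
  have hbd : ∀ G : Space n → ℝ, Continuous G →
      Integrable (fun y => G y * ⟪outwardNormal Ω y, a⟫) (surfaceMeasure Ω) := by
    intro G hG
    obtain ⟨M, hM⟩ := hΩ.isCompact_frontier.exists_bound_of_continuousOn hG.continuousOn
    refine Integrable.of_bound (C := M * ‖a‖)
      (hG.aestronglyMeasurable.mul (hNm.inner aestronglyMeasurable_const)) ?_
    filter_upwards [ae_mem_frontier Ω] with y hy
    rw [norm_mul]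
    refine mul_le_mul (hM y hy) ((norm_inner_le_norm _ _).trans ?_) (norm_nonneg _)
      ((norm_nonneg _).trans (hM y hy))
    exact mul_le_of_le_one_left (norm_nonneg _) (norm_outwardNormal_le Ω y)
  calc ∫ y, F y * ⟪outwardNormal Ω y, a⟫ ∂surfaceMeasure Ω
      = ∫ y, ∑ i, f i y * F y * ⟪outwardNormal Ω y, a⟫ ∂surfaceMeasure Ω := by
        refine integral_congr_ae ?_
        filter_upwards [ae_mem_frontier Ω] with y hy
        rw [← Finset.sum_mul, ← Finset.sum_mul, hsum y (frontier_subset_closure hy), one_mul]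
    _ = ∑ i, ∫ y in Ω, fderiv ℝ (fun y => f i y * F y) y a := by
        rw [integral_finsetSum _ fun i _ => hbd _ (hfF i).continuous]
        exact Finset.sum_congr rfl fun i _ => hi i
    _ = ∫ y in Ω, ∑ i, fderiv ℝ (fun y => f i y * F y) y a := by
        rw [integral_finsetSum]
        intro i _
        have hc : Continuous fun y => fderiv ℝ (fun y => f i y * F y) y a :=
          ((hfF i).continuous_fderiv (by norm_num)).clm_apply continuous_const
        exact (hc.continuousOn.integrableOn_compact hK).mono_set subset_closure
    _ = ∫ y in Ω, fderiv ℝ F y a := by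
        refine setIntegral_congr_fun hΩ.isOpen.measurableSet fun y hy => ?_
        have h1 : (fun z => ∑ i, f i z * F z) =ᶠ[𝓝 y] F := by
          filter_upwards [hΩ.isOpen.mem_nhds hy] with z hz
          rw [← Finset.sum_mul, hsum z (subset_closure hz), one_mul]
        have h2 : fderiv ℝ (fun z => ∑ i, f i z * F z) y = ∑ i, fderiv ℝ (fun z => f i z * F z) y :=
          fderiv_fun_sum fun i _ => (hfF i).differentiable (by norm_num) y
        rw [← h1.fderiv_eq, h2, sum_apply]

/-- The Laplacian, as the sum of the unmixed second partial derivatives. -/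
noncomputable def lap (u : Space n → ℝ) (y : Space n) : ℝ :=
  ∑ i, fderiv ℝ (fun z => fderiv ℝ u z (EuclideanSpace.single i 1)) y (EuclideanSpace.single i 1)

theorem clm_apply_eq_sum_inner (L : Space n →L[ℝ] ℝ) (v : Space n) :
    L v = ∑ i, L (EuclideanSpace.single i 1) * ⟪v, EuclideanSpace.single i 1⟫ := by
  have h := (EuclideanSpace.basisFun (Fin n) ℝ).sum_repr' v
  conv_lhs => rw [← h]
  simp [mul_comm, real_inner_comm]

/-- **Green's second identity** on a bounded `C²` domain. -/
theorem IsBoundedC2Domain.green (hΩ : IsBoundedC2Domain Ω) {u v : Space n → ℝ}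
    (hu : ContDiff ℝ 2 u) (hv : ContDiff ℝ 2 v) :
    ∫ P, (u P * fderiv ℝ v P (outwardNormal Ω P) - v P * fderiv ℝ u P (outwardNormal Ω P))
      ∂surfaceMeasure Ω = ∫ y in Ω, (u y * lap v y - v y * lap u y) := by
  have hfin := hΩ.isFiniteMeasure
  set e : Fin n → Space n := fun i => EuclideanSpace.single i 1 with he
  have hdu : ∀ i, ContDiff ℝ 1 fun z => fderiv ℝ u z (e i) := fun i =>
    (hu.fderiv_right (m := 1) (by norm_num)).clm_apply contDiff_const
  have hdv : ∀ i, ContDiff ℝ 1 fun z => fderiv ℝ v z (e i) := fun i =>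
    (hv.fderiv_right (m := 1) (by norm_num)).clm_apply contDiff_const
  have hu1 : ContDiff ℝ 1 u := hu.of_le (by norm_num)
  have hv1 : ContDiff ℝ 1 v := hv.of_le (by norm_num)
  set F : Fin n → Space n → ℝ := fun i z => u z * fderiv ℝ v z (e i) - v z * fderiv ℝ u z (e i)
    with hF
  have hFc : ∀ i, ContDiff ℝ 1 (F i) := fun i => (hu1.mul (hdv i)).sub (hv1.mul (hdu i))
  have hdF : ∀ i y, fderiv ℝ (F i) y (e i) = u y * fderiv ℝ (fun z => fderiv ℝ v z (e i)) y (e i) -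
      v y * fderiv ℝ (fun z => fderiv ℝ u z (e i)) y (e i) := by
    intro i y
    have h1 := (((hu1.differentiable (by norm_num)) y).hasFDerivAt.mul
      ((hdv i).differentiable (by norm_num) y).hasFDerivAt).sub
      (((hv1.differentiable (by norm_num)) y).hasFDerivAt.mul
      ((hdu i).differentiable (by norm_num) y).hasFDerivAt)
    have h2 : fderiv ℝ (F i) y = _ := h1.fderiv
    rw [h2]
    simp only [sub_apply, add_apply, smul_apply, smul_eq_mul]
    ring
  have hK : IsCompact (closure Ω) := hΩ.isBounded.isCompact_closure
  have hbd : ∀ i, Integrable (fun y => F i y * ⟪outwardNormal Ω y, e i⟫) (surfaceMeasure Ω) := by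
    intro i
    obtain ⟨M, hM⟩ := hΩ.isCompact_frontier.exists_bound_of_continuousOn
      (hFc i).continuous.continuousOn
    refine Integrable.of_bound (C := M * ‖e i‖) ((hFc i).continuous.aestronglyMeasurable.mul
      (hΩ.aestronglyMeasurable_normal.inner aestronglyMeasurable_const)) ?_
    filter_upwards [ae_mem_frontier Ω] with y hy
    rw [norm_mul]
    refine mul_le_mul (hM y hy) ((norm_inner_le_norm _ _).trans ?_) (norm_nonneg _)
      ((norm_nonneg _).trans (hM y hy))
    exact mul_le_of_le_one_left (norm_nonneg _) (norm_outwardNormal_le Ω y)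
  calc _ = ∫ P, ∑ i, F i P * ⟪outwardNormal Ω P, e i⟫ ∂surfaceMeasure Ω := by
        congr 1
        funext P
        rw [clm_apply_eq_sum_inner (fderiv ℝ v P), clm_apply_eq_sum_inner (fderiv ℝ u P),
          Finset.mul_sum, Finset.mul_sum, ← Finset.sum_sub_distrib]
        refine Finset.sum_congr rfl fun i _ => ?_
        simp only [hF, he]
        ring
    _ = ∑ i, ∫ y in Ω, fderiv ℝ (F i) y (e i) := by
        rw [integral_finsetSum _ fun i _ => hbd i]
        exact Finset.sum_congr rfl fun i _ => hΩ.gauss_green (hFc i) (e i)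
    _ = ∫ y in Ω, ∑ i, fderiv ℝ (F i) y (e i) := by
        rw [integral_finsetSum]
        intro i _
        have hc : Continuous fun y => fderiv ℝ (F i) y (e i) :=
          ((hFc i).continuous_fderiv (by norm_num)).clm_apply continuous_const
        exact (hc.continuousOn.integrableOn_compact hK).mono_set subset_closure
    _ = _ := by
        congr 1
        funext y
        simp only [hdF, Finset.sum_sub_distrib, ← Finset.mul_sum]
        rfl

end GaussGreen

end Stokes

namespace Stokes

/-! ### Radial integrals over the boundary -/

section Radial

/-- Layer-cake formula for a radial function given as an integral over `(‖P - P₀‖, ∞)`. -/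
theorem lintegral_radial {E : Type*} [NormedAddCommGroup E] [MeasurableSpace E]
    [OpensMeasurableSpace E] (μ : Measure E) [SFinite μ] (P₀ : E) {ψ : ℝ → ℝ≥0∞}
    (hψ : Measurable ψ) :
    ∫⁻ P, (∫⁻ s in Ioi ‖P - P₀‖, ψ s) ∂μ = ∫⁻ s in Ioi 0, ψ s * μ (Metric.ball P₀ s) := by
  have hset : MeasurableSet {z : E × ℝ | ‖z.1 - P₀‖ < z.2} := by
    have h1 : Measurable fun z : E => ‖z - P₀‖ := Continuous.measurable (by fun_prop)
    exact measurableSet_lt (h1.comp measurable_fst) measurable_snd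
  have h1 : ∀ P, ∫⁻ s in Ioi ‖P - P₀‖, ψ s =
      ∫⁻ s, {z : E × ℝ | ‖z.1 - P₀‖ < z.2}.indicator (fun z => ψ z.2) (P, s) := fun P => by
    rw [← lintegral_indicator measurableSet_Ioi]
    rfl
  simp_rw [h1]
  rw [lintegral_lintegral_swap]
  · rw [← lintegral_indicator measurableSet_Ioi]
    congr 1
    funext s
    have h2 : (fun P => {z : E × ℝ | ‖z.1 - P₀‖ < z.2}.indicator (fun z => ψ z.2) (P, s)) =
        (Metric.ball P₀ s).indicator fun _ => ψ s := by
      funext P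
      simp only [indicator, Set.mem_ofPred_eq, Metric.mem_ball, dist_eq_norm]
    rw [h2, lintegral_indicator Metric.isOpen_ball.measurableSet, lintegral_const,
      Measure.restrict_apply_univ]
    by_cases hs : 0 < s
    · rw [indicator_of_mem (mem_Ioi.mpr hs)]
    · rw [indicator_of_notMem (show s ∉ Ioi (0 : ℝ) from hs), Metric.ball_eq_empty.mpr
        (not_lt.mp hs),
        measure_empty, mul_zero]
  · exact ((hψ.comp measurable_snd).indicator hset).aemeasurable

theorem lintegral_Ioc_rpow_le {c q ρ : ℝ} (hc : 0 ≤ c) (hq : 0 < q) (hρ : 0 < ρ) :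
    ∫⁻ s in Ioc 0 ρ, ENNReal.ofReal (c * s ^ (q - 1)) ≤ ENNReal.ofReal (c * ρ ^ q / q) := by
  have hi : IntervalIntegrable (fun s : ℝ => c * s ^ (q - 1)) volume 0 ρ :=
    (intervalIntegral.intervalIntegrable_rpow' (by linarith)).const_mul c
  rw [← ofReal_integral_eq_lintegral_ofReal
      ((intervalIntegrable_iff_integrableOn_Ioc_of_le hρ.le).mp
    hi) (by
      filter_upwards [ae_restrict_mem measurableSet_Ioc] with s hs
      exact mul_nonneg hc (Real.rpow_nonneg hs.1.le _)),
    ← intervalIntegral.integral_of_le hρ.le, intervalIntegral.integral_const_mul,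
    integral_rpow (Or.inl (by linarith)), sub_add_cancel, Real.zero_rpow hq.ne', sub_zero,
    mul_div_assoc]

theorem lintegral_Ioi_rpow_eq {c q ρ : ℝ} (hc : 0 ≤ c) (hq : 0 < q) (hρ : 0 < ρ) :
    ∫⁻ s in Ioi ρ, ENNReal.ofReal (c * s ^ (-q - 1)) = ENNReal.ofReal (c * ρ ^ (-q) / q) := by
  have hi : IntegrableOn (fun s : ℝ => c * s ^ (-q - 1)) (Ioi ρ) :=
    (integrableOn_Ioi_rpow_of_lt (by linarith) hρ).const_mul c
  rw [← ofReal_integral_eq_lintegral_ofReal hi (by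
      filter_upwards [ae_restrict_mem measurableSet_Ioi] with s hs
      exact mul_nonneg hc (Real.rpow_nonneg (hρ.trans hs).le _)),
    integral_const_mul, integral_Ioi_rpow_of_lt (by linarith) hρ]
  congr 1
  rw [sub_add_cancel, neg_div_neg_eq, mul_div_assoc]

/-- A negative power as a layer-cake integral. -/
theorem ofReal_rpow_neg_le {p r : ℝ} (hp : 0 < p) (hr : 0 ≤ r) :
    ENNReal.ofReal (r ^ (-p)) ≤ ∫⁻ s in Ioi r, ENNReal.ofReal (p * s ^ (-p - 1)) := by
  rcases hr.eq_or_lt with rfl | hr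
  · rw [Real.zero_rpow (by linarith)]
    simp
  · rw [lintegral_Ioi_rpow_eq hp.le hp hr, mul_div_cancel_left₀ _ hp.ne']

variable {n : ℕ} {μ : Measure (Space n)} {A : ℝ}

theorem lintegral_rpow_neg_le (μ : Measure (Space n)) [SFinite μ] {p : ℝ} (hp : 0 < p)
    (P₀ : Space n) :
    ∫⁻ P, ENNReal.ofReal (‖P - P₀‖ ^ (-p)) ∂μ ≤
      ∫⁻ s in Ioi 0, ENNReal.ofReal (p * s ^ (-p - 1)) * μ (Metric.ball P₀ s) := by
  rw [← lintegral_radial μ P₀ (by fun_prop)]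
  exact lintegral_mono fun P => ofReal_rpow_neg_le hp (norm_nonneg _)

/-- The part near the centre of the integral of a subcritical negative power. -/
theorem lintegral_ball_rpow_neg_le [SFinite μ] (hA : 0 ≤ A) (hμ : ∀ (P : Space n) (ρ : ℝ), 0 < ρ →
      μ (Metric.ball P ρ) ≤ ENNReal.ofReal (A * ρ ^ (n - 1))) {p : ℝ} (hp : 0 < p)
    (hpn : p < (n - 1 : ℕ)) (P₀ : Space n) {ρ : ℝ} (hρ : 0 < ρ) :
    ∫⁻ P in Metric.ball P₀ ρ, ENNReal.ofReal (‖P - P₀‖ ^ (-p)) ∂μ ≤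
      ENNReal.ofReal ((p / ((n - 1 : ℕ) - p) + 1) * A * ρ ^ ((n - 1 : ℕ) - p)) := by
  refine (lintegral_rpow_neg_le _ hp P₀).trans ?_
  rw [← Ioc_union_Ioi_eq_Ioi hρ.le, lintegral_union measurableSet_Ioi
    (disjoint_left.mpr fun s hs hs' => absurd hs.2 (not_le.mpr hs'))]
  set m : ℝ := ((n - 1 : ℕ) : ℝ) with hm
  have hmp : 0 < m - p := by linarith
  have h1 : ∫⁻ s in Ioc 0 ρ, ENNReal.ofReal (p * s ^ (-p - 1)) *
      (μ.restrict (Metric.ball P₀ ρ)) (Metric.ball P₀ s) ≤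
      ENNReal.ofReal (p * A * ρ ^ (m - p) / (m - p)) := by
    refine le_trans ?_ (lintegral_Ioc_rpow_le (by positivity) hmp hρ)
    refine setLIntegral_mono' measurableSet_Ioc fun s hs => ?_
    refine (mul_le_mul_right ((Measure.restrict_apply_le _ _).trans (hμ P₀ s hs.1)) _).trans ?_
    rw [← ENNReal.ofReal_mul (mul_nonneg hp.le (Real.rpow_nonneg hs.1.le _))]
    refine ENNReal.ofReal_le_ofReal (le_of_eq ?_)
    rw [← Real.rpow_natCast s, ← hm, show m - p - 1 = (-p - 1) + m by ring, Real.rpow_add hs.1]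
    ring
  have h2 : ∫⁻ s in Ioi ρ, ENNReal.ofReal (p * s ^ (-p - 1)) *
      (μ.restrict (Metric.ball P₀ ρ)) (Metric.ball P₀ s) ≤ ENNReal.ofReal (A * ρ ^ (m - p)) := by
    have hb : ∀ s, (μ.restrict (Metric.ball P₀ ρ)) (Metric.ball P₀ s) ≤
        ENNReal.ofReal (A * ρ ^ (n - 1)) := fun s => by
      refine (measure_mono (subset_univ _)).trans ?_
      rw [Measure.restrict_apply_univ]
      exact hμ P₀ ρ hρ
    calc _ ≤ ∫⁻ s in Ioi ρ, ENNReal.ofReal (p * s ^ (-p - 1)) * ENNReal.ofReal (A * ρ ^ (n - 1)) :=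
          lintegral_mono fun s => mul_le_mul_right (hb s) _
      _ = ENNReal.ofReal (p * ρ ^ (-p) / p) * ENNReal.ofReal (A * ρ ^ (n - 1)) := by
          rw [lintegral_mul_const' _ _ ENNReal.ofReal_ne_top, lintegral_Ioi_rpow_eq hp.le hp hρ]
      _ = ENNReal.ofReal (A * ρ ^ (m - p)) := by
          rw [← ENNReal.ofReal_mul (by positivity)]
          congr 1
          rw [mul_div_cancel_left₀ _ hp.ne', ← Real.rpow_natCast ρ, ← hm,
            show m - p = -p + m by ring, Real.rpow_add hρ]
          ring
  refine (add_le_add h1 h2).trans ?_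
  rw [← ENNReal.ofReal_add (by positivity) (by positivity)]
  refine ENNReal.ofReal_le_ofReal (le_of_eq ?_)
  ring

/-- The part away from the centre of the integral of a supercritical negative power. -/
theorem lintegral_compl_ball_rpow_neg_le [SFinite μ] (hA : 0 ≤ A)
    (hμ : ∀ (P : Space n) (ρ : ℝ), 0 < ρ →
      μ (Metric.ball P ρ) ≤ ENNReal.ofReal (A * ρ ^ (n - 1))) {p : ℝ} (hp : 0 < p)
    (hpn : (n - 1 : ℕ) < p) (P₀ : Space n) {ρ : ℝ} (hρ : 0 < ρ) :
    ∫⁻ P in (Metric.ball P₀ ρ)ᶜ, ENNReal.ofReal (‖P - P₀‖ ^ (-p)) ∂μ ≤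
      ENNReal.ofReal (p * A * ρ ^ (-(p - (n - 1 : ℕ))) / (p - (n - 1 : ℕ))) := by
  refine (lintegral_rpow_neg_le _ hp P₀).trans ?_
  set m : ℝ := ((n - 1 : ℕ) : ℝ) with hm
  have hmp : 0 < p - m := by linarith
  rw [← lintegral_Ioi_rpow_eq (by positivity) hmp hρ, ← lintegral_indicator measurableSet_Ioi,
    ← lintegral_indicator measurableSet_Ioi]
  refine lintegral_mono fun s => ?_
  by_cases hs0 : s ∈ Ioi (0 : ℝ)
  · rw [indicator_of_mem hs0]
    by_cases hs : s ∈ Ioi ρ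
    · rw [indicator_of_mem hs]
      have hs1 : 0 < s := hs0
      refine (mul_le_mul_right ((Measure.restrict_apply_le _ _).trans (hμ P₀ s hs1)) _).trans ?_
      rw [← ENNReal.ofReal_mul (mul_nonneg hp.le (Real.rpow_nonneg hs1.le _))]
      refine ENNReal.ofReal_le_ofReal (le_of_eq ?_)
      rw [← Real.rpow_natCast s, ← hm, show -(p - m) - 1 = (-p - 1) + m by ring, Real.rpow_add hs1]
      ring
    · rw [Measure.restrict_apply Metric.isOpen_ball.measurableSet]
      have : Metric.ball P₀ s ∩ (Metric.ball P₀ ρ)ᶜ = ∅ := by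
        rw [← sdiff_eq, sdiff_eq_empty]
        exact Metric.ball_subset_ball (not_lt.mp hs)
      rw [this, measure_empty, mul_zero]
      exact zero_le
  · rw [indicator_of_notMem hs0]
    exact zero_le

/-- The critical power gives a logarithm. -/
theorem lintegral_compl_ball_critical_le [IsFiniteMeasure μ] (hn : 2 ≤ n) (hA : 0 ≤ A)
    (hμ : ∀ (P : Space n) (ρ : ℝ), 0 < ρ →
      μ (Metric.ball P ρ) ≤ ENNReal.ofReal (A * ρ ^ (n - 1))) (P₀ : Space n) {ρ : ℝ} (hρ : 0 < ρ) :
    ∫⁻ P in (Metric.ball P₀ ρ)ᶜ, ENNReal.ofReal (1 / ‖P - P₀‖ ^ (n - 1)) ∂μ ≤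
      ENNReal.ofReal (((n - 1 : ℕ) * A + 2 * μ.real univ) * (1 + |Real.log ρ|)) := by
  set m : ℝ := ((n - 1 : ℕ) : ℝ) with hm
  have hm0 : 0 < m := by rw [hm]; exact_mod_cast (by omega)
  have hS : 0 ≤ μ.real univ := measureReal_nonneg
  have hfar : ∀ r : ℝ, 1 ≤ r → ∫⁻ P in (Metric.ball P₀ r)ᶜ, ENNReal.ofReal
      (1 / ‖P - P₀‖ ^ (n - 1)) ∂μ ≤
      ENNReal.ofReal (μ.real univ) := fun r hr => by
    calc _ ≤ ∫⁻ P in (Metric.ball P₀ r)ᶜ, 1 ∂μ := by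
          refine setLIntegral_mono' Metric.isOpen_ball.measurableSet.compl fun P hP => ?_
          have h1 : 1 ≤ ‖P - P₀‖ := by
            rw [mem_compl_iff, Metric.mem_ball, dist_eq_norm, not_lt] at hP
            exact hr.trans hP
          rw [ENNReal.ofReal_le_one, div_le_one (by positivity)]
          exact one_le_pow₀ h1
      _ ≤ μ univ := by
          rw [lintegral_one, Measure.restrict_apply_univ]
          exact measure_mono (subset_univ _)
      _ = _ := (ofReal_measureReal).symm
  rcases le_or_gt 1 ρ with h1 | h1
  · refine (hfar ρ h1).trans (ENNReal.ofReal_le_ofReal ?_)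
    have h2 := mul_nonneg hm0.le hA
    have h3 := abs_nonneg (Real.log ρ)
    nlinarith [mul_nonneg h2 h3, mul_nonneg hS h3]
  · have hsplit : (Metric.ball P₀ ρ)ᶜ = (Metric.ball P₀ 1 \ Metric.ball P₀ ρ) ∪
      (Metric.ball P₀ 1)ᶜ := by
      ext P
      simp only [mem_compl_iff, Metric.mem_ball, mem_union, Set.mem_sdiff, not_lt]
      constructor
      · intro h
        rcases lt_or_ge (dist P P₀) 1 with h' | h'
        · exact Or.inl ⟨h', h⟩
        · exact Or.inr h'
      · rintro (h | h)
        · exact h.2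
        · exact h1.le.trans h
    set ν := μ.restrict (Metric.ball P₀ 1 \ Metric.ball P₀ ρ) with hν
    have hnear : ∫⁻ P, ENNReal.ofReal (1 / ‖P - P₀‖ ^ (n - 1)) ∂ν ≤
        ENNReal.ofReal (m * A * |Real.log ρ| + μ.real univ) := by
      calc ∫⁻ P, ENNReal.ofReal (1 / ‖P - P₀‖ ^ (n - 1)) ∂ν
          = ∫⁻ P, ENNReal.ofReal (‖P - P₀‖ ^ (-m)) ∂ν := by
            congr 1
            funext P
            rw [Real.rpow_neg (norm_nonneg _), hm, Real.rpow_natCast, one_div]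
        _ ≤ ∫⁻ s in Ioi 0, ENNReal.ofReal (m * s ^ (-m - 1)) * ν (Metric.ball P₀ s) :=
            lintegral_rpow_neg_le ν hm0 P₀
        _ ≤ ∫⁻ s in Ioc ρ 1 ∪ Ioi 1, ENNReal.ofReal (m * s ^ (-m - 1)) * ν (Metric.ball P₀ s) := by
            rw [Ioc_union_Ioi_eq_Ioi h1.le, ← lintegral_indicator measurableSet_Ioi,
              ← lintegral_indicator measurableSet_Ioi]
            refine lintegral_mono fun s => ?_
            by_cases hs : s ∈ Ioi ρ
            · rw [indicator_of_mem hs, indicator_of_mem (mem_Ioi.mpr (hρ.trans hs))]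
            · have : Metric.ball P₀ s ∩ (Metric.ball P₀ 1 \ Metric.ball P₀ ρ) = ∅ := by
                refine eq_empty_of_forall_notMem fun P hP => hP.2.2 ?_
                exact Metric.ball_subset_ball (not_lt.mp hs) hP.1
              rw [indicator_of_notMem hs]
              by_cases hs0 : s ∈ Ioi (0 : ℝ)
              · rw [indicator_of_mem hs0, hν,
                  Measure.restrict_apply Metric.isOpen_ball.measurableSet, this, measure_empty,
                  mul_zero]
              · rw [indicator_of_notMem hs0]
        _ ≤ ENNReal.ofReal (m * A * |Real.log ρ|) + ENNReal.ofReal (μ.real univ) := by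
            rw [lintegral_union measurableSet_Ioi
              (disjoint_left.mpr fun s hs hs' => absurd hs.2 (not_le.mpr hs'))]
            refine add_le_add ?_ ?_
            · have hii : IntegrableOn (fun s : ℝ => m * A * s⁻¹) (Ioc ρ 1) := by
                refine ContinuousOn.integrableOn_Icc ?_ |>.mono_set Ioc_subset_Icc_self
                exact continuousOn_const.mul (continuousOn_inv₀.mono fun s hs =>
                  (hρ.trans_le hs.1).ne')
              calc _ ≤ ∫⁻ s in Ioc ρ 1, ENNReal.ofReal (m * A * s⁻¹) := by
                    refine setLIntegral_mono' measurableSet_Ioc fun s hs => ?_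
                    have hs1 : 0 < s := hρ.trans hs.1
                    refine (mul_le_mul_right ((Measure.restrict_apply_le _ _).trans
                      (hμ P₀ s hs1)) _).trans ?_
                    rw [← ENNReal.ofReal_mul (by positivity)]
                    refine ENNReal.ofReal_le_ofReal (le_of_eq ?_)
                    rw [← Real.rpow_natCast s, ← hm, ← Real.rpow_neg_one,
                      show (-1 : ℝ) = (-m - 1) + m by ring, Real.rpow_add hs1]
                    ring_nf
                _ = ENNReal.ofReal (m * A * |Real.log ρ|) := by
                    rw [← ofReal_integral_eq_lintegral_ofReal hii (by
                      filter_upwards [ae_restrict_mem measurableSet_Ioc] with s hs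
                      have := hρ.trans hs.1
                      positivity), ← intervalIntegral.integral_of_le h1.le,
                      intervalIntegral.integral_const_mul, integral_inv_of_pos hρ one_pos, one_div,
                      Real.log_inv, abs_of_neg (Real.log_neg hρ h1)]
            · calc _ ≤ ∫⁻ s in Ioi 1, ENNReal.ofReal (m * s ^ (-m - 1)) * μ univ :=
                    lintegral_mono fun s => mul_le_mul_right ((Measure.restrict_apply_le _ _).trans
                      (measure_mono (subset_univ _))) _
                _ = ENNReal.ofReal (μ.real univ) := by
                    rw [lintegral_mul_const' _ _ (measure_ne_top _ _),
                      lintegral_Ioi_rpow_eq hm0.le hm0 one_pos, Real.one_rpow, mul_one,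
                      div_self hm0.ne', ENNReal.ofReal_one, one_mul, ofReal_measureReal]
        _ = _ := (ENNReal.ofReal_add (by positivity) hS).symm
    rw [hsplit]
    refine (lintegral_union_le _ _ _).trans ((add_le_add hnear (hfar 1 le_rfl)).trans ?_)
    rw [← ENNReal.ofReal_add (by positivity) hS]
    refine ENNReal.ofReal_le_ofReal ?_
    have h2 := mul_nonneg hm0.le hA
    have h3 := abs_nonneg (Real.log ρ)
    nlinarith [mul_nonneg h2 h3, mul_nonneg hS h3]

/-- A bound for the lower integral of a nonnegative function, as a statement on its Bochner
integral. -/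
theorem integrable_and_integral_le {α : Type*} [MeasurableSpace α] {μ : Measure α} {f : α → ℝ}
    {C : ℝ} (hf : AEStronglyMeasurable f μ) (h0 : 0 ≤ᵐ[μ] f) (hC : 0 ≤ C)
    (h : ∫⁻ a, ENNReal.ofReal (f a) ∂μ ≤ ENNReal.ofReal C) : Integrable f μ ∧ ∫ a, f a ∂μ ≤ C := by
  refine ⟨⟨hf, (hasFiniteIntegral_iff_ofReal h0).mpr (h.trans_lt ENNReal.ofReal_lt_top)⟩, ?_⟩
  rw [integral_eq_lintegral_of_nonneg_ae h0 hf]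
  exact ENNReal.toReal_le_of_le_ofReal hC h

end Radial

namespace IsBoundedC2Domain

variable {n : ℕ} {Ω : Set (Space n)}

theorem exists_lintegral_ball_le (hΩ : IsBoundedC2Domain Ω) (hn : 3 ≤ n) :
    ∃ C : ℝ, 0 < C ∧ ∀ (P₀ : Space n) (ρ : ℝ), 0 < ρ →
      ∫⁻ P in Metric.ball P₀ ρ, ENNReal.ofReal (1 / ‖P - P₀‖ ^ (n - 2)) ∂(surfaceMeasure Ω) ≤
        ENNReal.ofReal (C * ρ) := by
  obtain ⟨A, hA, hμ⟩ := hΩ.exists_ahlfors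
  have := hΩ.isFiniteMeasure
  have hp : 0 < ((n - 2 : ℕ) : ℝ) := by exact_mod_cast (by omega)
  have hpm : ((n - 1 : ℕ) : ℝ) - ((n - 2 : ℕ) : ℝ) = 1 := by
    rw [show n - 1 = (n - 2) + 1 by omega]; push_cast; ring
  refine ⟨(((n - 2 : ℕ) : ℝ) / 1 + 1) * A, by positivity, fun P₀ ρ hρ => ?_⟩
  have h := lintegral_ball_rpow_neg_le (μ := surfaceMeasure Ω) hA.le hμ hp (by linarith) P₀ hρ
  rw [hpm, Real.rpow_one] at h
  refine le_trans (le_of_eq (lintegral_congr fun P => ?_)) h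
  rw [Real.rpow_neg (norm_nonneg _), Real.rpow_natCast, one_div]

theorem exists_lintegral_le (hΩ : IsBoundedC2Domain Ω) (hn : 3 ≤ n) :
    ∃ C : ℝ, 0 < C ∧ ∀ P₀ : Space n,
      ∫⁻ P, ENNReal.ofReal (1 / ‖P - P₀‖ ^ (n - 2)) ∂(surfaceMeasure Ω) ≤ ENNReal.ofReal C := by
  obtain ⟨A, hA, hμ⟩ := hΩ.exists_lintegral_ball_le hn
  have := hΩ.isFiniteMeasure
  have hS : 0 ≤ (surfaceMeasure Ω).real univ := measureReal_nonneg
  refine ⟨A * 1 + (surfaceMeasure Ω).real univ, by positivity, fun P₀ => ?_⟩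
  rw [← lintegral_add_compl _ (Metric.isOpen_ball (x := P₀) (ε := 1)).measurableSet,
    ENNReal.ofReal_add (by positivity) hS]
  refine add_le_add (hμ P₀ 1 one_pos) ?_
  calc _ ≤ ∫⁻ P in (Metric.ball P₀ 1)ᶜ, 1 ∂(surfaceMeasure Ω) := by
        refine setLIntegral_mono' Metric.isOpen_ball.measurableSet.compl fun P hP => ?_
        rw [mem_compl_iff, Metric.mem_ball, dist_eq_norm, not_lt] at hP
        rw [ENNReal.ofReal_le_one, div_le_one (by positivity)]
        exact one_le_pow₀ hP
    _ ≤ surfaceMeasure Ω univ := by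
        rw [lintegral_one, Measure.restrict_apply_univ]
        exact measure_mono (subset_univ _)
    _ = _ := (ofReal_measureReal).symm

theorem exists_lintegral_compl_ball_le (hΩ : IsBoundedC2Domain Ω) (hn : 3 ≤ n) :
    ∃ C : ℝ, 0 < C ∧ ∀ (P₀ : Space n) (ρ : ℝ), 0 < ρ →
      ∫⁻ P in (Metric.ball P₀ ρ)ᶜ, ENNReal.ofReal (1 / ‖P - P₀‖ ^ (n - 1)) ∂(surfaceMeasure Ω) ≤
        ENNReal.ofReal (C * (1 + |Real.log ρ|)) := by
  obtain ⟨A, hA, hμ⟩ := hΩ.exists_ahlfors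
  have := hΩ.isFiniteMeasure
  have hS : 0 ≤ (surfaceMeasure Ω).real univ := measureReal_nonneg
  have hp : 0 < ((n - 1 : ℕ) : ℝ) := by exact_mod_cast (by omega)
  exact ⟨(n - 1 : ℕ) * A + 2 * (surfaceMeasure Ω).real univ, by positivity, fun P₀ ρ hρ =>
    lintegral_compl_ball_critical_le (by omega) hA.le hμ P₀ hρ⟩

theorem exists_lintegral_sqrt_le (hΩ : IsBoundedC2Domain Ω) (hn : 3 ≤ n) :
    ∃ C : ℝ, 0 < C ∧ ∀ P₀ : Space n,
      ∫⁻ P, ENNReal.ofReal (√‖P - P₀‖ / ‖P - P₀‖ ^ (n - 1)) ∂(surfaceMeasure Ω) ≤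
        ENNReal.ofReal C := by
  obtain ⟨A, hA, hμ⟩ := hΩ.exists_ahlfors
  have := hΩ.isFiniteMeasure
  have hS : 0 ≤ (surfaceMeasure Ω).real univ := measureReal_nonneg
  have hn1 : (2 : ℝ) ≤ ((n - 1 : ℕ) : ℝ) := by exact_mod_cast (by omega)
  have hp : 0 < ((n - 1 : ℕ) : ℝ) - 1 / 2 := by linarith
  set c : ℝ := ((((n - 1 : ℕ) : ℝ) - 1 / 2) / (1 / 2) + 1) * A with hc
  refine ⟨c + (surfaceMeasure Ω).real univ, by positivity, fun P₀ => ?_⟩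
  rw [← lintegral_add_compl _ (Metric.isOpen_ball (x := P₀) (ε := 1)).measurableSet,
    ENNReal.ofReal_add (by positivity) hS]
  refine add_le_add ?_ ?_
  · have h := lintegral_ball_rpow_neg_le (μ := surfaceMeasure Ω) hA.le hμ hp
      (by linarith) P₀ one_pos
    rw [Real.one_rpow, mul_one, show ((n - 1 : ℕ) : ℝ) - (((n - 1 : ℕ) : ℝ) - 1 / 2) =
        1 / 2 by ring]
      at h
    refine le_trans (le_of_eq (lintegral_congr fun P => ?_)) h
    congr 1
    rcases (norm_nonneg (P - P₀)).eq_or_lt with h0 | h0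
    · rw [← h0, Real.zero_rpow (by linarith), Real.sqrt_zero, zero_div]
    · rw [neg_sub, Real.rpow_sub h0, Real.sqrt_eq_rpow, Real.rpow_natCast]
  · calc _ ≤ ∫⁻ P in (Metric.ball P₀ 1)ᶜ, 1 ∂(surfaceMeasure Ω) := by
          refine setLIntegral_mono' Metric.isOpen_ball.measurableSet.compl fun P hP => ?_
          rw [mem_compl_iff, Metric.mem_ball, dist_eq_norm, not_lt] at hP
          rw [ENNReal.ofReal_le_one, div_le_one (by positivity)]
          calc √‖P - P₀‖ ≤ ‖P - P₀‖ := (Real.sqrt_le_left (by positivity)).mpr (by nlinarith)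
            _ ≤ ‖P - P₀‖ ^ (n - 1) := le_self_pow₀ hP (by omega)
      _ ≤ surfaceMeasure Ω univ := by
          rw [lintegral_one, Measure.restrict_apply_univ]
          exact measure_mono (subset_univ _)
      _ = _ := (ofReal_measureReal).symm

theorem exists_lintegral_add_pow_le (hΩ : IsBoundedC2Domain Ω) (hn : 3 ≤ n) :
    ∃ C : ℝ, 0 < C ∧ ∀ (P₀ : Space n) (ρ : ℝ), 0 < ρ →
      ∫⁻ P, ENNReal.ofReal (1 / (ρ + ‖P - P₀‖) ^ n) ∂(surfaceMeasure Ω) ≤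
        ENNReal.ofReal (C / ρ) := by
  obtain ⟨A, hA, hμ⟩ := hΩ.exists_ahlfors
  have := hΩ.isFiniteMeasure
  have hp : 0 < (n : ℝ) := by exact_mod_cast (by omega)
  have hpm : (n : ℝ) - ((n - 1 : ℕ) : ℝ) = 1 := by
    rw [Nat.cast_sub (by omega)]; push_cast; ring
  refine ⟨A + n * A, by positivity, fun P₀ ρ hρ => ?_⟩
  rw [← lintegral_add_compl _ (Metric.isOpen_ball (x := P₀) (ε := ρ)).measurableSet, add_div,
    ENNReal.ofReal_add (by positivity) (by positivity)]
  refine add_le_add ?_ ?_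
  · calc _ ≤ ∫⁻ P in Metric.ball P₀ ρ, ENNReal.ofReal (1 / ρ ^ n) ∂(surfaceMeasure Ω) := by
          refine lintegral_mono fun P => ENNReal.ofReal_le_ofReal ?_
          refine one_div_le_one_div_of_le (by positivity) ?_
          exact pow_le_pow_left₀ hρ.le (by linarith [norm_nonneg (P - P₀)]) _
      _ ≤ ENNReal.ofReal (1 / ρ ^ n) * ENNReal.ofReal (A * ρ ^ (n - 1)) := by
          rw [lintegral_const, Measure.restrict_apply_univ]
          exact mul_le_mul_right (hμ P₀ ρ hρ) _
      _ = ENNReal.ofReal (A / ρ) := by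
          rw [← ENNReal.ofReal_mul (by positivity)]
          congr 1
          obtain ⟨m, rfl⟩ : ∃ m, n = m + 1 := ⟨n - 1, by omega⟩
          rw [Nat.add_sub_cancel]
          field_simp
          ring
  · have h := lintegral_compl_ball_rpow_neg_le (μ := surfaceMeasure Ω) hA.le hμ hp
      (by linarith) P₀ hρ
    rw [hpm, Real.rpow_neg_one, div_one, ← div_eq_mul_inv] at h
    refine le_trans (setLIntegral_mono' Metric.isOpen_ball.measurableSet.compl fun P hP => ?_) h
    rw [mem_compl_iff, Metric.mem_ball, dist_eq_norm, not_lt] at hP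
    refine ENNReal.ofReal_le_ofReal ?_
    have h0 : 0 < ‖P - P₀‖ := hρ.trans_le hP
    rw [Real.rpow_neg h0.le, Real.rpow_natCast, ← one_div]
    exact one_div_le_one_div_of_le (by positivity) (pow_le_pow_left₀ h0.le (by linarith) _)

end IsBoundedC2Domain

end Stokes

namespace Stokes

/-! ### Radial kernels: derivatives and Laplacians -/

section RadialKernel

variable {n : ℕ}

theorem hasFDerivAt_radial {g : ℝ → ℝ} {g' : ℝ} {z : Space n} (hg : HasDerivAt g g' (‖z‖ ^ 2)) :
    HasFDerivAt (fun y : Space n => g (‖y‖ ^ 2)) ((2 * g') • innerSL ℝ z) z := by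
  have h := hg.comp_hasFDerivAt z (hasStrictFDerivAt_norm_sq z).hasFDerivAt
  refine h.congr_fderiv ?_
  ext v
  simp only [smul_apply, smul_eq_mul, nsmul_eq_mul, Nat.cast_ofNat]
  ring

/-- The derivative of a radial function multiplied by an affine one. -/
theorem hasFDerivAt_affine_mul_radial {g : ℝ → ℝ} {g' c : ℝ} {m a z : Space n}
    (hg : HasDerivAt g g' (‖z - a‖ ^ 2)) :
    HasFDerivAt (fun y : Space n => (c + ⟪y - a, m⟫) * g (‖y - a‖ ^ 2))
      (((c + ⟪z - a, m⟫) * (2 * g')) • innerSL ℝ (z - a) + g (‖z - a‖ ^ 2) • innerSL ℝ m) z := by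
  have h1 : HasFDerivAt (fun y : Space n => g (‖y - a‖ ^ 2)) ((2 * g') • innerSL ℝ (z - a)) z := by
    simpa [Function.comp_def] using (hasFDerivAt_radial hg).comp z ((hasFDerivAt_id z).sub_const a)
  have h2 : HasFDerivAt (fun y : Space n => c + ⟪y - a, m⟫) (innerSL ℝ m) z := by
    have h3 : HasFDerivAt (fun y : Space n => ⟪m, y - a⟫) (innerSL ℝ m) z := by
      simpa [Function.comp_def] using (innerSL ℝ m).hasFDerivAt.comp z
          ((hasFDerivAt_id z).sub_const a)
    simpa only [real_inner_comm m] using h3.const_add c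
  refine (h2.mul h1).congr_fderiv ?_
  ext v
  simp only [smul_apply, add_apply, smul_eq_mul]
  ring

theorem lap_congr {u v : Space n → ℝ} {y : Space n} (h : u =ᶠ[𝓝 y] v) : lap u y = lap v y := by
  refine Finset.sum_congr rfl fun i _ => ?_
  have : (fun z => fderiv ℝ u z (EuclideanSpace.single i 1)) =ᶠ[𝓝 y]
      fun z => fderiv ℝ v z (EuclideanSpace.single i 1) := by
    filter_upwards [h.eventuallyEq_nhds] with z hz
    rw [hz.fderiv_eq]
  rw [this.fderiv_eq]

/-- The Laplacian of a radial function multiplied by an affine one. -/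
theorem lap_affine_mul_radial {g g' : ℝ → ℝ} {g'' c : ℝ} {m a y : Space n}
    (hg : ∀ᶠ s in 𝓝 (‖y - a‖ ^ 2), HasDerivAt g (g' s) s) (hg' : HasDerivAt g' g'' (‖y - a‖ ^ 2)) :
    lap (fun y : Space n => (c + ⟪y - a, m⟫) * g (‖y - a‖ ^ 2)) y =
      (c + ⟪y - a, m⟫) * (2 * n * g' (‖y - a‖ ^ 2) + 4 * ‖y - a‖ ^ 2 * g'') +
        4 * g' (‖y - a‖ ^ 2) * ⟪y - a, m⟫ := by
  have hc : Continuous fun z : Space n => ‖z - a‖ ^ 2 := by fun_prop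
  have hev := (hc.tendsto y).eventually hg
  have hterm : ∀ i : Fin n, fderiv ℝ (fun z => fderiv ℝ (fun y : Space n =>
      (c + ⟪y - a, m⟫) * g (‖y - a‖ ^ 2)) z (EuclideanSpace.single i 1)) y
        (EuclideanSpace.single i 1) =
      (c + ⟪y - a, m⟫) * (2 * g' (‖y - a‖ ^ 2)) + 4 * g' (‖y - a‖ ^ 2) * ((y - a) i * m i) +
        (c + ⟪y - a, m⟫) * (4 * g'') * (y - a) i ^ 2 := by
    intro i
    have h1 : (fun z => fderiv ℝ (fun y : Space n =>
        (c + ⟪y - a, m⟫) * g (‖y - a‖ ^ 2)) z (EuclideanSpace.single i 1)) =ᶠ[𝓝 y]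
        fun z => ((c + ⟪z - a, m⟫) * (2 * g' (‖z - a‖ ^ 2))) * ⟪z - a, EuclideanSpace.single i 1⟫ +
          g (‖z - a‖ ^ 2) * m i := by
      filter_upwards [hev] with z hz
      rw [(hasFDerivAt_affine_mul_radial hz).fderiv]
      simp [innerSL_apply_apply, EuclideanSpace.inner_single_right]
    rw [h1.fderiv_eq]
    have h2 := hasFDerivAt_affine_mul_radial (c := c) (m := m) (hg'.const_mul 2)
    have h3 : HasFDerivAt (fun z : Space n => ⟪z - a, EuclideanSpace.single i (1 : ℝ)⟫)
        (innerSL ℝ (EuclideanSpace.single i (1 : ℝ))) y := by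
      have h3 : HasFDerivAt (fun z : Space n => ⟪EuclideanSpace.single i (1 : ℝ), z - a⟫)
          (innerSL ℝ (EuclideanSpace.single i (1 : ℝ))) y := by
        simpa [Function.comp_def] using
          (innerSL ℝ (EuclideanSpace.single i (1 : ℝ))).hasFDerivAt.comp y
              ((hasFDerivAt_id y).sub_const a)
      simpa only [real_inner_comm (EuclideanSpace.single i (1 : ℝ))] using h3
    have h4 := hasFDerivAt_affine_mul_radial (c := 1) (m := (0 : Space n)) hev.self_of_nhds
    simp only [inner_zero_right, add_zero, one_mul, map_zero, smul_zero] at h4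
    have h5 := (h2.fun_mul h3).fun_add (h4.mul_const (m i))
    rw [h5.fderiv]
    simp only [add_apply, smul_apply, innerSL_apply_apply, smul_eq_mul,
      EuclideanSpace.inner_single_right]
    simp
    ring
  rw [lap, Finset.sum_congr rfl fun i _ => hterm i, Finset.sum_add_distrib, Finset.sum_add_distrib,
    Finset.sum_const, ← Finset.mul_sum, ← Finset.mul_sum, Finset.card_univ, Fintype.card_fin]
  have h6 : ∑ i, (y - a) i * m i = ⟪y - a, m⟫ := by
    rw [PiLp.inner_apply]
    exact Finset.sum_congr rfl fun i _ => by simp [mul_comm]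
  have h7 : ∑ i, (y - a) i ^ 2 = ‖y - a‖ ^ 2 := by
    rw [EuclideanSpace.norm_sq_eq]
    simp
  rw [h6, h7, nsmul_eq_mul]
  ring

end RadialKernel

variable {n : ℕ} {Ω : Set (Space n)}

theorem aestronglyMeasurable_surfaceMeasure {F : Type*} [TopologicalSpace F]
    [TopologicalSpace.PseudoMetrizableSpace F] {f : Space n → F}
    (hΩ : IsBoundedC2Domain Ω) (hf : ContinuousOn f (frontier Ω)) :
    AEStronglyMeasurable f (surfaceMeasure Ω) :=
  hf.aestronglyMeasurable_of_isCompact hΩ.isCompact_frontier isClosed_frontier.measurableSet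

/-- Differentiation under the integral sign for potentials of radial kernels, away from the
boundary. -/
theorem IsBoundedC2Domain.hasFDerivAt_integral_radial (hΩ : IsBoundedC2Domain Ω) {x : Space n}
    (hx : x ∉ frontier Ω) {h : Space n → ℝ} (hh : Integrable h (surfaceMeasure Ω))
    {m : Space n → Space n} (hm : AEStronglyMeasurable m (surfaceMeasure Ω))
    (hm1 : ∀ P, ‖m P‖ ≤ 1) (c : ℝ) {g g' : ℝ → ℝ} (hg : ∀ s, 0 < s → HasDerivAt g (g' s) s)
    (hg' : ContinuousOn g' (Ioi 0)) :
    Integrable (fun P => (c + ⟪x - P, m P⟫) * g (‖x - P‖ ^ 2) * h P) (surfaceMeasure Ω) ∧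
    ∃ F' : Space n →L[ℝ] ℝ,
      HasFDerivAt (fun y => ∫ P, (c + ⟪y - P, m P⟫) * g (‖y - P‖ ^ 2) * h P ∂(surfaceMeasure Ω))
        F' x ∧
      ∀ e, F' e = ∫ P, h P * ((c + ⟪x - P, m P⟫) * (2 * g' (‖x - P‖ ^ 2)) * ⟪x - P, e⟫ +
        g (‖x - P‖ ^ 2) * ⟪m P, e⟫) ∂(surfaceMeasure Ω) := by
  have hgc : ContinuousOn g (Ioi 0) := fun s hs => (hg s hs).continuousAt.continuousWithinAt
  obtain ⟨δ, hδ, hball⟩ := Metric.isOpen_iff.mp isClosed_frontier.isOpen_compl x hx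
  have hpos : ∀ y ∈ Metric.closedBall x (δ / 2), ∀ P ∈ frontier Ω, 0 < ‖y - P‖ ^ 2 := by
    intro y hy P hP
    have : y ≠ P := by
      rintro rfl
      exact hball (Metric.closedBall_subset_ball (by linarith) hy) hP
    have := norm_pos_iff.mpr (sub_ne_zero.mpr this)
    positivity
  have hcomp : ∀ f : ℝ → ℝ, ContinuousOn f (Ioi 0) → ContinuousOn (fun z : Space n × Space n =>
      f (‖z.1 - z.2‖ ^ 2)) (Metric.closedBall x (δ / 2) ×ˢ frontier Ω) := fun f hf =>
    hf.comp (by fun_prop) fun z hz => hpos z.1 hz.1 z.2 hz.2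
  have hcomp' : ∀ f : ℝ → ℝ, ContinuousOn f (Ioi 0) → ∀ y ∈ Metric.closedBall x (δ / 2),
      ContinuousOn (fun P : Space n => f (‖y - P‖ ^ 2)) (frontier Ω) := fun f hf y hy =>
    hf.comp (by fun_prop) fun P hP => hpos y hy P hP
  have hx' : x ∈ Metric.closedBall x (δ / 2) := Metric.mem_closedBall_self (by linarith)
  obtain ⟨C, hC⟩ := ((isCompact_closedBall x (δ / 2)).prod hΩ.isCompact_frontier
    ).exists_bound_of_continuousOn (f := fun z : Space n × Space n =>
      (|c| + ‖z.1 - z.2‖) * (2 * g' (‖z.1 - z.2‖ ^ 2)) * ‖z.1 - z.2‖)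
    (((continuousOn_const.add (by fun_prop)).mul (continuousOn_const.mul (hcomp g' hg'))).mul
      (by fun_prop))
  obtain ⟨C', hC'⟩ := ((isCompact_closedBall x (δ / 2)).prod hΩ.isCompact_frontier
    ).exists_bound_of_continuousOn (hcomp g hgc)
  obtain ⟨C'', hC''⟩ := ((isCompact_closedBall x (δ / 2)).prod hΩ.isCompact_frontier
    ).exists_bound_of_continuousOn (f := fun z : Space n × Space n =>
      (|c| + ‖z.1 - z.2‖) * g (‖z.1 - z.2‖ ^ 2))
    ((continuousOn_const.add (by fun_prop)).mul (hcomp g hgc))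
  have hcm : ∀ y P : Space n, |c + ⟪y - P, m P⟫| ≤ |c| + ‖y - P‖ := fun y P => by
    refine (abs_add_le _ _).trans (add_le_add le_rfl ?_)
    refine (abs_real_inner_le_norm _ _).trans ?_
    exact mul_le_of_le_one_right (norm_nonneg _) (hm1 P)
  have hmeas : ∀ y ∈ Metric.closedBall x (δ / 2), AEStronglyMeasurable
      (fun P => (c + ⟪y - P, m P⟫) * g (‖y - P‖ ^ 2)) (surfaceMeasure Ω) := fun y hy => by
    refine (aestronglyMeasurable_const.add ?_).mul
      (aestronglyMeasurable_surfaceMeasure hΩ (hcomp' g hgc y hy))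
    exact AEStronglyMeasurable.inner (Continuous.aestronglyMeasurable (by fun_prop)) hm
  set F : Space n → Space n → (Space n →L[ℝ] ℝ) := fun y P =>
    h P • (((c + ⟪y - P, m P⟫) * (2 * g' (‖y - P‖ ^ 2))) • innerSL ℝ (y - P) +
      g (‖y - P‖ ^ 2) • innerSL ℝ (m P)) with hF
  have hFmeas : AEStronglyMeasurable (F x) (surfaceMeasure Ω) :=
    hh.aestronglyMeasurable.smul (((AEStronglyMeasurable.mul (aestronglyMeasurable_const.add
      (AEStronglyMeasurable.inner (Continuous.aestronglyMeasurable (by fun_prop)) hm))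
      (aestronglyMeasurable_const.mul (aestronglyMeasurable_surfaceMeasure hΩ
        (hcomp' g' hg' x hx')))).smul (Continuous.aestronglyMeasurable (by fun_prop))).add
      ((aestronglyMeasurable_surfaceMeasure hΩ (hcomp' g hgc x hx')).smul
        ((innerSL ℝ).continuous.comp_aestronglyMeasurable hm)))
  have hFbound : ∀ᵐ P ∂(surfaceMeasure Ω), ∀ y ∈ Metric.ball x (δ / 2),
      ‖F y P‖ ≤ (C + C') * ‖h P‖ := by
    filter_upwards [ae_mem_frontier Ω] with P hP y hy
    have hy' := Metric.ball_subset_closedBall hy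
    rw [hF, norm_smul, mul_comm]
    refine mul_le_mul_of_nonneg_right ((norm_add_le _ _).trans (add_le_add ?_ ?_)) (norm_nonneg _)
    · refine le_trans ?_ (hC (y, P) ⟨hy', hP⟩)
      simp only [norm_smul, innerSL_apply_norm, norm_mul, norm_norm]
      gcongr
      exact (hcm y P).trans (le_abs_self _)
    · rw [norm_smul, innerSL_apply_norm]
      exact (mul_le_of_le_one_right (norm_nonneg _) (hm1 P)).trans (hC' (y, P) ⟨hy', hP⟩)
  have hFint : Integrable (F x) (surfaceMeasure Ω) := by
    refine (hh.norm.const_mul (C + C')).mono' hFmeas ?_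
    filter_upwards [hFbound] with P hP using hP x (Metric.mem_ball_self (half_pos hδ))
  have hint : Integrable (fun P => (c + ⟪x - P, m P⟫) * g (‖x - P‖ ^ 2) * h P)
      (surfaceMeasure Ω) := by
    refine hh.bdd_mul (hmeas x hx') (c := C'') ?_
    filter_upwards [ae_mem_frontier Ω] with P hP
    have := hC'' (x, P) ⟨hx', hP⟩
    refine le_trans ?_ this
    rw [norm_mul, norm_mul, Real.norm_eq_abs, Real.norm_eq_abs (|c| + _)]
    exact mul_le_mul_of_nonneg_right ((hcm x P).trans (le_abs_self _)) (norm_nonneg _)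
  refine ⟨hint, ∫ P, F x P ∂(surfaceMeasure Ω), hasFDerivAt_integral_of_dominated_of_fderiv_le
    (Metric.ball_mem_nhds x (half_pos hδ)) ?_ hint hFmeas hFbound (hh.norm.const_mul _) ?_,
    fun e => ?_⟩
  · filter_upwards [Metric.closedBall_mem_nhds x (half_pos hδ)] with y hy
    exact (hmeas y hy).mul hh.aestronglyMeasurable
  · filter_upwards [ae_mem_frontier Ω] with P hP y hy
    refine ((hasFDerivAt_affine_mul_radial (hg _ (hpos y (Metric.ball_subset_closedBall hy) P
      hP))).mul_const (h P)).congr_fderiv ?_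
    rfl
  · rw [ContinuousLinearMap.integral_apply hFint]
    refine integral_congr_ae (Eventually.of_forall fun P => ?_)
    simp only [hF, smul_apply, add_apply, smul_eq_mul, innerSL_apply_apply]

end Stokes

namespace Stokes

/-! ### The Laplace kernel and representation formulas -/

section Profile

/-- The area `ω_n` of the unit sphere of `ℝⁿ`. -/
noncomputable def sphereArea (n : ℕ) : ℝ := n * volume.real (Metric.ball (0 : Space n) 1)

/-- The function of `‖x‖²` describing the Laplace kernel, regularised by `ε ≥ 0`. -/
noncomputable def laplaceProfile (n : ℕ) (ε s : ℝ) : ℝ :=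
  -(1 / (((n : ℝ) - 2) * sphereArea n)) * (s + ε) ^ (1 - (n : ℝ) / 2)

/-- The derivative of `laplaceProfile`. -/
noncomputable def laplaceProfileDeriv (n : ℕ) (ε s : ℝ) : ℝ :=
  1 / (2 * sphereArea n) * (s + ε) ^ (-(n : ℝ) / 2)

/-- The derivative of `laplaceProfileDeriv`. -/
noncomputable def laplaceProfileDeriv₂ (n : ℕ) (ε s : ℝ) : ℝ :=
  -(n / (4 * sphereArea n)) * (s + ε) ^ (-(n : ℝ) / 2 - 1)

variable {n : ℕ}

theorem sphereArea_pos (hn : 3 ≤ n) : 0 < sphereArea n := by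
  have h : 0 < volume.real (Metric.ball (0 : Space n) 1) :=
    ENNReal.toReal_pos (Metric.measure_ball_pos _ _ one_pos).ne' measure_ball_lt_top.ne
  have : (0 : ℝ) < n := by exact_mod_cast (by omega)
  exact mul_pos this h

theorem hasDerivAt_laplaceProfile (hn : 3 ≤ n) {ε s : ℝ} (hs : 0 < s + ε) :
    HasDerivAt (laplaceProfile n ε) (laplaceProfileDeriv n ε s) s := by
  have h := (((hasDerivAt_id s).add_const ε).rpow_const (p := 1 - (n : ℝ) / 2)
    (Or.inl hs.ne')).const_mul (-(1 / (((n : ℝ) - 2) * sphereArea n)))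
  refine h.congr_deriv ?_
  have h1 : (n : ℝ) - 2 ≠ 0 := by
    have : (3 : ℝ) ≤ n := by exact_mod_cast hn
    intro h; linarith
  have h2 := (sphereArea_pos hn).ne'
  rw [laplaceProfileDeriv, show 1 - (n : ℝ) / 2 - 1 = -(n : ℝ) / 2 by ring, id]
  field_simp
  ring

theorem hasDerivAt_laplaceProfileDeriv (hn : 3 ≤ n) {ε s : ℝ} (hs : 0 < s + ε) :
    HasDerivAt (laplaceProfileDeriv n ε) (laplaceProfileDeriv₂ n ε s) s := by
  have h := (((hasDerivAt_id s).add_const ε).rpow_const (p := -(n : ℝ) / 2)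
    (Or.inl hs.ne')).const_mul (1 / (2 * sphereArea n))
  refine h.congr_deriv ?_
  have h2 := (sphereArea_pos hn).ne'
  rw [laplaceProfileDeriv₂, id]
  field_simp
  norm_num

theorem laplaceProfile_lap (hn : 3 ≤ n) {ε s : ℝ} (hs : 0 < s + ε) :
    2 * n * laplaceProfileDeriv n ε s + 4 * s * laplaceProfileDeriv₂ n ε s =
      n * ε / sphereArea n * (s + ε) ^ (-(n : ℝ) / 2 - 1) := by
  have h2 := (sphereArea_pos hn).ne'
  rw [laplaceProfileDeriv, laplaceProfileDeriv₂,
    show (s + ε) ^ (-(n : ℝ) / 2) = (s + ε) ^ (-(n : ℝ) / 2 - 1) * (s + ε) by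
      rw [← Real.rpow_add_one hs.ne', sub_add_cancel]]
  field_simp
  ring

theorem rpow_norm_sq {z : Space n} (k : ℕ) : (‖z‖ ^ 2) ^ (-(k : ℝ) / 2) = (‖z‖ ^ k)⁻¹ := by
  rw [← Real.rpow_natCast, ← Real.rpow_mul (norm_nonneg _), ← Real.rpow_natCast ‖z‖ k,
    ← Real.rpow_neg (norm_nonneg _)]
  congr 1
  push_cast
  ring

theorem laplaceKernel_eq (hn : 3 ≤ n) (z : Space n) :
    laplaceKernel z = laplaceProfile n 0 (‖z‖ ^ 2) := by
  rw [laplaceKernel, laplaceProfile, add_zero, show 1 - (n : ℝ) / 2 = -((n - 2 : ℕ) : ℝ) / 2 by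
    rw [Nat.cast_sub (by omega)]; push_cast; ring, rpow_norm_sq, ← sphereArea]
  rw [neg_mul, one_div, one_div, mul_inv]

theorem laplaceProfileDeriv_norm_sq (z : Space n) :
    2 * laplaceProfileDeriv n 0 (‖z‖ ^ 2) = 1 / (sphereArea n * ‖z‖ ^ n) := by
  rw [laplaceProfileDeriv, add_zero, rpow_norm_sq, one_div, one_div, mul_inv, mul_inv]
  ring

theorem laplaceProfileDeriv₂_norm_sq (z : Space n) :
    4 * laplaceProfileDeriv₂ n 0 (‖z‖ ^ 2) = -(n / (sphereArea n * ‖z‖ ^ (n + 2))) := by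
  rw [laplaceProfileDeriv₂, add_zero,
    show -(n : ℝ) / 2 - 1 = -((n + 2 : ℕ) : ℝ) / 2 by push_cast; ring, rpow_norm_sq,
    div_mul_eq_div_div, div_mul_eq_div_div]
  ring

/-- The mass distribution of the regularised Laplace kernels. -/
noncomputable def bump (n : ℕ) (z : Space n) : ℝ :=
  n / sphereArea n * (1 + ‖z‖ ^ 2) ^ (-(n : ℝ) / 2 - 1)

theorem bump_nonneg (hn : 3 ≤ n) (z : Space n) : 0 ≤ bump n z := by
  have := sphereArea_pos hn
  unfold bump
  positivity

theorem integral_bump (hn : 3 ≤ n) : ∫ z, bump n z = 1 := by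
  have hn0 : (0 : ℝ) < n := by exact_mod_cast (by omega)
  have hderiv : ∀ y ∈ Ioi (0 : ℝ), HasDerivAt
      (fun y : ℝ => y ^ n * (1 + y ^ 2) ^ (-(n : ℝ) / 2) / n)
      (y ^ (n - 1) * (1 + y ^ 2) ^ (-(n : ℝ) / 2 - 1)) y := by
    intro y hy
    have hy1 : 0 < 1 + y ^ 2 := by positivity
    have h1 : HasDerivAt (fun y : ℝ => 1 + y ^ 2) (2 * y) y := by
      simpa using (hasDerivAt_pow 2 y).const_add 1
    have h2 := ((hasDerivAt_pow n y).fun_mul (h1.rpow_const (p := -(n : ℝ) / 2)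
      (Or.inl hy1.ne'))).div_const (n : ℝ)
    refine h2.congr_deriv ?_
    rw [show (1 + y ^ 2) ^ (-(n : ℝ) / 2) = (1 + y ^ 2) ^ (-(n : ℝ) / 2 - 1) * (1 + y ^ 2) by
      rw [← Real.rpow_add_one hy1.ne', sub_add_cancel]]
    obtain ⟨m, rfl⟩ : ∃ m, n = m + 1 := ⟨n - 1, by omega⟩
    rw [Nat.add_sub_cancel]
    field_simp
    ring
  have hlim : Tendsto (fun y : ℝ => y ^ n * (1 + y ^ 2) ^ (-(n : ℝ) / 2) / n) atTop
      (𝓝 (1 / (n : ℝ))) := by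
    refine Tendsto.div_const ?_ _
    have h1 : Tendsto (fun y : ℝ => (1 - (1 + y ^ 2)⁻¹) ^ ((n : ℝ) / 2)) atTop
        (𝓝 ((1 - 0) ^ ((n : ℝ) / 2))) := by
      refine Tendsto.rpow_const (tendsto_const_nhds.sub (tendsto_inv_atTop_zero.comp ?_))
        (Or.inr (by positivity))
      exact tendsto_atTop_add_const_left _ _ (tendsto_pow_atTop two_ne_zero)
    rw [sub_zero, Real.one_rpow] at h1
    refine h1.congr' ?_
    filter_upwards [eventually_gt_atTop 0] with y hy
    have hy1 : 0 < 1 + y ^ 2 := by positivity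
    rw [show 1 - (1 + y ^ 2)⁻¹ = y ^ 2 * (1 + y ^ 2)⁻¹ by field_simp; ring,
      Real.mul_rpow (by positivity) (by positivity), neg_div, Real.rpow_neg hy1.le,
      Real.inv_rpow hy1.le, ← Real.rpow_natCast y 2, ← Real.rpow_mul hy.le,
      ← Real.rpow_natCast y n]
    congr 2
    push_cast
    ring
  have hint : ∫ y in Ioi (0 : ℝ), y ^ (n - 1) * (1 + y ^ 2) ^ (-(n : ℝ) / 2 - 1) = 1 / (n : ℝ) := by
    have hc : ContinuousWithinAt (fun y : ℝ => y ^ n * (1 + y ^ 2) ^ (-(n : ℝ) / 2) / n)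
        (Ici 0) 0 := by
      refine Continuous.continuousWithinAt (Continuous.div_const ((continuous_pow n).mul ?_) _)
      exact Continuous.rpow_const (by fun_prop) fun y => Or.inl (by positivity)
    rw [integral_Ioi_of_hasDerivAt_of_nonneg hc hderiv (fun y hy => by
      have : 0 < y := hy
      positivity) hlim, zero_pow (by omega), zero_mul, zero_div, sub_zero]
  have : Nonempty (Fin n) := ⟨⟨0, by omega⟩⟩
  have h := integral_fun_norm_addHaar (volume : Measure (Space n))
    (fun y => n / sphereArea n * (1 + y ^ 2) ^ (-(n : ℝ) / 2 - 1))
  have h2 := (sphereArea_pos hn).ne'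
  change (∫ z : Space n, n / sphereArea n * (1 + ‖z‖ ^ 2) ^ (-(n : ℝ) / 2 - 1)) = 1
  rw [h]
  simp only [finrank_euclideanSpace_fin, smul_eq_mul, nsmul_eq_mul]
  rw [show (fun y : ℝ => y ^ (n - 1) * (n / sphereArea n * (1 + y ^ 2) ^ (-(n : ℝ) / 2 - 1))) =
    fun y => n / sphereArea n * (y ^ (n - 1) * (1 + y ^ 2) ^ (-(n : ℝ) / 2 - 1)) by
      funext y; ring, integral_const_mul, hint]
  rw [← mul_assoc, ← sphereArea]
  field_simp

theorem tendsto_norm_pow_mul_bump (hn : 3 ≤ n) :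
    Tendsto (fun z : Space n => ‖z‖ ^ n * bump n z) (Bornology.cobounded (Space n)) (𝓝 0) := by
  have h2 := sphereArea_pos hn
  have h1 : Tendsto (fun z : Space n => n / sphereArea n * (1 + ‖z‖ ^ 2)⁻¹)
      (Bornology.cobounded (Space n)) (𝓝 (n / sphereArea n * 0)) := by
    refine tendsto_const_nhds.mul (tendsto_inv_atTop_zero.comp ?_)
    exact tendsto_atTop_add_const_left _ _ ((tendsto_pow_atTop two_ne_zero).comp
      tendsto_norm_cobounded_atTop)
  rw [mul_zero] at h1
  refine squeeze_zero (fun z => mul_nonneg (by positivity) (bump_nonneg hn z)) (fun z => ?_) h1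
  have hz : 0 < 1 + ‖z‖ ^ 2 := by positivity
  have h3 : ‖z‖ ^ n ≤ (1 + ‖z‖ ^ 2) ^ ((n : ℝ) / 2) := by
    rw [← Real.rpow_natCast, show (n : ℝ) = 2 * ((n : ℝ) / 2) by ring,
      Real.rpow_mul (norm_nonneg _), show 2 * ((n : ℝ) / 2) / 2 = (n : ℝ) / 2 by ring]
    refine Real.rpow_le_rpow (by positivity) ?_ (by positivity)
    rw [Real.rpow_two]
    linarith
  calc ‖z‖ ^ n * bump n z ≤ (1 + ‖z‖ ^ 2) ^ ((n : ℝ) / 2) * bump n z :=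
        mul_le_mul_of_nonneg_right h3 (bump_nonneg hn z)
    _ = n / sphereArea n * (1 + ‖z‖ ^ 2)⁻¹ := by
        rw [bump, mul_left_comm, ← Real.rpow_add hz,
          show (n : ℝ) / 2 + (-(n : ℝ) / 2 - 1) = -1 by ring, Real.rpow_neg_one]

/-- The Laplacian of the regularised kernel is an approximate identity. -/
theorem lap_laplaceProfile (hn : 3 ≤ n) (x y : Space n) {c : ℝ} (hc : 0 < c) :
    lap (fun y => laplaceProfile n (1 / c ^ 2) (‖y - x‖ ^ 2)) y =
      c ^ n * bump n (c • (x - y)) := by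
  have hε : 0 < 1 / c ^ 2 := by positivity
  have hs : 0 < ‖y - x‖ ^ 2 + 1 / c ^ 2 := by positivity
  have h := lap_affine_mul_radial (c := 1) (m := (0 : Space n)) (a := x) (y := y)
    (g := laplaceProfile n (1 / c ^ 2)) (g' := laplaceProfileDeriv n (1 / c ^ 2)) (by
      filter_upwards [lt_mem_nhds (show -(1 / c ^ 2) < ‖y - x‖ ^ 2 by linarith)] with s hs
      exact hasDerivAt_laplaceProfile hn (by linarith)) (hasDerivAt_laplaceProfileDeriv hn hs)
  simp only [inner_zero_right, add_zero, one_mul, mul_zero] at h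
  rw [h, laplaceProfile_lap hn hs, bump, norm_smul, Real.norm_of_nonneg hc.le, norm_sub_rev x y,
    show ‖y - x‖ ^ 2 + 1 / c ^ 2 = (1 + (c * ‖y - x‖) ^ 2) * (c ^ 2)⁻¹ by field_simp; ring,
    Real.mul_rpow (by positivity) (by positivity)]
  have h3 : ((c ^ 2)⁻¹ : ℝ) ^ (-(n : ℝ) / 2 - 1) = c ^ n * c ^ 2 := by
    rw [Real.inv_rpow (by positivity), ← Real.rpow_neg (by positivity), ← Real.rpow_natCast c 2,
      ← Real.rpow_mul hc.le, ← Real.rpow_natCast c n, ← Real.rpow_add hc]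
    congr 1
    push_cast
    ring
  rw [h3]
  field_simp

theorem contDiff_laplaceProfile (x : Space n) {ε : ℝ} (hε : 0 < ε) :
    ContDiff ℝ 2 (fun y => laplaceProfile n ε (‖y - x‖ ^ 2)) := by
  unfold laplaceProfile
  refine contDiff_const.mul (ContDiff.rpow_const_of_ne ?_ fun y => by positivity)
  exact ((contDiff_norm_sq ℝ).comp (contDiff_id.sub contDiff_const)).add contDiff_const

end Profile

end Stokes

namespace Stokes

section Representation

variable {n : ℕ} {Ω : Set (Space n)}

theorem hasFDerivAt_laplaceProfile (hn : 3 ≤ n) {ε : ℝ} {a z : Space n} (hs : 0 < ‖z - a‖ ^ 2 + ε) :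
    HasFDerivAt (fun y => laplaceProfile n ε (‖y - a‖ ^ 2))
      ((2 * laplaceProfileDeriv n ε (‖z - a‖ ^ 2)) • innerSL ℝ (z - a)) z := by
  have h := hasFDerivAt_affine_mul_radial (c := 1) (m := (0 : Space n))
    (hasDerivAt_laplaceProfile hn hs)
  simpa only [inner_zero_right, add_zero, one_mul, map_zero, smul_zero] using h

/-- A global `C²` function that agrees near `closure Ω` with the Laplace kernel with a pole
outside `closure Ω`. -/
theorem exists_contDiff_eq_laplaceProfile (hn : 3 ≤ n) {q : Space n} (hq : q ∉ closure Ω) :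
    ∃ v : Space n → ℝ, ContDiff ℝ 2 v ∧
      (∀ P ∈ closure Ω, v =ᶠ[𝓝 P] fun y => laplaceProfile n 0 (‖y - q‖ ^ 2)) ∧
      ∀ P ∈ closure Ω, lap v P = 0 := by
  obtain ⟨r, hr, hball⟩ := Metric.isOpen_iff.mp isClosed_closure.isOpen_compl q hq
  let b : ContDiffBump q := ⟨r / 4, r / 2, by linarith, by linarith⟩
  have hev : ∀ P ∈ closure Ω, (fun y => (1 - b y) * laplaceProfile n 0 (‖y - q‖ ^ 2)) =ᶠ[𝓝 P]
      fun y => laplaceProfile n 0 (‖y - q‖ ^ 2) := by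
    intro P hP
    have h1 : r / 2 < dist P q := by
      by_contra hc
      exact hball (Metric.mem_ball.mpr (by linarith)) hP
    filter_upwards [(continuous_id.dist continuous_const).continuousAt.eventually
      (lt_mem_nhds h1)] with y hy
    rw [b.zero_of_le_dist (show r / 2 ≤ dist y q from hy.le), sub_zero, one_mul]
  refine ⟨fun y => (1 - b y) * laplaceProfile n 0 (‖y - q‖ ^ 2), ?_, hev, fun P hP => ?_⟩
  · rw [contDiff_iff_contDiffAt]
    intro y
    by_cases hy : y = q
    · subst hy
      have : (fun z => (1 - b z) * laplaceProfile n 0 (‖z - y‖ ^ 2)) =ᶠ[𝓝 y] fun _ => 0 := by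
        filter_upwards [b.eventuallyEq_one] with z hz
        rw [hz, Pi.one_apply, sub_self, zero_mul]
      exact contDiffAt_const.congr_of_eventuallyEq this
    · have h0 : ‖y - q‖ ^ 2 + 0 ≠ 0 := by
        have := norm_pos_iff.mpr (sub_ne_zero.mpr hy)
        positivity
      refine (contDiffAt_const.sub b.contDiffAt).mul ?_
      unfold laplaceProfile
      refine contDiffAt_const.mul (ContDiffAt.rpow_const_of_ne ?_ h0)
      exact ContDiff.contDiffAt (((contDiff_norm_sq ℝ).comp
        (contDiff_id.sub contDiff_const)).add contDiff_const)
  · rw [lap_congr (hev P hP)]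
    have hs : 0 < ‖P - q‖ ^ 2 + 0 := by
      have : P ≠ q := by rintro rfl; exact hq hP
      have := norm_pos_iff.mpr (sub_ne_zero.mpr this)
      positivity
    have h := lap_affine_mul_radial (c := 1) (m := (0 : Space n)) (a := q) (y := P)
      (g := laplaceProfile n 0) (g' := laplaceProfileDeriv n 0) (by
        filter_upwards [lt_mem_nhds (show 0 < ‖P - q‖ ^ 2 by linarith)] with s hs
        exact hasDerivAt_laplaceProfile hn (by linarith)) (hasDerivAt_laplaceProfileDeriv hn hs)
    simp only [inner_zero_right, add_zero, one_mul, mul_zero] at h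
    have h2 := laplaceProfile_lap hn hs
    simp only [mul_zero, zero_div, zero_mul] at h2
    rw [h, h2]

theorem IsBoundedC2Domain.aestronglyMeasurable_apply_normal (hΩ : IsBoundedC2Domain Ω)
    {L : Space n → (Space n →L[ℝ] ℝ)} (hL : Continuous L) :
    AEStronglyMeasurable (fun P => L P (outwardNormal Ω P)) (surfaceMeasure Ω) :=
  isBoundedBilinearMap_apply.continuous.comp_aestronglyMeasurable
    (hL.aestronglyMeasurable.prodMk hΩ.aestronglyMeasurable_normal)

/-- Green's representation formula for harmonic functions. The regularised kernels are globally
smooth, so that no ball around the pole has to be removed. -/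
theorem IsBoundedC2Domain.representation (hΩ : IsBoundedC2Domain Ω) (hn : 3 ≤ n) {x : Space n}
    (hx : x ∉ frontier Ω) {v : Space n → ℝ} (hv : ContDiff ℝ 2 v) (hlap : ∀ y ∈ Ω, lap v y = 0) :
    ∫ P, (v P * (2 * laplaceProfileDeriv n 0 (‖P - x‖ ^ 2) * ⟪P - x, outwardNormal Ω P⟫) -
      laplaceProfile n 0 (‖P - x‖ ^ 2) * fderiv ℝ v P (outwardNormal Ω P)) ∂(surfaceMeasure Ω) =
      Ω.indicator v x := by
  have hne : ∀ P ∈ frontier Ω, 0 < ‖P - x‖ ^ 2 := fun P hP => by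
    have : P ≠ x := by rintro rfl; exact hx hP
    have := norm_pos_iff.mpr (sub_ne_zero.mpr this)
    positivity
  by_cases hxΩ : x ∈ Ω
  · rw [indicator_of_mem hxΩ]
    have hgreen : ∀ c : ℝ, 0 < c →
        ∫ P, (v P * (2 * laplaceProfileDeriv n (1 / c ^ 2) (‖P - x‖ ^ 2) *
            ⟪P - x, outwardNormal Ω P⟫) - laplaceProfile n (1 / c ^ 2) (‖P - x‖ ^ 2) *
            fderiv ℝ v P (outwardNormal Ω P)) ∂(surfaceMeasure Ω) =
          ∫ y, (c ^ Module.finrank ℝ (Space n) * bump n (c • (x - y))) • Ω.indicator v y := by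
      intro c hc
      have hε : 0 < 1 / c ^ 2 := by positivity
      have h := hΩ.green hv (contDiff_laplaceProfile x hε)
      simp only [finrank_euclideanSpace_fin, smul_eq_mul]
      have h1 : ∀ y, (c ^ n * bump n (c • (x - y))) * Ω.indicator v y =
          Ω.indicator (fun y => v y * (c ^ n * bump n (c • (x - y)))) y := fun y => by
        by_cases hy : y ∈ Ω
        · rw [indicator_of_mem hy, indicator_of_mem hy, mul_comm]
        · rw [indicator_of_notMem hy, indicator_of_notMem hy, mul_zero]
      simp_rw [h1]
      rw [integral_indicator hΩ.isOpen.measurableSet]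
      refine Eq.trans (integral_congr_ae (Eventually.of_forall fun P => ?_)) (h.trans
        (setIntegral_congr_fun hΩ.isOpen.measurableSet fun y hy => ?_))
      · rw [(hasFDerivAt_laplaceProfile hn (by positivity)).fderiv, smul_apply, smul_eq_mul,
          innerSL_apply_apply]
      · rw [hlap y hy, mul_zero, sub_zero, lap_laplaceProfile hn x y hc]
    have hR : Tendsto (fun c : ℝ => ∫ y, (c ^ Module.finrank ℝ (Space n) *
        bump n (c • (x - y))) • Ω.indicator v y) atTop (𝓝 (Ω.indicator v x)) := by
      refine tendsto_integral_comp_smul_smul_of_integrable' (bump_nonneg hn) (integral_bump hn)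
        (by simpa only [finrank_euclideanSpace_fin] using tendsto_norm_pow_mul_bump hn) ?_ ?_
      · rw [integrable_indicator_iff hΩ.isOpen.measurableSet]
        exact (hv.continuous.continuousOn.integrableOn_compact hΩ.isBounded.isCompact_closure
          ).mono_set subset_closure
      · refine hv.continuous.continuousAt.congr ?_
        filter_upwards [hΩ.isOpen.mem_nhds hxΩ] with y hy
        rw [indicator_of_mem hy]
    rw [indicator_of_mem hxΩ] at hR
    refine tendsto_nhds_unique ?_ (hR.congr' (by
      filter_upwards [eventually_gt_atTop 0] with c hc using (hgreen c hc).symm))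
    have hε0 : Tendsto (fun c : ℝ => 1 / c ^ 2) atTop (𝓝 0) := by
      simp only [one_div]
      exact tendsto_inv_atTop_zero.comp (tendsto_pow_atTop two_ne_zero)
    have hprof : ∀ (P : Space n), P ∈ frontier Ω → ∀ ε : ℝ, 0 ≤ ε →
        |laplaceProfile n ε (‖P - x‖ ^ 2)| ≤ |laplaceProfile n 0 (‖P - x‖ ^ 2)| ∧
        |laplaceProfileDeriv n ε (‖P - x‖ ^ 2)| ≤ |laplaceProfileDeriv n 0 (‖P - x‖ ^ 2)| := by
      intro P hP ε hε
      have h0 := hne P hP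
      have hn2 : (3 : ℝ) ≤ n := by exact_mod_cast hn
      simp only [laplaceProfile, laplaceProfileDeriv, abs_mul]
      constructor <;> refine mul_le_mul_of_nonneg_left ?_ (abs_nonneg _)
      · rw [abs_of_nonneg (by positivity), abs_of_nonneg (by positivity)]
        exact Real.rpow_le_rpow_of_nonpos (by linarith) (by linarith) (by linarith)
      · rw [abs_of_nonneg (by positivity), abs_of_nonneg (by positivity)]
        exact Real.rpow_le_rpow_of_nonpos (by linarith) (by linarith) (by linarith)
    have hc1 : ContinuousOn (fun P : Space n => laplaceProfile n 0 (‖P - x‖ ^ 2)) (frontier Ω) :=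
      fun P hP => ((hasFDerivAt_laplaceProfile hn
        (by simpa using hne P hP)).continuousAt).continuousWithinAt
    have hc2 : ∀ ε : ℝ, 0 ≤ ε → ContinuousOn
        (fun P : Space n => laplaceProfileDeriv n ε (‖P - x‖ ^ 2)) (frontier Ω) := by
      intro ε hε P hP
      have h0 := hne P hP
      have := (hasDerivAt_laplaceProfileDeriv hn
          (show 0 < ‖P - x‖ ^ 2 + ε by positivity)).continuousAt
      exact (ContinuousAt.comp (f := fun P : Space n => ‖P - x‖ ^ 2) this
        (by fun_prop)).continuousWithinAt
    have hdv : Continuous (fderiv ℝ v) := hv.continuous_fderiv (by norm_num)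
    obtain ⟨C, hC⟩ := hΩ.isCompact_frontier.exists_bound_of_continuousOn
      (f := fun P => |v P| * (2 * |laplaceProfileDeriv n 0 (‖P - x‖ ^ 2)| * ‖P - x‖) +
        |laplaceProfile n 0 (‖P - x‖ ^ 2)| * ‖fderiv ℝ v P‖)
      ((hv.continuous.continuousOn.abs.mul ((continuousOn_const.mul
        (hc2 0 le_rfl).abs).mul (by fun_prop))).add (hc1.abs.mul hdv.norm.continuousOn))
    have hNmeas := hΩ.aestronglyMeasurable_normal
    have := hΩ.isFiniteMeasure
    refine tendsto_integral_filter_of_dominated_convergence (fun _ => C) ?_ ?_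
      (integrable_const _) ?_
    · filter_upwards [eventually_gt_atTop 0] with c hc
      have hε : 0 < 1 / c ^ 2 := by positivity
      refine AEStronglyMeasurable.sub (hv.continuous.aestronglyMeasurable.mul
        ((aestronglyMeasurable_const.mul (aestronglyMeasurable_surfaceMeasure hΩ
          (hc2 _ hε.le))).mul ?_)) (AEStronglyMeasurable.mul ?_ ?_)
      · exact AEStronglyMeasurable.inner (Continuous.aestronglyMeasurable (by fun_prop)) hNmeas
      · exact (contDiff_laplaceProfile x hε).continuous.aestronglyMeasurable
      · exact hΩ.aestronglyMeasurable_apply_normal hdv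
    · filter_upwards [eventually_gt_atTop 0] with c hc
      have hε : 0 ≤ 1 / c ^ 2 := by positivity
      filter_upwards [ae_mem_frontier Ω] with P hP
      refine le_trans ?_ ((le_abs_self _).trans (hC P hP))
      refine (norm_sub_le _ _).trans (add_le_add ?_ ?_)
      · rw [norm_mul, norm_mul, norm_mul, Real.norm_two]
        refine mul_le_mul_of_nonneg_left (mul_le_mul (mul_le_mul_of_nonneg_left
          (hprof P hP _ hε).2 two_pos.le) ?_ (norm_nonneg _) (by positivity)) (norm_nonneg _)
        exact (norm_inner_le_norm _ _).trans (mul_le_of_le_one_right (norm_nonneg _)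
          (norm_outwardNormal_le Ω P))
      · rw [norm_mul]
        refine mul_le_mul (hprof P hP _ hε).1 ?_ (norm_nonneg _) (abs_nonneg _)
        exact (ContinuousLinearMap.le_opNorm _ _).trans (mul_le_of_le_one_right (norm_nonneg _)
          (norm_outwardNormal_le Ω P))
    · filter_upwards [ae_mem_frontier Ω] with P hP
      have h0 := hne P hP
      have hlim : ∀ p : ℝ, Tendsto (fun c : ℝ => (‖P - x‖ ^ 2 + 1 / c ^ 2) ^ p) atTop
          (𝓝 ((‖P - x‖ ^ 2 + 0) ^ p)) := fun p =>
        (tendsto_const_nhds.add hε0).rpow_const (Or.inl (by simpa using h0.ne'))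
      exact (tendsto_const_nhds.mul ((tendsto_const_nhds.mul (tendsto_const_nhds.mul
        (hlim _))).mul_const _)).sub ((tendsto_const_nhds.mul (hlim _)).mul_const _)
  · have hxc : x ∉ closure Ω := by
      rw [closure_eq_self_union_frontier]
      exact fun h => h.elim hxΩ hx
    rw [indicator_of_notMem hxΩ]
    obtain ⟨u, hu, hu1, hu2⟩ := exists_contDiff_eq_laplaceProfile hn hxc
    have h := hΩ.green hv hu
    refine Eq.trans (integral_congr_ae ?_) (h.trans ?_)
    · filter_upwards [ae_mem_frontier Ω] with P hP
      have hP' := frontier_subset_closure hP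
      rw [(hu1 P hP').fderiv_eq, (hu1 P hP').eq_of_nhds, (hasFDerivAt_laplaceProfile hn
        (by simpa using hne P hP)).fderiv, smul_apply, smul_eq_mul, innerSL_apply_apply]
    · rw [setIntegral_congr_fun hΩ.isOpen.measurableSet (g := fun _ => (0 : ℝ)), integral_zero]
      intro y hy
      simp only
      rw [hlap y hy, hu2 y (subset_closure hy), mul_zero, mul_zero, sub_zero]

/-- The derivative `∂_e E` of the Laplace kernel. -/
noncomputable def gradKernel (e z : Space n) : ℝ := ⟪z, e⟫ / (sphereArea n * ‖z‖ ^ n)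

/-- The second derivative `∂_e ∂_m E` of the Laplace kernel. -/
noncomputable def hessKernel (e m z : Space n) : ℝ :=
  ⟪m, e⟫ / (sphereArea n * ‖z‖ ^ n) - n * ⟪z, m⟫ * ⟪z, e⟫ / (sphereArea n * ‖z‖ ^ (n + 2))

theorem gradKernel_eq (e z : Space n) :
    gradKernel e z = 2 * laplaceProfileDeriv n 0 (‖z‖ ^ 2) * ⟪z, e⟫ := by
  rw [laplaceProfileDeriv_norm_sq, gradKernel]
  ring

theorem hessKernel_eq (e m z : Space n) :
    hessKernel e m z = 2 * laplaceProfileDeriv n 0 (‖z‖ ^ 2) * ⟪m, e⟫ +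
      4 * laplaceProfileDeriv₂ n 0 (‖z‖ ^ 2) * ⟪z, m⟫ * ⟪z, e⟫ := by
  rw [laplaceProfileDeriv_norm_sq, laplaceProfileDeriv₂_norm_sq, hessKernel]
  ring

/-- The derivative of Green's representation formula for harmonic functions; the left-hand side
vanishes for points outside `Ω`. -/
theorem IsBoundedC2Domain.representation_fderiv (hΩ : IsBoundedC2Domain Ω) (hn : 3 ≤ n)
    {x : Space n} (hx : x ∉ frontier Ω) {v : Space n → ℝ} (hv : ContDiff ℝ 2 v)
    (hlap : ∀ y ∈ Ω, lap v y = 0) (e : Space n) :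
    ∫ P, hessKernel e (outwardNormal Ω P) (x - P) * v P ∂(surfaceMeasure Ω) =
      -(∫ P, gradKernel e (x - P) * fderiv ℝ v P (outwardNormal Ω P) ∂(surfaceMeasure Ω)) -
        Ω.indicator (fun x => fderiv ℝ v x e) x := by
  have := hΩ.isFiniteMeasure
  have hNmeas := hΩ.aestronglyMeasurable_normal
  have hdv : Continuous (fderiv ℝ v) := hv.continuous_fderiv (by norm_num)
  have hv1 : Integrable v (surfaceMeasure Ω) := by
    obtain ⟨C, hC⟩ := hΩ.isCompact_frontier.exists_bound_of_continuousOn hv.continuous.continuousOn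
    refine (integrable_const C).mono' hv.continuous.aestronglyMeasurable ?_
    filter_upwards [ae_mem_frontier Ω] with P hP using hC P hP
  have hv2 : Integrable (fun P => fderiv ℝ v P (outwardNormal Ω P)) (surfaceMeasure Ω) := by
    obtain ⟨C, hC⟩ := hΩ.isCompact_frontier.exists_bound_of_continuousOn hdv.continuousOn
    refine (integrable_const C).mono' (hΩ.aestronglyMeasurable_apply_normal hdv) ?_
    filter_upwards [ae_mem_frontier Ω] with P hP
    exact (ContinuousLinearMap.le_opNorm _ _).trans ((mul_le_of_le_one_right (norm_nonneg _)
      (norm_outwardNormal_le Ω P)).trans (hC P hP))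
  have hD1 : ∀ s : ℝ, 0 < s → HasDerivAt (fun s => 2 * laplaceProfileDeriv n 0 s)
      (2 * laplaceProfileDeriv₂ n 0 s) s := fun s hs =>
    (hasDerivAt_laplaceProfileDeriv hn (by linarith)).const_mul 2
  have hcont : ∀ p : ℝ, ContinuousOn (fun s : ℝ => (s + 0) ^ p) (Ioi 0) := fun p =>
    ContinuousOn.rpow_const (by fun_prop) fun s hs => Or.inl (by
      rw [add_zero]; exact (mem_Ioi.mp hs).ne')
  have hK1 := fun y (hy : y ∉ frontier Ω) => hΩ.hasFDerivAt_integral_radial hy hv1 hNmeas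
    (norm_outwardNormal_le Ω) 0 hD1 (continuousOn_const.mul (continuousOn_const.mul (hcont _)))
  have hK2 := fun y (hy : y ∉ frontier Ω) => hΩ.hasFDerivAt_integral_radial hy hv2
    (m := fun _ => 0) aestronglyMeasurable_const (by simp) 1
    (fun s hs => hasDerivAt_laplaceProfile hn (ε := 0) (by linarith))
    (continuousOn_const.mul (hcont _))
  simp only [inner_zero_right, inner_zero_left, zero_add, add_zero, one_mul, mul_zero] at hK1 hK2
  have hrep : ∀ y ∉ frontier Ω, Ω.indicator v y =
      -(∫ P, ⟪y - P, outwardNormal Ω P⟫ * (2 * laplaceProfileDeriv n 0 (‖y - P‖ ^ 2)) * v P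
        ∂(surfaceMeasure Ω)) - ∫ P, laplaceProfile n 0 (‖y - P‖ ^ 2) *
          fderiv ℝ v P (outwardNormal Ω P) ∂(surfaceMeasure Ω) := by
    intro y hy
    have h1 : Integrable (fun P => -(⟪y - P, outwardNormal Ω P⟫ *
      (2 * laplaceProfileDeriv n 0 (‖y - P‖ ^ 2)) * v P)) (surfaceMeasure Ω) := (hK1 y hy).1.neg
    rw [← hΩ.representation hn hy hv hlap, ← integral_neg, ← integral_sub h1 (hK2 y hy).1]
    refine integral_congr_ae (Eventually.of_forall fun P => ?_)
    simp only
    rw [norm_sub_rev P y, ← neg_sub y P, inner_neg_left]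
    ring
  obtain ⟨F1, hF1, hF1e⟩ := (hK1 x hx).2
  obtain ⟨F2, hF2, hF2e⟩ := (hK2 x hx).2
  have hd : HasFDerivAt (Ω.indicator v) (-F1 - F2) x := by
    refine (hF1.neg.sub hF2).congr_of_eventuallyEq ?_
    filter_upwards [isClosed_frontier.isOpen_compl.mem_nhds hx] with y hy using hrep y hy
  have hind : Ω.indicator (fun x => fderiv ℝ v x e) x = (-F1 - F2) e := by
    by_cases hxΩ : x ∈ Ω
    · rw [indicator_of_mem hxΩ, ← hd.fderiv]
      congr 1
      refine Filter.EventuallyEq.fderiv_eq ?_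
      filter_upwards [hΩ.isOpen.mem_nhds hxΩ] with y hy
      rw [indicator_of_mem hy]
    · have hxc : x ∉ closure Ω := by
        rw [closure_eq_self_union_frontier]
        exact fun h => h.elim hxΩ hx
      have h0 : Ω.indicator v =ᶠ[𝓝 x] fun _ => 0 := by
        filter_upwards [isClosed_closure.isOpen_compl.mem_nhds hxc] with y hy
        exact indicator_of_notMem (fun h => hy (subset_closure h)) _
      rw [indicator_of_notMem hxΩ, ← hd.fderiv, h0.fderiv_eq]
      simp
  rw [hind, sub_apply, neg_apply, hF1e, hF2e]
  have e1 : ∀ P, hessKernel e (outwardNormal Ω P) (x - P) * v P =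
      v P * (⟪x - P, outwardNormal Ω P⟫ * (2 * (2 * laplaceProfileDeriv₂ n 0 (‖x - P‖ ^ 2))) *
        ⟪x - P, e⟫ + 2 * laplaceProfileDeriv n 0 (‖x - P‖ ^ 2) * ⟪outwardNormal Ω P, e⟫) := by
    intro P
    rw [hessKernel_eq]
    ring
  have e2 : ∀ P, gradKernel e (x - P) * fderiv ℝ v P (outwardNormal Ω P) =
      fderiv ℝ v P (outwardNormal Ω P) *
        (2 * laplaceProfileDeriv n 0 (‖x - P‖ ^ 2) * ⟪x - P, e⟫) := by
    intro P
    rw [gradKernel_eq]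
    ring
  simp_rw [e1, e2]
  ring

end Representation

end Stokes

namespace Stokes

/-! ### Estimates for the Laplace kernel and single layer potentials -/

section KernelEstimates

theorem abs_one_div_pow_sub_le {a b R : ℝ} (hR : 0 < R) (ha : R ≤ a) (hb : R ≤ b) (m : ℕ)
    (hm : m ≠ 0) : |1 / a ^ m - 1 / b ^ m| ≤ m * |a ^ 2 - b ^ 2| / R ^ (m + 2) := by
  have ha0 : 0 < a := hR.trans_le ha
  have hb0 : 0 < b := hR.trans_le hb
  have h1 : |1 / a - 1 / b| ≤ |a ^ 2 - b ^ 2| / R ^ 3 := by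
    rw [show 1 / a - 1 / b = -(a ^ 2 - b ^ 2) / (a * b * (a + b)) by field_simp; ring, abs_div,
      abs_neg, abs_of_pos (show 0 < a * b * (a + b) by positivity)]
    refine div_le_div_of_nonneg_left (abs_nonneg _) (by positivity) ?_
    calc R ^ 3 = R * R * R := by ring
      _ ≤ a * b * (a + b) := by gcongr; linarith
  have h2 : max |1 / a| |1 / b| ≤ 1 / R := by
    rw [abs_of_pos (by positivity), abs_of_pos (by positivity)]
    exact max_le (one_div_le_one_div_of_le hR ha) (one_div_le_one_div_of_le hR hb)
  rw [← one_div_pow, ← one_div_pow]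
  calc |(1 / a) ^ m - (1 / b) ^ m| ≤ |1 / a - 1 / b| * m * max |1 / a| |1 / b| ^ (m - 1) :=
        abs_pow_sub_pow_le _ _ _
    _ ≤ |a ^ 2 - b ^ 2| / R ^ 3 * m * (1 / R) ^ (m - 1) := by gcongr
    _ = m * |a ^ 2 - b ^ 2| / R ^ (m + 2) := by
        obtain ⟨k, rfl⟩ := Nat.exists_eq_succ_of_ne_zero hm
        rw [Nat.succ_sub_one, show k.succ + 2 = k + 3 by omega, pow_add, one_div_pow]
        field_simp

variable {n : ℕ} {Ω : Set (Space n)}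

theorem abs_reflected_sum_le {r d a b R μ η θ ζ c C₁ C₂ : ℝ} (hR : 0 < R) (hr : 0 ≤ r) (hd : 0 ≤ d)
    (hc : 0 ≤ c) (hC₁ : 0 ≤ C₁) (hrR : r ≤ 2 * R) (hdR : d ≤ 2 * R) (ha : R ≤ a) (hb : R ≤ b)
    (hμ : |μ| ≤ 1) (hη : |η| ≤ C₁ * r ^ 2) (hθ : |θ| ≤ C₂ * r * c) (hζ : |ζ| ≤ r * c)
    (hab : |a ^ 2 - b ^ 2| ≤ 4 * d * (C₁ * r ^ 2)) :
    |θ * (1 / a ^ n + 1 / b ^ n) - n * ζ * (d * μ * (1 / a ^ (n + 2) - 1 / b ^ (n + 2)) +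
      η * (1 / a ^ (n + 2) + 1 / b ^ (n + 2)))| ≤
      (2 * C₂ + n * (4 * (n + 2) * C₁ * 16 + 8 * C₁)) * c * (r * (1 / R ^ n)) := by
  have hpow : ∀ k : ℕ, 1 / a ^ k ≤ 1 / R ^ k ∧ 1 / b ^ k ≤ 1 / R ^ k := fun k =>
    ⟨one_div_le_one_div_of_le (by positivity) (pow_le_pow_left₀ hR.le ha _),
      one_div_le_one_div_of_le (by positivity) (pow_le_pow_left₀ hR.le hb _)⟩
  have ha0 : 0 < a := hR.trans_le ha
  have hb0 : 0 < b := hR.trans_le hb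
  have hd2 : d ^ 2 ≤ 4 * R ^ 2 := by nlinarith
  have hr2 : r ^ 2 ≤ 4 * R ^ 2 := by nlinarith
  have t1 : |θ * (1 / a ^ n + 1 / b ^ n)| ≤ C₂ * r * c * (2 * (1 / R ^ n)) := by
    rw [abs_mul, abs_of_pos (show 0 < 1 / a ^ n + 1 / b ^ n by positivity)]
    refine mul_le_mul hθ ?_ (by positivity) ((abs_nonneg _).trans hθ)
    linarith [(hpow n).1, (hpow n).2]
  have t2 : |d * μ * (1 / a ^ (n + 2) - 1 / b ^ (n + 2))| ≤
      4 * (n + 2) * C₁ * 16 * (1 / R ^ n) := by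
    have h := (abs_one_div_pow_sub_le hR ha hb (n + 2) (by omega)).trans
      (div_le_div_of_nonneg_right (mul_le_mul_of_nonneg_left hab (Nat.cast_nonneg _))
        (by positivity))
    rw [abs_mul, abs_mul, abs_of_nonneg hd]
    calc d * |μ| * |1 / a ^ (n + 2) - 1 / b ^ (n + 2)|
        ≤ d * 1 * ((n + 2 : ℕ) * (4 * d * (C₁ * r ^ 2)) / R ^ (n + 2 + 2)) :=
          mul_le_mul (mul_le_mul_of_nonneg_left hμ hd) h (abs_nonneg _) (by positivity)
      _ = 4 * (n + 2) * C₁ * (d ^ 2 * r ^ 2) / R ^ (n + 2 + 2) := by push_cast; ring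
      _ ≤ 4 * (n + 2) * C₁ * ((4 * R ^ 2) * (4 * R ^ 2)) / R ^ (n + 2 + 2) := by gcongr
      _ = 4 * (n + 2) * C₁ * 16 * (1 / R ^ n) := by
          rw [pow_add, pow_add]; field_simp; ring
  have t3 : |η * (1 / a ^ (n + 2) + 1 / b ^ (n + 2))| ≤ 8 * C₁ * (1 / R ^ n) := by
    rw [abs_mul, abs_of_pos (show 0 < 1 / a ^ (n + 2) + 1 / b ^ (n + 2) by positivity)]
    calc |η| * (1 / a ^ (n + 2) + 1 / b ^ (n + 2))
        ≤ C₁ * (4 * R ^ 2) * (2 * (1 / R ^ (n + 2))) := by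
          refine mul_le_mul (hη.trans (mul_le_mul_of_nonneg_left hr2 hC₁)) ?_ (by positivity)
            (by positivity)
          linarith [(hpow (n + 2)).1, (hpow (n + 2)).2]
      _ = 8 * C₁ * (1 / R ^ n) := by rw [pow_add]; field_simp; ring
  have t4 : |n * ζ * (d * μ * (1 / a ^ (n + 2) - 1 / b ^ (n + 2)) +
      η * (1 / a ^ (n + 2) + 1 / b ^ (n + 2)))| ≤
      n * (r * c) * (4 * (n + 2) * C₁ * 16 * (1 / R ^ n) + 8 * C₁ * (1 / R ^ n)) := by
    rw [abs_mul, abs_mul, Nat.abs_cast]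
    exact mul_le_mul (mul_le_mul_of_nonneg_left hζ (Nat.cast_nonneg _))
      ((abs_add_le _ _).trans (add_le_add t2 t3)) (abs_nonneg _) (by positivity)
  exact ((abs_sub _ _).trans (add_le_add t1 t4)).trans (le_of_eq (by ring))

theorem abs_reflected_sub_le {r d a b R ζ c C₁ : ℝ} (hn : n ≠ 0) (hR : 0 < R) (hr : 0 ≤ r)
    (hc : 0 ≤ c) (hC₁ : 0 ≤ C₁) (hrR : r ≤ 2 * R) (hdR : d ≤ 2 * R) (ha : R ≤ a)
    (hb : R ≤ b) (hζ : |ζ| ≤ r * c) (hab : |a ^ 2 - b ^ 2| ≤ 4 * d * (C₁ * r ^ 2)) :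
    |ζ * (1 / a ^ n - 1 / b ^ n)| ≤ c * (16 * n * C₁) * (r ^ 2 * (1 / R ^ n)) := by
  have h := (abs_one_div_pow_sub_le hR ha hb n hn).trans
    (div_le_div_of_nonneg_right (mul_le_mul_of_nonneg_left hab (Nat.cast_nonneg _))
      (by positivity))
  rw [abs_mul]
  calc |ζ| * |1 / a ^ n - 1 / b ^ n|
      ≤ r * c * (n * (4 * d * (C₁ * r ^ 2)) / R ^ (n + 2)) :=
        mul_le_mul hζ h (abs_nonneg _) (by positivity)
    _ = c * (4 * n * C₁) * r ^ 2 * (d * r) / R ^ (n + 2) := by ring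
    _ ≤ c * (4 * n * C₁) * r ^ 2 * ((2 * R) * (2 * R)) / R ^ (n + 2) := by gcongr
    _ = c * (16 * n * C₁) * (r ^ 2 * (1 / R ^ n)) := by
        rw [pow_add]; field_simp; ring

/-- The points `p - d ν` and `p + d ν` are nearly equidistant from the boundary, which makes the
sum of the second derivatives and the difference of the first derivatives of the Laplace kernel
less singular than each term. -/
theorem IsBoundedC2Domain.exists_reflection_le (hΩ : IsBoundedC2Domain Ω) (hn : 3 ≤ n) :
    ∃ C δ : ℝ, 0 < C ∧ 0 < δ ∧ ∀ p ∈ frontier Ω, ∀ d : ℝ, 0 ≤ d → d ≤ δ →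
      ∀ e : Space n, ⟪outwardNormal Ω p, e⟫ = 0 → ∀ P ∈ frontier Ω, P ≠ p →
      |hessKernel e (outwardNormal Ω P) (p - d • outwardNormal Ω p - P) +
        hessKernel e (outwardNormal Ω P) (p + d • outwardNormal Ω p - P)| ≤
          C * ‖e‖ / ‖P - p‖ ^ (n - 1) ∧
      |gradKernel e (p - d • outwardNormal Ω p - P) -
        gradKernel e (p + d • outwardNormal Ω p - P)| ≤ C * ‖e‖ / ‖P - p‖ ^ (n - 2) := by
  obtain ⟨C₁, hC₁, h1⟩ := hΩ.exists_inner_normal_le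
  obtain ⟨C₂, hC₂, h2⟩ := hΩ.exists_lipschitz_normal
  obtain ⟨δ, hδ, h3⟩ := hΩ.exists_norm_sub_normal
  have hω := sphereArea_pos hn
  refine ⟨1 / sphereArea n * (2 * C₂ + n * (4 * (n + 2) * C₁ * 16 + 8 * C₁)) * 2 ^ n +
    1 / sphereArea n * (16 * n * C₁) * 2 ^ n, δ, by positivity, hδ,
    fun p hp d hd hdδ e he P hP hPp => ?_⟩
  have hy0 : 0 < ‖P - p‖ := norm_pos_iff.mpr (sub_ne_zero.mpr hPp)
  have hν1 := norm_outwardNormal_le Ω p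
  have hN1 := norm_outwardNormal_le Ω P
  have hνy : |⟪outwardNormal Ω p, P - p⟫| ≤ C₁ * ‖P - p‖ ^ 2 := by
    have := h1 p hp P hP
    rwa [dist_eq_norm, norm_sub_rev, real_inner_comm] at this
  have hη : |⟪P - p, outwardNormal Ω P⟫| ≤ C₁ * ‖P - p‖ ^ 2 := by
    have := h1 P hP p hp
    rwa [dist_eq_norm, ← neg_sub, inner_neg_left, abs_neg] at this
  have hθ : |⟪outwardNormal Ω P, e⟫| ≤ C₂ * ‖P - p‖ * ‖e‖ := by
    have : ⟪outwardNormal Ω P, e⟫ = ⟪outwardNormal Ω P - outwardNormal Ω p, e⟫ := by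
      rw [inner_sub_left, he, sub_zero]
    rw [this]
    refine (abs_real_inner_le_norm _ _).trans (mul_le_mul_of_nonneg_right ?_ (norm_nonneg _))
    have := h2 P hP p hp
    rwa [dist_eq_norm] at this
  have hRa := h3 P hP p hp (-d) (by rwa [abs_neg, abs_of_nonneg hd])
  have hRb := h3 P hP p hp d (by rwa [abs_of_nonneg hd])
  rw [show P - (p + -d • outwardNormal Ω p) = d • outwardNormal Ω p + (P - p) by
    rw [neg_smul]; abel, neg_sq] at hRa
  rw [show P - (p + d • outwardNormal Ω p) = -(d • outwardNormal Ω p - (P - p)) by abel,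
    norm_neg] at hRb
  rw [show p - d • outwardNormal Ω p - P = -(d • outwardNormal Ω p + (P - p)) by abel,
    show p + d • outwardNormal Ω p - P = d • outwardNormal Ω p - (P - p) by abel]
  generalize outwardNormal Ω p = ν at *
  generalize outwardNormal Ω P = N at *
  generalize P - p = y at *
  have hζ : |⟪y, e⟫| ≤ ‖y‖ * ‖e‖ := abs_real_inner_le_norm _ _
  have hμ : |⟪ν, N⟫| ≤ 1 := (abs_real_inner_le_norm _ _).trans (mul_le_one₀ hν1 (norm_nonneg _) hN1)
  have hab : |‖d • ν + y‖ ^ 2 - ‖d • ν - y‖ ^ 2| ≤ 4 * d * (C₁ * ‖y‖ ^ 2) := by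
    have : ‖d • ν + y‖ ^ 2 - ‖d • ν - y‖ ^ 2 = 4 * d * ⟪ν, y⟫ := by
      rw [norm_add_sq_real, norm_sub_sq_real, real_inner_smul_left]
      ring
    rw [this, abs_mul, abs_of_nonneg (by positivity)]
    gcongr
  -- `R` is comparable with the distance of `P` to either point
  obtain ⟨R, hR0, hR2⟩ : ∃ R : ℝ, 0 < R ∧ R ^ 2 = (‖y‖ ^ 2 + d ^ 2) / 2 :=
    ⟨√((‖y‖ ^ 2 + d ^ 2) / 2), Real.sqrt_pos.mpr (by positivity), Real.sq_sqrt (by positivity)⟩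
  have hrR : ‖y‖ ≤ 2 * R := by nlinarith [sq_nonneg d]
  have hdR : d ≤ 2 * R := by nlinarith [sq_nonneg ‖y‖]
  rw [← hR2] at hRa hRb
  replace hRa := (sq_le_sq₀ hR0.le (norm_nonneg _)).mp hRa
  replace hRb := (sq_le_sq₀ hR0.le (norm_nonneg _)).mp hRb
  have ha0 := hR0.trans_le hRa
  have hb0 := hR0.trans_le hRb
  have hrn : 1 / R ^ n ≤ 2 ^ n / ‖y‖ ^ n := by
    rw [div_le_div_iff₀ (by positivity) (by positivity), one_mul, ← mul_pow]
    exact pow_le_pow_left₀ hy0.le hrR _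
  have h4 := abs_reflected_sum_le (n := n) hR0 hy0.le hd (norm_nonneg e) hC₁.le hrR hdR hRa hRb hμ
    hη hθ hζ hab
  have h5 := abs_reflected_sub_le (n := n) (by omega) hR0 hy0.le (norm_nonneg e) hC₁.le hrR hdR
    hRa hRb hζ hab
  constructor
  · have hsum : hessKernel e N (-(d • ν + y)) + hessKernel e N (d • ν - y) =
        1 / sphereArea n * (⟪N, e⟫ * (1 / ‖d • ν + y‖ ^ n + 1 / ‖d • ν - y‖ ^ n) -
          n * ⟪y, e⟫ * (d * ⟪ν, N⟫ * (1 / ‖d • ν + y‖ ^ (n + 2) - 1 / ‖d • ν - y‖ ^ (n + 2)) +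
            ⟪y, N⟫ * (1 / ‖d • ν + y‖ ^ (n + 2) + 1 / ‖d • ν - y‖ ^ (n + 2)))) := by
      simp only [hessKernel, inner_neg_left, inner_add_left, inner_sub_left, real_inner_smul_left,
        he, norm_neg]
      generalize ‖d • ν + y‖ = a at *
      generalize ‖d • ν - y‖ = b at *
      have e1 : ∀ u w : ℝ, u / (sphereArea n * w) = 1 / sphereArea n * (u * (1 / w)) := by
        intro u w
        rw [← div_div]
        ring
      simp only [e1]
      ring
    rw [hsum, abs_mul, abs_of_pos (show 0 < 1 / sphereArea n by positivity)]
    calc _ ≤ 1 / sphereArea n * ((2 * C₂ + n * (4 * (n + 2) * C₁ * 16 + 8 * C₁)) * ‖e‖ *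
          (‖y‖ * (2 ^ n / ‖y‖ ^ n))) := by
          refine mul_le_mul_of_nonneg_left (h4.trans ?_) (by positivity)
          exact mul_le_mul_of_nonneg_left (mul_le_mul_of_nonneg_left hrn hy0.le) (by positivity)
      _ = 1 / sphereArea n * (2 * C₂ + n * (4 * (n + 2) * C₁ * 16 + 8 * C₁)) * 2 ^ n * ‖e‖ /
          ‖y‖ ^ (n - 1) := by
          obtain ⟨m, rfl⟩ : ∃ m, n = m + 1 := ⟨n - 1, by omega⟩
          rw [Nat.add_sub_cancel, pow_succ ‖y‖]
          field_simp
      _ ≤ _ := by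
          refine div_le_div_of_nonneg_right (mul_le_mul_of_nonneg_right ?_ (norm_nonneg _))
            (by positivity)
          exact le_add_of_nonneg_right (by positivity)
  · have hdiff : gradKernel e (-(d • ν + y)) - gradKernel e (d • ν - y) =
        -(1 / sphereArea n * (⟪y, e⟫ * (1 / ‖d • ν + y‖ ^ n - 1 / ‖d • ν - y‖ ^ n))) := by
      simp only [gradKernel, inner_neg_left, inner_add_left, inner_sub_left, real_inner_smul_left,
        he, norm_neg]
      have e1 : ∀ u w : ℝ, u / (sphereArea n * w) = 1 / sphereArea n * (u * (1 / w)) := by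
        intro u w
        rw [← div_div]
        ring
      simp only [e1]
      ring
    rw [hdiff, abs_neg, abs_mul, abs_of_pos (show 0 < 1 / sphereArea n by positivity)]
    calc _ ≤ 1 / sphereArea n * (‖e‖ * (16 * n * C₁) * (‖y‖ ^ 2 * (2 ^ n / ‖y‖ ^ n))) := by
          refine mul_le_mul_of_nonneg_left (h5.trans ?_) (by positivity)
          exact mul_le_mul_of_nonneg_left (mul_le_mul_of_nonneg_left hrn (by positivity))
            (by positivity)
      _ = 1 / sphereArea n * (16 * n * C₁) * 2 ^ n * ‖e‖ / ‖y‖ ^ (n - 2) := by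
          obtain ⟨m, rfl⟩ : ∃ m, n = m + 2 := ⟨n - 2, by omega⟩
          rw [Nat.add_sub_cancel, pow_add ‖y‖]
          field_simp
      _ ≤ _ := by
          refine div_le_div_of_nonneg_right (mul_le_mul_of_nonneg_right ?_ (norm_nonneg _))
            (by positivity)
          exact le_add_of_nonneg_left (by positivity)

theorem abs_laplaceKernel (hn : 3 ≤ n) (z : Space n) :
    |laplaceKernel z| = 1 / (((n : ℝ) - 2) * sphereArea n) * (1 / ‖z‖ ^ (n - 2)) := by
  have hn3 : (3 : ℝ) ≤ n := by exact_mod_cast hn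
  have := sphereArea_pos hn
  have : 0 < (n : ℝ) - 2 := by linarith
  rw [laplaceKernel, ← sphereArea, abs_neg, abs_of_nonneg (by positivity), one_div_mul_one_div]

theorem aestronglyMeasurable_laplaceKernel {μ : Measure (Space n)} (P : Space n) :
    AEStronglyMeasurable (fun Q => laplaceKernel (P - Q)) μ := by
  have : Measurable (laplaceKernel (n := n)) := by unfold laplaceKernel; fun_prop
  exact (this.comp (measurable_const.sub measurable_id)).aestronglyMeasurable

theorem IsBoundedC2Domain.exists_lintegral_laplaceKernel_le (hΩ : IsBoundedC2Domain Ω)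
    (hn : 3 ≤ n) : ∃ C : ℝ, 0 < C ∧ ∀ P : Space n,
      ∫⁻ Q, ENNReal.ofReal |laplaceKernel (P - Q)| ∂(surfaceMeasure Ω) ≤ ENNReal.ofReal C := by
  obtain ⟨C, hC, h⟩ := hΩ.exists_lintegral_le hn
  have hn3 : (3 : ℝ) ≤ n := by exact_mod_cast hn
  have hω := sphereArea_pos hn
  have hn2 : 0 < (n : ℝ) - 2 := by linarith
  refine ⟨1 / (((n : ℝ) - 2) * sphereArea n) * C, by positivity, fun P => ?_⟩
  simp_rw [abs_laplaceKernel hn, norm_sub_rev P, ENNReal.ofReal_mul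
    (show 0 ≤ 1 / (((n : ℝ) - 2) * sphereArea n) by positivity)]
  rw [lintegral_const_mul' _ _ ENNReal.ofReal_ne_top]
  exact mul_le_mul_right (h P) _

theorem IsBoundedC2Domain.integrable_laplaceKernel (hΩ : IsBoundedC2Domain Ω) (hn : 3 ≤ n)
    (P : Space n) : Integrable (fun Q => laplaceKernel (P - Q)) (surfaceMeasure Ω) := by
  obtain ⟨C, hC, h⟩ := hΩ.exists_lintegral_laplaceKernel_le hn
  refine ⟨aestronglyMeasurable_laplaceKernel P, ?_⟩
  rw [hasFiniteIntegral_iff_norm]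
  exact (h P).trans_lt ENNReal.ofReal_lt_top

theorem IsBoundedC2Domain.integrable_laplaceKernel_mul (hΩ : IsBoundedC2Domain Ω) (hn : 3 ≤ n)
    {h : Space n → ℝ} {B : ℝ} (hh : AEStronglyMeasurable h (surfaceMeasure Ω))
    (hB : ∀ᵐ Q ∂(surfaceMeasure Ω), |h Q| ≤ B) (P : Space n) :
    Integrable (fun Q => laplaceKernel (P - Q) * h Q) (surfaceMeasure Ω) :=
  (hΩ.integrable_laplaceKernel hn P).mul_bdd (c := B) hh hB

theorem abs_integral_mul_le {α : Type*} [MeasurableSpace α] {μ : Measure α} {K h : α → ℝ} {B C : ℝ}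
    (hB0 : 0 ≤ B) (hC : 0 ≤ C) (hB : ∀ᵐ Q ∂μ, |h Q| ≤ B)
    (hK : ∫⁻ Q, ENNReal.ofReal |K Q| ∂μ ≤ ENNReal.ofReal C) : |∫ Q, K Q * h Q ∂μ| ≤ C * B := by
  refine (norm_integral_le_lintegral_norm (fun Q => K Q * h Q)).trans
      (ENNReal.toReal_le_of_le_ofReal (by positivity) ?_)
  calc ∫⁻ Q, ENNReal.ofReal ‖K Q * h Q‖ ∂μ
      ≤ ∫⁻ Q, ENNReal.ofReal |K Q| * ENNReal.ofReal B ∂μ := by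
        refine lintegral_mono_ae ?_
        filter_upwards [hB] with Q hQ
        rw [norm_mul, ENNReal.ofReal_mul (norm_nonneg _)]
        exact mul_le_mul_right (ENNReal.ofReal_le_ofReal hQ) _
    _ ≤ ENNReal.ofReal C * ENNReal.ofReal B := by
        rw [lintegral_mul_const' _ _ ENNReal.ofReal_ne_top]
        exact mul_le_mul_left hK _
    _ = ENNReal.ofReal (C * B) := (ENNReal.ofReal_mul hC).symm

theorem IsBoundedC2Domain.exists_abs_singleLayer_le (hΩ : IsBoundedC2Domain Ω) (hn : 3 ≤ n) :
    ∃ C : ℝ, 0 < C ∧ ∀ (h : Space n → ℝ) (B : ℝ), 0 ≤ B →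
      (∀ᵐ Q ∂(surfaceMeasure Ω), |h Q| ≤ B) → ∀ P, |singleLayer Ω h P| ≤ C * B := by
  obtain ⟨C, hC, hK⟩ := hΩ.exists_lintegral_laplaceKernel_le hn
  exact ⟨C, hC, fun h B hB0 hB P => abs_integral_mul_le hB0 hC.le hB (hK P)⟩

theorem abs_laplaceKernel_sub_le (hn : 3 ≤ n) {y z : Space n} (hyz : 2 * ‖y - z‖ ≤ ‖y‖)
    (hy : 0 < ‖y‖) : |laplaceKernel y - laplaceKernel z| ≤
      2 ^ (n + 2) / sphereArea n * ‖y - z‖ * (1 / ‖y‖ ^ (n - 1)) := by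
  have hn3 : (3 : ℝ) ≤ n := by exact_mod_cast hn
  have hω := sphereArea_pos hn
  have hn2 : 0 < (n : ℝ) - 2 := by linarith
  have h4 : laplaceKernel y - laplaceKernel z =
      -(1 / (((n : ℝ) - 2) * sphereArea n)) * (1 / ‖y‖ ^ (n - 2) - 1 / ‖z‖ ^ (n - 2)) := by
    have e1 : ∀ u : Space n, laplaceKernel u =
        -(1 / (((n : ℝ) - 2) * sphereArea n)) * (1 / ‖u‖ ^ (n - 2)) := fun u => by
      rw [laplaceKernel, ← sphereArea, ← one_div_mul_one_div, neg_mul]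
    rw [e1, e1, mul_sub]
  set a := ‖y‖
  set b := ‖z‖
  set ρ := ‖y - z‖
  have h1 : |a - b| ≤ ρ := abs_norm_sub_norm_le y z
  have hba : a / 2 ≤ b := by linarith [le_abs_self (a - b)]
  have hb2 : b ≤ 2 * a := by linarith [neg_abs_le (a - b)]
  have h2 : |a ^ 2 - b ^ 2| ≤ ρ * (3 * a) := by
    rw [sq_sub_sq, mul_comm, abs_mul, abs_of_nonneg (show 0 ≤ a + b by positivity)]
    gcongr
    linarith
  have h3 := abs_one_div_pow_sub_le (half_pos hy) (half_le_self hy.le) hba (n - 2) (by omega)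
  rw [h4, abs_mul, abs_neg, abs_of_pos (show 0 < 1 / (((n : ℝ) - 2) * sphereArea n) by positivity)]
  calc _ ≤ 1 / (((n : ℝ) - 2) * sphereArea n) *
        ((n - 2 : ℕ) * (ρ * (3 * a)) / (a / 2) ^ (n - 2 + 2)) := by
        gcongr
        refine h3.trans ?_
        gcongr
    _ = 3 * 2 ^ n / sphereArea n * ρ * (1 / a ^ (n - 1)) := by
        obtain ⟨m, rfl⟩ : ∃ m, n = m + 3 := ⟨n - 3, by omega⟩
        rw [show m + 3 - 2 = m + 1 by omega, show m + 3 - 1 = m + 2 by omega, div_pow]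
        push_cast
        have : (m : ℝ) + 3 - 2 ≠ 0 := by push_cast at hn2; exact hn2.ne'
        rw [show (m : ℝ) + 3 - 2 = m + 1 by ring] at this ⊢
        rw [show m + 1 + 2 = m + 3 by omega]
        have e1 : a ^ (m + 3) = a ^ (m + 2) * a := pow_succ _ _
        rw [e1]
        field_simp
    _ ≤ 2 ^ (n + 2) / sphereArea n * ρ * (1 / a ^ (n - 1)) := by
        gcongr
        rw [pow_add]
        linarith [pow_pos (two_pos (α := ℝ)) n]

/-- Single layer potentials of bounded functions are log-Lipschitz. -/
theorem IsBoundedC2Domain.exists_singleLayer_sub_le (hΩ : IsBoundedC2Domain Ω) (hn : 3 ≤ n) :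
    ∃ C : ℝ, 0 < C ∧ ∀ (h : Space n → ℝ) (B : ℝ), 0 ≤ B →
      AEStronglyMeasurable h (surfaceMeasure Ω) → (∀ᵐ Q ∂(surfaceMeasure Ω), |h Q| ≤ B) →
      ∀ P P' : Space n, P ≠ P' → |singleLayer Ω h P - singleLayer Ω h P'| ≤
        C * B * (‖P - P'‖ * (1 + |Real.log ‖P - P'‖|)) := by
  obtain ⟨C₁, hC₁, h1⟩ := hΩ.exists_lintegral_ball_le hn
  obtain ⟨C₂, hC₂, h2⟩ := hΩ.exists_lintegral_compl_ball_le hn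
  have hn3 : (3 : ℝ) ≤ n := by exact_mod_cast hn
  have hω := sphereArea_pos hn
  have hn2 : 0 < (n : ℝ) - 2 := by linarith
  set κ := 1 / (((n : ℝ) - 2) * sphereArea n) with hκ
  have hκ0 : 0 < κ := by positivity
  set κ' := 2 ^ (n + 2) / sphereArea n with hκ'
  have hκ0' : 0 < κ' := by positivity
  refine ⟨κ * (C₁ * 2) + κ * (C₁ * 3) + κ' * (C₂ * 2), by positivity,
    fun h B hB0 hh hB P P' hPP => ?_⟩
  set ρ := ‖P - P'‖ with hρ
  have hρ0 : 0 < ρ := norm_pos_iff.mpr (sub_ne_zero.mpr hPP)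
  have hL : 0 ≤ |Real.log ρ| := abs_nonneg _
  rw [singleLayer, singleLayer, ← integral_sub (hΩ.integrable_laplaceKernel_mul hn hh hB P)
    (hΩ.integrable_laplaceKernel_mul hn hh hB P')]
  simp_rw [← sub_mul]
  refine (abs_integral_mul_le hB0 (C := (κ * (C₁ * 2) + κ * (C₁ * 3) + κ' * (C₂ * 2)) *
    (ρ * (1 + |Real.log ρ|))) (by positivity) hB ?_).trans (le_of_eq (by ring))
  rw [← lintegral_add_compl _ (Metric.isOpen_ball (x := P) (ε := 2 * ρ)).measurableSet]
  have hnear : ∫⁻ Q in Metric.ball P (2 * ρ), ENNReal.ofReal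
      |laplaceKernel (P - Q) - laplaceKernel (P' - Q)| ∂(surfaceMeasure Ω) ≤
      ENNReal.ofReal (κ * (C₁ * (2 * ρ)) + κ * (C₁ * (3 * ρ))) := by
    calc _ ≤ ∫⁻ Q in Metric.ball P (2 * ρ),
        (ENNReal.ofReal κ * ENNReal.ofReal (1 / ‖Q - P‖ ^ (n - 2)) +
            ENNReal.ofReal κ * ENNReal.ofReal (1 / ‖Q - P'‖ ^ (n - 2))) ∂(surfaceMeasure Ω) := by
          refine lintegral_mono fun Q => ?_
          rw [← ENNReal.ofReal_mul hκ0.le, ← ENNReal.ofReal_mul hκ0.le,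
            ← ENNReal.ofReal_add (by positivity) (by positivity)]
          refine ENNReal.ofReal_le_ofReal ((abs_sub _ _).trans (le_of_eq ?_))
          rw [abs_laplaceKernel hn, abs_laplaceKernel hn, norm_sub_rev P, norm_sub_rev P']
      _ = ENNReal.ofReal κ * ∫⁻ Q in Metric.ball P (2 * ρ), ENNReal.ofReal (1 / ‖Q - P‖ ^ (n - 2))
            ∂(surfaceMeasure Ω) + ENNReal.ofReal κ * ∫⁻ Q in Metric.ball P (2 * ρ),
            ENNReal.ofReal (1 / ‖Q - P'‖ ^ (n - 2)) ∂(surfaceMeasure Ω) := by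
          rw [lintegral_add_left (by fun_prop), lintegral_const_mul' _ _ ENNReal.ofReal_ne_top,
            lintegral_const_mul' _ _ ENNReal.ofReal_ne_top]
      _ ≤ ENNReal.ofReal κ * ENNReal.ofReal (C₁ * (2 * ρ)) +
            ENNReal.ofReal κ * ENNReal.ofReal (C₁ * (3 * ρ)) := by
          refine add_le_add (mul_le_mul_right (h1 P _ (by positivity)) _) (mul_le_mul_right ?_ _)
          refine (lintegral_mono_set ?_).trans (h1 P' _ (by positivity))
          refine Metric.ball_subset_ball' ?_
          rw [dist_eq_norm, ← hρ]
          linarith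
      _ = _ := by
          rw [← ENNReal.ofReal_mul hκ0.le, ← ENNReal.ofReal_mul hκ0.le,
            ← ENNReal.ofReal_add (by positivity) (by positivity)]
  have hfar : ∫⁻ Q in (Metric.ball P (2 * ρ))ᶜ, ENNReal.ofReal
      |laplaceKernel (P - Q) - laplaceKernel (P' - Q)| ∂(surfaceMeasure Ω) ≤
      ENNReal.ofReal (κ' * ρ * (C₂ * (1 + |Real.log (2 * ρ)|))) := by
    calc _ ≤ ∫⁻ Q in (Metric.ball P (2 * ρ))ᶜ, ENNReal.ofReal (κ' * ρ) *
            ENNReal.ofReal (1 / ‖Q - P‖ ^ (n - 1)) ∂(surfaceMeasure Ω) := by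
          refine setLIntegral_mono' Metric.isOpen_ball.measurableSet.compl fun Q hQ => ?_
          rw [mem_compl_iff, Metric.mem_ball, dist_eq_norm, not_lt, norm_sub_rev] at hQ
          have e1 : P - Q - (P' - Q) = P - P' := by abel
          have h3 := abs_laplaceKernel_sub_le hn (y := P - Q) (z := P' - Q) (by rw [e1]; exact hQ)
            (by linarith)
          rw [e1] at h3
          rw [← ENNReal.ofReal_mul (by positivity), norm_sub_rev Q]
          exact ENNReal.ofReal_le_ofReal h3
      _ ≤ ENNReal.ofReal (κ' * ρ) * ENNReal.ofReal (C₂ * (1 + |Real.log (2 * ρ)|)) := by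
          rw [lintegral_const_mul' _ _ ENNReal.ofReal_ne_top]
          exact mul_le_mul_right (h2 P _ (by positivity)) _
      _ = _ := (ENNReal.ofReal_mul (by positivity)).symm
  refine (add_le_add hnear hfar).trans ?_
  rw [← ENNReal.ofReal_add (by positivity) (by positivity)]
  refine ENNReal.ofReal_le_ofReal ?_
  have hlog : 1 + |Real.log (2 * ρ)| ≤ 2 * (1 + |Real.log ρ|) := by
    rw [Real.log_mul two_ne_zero hρ0.ne']
    have := abs_add_le (Real.log 2) (Real.log ρ)
    have h2 : |Real.log 2| ≤ 1 := by
      rw [abs_of_pos (Real.log_pos one_lt_two)]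
      linarith [Real.log_two_lt_d9]
    linarith
  calc _ ≤ κ * (C₁ * (2 * ρ)) + κ * (C₁ * (3 * ρ)) + κ' * ρ * (C₂ * (2 * (1 + |Real.log ρ|))) := by
        gcongr
    _ ≤ (κ * (C₁ * 2) + κ * (C₁ * 3)) * (ρ * (1 + |Real.log ρ|)) +
        κ' * ρ * (C₂ * (2 * (1 + |Real.log ρ|))) := by
        have : κ * (C₁ * (2 * ρ)) + κ * (C₁ * (3 * ρ)) = (κ * (C₁ * 2) + κ * (C₁ * 3)) *
            (ρ * 1) := by
          ring
        rw [this]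
        gcongr
        linarith
    _ = _ := by ring

end KernelEstimates

end Stokes

namespace Stokes

/-! ### The stationary cancellation between the two potentials -/

section Stationary

variable {n : ℕ} {Ω : Set (Space n)}

theorem abs_gradKernel_le (hn : 3 ≤ n) (e z : Space n) :
    |gradKernel e z| ≤ ‖e‖ / (sphereArea n * ‖z‖ ^ (n - 1)) := by
  have hω := sphereArea_pos hn
  rcases eq_or_ne z 0 with rfl | hz
  · rw [gradKernel, inner_zero_left, zero_div, abs_zero]
    positivity
  have hz := norm_pos_iff.mpr hz
  rw [gradKernel, abs_div, abs_of_pos (show 0 < sphereArea n * ‖z‖ ^ n by positivity)]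
  calc _ ≤ ‖z‖ * ‖e‖ / (sphereArea n * ‖z‖ ^ n) := by gcongr; exact abs_real_inner_le_norm _ _
    _ = _ := by
        obtain ⟨m, rfl⟩ : ∃ m, n = m + 1 := ⟨n - 1, by omega⟩
        rw [Nat.add_sub_cancel, pow_succ]
        field_simp

theorem abs_hessKernel_le (hn : 3 ≤ n) (e z : Space n) {m : Space n} (hm : ‖m‖ ≤ 1) :
    |hessKernel e m z| ≤ (1 + n) * ‖e‖ / (sphereArea n * ‖z‖ ^ n) := by
  have hω := sphereArea_pos hn
  rcases eq_or_ne z 0 with rfl | hz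
  · rw [hessKernel, norm_zero, zero_pow (by omega), zero_pow (by omega)]
    simp
  have hz := norm_pos_iff.mpr hz
  have h1 : |⟪m, e⟫| ≤ ‖e‖ := (abs_real_inner_le_norm _ _).trans
    (mul_le_of_le_one_left (norm_nonneg _) hm)
  have h2 : |⟪z, m⟫| ≤ ‖z‖ := (abs_real_inner_le_norm _ _).trans
    (mul_le_of_le_one_right (norm_nonneg _) hm)
  have h3 : |⟪z, e⟫| ≤ ‖z‖ * ‖e‖ := abs_real_inner_le_norm _ _
  rw [hessKernel]
  refine (abs_sub _ _).trans ?_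
  rw [abs_div, abs_div, abs_of_pos (show 0 < sphereArea n * ‖z‖ ^ n by positivity),
    abs_of_pos (show 0 < sphereArea n * ‖z‖ ^ (n + 2) by positivity), abs_mul, abs_mul,
        Nat.abs_cast]
  calc _ ≤ ‖e‖ / (sphereArea n * ‖z‖ ^ n) +
        n * ‖z‖ * (‖z‖ * ‖e‖) / (sphereArea n * ‖z‖ ^ (n + 2)) := by gcongr
    _ = _ := by
        rw [pow_add]
        field_simp

theorem IsBoundedC2Domain.ae_ne (hΩ : IsBoundedC2Domain Ω) (hn : 3 ≤ n) (Q : Space n) :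
    ∀ᵐ P ∂(surfaceMeasure Ω), P ≠ Q := by
  rw [ae_iff]
  simpa using hΩ.surfaceMeasure_singleton (by omega) Q

theorem measurable_gradKernel (e : Space n) : Measurable (gradKernel e) := by
  unfold gradKernel
  fun_prop

theorem IsBoundedC2Domain.aestronglyMeasurable_hessKernel (hΩ : IsBoundedC2Domain Ω)
    (e x : Space n) : AEStronglyMeasurable
      (fun P => hessKernel e (outwardNormal Ω P) (x - P)) (surfaceMeasure Ω) := by
  have hN := hΩ.aestronglyMeasurable_normal.aemeasurable
  unfold hessKernel
  refine AEMeasurable.aestronglyMeasurable ?_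
  fun_prop

theorem exists_pos_le_norm_sub {x : Space n} (hx : x ∉ frontier Ω) :
    ∃ ρ : ℝ, 0 < ρ ∧ ∀ P ∈ frontier Ω, ρ ≤ ‖x - P‖ := by
  obtain ⟨ρ, hρ, hball⟩ := Metric.isOpen_iff.mp isClosed_frontier.isOpen_compl x hx
  refine ⟨ρ, hρ, fun P hP => ?_⟩
  by_contra hc
  exact hball (by rw [Metric.mem_ball, dist_comm, dist_eq_norm]; exact not_le.mp hc) hP

theorem exists_hessKernel_bound (hn : 3 ≤ n)
    {x : Space n} (hx : x ∉ frontier Ω) (e : Space n) : ∃ C : ℝ, 0 ≤ C ∧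
      ∀ᵐ P ∂(surfaceMeasure Ω), ‖hessKernel e (outwardNormal Ω P) (x - P)‖ ≤ C := by
  obtain ⟨ρ, hρ, h⟩ := exists_pos_le_norm_sub hx
  have hω := sphereArea_pos hn
  refine ⟨(1 + n) * ‖e‖ / (sphereArea n * ρ ^ n), by positivity, ?_⟩
  filter_upwards [ae_mem_frontier Ω] with P hP
  refine (abs_hessKernel_le hn e _ (norm_outwardNormal_le Ω P)).trans ?_
  have := h P hP
  gcongr

theorem IsBoundedC2Domain.integrable_laplaceKernel_prod (hΩ : IsBoundedC2Domain Ω) (hn : 3 ≤ n) :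
    Integrable (fun z : Space n × Space n => laplaceKernel (z.1 - z.2))
      ((surfaceMeasure Ω).prod (surfaceMeasure Ω)) := by
  have := hΩ.isFiniteMeasure
  have hm : Measurable (laplaceKernel (n := n)) := by unfold laplaceKernel; fun_prop
  have hm2 : Measurable (fun z : Space n × Space n => laplaceKernel (z.1 - z.2)) :=
    hm.comp (measurable_fst.sub measurable_snd)
  refine ⟨hm2.aestronglyMeasurable, ?_⟩
  obtain ⟨C, hC, h⟩ := hΩ.exists_lintegral_laplaceKernel_le hn
  rw [hasFiniteIntegral_iff_norm, lintegral_prod _ (by fun_prop)]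
  calc _ ≤ ∫⁻ _, ENNReal.ofReal C ∂(surfaceMeasure Ω) := lintegral_mono fun P => h P
    _ < ∞ := by
        rw [lintegral_const]
        exact ENNReal.mul_lt_top ENNReal.ofReal_lt_top (measure_lt_top _ _)

theorem IsBoundedC2Domain.integrable_mul_laplaceKernel_mul (hΩ : IsBoundedC2Domain Ω) (hn : 3 ≤ n)
    {A h : Space n → ℝ} {B C : ℝ} (hA : AEStronglyMeasurable A (surfaceMeasure Ω))
    (hC : ∀ᵐ P ∂(surfaceMeasure Ω), ‖A P‖ ≤ C) (hh : AEStronglyMeasurable h (surfaceMeasure Ω))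
    (hB : ∀ᵐ Q ∂(surfaceMeasure Ω), |h Q| ≤ B) :
    Integrable (fun z : Space n × Space n => A z.1 * (laplaceKernel (z.1 - z.2) * h z.2))
      ((surfaceMeasure Ω).prod (surfaceMeasure Ω)) := by
  have := hΩ.isFiniteMeasure
  have h1 : Integrable (fun z : Space n × Space n => laplaceKernel (z.1 - z.2) * h z.2)
      ((surfaceMeasure Ω).prod (surfaceMeasure Ω)) :=
    (hΩ.integrable_laplaceKernel_prod hn).mul_bdd (c := B) hh.comp_snd
      (Measure.quasiMeasurePreserving_snd.ae hB)
  exact h1.bdd_mul (c := C) hA.comp_fst (Measure.quasiMeasurePreserving_fst.ae hC)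

theorem IsBoundedC2Domain.aestronglyMeasurable_singleLayer (hΩ : IsBoundedC2Domain Ω)
    (hn : 3 ≤ n) {h : Space n → ℝ} {B : ℝ} (hh : AEStronglyMeasurable h (surfaceMeasure Ω))
    (hB : ∀ᵐ Q ∂(surfaceMeasure Ω), |h Q| ≤ B) :
    AEStronglyMeasurable (singleLayer Ω h) (surfaceMeasure Ω) := by
  have := hΩ.isFiniteMeasure
  have h1 := (hΩ.integrable_mul_laplaceKernel_mul hn (A := fun _ => 1) (C := 1)
    aestronglyMeasurable_const (by simp) hh hB).integral_prod_left.aestronglyMeasurable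
  simp only [one_mul] at h1
  exact h1

/-- Fubini's theorem for a bounded kernel integrated against a single layer potential. -/
theorem IsBoundedC2Domain.integral_mul_singleLayer (hΩ : IsBoundedC2Domain Ω) (hn : 3 ≤ n)
    {A h : Space n → ℝ} {B C : ℝ} (hA : AEStronglyMeasurable A (surfaceMeasure Ω))
    (hC : ∀ᵐ P ∂(surfaceMeasure Ω), ‖A P‖ ≤ C) (hh : AEStronglyMeasurable h (surfaceMeasure Ω))
    (hB : ∀ᵐ Q ∂(surfaceMeasure Ω), |h Q| ≤ B) :
    ∫ P, A P * singleLayer Ω h P ∂(surfaceMeasure Ω) =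
      ∫ Q, (∫ P, A P * laplaceKernel (P - Q) ∂(surfaceMeasure Ω)) * h Q ∂(surfaceMeasure Ω) := by
  have := hΩ.isFiniteMeasure
  have h1 := integral_integral_swap (f := fun P Q => A P * (laplaceKernel (P - Q) * h Q))
      (hΩ.integrable_mul_laplaceKernel_mul hn hA hC hh hB)
  simp only [singleLayer, ← integral_const_mul, ← integral_mul_const] at h1 ⊢
  rw [h1]
  simp only [mul_assoc]

/-- The double layer kernel with a pole moved off the boundary by `δ` in the normal direction. -/
theorem IsBoundedC2Domain.exists_gradKernel_normal_le (hΩ : IsBoundedC2Domain Ω) (hn : 3 ≤ n) :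
    ∃ K δ₀ : ℝ, 0 < K ∧ 0 < δ₀ ∧ ∀ P ∈ frontier Ω, ∀ Q ∈ frontier Ω, P ≠ Q → ∀ δ, 0 < δ → δ ≤ δ₀ →
      |gradKernel (outwardNormal Ω P) (P - (Q + δ • outwardNormal Ω Q))| ≤
        K * (1 / ‖P - Q‖ ^ (n - 2) + δ * (1 / (δ + ‖P - Q‖) ^ n)) := by
  obtain ⟨C₁, hC₁, h1⟩ := hΩ.exists_inner_normal_le
  obtain ⟨δ₀, hδ₀, h3⟩ := hΩ.exists_norm_sub_normal
  have hω := sphereArea_pos hn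
  refine ⟨(C₁ + 1) * 2 ^ n / sphereArea n, δ₀, by positivity, hδ₀,
    fun P hP Q hQ hPQ δ hδ hδ' => ?_⟩
  have hr : 0 < ‖P - Q‖ := norm_pos_iff.mpr (sub_ne_zero.mpr hPQ)
  set r := ‖P - Q‖
  have hden : (δ + r) / 2 ≤ ‖P - (Q + δ • outwardNormal Ω Q)‖ := by
    have := h3 P hP Q hQ δ (by rwa [abs_of_pos hδ])
    refine (sq_le_sq₀ (by positivity) (norm_nonneg _)).mp (le_trans ?_ this)
    nlinarith [sq_nonneg (δ - r)]
  have hnum : |⟪P - (Q + δ • outwardNormal Ω Q), outwardNormal Ω P⟫| ≤ C₁ * r ^ 2 + δ := by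
    have e1 : P - (Q + δ • outwardNormal Ω Q) = -(Q - P) - δ • outwardNormal Ω Q := by abel
    have h2 := h1 P hP Q hQ
    rw [dist_eq_norm] at h2
    rw [e1, inner_sub_left, inner_neg_left, real_inner_smul_left]
    refine (abs_sub _ _).trans (add_le_add (by rwa [abs_neg]) ?_)
    rw [abs_mul, abs_of_pos hδ]
    exact mul_le_of_le_one_right hδ.le ((abs_real_inner_le_norm _ _).trans
      (mul_le_one₀ (norm_outwardNormal_le Ω Q) (norm_nonneg _) (norm_outwardNormal_le Ω P)))
  have hd0 : 0 < (δ + r) / 2 := by positivity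
  rw [gradKernel, abs_div, abs_of_pos (mul_pos hω (pow_pos (hd0.trans_le hden) n))]
  calc _ ≤ (C₁ * r ^ 2 + δ) / (sphereArea n * ((δ + r) / 2) ^ n) := by gcongr
    _ = C₁ * 2 ^ n / sphereArea n * (r ^ 2 * (1 / (δ + r) ^ n)) +
        2 ^ n / sphereArea n * (δ * (1 / (δ + r) ^ n)) := by
        rw [div_pow]
        field_simp
    _ ≤ (C₁ + 1) * 2 ^ n / sphereArea n * (1 / r ^ (n - 2)) +
        (C₁ + 1) * 2 ^ n / sphereArea n * (δ * (1 / (δ + r) ^ n)) := by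
        have e2 : r ^ 2 * (1 / (δ + r) ^ n) ≤ 1 / r ^ (n - 2) := by
          calc r ^ 2 * (1 / (δ + r) ^ n) ≤ r ^ 2 * (1 / r ^ n) := by
                gcongr
                linarith
            _ = 1 / r ^ (n - 2) := by
                obtain ⟨m, rfl⟩ : ∃ m, n = m + 2 := ⟨n - 2, by omega⟩
                rw [Nat.add_sub_cancel, pow_add]
                field_simp
        have e3 : C₁ * 2 ^ n / sphereArea n ≤ (C₁ + 1) * 2 ^ n / sphereArea n := by
          gcongr
          linarith
        have e4 : 2 ^ n / sphereArea n ≤ (C₁ + 1) * 2 ^ n / sphereArea n := by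
          gcongr
          nlinarith [pow_pos (two_pos (α := ℝ)) n]
        gcongr
    _ = _ := by ring

/-- For a pole outside `closure Ω`, the reflected representation formulas combine to an identity
in which only the difference of first derivatives appears. -/
theorem IsBoundedC2Domain.gradKernel_add_integral (hΩ : IsBoundedC2Domain Ω) (hn : 3 ≤ n)
    {x x' q : Space n} (hx : x ∈ Ω) (hx' : x' ∉ closure Ω) (hq : q ∉ closure Ω) (e : Space n) :
    gradKernel e (x - q) + ∫ P, (hessKernel e (outwardNormal Ω P) (x - P) -
        hessKernel e (outwardNormal Ω P) (x' - P)) * laplaceKernel (P - q) ∂(surfaceMeasure Ω) =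
      -∫ P, (gradKernel e (x - P) - gradKernel e (x' - P)) *
        gradKernel (outwardNormal Ω P) (P - q) ∂(surfaceMeasure Ω) := by
  have := hΩ.isFiniteMeasure
  have hxf : x ∉ frontier Ω := fun h => by
    rw [hΩ.isOpen.frontier_eq] at h
    exact h.2 hx
  have hxf' : x' ∉ frontier Ω := fun h => hx' (frontier_subset_closure h)
  have hx'Ω : x' ∉ Ω := fun h => hx' (subset_closure h)
  have hqf : q ∉ frontier Ω := fun h => hq (frontier_subset_closure h)
  obtain ⟨v, hv, hv1, hv2⟩ := exists_contDiff_eq_laplaceProfile hn hq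
  have h1 := hΩ.representation_fderiv hn hxf hv (fun y hy => hv2 y (subset_closure hy)) e
  have h2 := hΩ.representation_fderiv hn hxf' hv (fun y hy => hv2 y (subset_closure hy)) e
  rw [indicator_of_mem hx] at h1
  rw [indicator_of_notMem hx'Ω] at h2
  have hfd : ∀ P ∈ closure Ω, ∀ w, fderiv ℝ v P w = gradKernel w (P - q) := by
    intro P hP w
    have hs : 0 < ‖P - q‖ ^ 2 + 0 := by
      have : P ≠ q := by rintro rfl; exact hq hP
      have := norm_pos_iff.mpr (sub_ne_zero.mpr this)
      positivity
    rw [(hv1 P hP).fderiv_eq, (hasFDerivAt_laplaceProfile hn hs).fderiv, gradKernel_eq,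
      smul_apply, smul_eq_mul, innerSL_apply_apply]
  have hval : ∀ P ∈ closure Ω, v P = laplaceKernel (P - q) := fun P hP => by
    rw [(hv1 P hP).eq_of_nhds, laplaceKernel_eq hn]
  have hvb : ∃ C : ℝ, ∀ᵐ P ∂(surfaceMeasure Ω), ‖v P‖ ≤ C := by
    obtain ⟨C, hC⟩ := hΩ.isCompact_frontier.exists_bound_of_continuousOn hv.continuous.continuousOn
    refine ⟨C, ?_⟩
    filter_upwards [ae_mem_frontier Ω] with P hP using hC P hP
  obtain ⟨C, hC⟩ := hvb
  have hdv : Continuous (fderiv ℝ v) := hv.continuous_fderiv (by norm_num)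
  have hdvb : ∃ C : ℝ, ∀ᵐ P ∂(surfaceMeasure Ω), ‖fderiv ℝ v P (outwardNormal Ω P)‖ ≤ C := by
    obtain ⟨C, hC⟩ := hΩ.isCompact_frontier.exists_bound_of_continuousOn hdv.continuousOn
    refine ⟨C, ?_⟩
    filter_upwards [ae_mem_frontier Ω] with P hP
    exact (ContinuousLinearMap.le_opNorm _ _).trans ((mul_le_of_le_one_right (norm_nonneg _)
      (norm_outwardNormal_le Ω P)).trans (hC P hP))
  obtain ⟨C', hC'⟩ := hdvb
  have hI1 : ∀ y ∉ frontier Ω, Integrable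
      (fun P => hessKernel e (outwardNormal Ω P) (y - P) * v P) (surfaceMeasure Ω) := by
    intro y hy
    obtain ⟨K, -, hK⟩ := exists_hessKernel_bound hn hy e
    exact (Integrable.of_bound (hΩ.aestronglyMeasurable_hessKernel e y) K hK).mul_bdd (c := C)
      hv.continuous.aestronglyMeasurable hC
  have hI2 : ∀ y ∉ frontier Ω, Integrable (fun P => gradKernel e (y - P) *
      fderiv ℝ v P (outwardNormal Ω P)) (surfaceMeasure Ω) := by
    intro y hy
    obtain ⟨ρ, hρ, h⟩ := exists_pos_le_norm_sub hy
    have hω := sphereArea_pos hn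
    refine (Integrable.of_bound (C := ‖e‖ / (sphereArea n * ρ ^ (n - 1)))
      (f := fun P => gradKernel e (y - P)) ((measurable_gradKernel e).comp (measurable_const.sub
        measurable_id)).aestronglyMeasurable ?_).mul_bdd (c := C')
      (hΩ.aestronglyMeasurable_apply_normal hdv) hC'
    filter_upwards [ae_mem_frontier Ω] with P hP
    refine (abs_gradKernel_le hn e _).trans ?_
    have := h P hP
    gcongr
  have e1 : ∫ P, (hessKernel e (outwardNormal Ω P) (x - P) -
      hessKernel e (outwardNormal Ω P) (x' - P)) * laplaceKernel (P - q) ∂(surfaceMeasure Ω) =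
      ∫ P, hessKernel e (outwardNormal Ω P) (x - P) * v P ∂(surfaceMeasure Ω) -
      ∫ P, hessKernel e (outwardNormal Ω P) (x' - P) * v P ∂(surfaceMeasure Ω) := by
    rw [← integral_sub (hI1 x hxf) (hI1 x' hxf')]
    refine integral_congr_ae ?_
    filter_upwards [ae_mem_frontier Ω] with P hP
    rw [hval P (frontier_subset_closure hP), sub_mul]
  have e2 : ∫ P, (gradKernel e (x - P) - gradKernel e (x' - P)) *
      gradKernel (outwardNormal Ω P) (P - q) ∂(surfaceMeasure Ω) =
      ∫ P, gradKernel e (x - P) * fderiv ℝ v P (outwardNormal Ω P) ∂(surfaceMeasure Ω) -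
      ∫ P, gradKernel e (x' - P) * fderiv ℝ v P (outwardNormal Ω P) ∂(surfaceMeasure Ω) := by
    rw [← integral_sub (hI2 x hxf) (hI2 x' hxf')]
    refine integral_congr_ae ?_
    filter_upwards [ae_mem_frontier Ω] with P hP
    rw [hfd P (frontier_subset_closure hP), sub_mul]
  rw [e1, e2, h1, h2, hfd x (subset_closure hx)]
  ring

/-- The kernel of the stationary operator has bounded `L¹` norm. -/
theorem IsBoundedC2Domain.exists_lintegral_stationaryKernel_le (hΩ : IsBoundedC2Domain Ω)
    (hn : 3 ≤ n) : ∃ C δ : ℝ, 0 < C ∧ 0 < δ ∧ ∀ p ∈ frontier Ω, ∀ d : ℝ, 0 < d → d ≤ δ →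
      p - d • outwardNormal Ω p ∈ Ω → ∀ e : Space n, ⟪outwardNormal Ω p, e⟫ = 0 →
      ∫⁻ Q, ENNReal.ofReal |gradKernel e (p - d • outwardNormal Ω p - Q) +
        ∫ P, (hessKernel e (outwardNormal Ω P) (p - d • outwardNormal Ω p - P) -
          hessKernel e (outwardNormal Ω P) (p + d • outwardNormal Ω p - P)) *
            laplaceKernel (P - Q) ∂(surfaceMeasure Ω)| ∂(surfaceMeasure Ω) ≤
        ENNReal.ofReal (C * ‖e‖) := by
  obtain ⟨C₁, δ₁, hC₁, hδ₁, hrefl⟩ := hΩ.exists_reflection_le hn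
  obtain ⟨K, δ₂, hK, hδ₂, hdl⟩ := hΩ.exists_gradKernel_normal_le hn
  obtain ⟨δ₃, hδ₃, hout⟩ := hΩ.exists_notMem_closure
  obtain ⟨δ₄, hδ₄, hnorm⟩ := hΩ.exists_norm_sub_normal
  obtain ⟨C₂, hC₂, hR2⟩ := hΩ.exists_lintegral_le hn
  obtain ⟨C₃, hC₃, hR1⟩ := hΩ.exists_lintegral_add_pow_le hn
  have := hΩ.isFiniteMeasure
  refine ⟨C₁ * C₂ * (K * (C₂ + C₃)), min δ₁ δ₃, by positivity, by positivity,
    fun p hp d hd hdδ hx e he => ?_⟩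
  set x := p - d • outwardNormal Ω p with hxdef
  set x' := p + d • outwardNormal Ω p with hxdef'
  have hx' : x' ∉ closure Ω := hout p hp d hd (hdδ.trans (min_le_right _ _))
  have hxf : x ∉ frontier Ω := fun h => by
    rw [hΩ.isOpen.frontier_eq] at h
    exact h.2 hx
  have hxf' : x' ∉ frontier Ω := fun h => hx' (frontier_subset_closure h)
  set H : Space n → ℝ := fun P => hessKernel e (outwardNormal Ω P) (x - P) -
    hessKernel e (outwardNormal Ω P) (x' - P) with hH
  obtain ⟨K₁, hK₁0, hK₁⟩ := exists_hessKernel_bound hn hxf e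
  obtain ⟨K₂, hK₂0, hK₂⟩ := exists_hessKernel_bound hn hxf' e
  have hHm : AEStronglyMeasurable H (surfaceMeasure Ω) :=
    (hΩ.aestronglyMeasurable_hessKernel e x).sub (hΩ.aestronglyMeasurable_hessKernel e x')
  have hHb : ∀ᵐ P ∂(surfaceMeasure Ω), ‖H P‖ ≤ K₁ + K₂ := by
    filter_upwards [hK₁, hK₂] with P h1 h2 using (norm_sub_le _ _).trans (add_le_add h1 h2)
  set δ₀ := min δ₂ (min δ₃ δ₄) with hδ₀
  have hδ₀pos : 0 < δ₀ := by positivity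
  set s : ℕ → ℝ := fun j => δ₀ / (j + 1) with hs
  have hs0 : ∀ j, 0 < s j := fun j => by positivity
  have hsle : ∀ j, s j ≤ δ₀ := fun j => div_le_self hδ₀pos.le (by
    have := Nat.cast_nonneg (α := ℝ) j
    linarith)
  have hslim : Tendsto s atTop (𝓝 0) := by
    have := (tendsto_one_div_add_atTop_nhds_zero_nat (𝕜 := ℝ)).const_mul δ₀
    simpa only [mul_one_div, mul_zero] using this
  set k : ℕ → Space n → ℝ := fun j Q => gradKernel e (x - (Q + s j • outwardNormal Ω Q)) +
    ∫ P, H P * laplaceKernel (P - (Q + s j • outwardNormal Ω Q)) ∂(surfaceMeasure Ω) with hk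
  set w : ℕ → Space n → Space n → ℝ := fun j P Q =>
    K * (1 / ‖P - Q‖ ^ (n - 2) + s j * (1 / (s j + ‖P - Q‖) ^ n)) with hw
  have hw0 : ∀ j P Q, 0 ≤ w j P Q := fun j P Q => by
    have := (hs0 j).le
    simp only [hw]
    positivity
  set b : Space n → ℝ := fun P => C₁ * ‖e‖ * (1 / ‖P - p‖ ^ (n - 2)) with hb
  have hb0 : ∀ P, 0 ≤ b P := fun P => by positivity
  set M : ℕ → Space n → ℝ≥0∞ := fun j Q =>
    ∫⁻ P, ENNReal.ofReal (b P) * ENNReal.ofReal (w j P Q) ∂(surfaceMeasure Ω) with hM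
  have hmeas : ∀ j, Measurable fun z : Space n × Space n =>
      ENNReal.ofReal (b z.2) * ENNReal.ofReal (w j z.2 z.1) := fun j => by
    simp only [hb, hw]
    fun_prop
  -- the regularised kernels are dominated by `M`
  have hkM : ∀ j, ∀ Q ∈ frontier Ω, ENNReal.ofReal |k j Q| ≤ M j Q := by
    intro j Q hQ
    have hq : Q + s j • outwardNormal Ω Q ∉ closure Ω := hout Q hQ _ (hs0 j)
      ((hsle j).trans ((min_le_right _ _).trans (min_le_left _ _)))
    simp only [hk, hH]
    rw [hΩ.gradKernel_add_integral hn hx hx' hq e, abs_neg]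
    have h1 := enorm_integral_le_lintegral_enorm (μ := surfaceMeasure Ω) fun P =>
      (gradKernel e (x - P) - gradKernel e (x' - P)) *
        gradKernel (outwardNormal Ω P) (P - (Q + s j • outwardNormal Ω Q))
    rw [Real.enorm_eq_ofReal_abs] at h1
    refine h1.trans (lintegral_mono_ae ?_)
    filter_upwards [ae_mem_frontier Ω, hΩ.ae_ne hn p, hΩ.ae_ne hn Q] with P hP hPp hPQ
    rw [Real.enorm_eq_ofReal_abs, abs_mul, ENNReal.ofReal_mul (abs_nonneg _)]
    refine mul_le_mul' (ENNReal.ofReal_le_ofReal ?_) (ENNReal.ofReal_le_ofReal ?_)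
    · refine (hrefl p hp d hd.le (hdδ.trans (min_le_left _ _)) e he P hP hPp).2.trans (le_of_eq ?_)
      simp only [hb, mul_one_div]
    · exact hdl P hP Q hQ hPQ (s j) (hs0 j) ((hsle j).trans (min_le_left _ _))
  have hMint : ∀ j, ∫⁻ Q, M j Q ∂(surfaceMeasure Ω) ≤
      ENNReal.ofReal (C₁ * C₂ * (K * (C₂ + C₃)) * ‖e‖) := by
    intro j
    have hinner : ∀ P, ∫⁻ Q, ENNReal.ofReal (w j P Q) ∂(surfaceMeasure Ω) ≤
        ENNReal.ofReal (K * (C₂ + C₃)) := by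
      intro P
      have e1 : ∀ Q, ENNReal.ofReal (w j P Q) = ENNReal.ofReal K *
          (ENNReal.ofReal (1 / ‖Q - P‖ ^ (n - 2)) +
            ENNReal.ofReal (s j) * ENNReal.ofReal (1 / (s j + ‖Q - P‖) ^ n)) := fun Q => by
        have := hs0 j
        rw [← ENNReal.ofReal_mul this.le, ← ENNReal.ofReal_add (by positivity) (by positivity),
          ← ENNReal.ofReal_mul hK.le, norm_sub_rev Q P]
      simp_rw [e1]
      rw [lintegral_const_mul' _ _ ENNReal.ofReal_ne_top, lintegral_add_left (by fun_prop),
        lintegral_const_mul' _ _ ENNReal.ofReal_ne_top, ENNReal.ofReal_mul hK.le,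
        ENNReal.ofReal_add hC₂.le hC₃.le]
      refine mul_le_mul_right (add_le_add (hR2 P) ?_) _
      refine (mul_le_mul_right (hR1 P (s j) (hs0 j)) _).trans (le_of_eq ?_)
      rw [← ENNReal.ofReal_mul (hs0 j).le, mul_div_cancel₀ _ (hs0 j).ne']
    calc ∫⁻ Q, M j Q ∂(surfaceMeasure Ω)
        = ∫⁻ P, ∫⁻ Q, ENNReal.ofReal (b P) * ENNReal.ofReal (w j P Q) ∂(surfaceMeasure Ω)
            ∂(surfaceMeasure Ω) := lintegral_lintegral_swap (hmeas j).aemeasurable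
      _ = ∫⁻ P, ENNReal.ofReal (b P) * ∫⁻ Q, ENNReal.ofReal (w j P Q) ∂(surfaceMeasure Ω)
            ∂(surfaceMeasure Ω) := by
          simp_rw [lintegral_const_mul' _ _ ENNReal.ofReal_ne_top]
      _ ≤ ∫⁻ P, ENNReal.ofReal (C₁ * ‖e‖) * ENNReal.ofReal (1 / ‖P - p‖ ^ (n - 2)) *
            ENNReal.ofReal (K * (C₂ + C₃)) ∂(surfaceMeasure Ω) := by
          refine lintegral_mono fun P => ?_
          refine mul_le_mul' (le_of_eq ?_) (hinner P)
          rw [hb, ENNReal.ofReal_mul (by positivity)]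
      _ ≤ ENNReal.ofReal (C₁ * ‖e‖) * ENNReal.ofReal C₂ * ENNReal.ofReal (K * (C₂ + C₃)) := by
          rw [lintegral_mul_const' _ _ ENNReal.ofReal_ne_top,
            lintegral_const_mul' _ _ ENNReal.ofReal_ne_top]
          exact mul_le_mul_left (mul_le_mul_right (hR2 p) _) _
      _ = _ := by
          rw [← ENNReal.ofReal_mul (by positivity), ← ENNReal.ofReal_mul (by positivity)]
          congr 1
          ring
  -- the regularised kernels converge
  have hlim : ∀ Q ∈ frontier Ω, Tendsto (fun j => k j Q) atTop
      (𝓝 (gradKernel e (x - Q) + ∫ P, H P * laplaceKernel (P - Q) ∂(surfaceMeasure Ω))) := by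
    intro Q hQ
    have hq : Tendsto (fun j => Q + s j • outwardNormal Ω Q) atTop (𝓝 Q) := by
      have := tendsto_const_nhds (x := Q).add (hslim.smul_const (outwardNormal Ω Q))
      simpa only [zero_smul, add_zero] using this
    have hcE : ∀ P, P ≠ Q → Tendsto (fun j => laplaceKernel (P - (Q + s j • outwardNormal Ω Q)))
        atTop (𝓝 (laplaceKernel (P - Q))) := by
      intro P hPQ
      have h0 : ‖P - Q‖ ≠ 0 := norm_ne_zero_iff.mpr (sub_ne_zero.mpr hPQ)
      have hn2 : ((n : ℝ) - 2) * sphereArea n ≠ 0 := by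
        have hn3 : (3 : ℝ) ≤ n := by exact_mod_cast hn
        exact mul_ne_zero (by linarith) (sphereArea_pos hn).ne'
      unfold laplaceKernel
      rw [← sphereArea]
      exact (tendsto_const_nhds.div (tendsto_const_nhds.mul
        ((tendsto_const_nhds.sub hq).norm.pow _)) (mul_ne_zero hn2 (pow_ne_zero _ h0))).neg
    refine Tendsto.add ?_ ?_
    · have h0 : ‖x - Q‖ ≠ 0 := norm_ne_zero_iff.mpr (sub_ne_zero.mpr (by
        rintro h; exact hxf (h ▸ hQ)))
      unfold gradKernel
      exact ((tendsto_const_nhds.sub hq).inner tendsto_const_nhds).div (tendsto_const_nhds.mul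
        ((tendsto_const_nhds.sub hq).norm.pow _)) (mul_ne_zero (sphereArea_pos hn).ne'
          (pow_ne_zero _ h0))
    · refine tendsto_integral_of_dominated_convergence
        (fun P => (K₁ + K₂) * (2 ^ (n - 2) * |laplaceKernel (P - Q)|)) (fun j => ?_) ?_
            (fun j => ?_)
        ?_
      · refine hHm.mul ?_
        have hm : Measurable (laplaceKernel (n := n)) := by unfold laplaceKernel; fun_prop
        exact (hm.comp (measurable_id.sub measurable_const)).aestronglyMeasurable
      · have h1 := hΩ.integrable_laplaceKernel hn Q
        have h2 : ∀ P, laplaceKernel (Q - P) = laplaceKernel (P - Q) := fun P => by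
          rw [laplaceKernel, laplaceKernel, norm_sub_rev]
        simp_rw [h2] at h1
        exact (h1.abs.const_mul _).const_mul _
      · filter_upwards [ae_mem_frontier Ω, hHb, hΩ.ae_ne hn Q] with P hP hHP hPQ
        rw [norm_mul]
        refine mul_le_mul hHP ?_ (norm_nonneg _) (by positivity)
        have hr : 0 < ‖P - Q‖ := norm_pos_iff.mpr (sub_ne_zero.mpr hPQ)
        have hden : ‖P - Q‖ / 2 ≤ ‖P - (Q + s j • outwardNormal Ω Q)‖ := by
          have := hnorm P hP Q hQ (s j) (by
            rw [abs_of_pos (hs0 j)]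
            exact (hsle j).trans ((min_le_right _ _).trans (min_le_right _ _)))
          refine (sq_le_sq₀ (by positivity) (norm_nonneg _)).mp (le_trans ?_ this)
          nlinarith [sq_nonneg (s j)]
        rw [Real.norm_eq_abs, abs_laplaceKernel hn, abs_laplaceKernel hn, mul_left_comm]
        have hn3 : (3 : ℝ) ≤ n := by exact_mod_cast hn
        have h4 : 0 ≤ 1 / (((n : ℝ) - 2) * sphereArea n) := by
          have := sphereArea_pos hn
          have : 0 < (n : ℝ) - 2 := by linarith
          positivity
        refine mul_le_mul_of_nonneg_left ?_ h4
        calc _ ≤ 1 / (‖P - Q‖ / 2) ^ (n - 2) := by gcongr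
          _ = _ := by rw [div_pow]; field_simp
      · filter_upwards [hΩ.ae_ne hn Q] with P hPQ
        exact tendsto_const_nhds.mul (hcE P hPQ)
  -- Fatou's lemma
  calc _ ≤ ∫⁻ Q, liminf (fun j => M j Q) atTop ∂(surfaceMeasure Ω) := by
        refine lintegral_mono_ae ?_
        filter_upwards [ae_mem_frontier Ω] with Q hQ
        have h1 : Tendsto (fun j => ENNReal.ofReal |k j Q|) atTop (𝓝 (ENNReal.ofReal
            |gradKernel e (x - Q) + ∫ P, H P * laplaceKernel (P - Q) ∂(surfaceMeasure Ω)|)) :=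
          (ENNReal.continuous_ofReal.tendsto _).comp (hlim Q hQ).abs
        rw [← h1.liminf_eq]
        exact liminf_le_liminf (Eventually.of_forall fun j => hkM j Q hQ)
    _ ≤ liminf (fun j => ∫⁻ Q, M j Q ∂(surfaceMeasure Ω)) atTop :=
        lintegral_liminf_le fun j => (hmeas j).lintegral_prod_right'
    _ ≤ _ := by
        refine (liminf_le_liminf (Eventually.of_forall hMint)).trans ?_
        rw [liminf_const]

theorem mul_one_add_abs_log_le {r D : ℝ} (hr : 0 < r) (hD : 1 ≤ D) (hrD : r ≤ D) :
    r * (1 + |Real.log r|) ≤ 4 * D ^ 2 * √r := by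
  have hs := Real.sqrt_pos.mpr hr
  have hsq : √r * √r = r := Real.mul_self_sqrt hr.le
  have key : √r * (1 + |Real.log r|) ≤ 4 * D ^ 2 := by
    rcases le_or_gt r 1 with h1 | h1
    · have hs1 : √r ≤ 1 := Real.sqrt_le_one.mpr h1
      have h2 := Real.abs_log_mul_self_lt (√r) hs hs1
      rw [Real.log_sqrt hr.le, abs_mul, abs_div, abs_of_pos hs, abs_two] at h2
      nlinarith
    · have h2 : Real.log r ≤ r := (Real.log_le_sub_one_of_pos hr).trans (by linarith)
      rw [abs_of_pos (Real.log_pos h1)]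
      have h3 : √r ≤ D := (Real.sqrt_le_left (by linarith)).mpr (by nlinarith)
      have h4 : 1 + Real.log r ≤ 2 * D := by linarith
      have h5 : 0 ≤ 1 + Real.log r := by linarith [Real.log_pos h1]
      nlinarith
  calc r * (1 + |Real.log r|) = √r * (√r * (1 + |Real.log r|)) := by rw [← mul_assoc, hsq]
    _ ≤ √r * (4 * D ^ 2) := by gcongr
    _ = _ := by ring

/-- The stationary cancellation: the tangential derivative of the single layer potential almost
equals the double layer of the single layer. -/
theorem IsBoundedC2Domain.exists_stationary_le (hΩ : IsBoundedC2Domain Ω) (hn : 3 ≤ n) :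
    ∃ C δ : ℝ, 0 < C ∧ 0 < δ ∧ ∀ p ∈ frontier Ω, ∀ d : ℝ, 0 < d → d ≤ δ →
      p - d • outwardNormal Ω p ∈ Ω → ∀ e : Space n, ⟪outwardNormal Ω p, e⟫ = 0 →
      ∀ (h : Space n → ℝ) (B : ℝ), 0 ≤ B → AEStronglyMeasurable h (surfaceMeasure Ω) →
      (∀ᵐ Q ∂(surfaceMeasure Ω), |h Q| ≤ B) →
      |∫ Q, gradKernel e (p - d • outwardNormal Ω p - Q) * h Q ∂(surfaceMeasure Ω) +
        2 * ∫ P, hessKernel e (outwardNormal Ω P) (p - d • outwardNormal Ω p - P) *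
          singleLayer Ω h P ∂(surfaceMeasure Ω)| ≤ C * B * ‖e‖ := by
  obtain ⟨C₁, δ₁, hC₁, hδ₁, hrefl⟩ := hΩ.exists_reflection_le hn
  obtain ⟨C₂, δ₂, hC₂, hδ₂, hker⟩ := hΩ.exists_lintegral_stationaryKernel_le hn
  obtain ⟨δ₃, hδ₃, hout⟩ := hΩ.exists_notMem_closure
  obtain ⟨C₄, hC₄, hV⟩ := hΩ.exists_singleLayer_sub_le hn
  obtain ⟨C₅, hC₅, hR4⟩ := hΩ.exists_lintegral_sqrt_le hn
  obtain ⟨C₆, hC₆, hVb⟩ := hΩ.exists_abs_singleLayer_le hn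
  obtain ⟨D, hD, hdiam⟩ := hΩ.frontier_bounded
  have := hΩ.isFiniteMeasure
  have hω := sphereArea_pos hn
  refine ⟨C₂ + C₁ * C₅ * (C₄ * (4 * D ^ 2)), min δ₁ (min δ₂ δ₃), by positivity, by positivity,
    fun p hp d hd hdδ hx e he h B hB0 hh hB => ?_⟩
  have hx' : p + d • outwardNormal Ω p ∉ closure Ω :=
    hout p hp d hd (hdδ.trans ((min_le_right _ _).trans (min_le_right _ _)))
  have hkerd := hker p hp d hd (hdδ.trans ((min_le_right _ _).trans (min_le_left _ _))) hx e he
  have hrefld := fun P hP hPp => (hrefl p hp d hd.le (hdδ.trans (min_le_left _ _)) e he P hP hPp).1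
  generalize p - d • outwardNormal Ω p = x at *
  generalize p + d • outwardNormal Ω p = x' at *
  have hxf : x ∉ frontier Ω := fun h => by
    rw [hΩ.isOpen.frontier_eq] at h
    exact h.2 hx
  have hxf' : x' ∉ frontier Ω := fun h => hx' (frontier_subset_closure h)
  set H : Space n → ℝ := fun P => hessKernel e (outwardNormal Ω P) (x - P) with hH
  set H' : Space n → ℝ := fun P => hessKernel e (outwardNormal Ω P) (x' - P) with hH'
  obtain ⟨K₁, hK₁0, hK₁⟩ := exists_hessKernel_bound hn hxf e
  obtain ⟨K₂, hK₂0, hK₂⟩ := exists_hessKernel_bound hn hxf' e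
  have hHm : AEStronglyMeasurable H (surfaceMeasure Ω) := hΩ.aestronglyMeasurable_hessKernel e x
  have hHm' : AEStronglyMeasurable H' (surfaceMeasure Ω) := hΩ.aestronglyMeasurable_hessKernel e x'
  have hHi : Integrable H (surfaceMeasure Ω) := Integrable.of_bound hHm K₁ hK₁
  have hHi' : Integrable H' (surfaceMeasure Ω) := Integrable.of_bound hHm' K₂ hK₂
  -- the kernels have mean zero
  have hmean : ∀ y ∉ frontier Ω, ∫ P, hessKernel e (outwardNormal Ω P) (y - P)
      ∂(surfaceMeasure Ω) = 0 := by
    intro y hy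
    have h1 := hΩ.representation_fderiv hn hy (v := fun _ => 1) contDiff_const
      (fun z _ => by simp [lap]) e
    simpa [indicator] using h1
  set V := singleLayer Ω h with hVdef
  have hVm : AEStronglyMeasurable V (surfaceMeasure Ω) :=
    hΩ.aestronglyMeasurable_singleLayer hn hh hB
  have hVB : ∀ P, ‖V P‖ ≤ C₆ * B := hVb h B hB0 hB
  have hHV : Integrable (fun P => H P * V P) (surfaceMeasure Ω) :=
    hHi.mul_bdd hVm (Eventually.of_forall hVB)
  have hHV' : Integrable (fun P => H' P * V P) (surfaceMeasure Ω) :=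
    hHi'.mul_bdd hVm (Eventually.of_forall hVB)
  have hsub : ∫ P, (H P - H' P) * V P ∂(surfaceMeasure Ω) =
      ∫ P, H P * V P ∂(surfaceMeasure Ω) - ∫ P, H' P * V P ∂(surfaceMeasure Ω) := by
    rw [← integral_sub hHV hHV']
    simp only [sub_mul]
  have hadd : ∫ P, (H P + H' P) * (V P - V p) ∂(surfaceMeasure Ω) =
      ∫ P, H P * V P ∂(surfaceMeasure Ω) + ∫ P, H' P * V P ∂(surfaceMeasure Ω) := by
    have e1 : ∀ P, (H P + H' P) * (V P - V p) = (H P * V P + H' P * V P) - (H P + H' P) * V p :=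
      fun P => by ring
    have i1 : Integrable (fun P => H P * V P + H' P * V P) (surfaceMeasure Ω) := hHV.add hHV'
    have i2 : Integrable (fun P => (H P + H' P) * V p) (surfaceMeasure Ω) :=
      (hHi.add hHi').mul_const _
    simp_rw [e1]
    rw [integral_sub i1 i2, integral_add hHV hHV',
      integral_mul_const, integral_add hHi hHi', hmean x hxf, hmean x' hxf', add_zero, zero_mul,
      sub_zero]
  have hA : |∫ P, (H P + H' P) * (V P - V p) ∂(surfaceMeasure Ω)| ≤
      C₁ * C₅ * (C₄ * (4 * D ^ 2)) * B * ‖e‖ := by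
    have h1 : |∫ P, (H P + H' P) * (V P - V p) ∂(surfaceMeasure Ω)| ≤
        ∫ P, C₁ * ‖e‖ * (C₄ * B * (4 * D ^ 2)) * (√‖P - p‖ / ‖P - p‖ ^ (n - 1))
          ∂(surfaceMeasure Ω) := by
      have hi := (integrable_and_integral_le (μ := surfaceMeasure Ω) (f := fun P : Space n =>
        √‖P - p‖ / ‖P - p‖ ^ (n - 1)) (Measurable.aestronglyMeasurable (by fun_prop))
        (Eventually.of_forall fun P => by positivity) hC₅.le (hR4 p)).1
      rw [← Real.norm_eq_abs]
      refine norm_integral_le_of_norm_le (hi.const_mul _) ?_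
      filter_upwards [ae_mem_frontier Ω, hΩ.ae_ne hn p] with P hP hPp
      have hr : 0 < ‖P - p‖ := norm_pos_iff.mpr (sub_ne_zero.mpr hPp)
      have h2 : |V P - V p| ≤ C₄ * B * (4 * D ^ 2 * √‖P - p‖) := by
        refine (hV h B hB0 hh hB P p hPp).trans ?_
        refine mul_le_mul_of_nonneg_left (mul_one_add_abs_log_le hr hD ?_) (by positivity)
        rw [← dist_eq_norm]
        exact hdiam P (frontier_subset_closure hP) p (frontier_subset_closure hp)
      rw [norm_mul]
      calc _ ≤ C₁ * ‖e‖ / ‖P - p‖ ^ (n - 1) * (C₄ * B * (4 * D ^ 2 * √‖P - p‖)) :=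
            mul_le_mul (hrefld P hP hPp) h2 (abs_nonneg _) (by positivity)
        _ = _ := by ring
    refine h1.trans ?_
    rw [integral_const_mul]
    have h3 := (integrable_and_integral_le (μ := surfaceMeasure Ω) (f := fun P : Space n =>
        √‖P - p‖ / ‖P - p‖ ^ (n - 1)) (Measurable.aestronglyMeasurable (by fun_prop))
        (Eventually.of_forall fun P => by positivity) hC₅.le (hR4 p)).2
    calc _ ≤ C₁ * ‖e‖ * (C₄ * B * (4 * D ^ 2)) * C₅ := by gcongr
      _ = _ := by ring
  have hS : |∫ Q, gradKernel e (x - Q) * h Q ∂(surfaceMeasure Ω) +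
      ∫ P, (H P - H' P) * V P ∂(surfaceMeasure Ω)| ≤ C₂ * ‖e‖ * B := by
    have hHb : ∀ᵐ P ∂(surfaceMeasure Ω), ‖H P - H' P‖ ≤ K₁ + K₂ := by
      filter_upwards [hK₁, hK₂] with P h1 h2 using (norm_sub_le _ _).trans (add_le_add h1 h2)
    have hF := hΩ.integral_mul_singleLayer hn (hHm.sub hHm') hHb hh hB
    have hi1 : Integrable (fun Q => gradKernel e (x - Q) * h Q) (surfaceMeasure Ω) := by
      obtain ⟨ρ, hρ, hρ'⟩ := exists_pos_le_norm_sub hxf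
      refine (Integrable.of_bound (C := ‖e‖ / (sphereArea n * ρ ^ (n - 1)))
        (f := fun Q => gradKernel e (x - Q)) ((measurable_gradKernel e).comp
        (measurable_const.sub measurable_id)).aestronglyMeasurable ?_).mul_bdd (c := B) hh hB
      filter_upwards [ae_mem_frontier Ω] with P hP
      refine (abs_gradKernel_le hn e _).trans ?_
      have := hρ' P hP
      gcongr
    have hi2 : Integrable (fun Q => (∫ P, (H P - H' P) * laplaceKernel (P - Q)
        ∂(surfaceMeasure Ω)) * h Q) (surfaceMeasure Ω) := by
      have h1 := (hΩ.integrable_mul_laplaceKernel_mul hn (hHm.sub hHm') hHb hh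
        hB).integral_prod_right
      refine h1.congr (Eventually.of_forall fun Q => ?_)
      simp only [← integral_mul_const, mul_assoc, Pi.sub_apply]
    simp only [Pi.sub_apply] at hF
    rw [hF, ← integral_add hi1 hi2]
    simp only [← add_mul]
    exact abs_integral_mul_le hB0 (by positivity) hB hkerd
  have hfinal : ∫ Q, gradKernel e (x - Q) * h Q ∂(surfaceMeasure Ω) +
      2 * ∫ P, H P * V P ∂(surfaceMeasure Ω) =
      (∫ Q, gradKernel e (x - Q) * h Q ∂(surfaceMeasure Ω) +
        ∫ P, (H P - H' P) * V P ∂(surfaceMeasure Ω)) +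
      ∫ P, (H P + H' P) * (V P - V p) ∂(surfaceMeasure Ω) := by
    rw [hsub, hadd]
    ring
  rw [hfinal]
  calc _ ≤ C₂ * ‖e‖ * B + C₁ * C₅ * (C₄ * (4 * D ^ 2)) * B * ‖e‖ :=
        (abs_add_le _ _).trans (add_le_add hS hA)
    _ = _ := by ring

end Stationary

end Stokes

namespace Stokes

/-! ### The heat kernel -/

section Heat

theorem setIntegral_rpow_mul_exp_neg_div {a r : ℝ} (ha : 0 < a) (hr : 0 < r) :
    IntegrableOn (fun τ : ℝ => τ ^ (-1 - a) * Real.exp (-(r / τ))) (Ioi 0) ∧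
      ∫ τ in Ioi (0 : ℝ), τ ^ (-1 - a) * Real.exp (-(r / τ)) = (1 / r) ^ a * Real.Gamma a := by
  have h : ∫ τ in Ioi (0 : ℝ), τ ^ (-1 - a) * Real.exp (-(r / τ)) =
      (1 / r) ^ a * Real.Gamma a := by
    rw [← Real.integral_rpow_mul_exp_neg_mul_Ioi ha hr,
      ← integral_comp_rpow_Ioi (fun t => t ^ (a - 1) * Real.exp (-(r * t)))
        (show (-1 : ℝ) ≠ 0 by norm_num)]
    refine setIntegral_congr_fun measurableSet_Ioi fun τ hτ => ?_
    have hτ : 0 < τ := hτ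
    simp only [smul_eq_mul]
    rw [abs_neg, abs_one, one_mul, ← Real.rpow_mul hτ.le, ← mul_assoc, ← Real.rpow_add hτ,
      Real.rpow_neg_one, div_eq_mul_inv]
    congr 2
    ring
  refine ⟨Integrable.of_integral_ne_zero ?_, h⟩
  rw [h]
  exact (mul_pos (by positivity) (Real.Gamma_pos_of_pos ha)).ne'

/-- Exponential decay beats polynomial growth. -/
theorem exists_pow_mul_exp_le (m : ℕ) {c : ℝ} (hc : 0 < c) :
    ∃ C : ℝ, 0 < C ∧ ∀ x : ℝ, 0 ≤ x → (1 + x) ^ m * Real.exp (-(x / c)) ≤ C := by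
  refine ⟨c ^ m * m.factorial * Real.exp (1 / c), by positivity, fun x hx => ?_⟩
  have h := Real.pow_div_factorial_le_exp ((1 + x) / c) (by positivity) m
  rw [div_pow, div_div, div_le_iff₀ (by positivity)] at h
  calc (1 + x) ^ m * Real.exp (-(x / c))
      ≤ Real.exp ((1 + x) / c) * (c ^ m * m.factorial) * Real.exp (-(x / c)) := by gcongr
    _ = c ^ m * m.factorial * (Real.exp ((1 + x) / c) * Real.exp (-(x / c))) := by ring
    _ = _ := by
        rw [← Real.exp_add]
        congr 2
        ring

/-- The heat kernel at time `τ` as a function of `‖x‖²`. -/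
noncomputable def heatProfile (n : ℕ) (τ s : ℝ) : ℝ :=
  1 / √(2 * Real.pi * τ) ^ n * Real.exp (-s / (2 * τ))

variable {n : ℕ}

theorem heatProfile_nonneg (τ s : ℝ) : 0 ≤ heatProfile n τ s := by
  unfold heatProfile
  positivity

theorem heatKernel_eq {τ : ℝ} (hτ : 0 < τ) (z : Space n) :
    heatKernel z τ = heatProfile n τ (‖z‖ ^ 2) := by
  rw [heatKernel, if_pos hτ, heatProfile]

theorem hasDerivAt_heatProfile (τ s : ℝ) :
    HasDerivAt (heatProfile n τ) (-(1 / (2 * τ)) * heatProfile n τ s) s := by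
  have h := (((hasDerivAt_id s).neg.div_const (2 * τ)).exp).const_mul (1 / √(2 * Real.pi * τ) ^ n)
  refine h.congr_deriv ?_
  simp only [heatProfile, Pi.neg_apply, id]
  ring

theorem heatProfile_le {τ s : ℝ} (hτ : 0 < τ) :
    heatProfile n τ s ≤ 1 / √τ ^ n * Real.exp (-(s / (2 * τ))) := by
  rw [heatProfile, neg_div]
  refine mul_le_mul_of_nonneg_right ?_ (Real.exp_pos _).le
  have h1 : √τ ≤ √(2 * Real.pi * τ) := Real.sqrt_le_sqrt (by nlinarith [Real.pi_gt_three])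
  have h2 : 0 < √τ := Real.sqrt_pos.mpr hτ
  exact one_div_le_one_div_of_le (by positivity) (pow_le_pow_left₀ h2.le h1 _)

/-- The second derivative `-∂_e ∂_m Γ` of the heat kernel: the derivative in direction `e` of
`x ↦ ∂Γ(x - P, τ)/∂m(P)`, at `z = x - P`. -/
noncomputable def heatHess (τ : ℝ) (e m z : Space n) : ℝ :=
  (⟪m, e⟫ / τ - ⟪z, m⟫ * ⟪z, e⟫ / τ ^ 2) * heatProfile n τ (‖z‖ ^ 2)

theorem fderiv_heatKernel {τ : ℝ} (hτ : 0 < τ) (y P m : Space n) :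
    fderiv ℝ (fun P' => heatKernel (y - P') τ) P m =
      ⟪y - P, m⟫ * (1 / τ * heatProfile n τ (‖y - P‖ ^ 2)) := by
  have h1 : (fun P' => heatKernel (y - P') τ) = fun P' =>
      (1 + ⟪P' - y, (0 : Space n)⟫) * heatProfile n τ (‖P' - y‖ ^ 2) := by
    funext P'
    rw [heatKernel_eq hτ, norm_sub_rev, inner_zero_right, add_zero, one_mul]
  rw [h1, (hasFDerivAt_affine_mul_radial (hasDerivAt_heatProfile _ _)).fderiv]
  simp only [inner_zero_right, add_zero, one_mul, map_zero, smul_zero, smul_apply, smul_eq_mul,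
    innerSL_apply_apply]
  rw [← neg_sub y P, inner_neg_left, norm_neg]
  field_simp

theorem abs_heatHess_le {τ : ℝ} (hτ : 0 < τ) (e z : Space n) {m : Space n} (hm : ‖m‖ ≤ 1) :
    |heatHess τ e m z| ≤ ‖e‖ * (1 / τ * (1 + ‖z‖ ^ 2 / τ) * heatProfile n τ (‖z‖ ^ 2)) := by
  rw [heatHess, abs_mul, abs_of_nonneg (heatProfile_nonneg _ _), ← mul_assoc]
  refine mul_le_mul_of_nonneg_right ?_ (heatProfile_nonneg _ _)
  have h1 : |⟪m, e⟫| ≤ ‖e‖ := (abs_real_inner_le_norm _ _).trans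
    (mul_le_of_le_one_left (norm_nonneg _) hm)
  have h2 : |⟪z, m⟫| ≤ ‖z‖ := (abs_real_inner_le_norm _ _).trans
    (mul_le_of_le_one_right (norm_nonneg _) hm)
  have h3 : |⟪z, e⟫| ≤ ‖z‖ * ‖e‖ := abs_real_inner_le_norm _ _
  refine (abs_sub _ _).trans ?_
  rw [abs_div, abs_div, abs_mul, abs_of_pos hτ, abs_of_pos (show 0 < τ ^ 2 by positivity)]
  calc _ ≤ ‖e‖ / τ + ‖z‖ * (‖z‖ * ‖e‖) / τ ^ 2 := by gcongr
    _ = _ := by field_simp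

/-- Away from the singularity, the second derivatives of the heat kernel are integrable in time,
uniformly in space. -/
theorem exists_heat_crude_le (hn : 3 ≤ n) {δ : ℝ} (hδ : 0 < δ) : ∃ C : ℝ, 0 < C ∧ ∀ τ s : ℝ,
    0 < τ → 0 ≤ s → δ ≤ τ + s →
      1 / τ * (1 + s / τ) * heatProfile n τ s ≤ C * (1 + τ ^ 2)⁻¹ := by
  obtain ⟨C, hC, h⟩ := exists_pow_mul_exp_le (n + 1) two_pos
  refine ⟨C * (1 + 1 / δ ^ n) * 2, by positivity, fun τ s hτ hs hδs => ?_⟩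
  have hu : 0 < √τ := Real.sqrt_pos.mpr hτ
  have hX : 0 ≤ s / τ := by positivity
  have h1 : (1 + s / τ) * heatProfile n τ s ≤ C * (1 / √τ ^ n * (1 / (1 + s / τ) ^ n)) := by
    have h2 := h (s / τ) hX
    rw [pow_succ, div_div, mul_comm τ 2] at h2
    calc _ ≤ (1 + s / τ) * (1 / √τ ^ n * Real.exp (-(s / (2 * τ)))) := by
          gcongr
          exact heatProfile_le hτ
      _ = ((1 + s / τ) ^ n * (1 + s / τ) * Real.exp (-(s / (2 * τ)))) *
          (1 / √τ ^ n * (1 / (1 + s / τ) ^ n)) := by field_simp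
      _ ≤ C * (1 / √τ ^ n * (1 / (1 + s / τ) ^ n)) := by gcongr
  have h3 : 1 / τ * (1 / √τ ^ n * (1 / (1 + s / τ) ^ n)) ≤ (1 + 1 / δ ^ n) *
      (2 * (1 + τ ^ 2)⁻¹) := by
    have hsq : √τ ^ 2 = τ := Real.sq_sqrt hτ.le
    have hδn : 0 < 1 / δ ^ n := by positivity
    rcases le_or_gt 1 τ with h1 | h1
    · have hu1 : 1 ≤ √τ := Real.one_le_sqrt.mpr h1
      have e1 : 1 / (1 + s / τ) ^ n ≤ 1 := by
        rw [div_le_one (by positivity)]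
        exact one_le_pow₀ (by linarith)
      have e2 : 1 / √τ ^ n ≤ 1 / τ := by
        calc 1 / √τ ^ n ≤ 1 / √τ ^ 2 :=
              one_div_le_one_div_of_le (by positivity) (pow_le_pow_right₀ hu1 (by omega))
          _ = 1 / τ := by rw [hsq]
      calc _ ≤ 1 / τ * (1 / τ * 1) := by gcongr
        _ ≤ 1 * (2 * (1 + τ ^ 2)⁻¹) := by
            rw [one_mul, mul_one, one_div_mul_one_div, ← div_eq_mul_inv,
              div_le_div_iff₀ (by positivity) (by positivity)]
            nlinarith
        _ ≤ _ := by gcongr; linarith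
    · have hu1 : √τ ≤ 1 := Real.sqrt_le_one.mpr h1.le
      have e1 : δ ^ n ≤ τ * √τ ^ n * (1 + s / τ) ^ n := by
        calc δ ^ n ≤ (τ + s) ^ n := pow_le_pow_left₀ hδ.le hδs _
          _ = τ ^ n * (1 + s / τ) ^ n := by
              rw [← mul_pow]
              congr 1
              field_simp
          _ ≤ τ * √τ ^ n * (1 + s / τ) ^ n := by
              gcongr
              calc τ ^ n = √τ ^ (2 * n) := by rw [pow_mul, hsq]
                _ ≤ √τ ^ (2 + n) := pow_le_pow_of_le_one hu.le hu1 (by omega)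
                _ = τ * √τ ^ n := by rw [pow_add, hsq]
      calc _ = 1 / (τ * √τ ^ n * (1 + s / τ) ^ n) := by field_simp
        _ ≤ 1 / δ ^ n := one_div_le_one_div_of_le (by positivity) e1
        _ ≤ (1 + 1 / δ ^ n) * 1 := by linarith
        _ ≤ _ := by
            gcongr
            rw [← div_eq_mul_inv, le_div_iff₀ (by positivity)]
            nlinarith
  calc 1 / τ * (1 + s / τ) * heatProfile n τ s = 1 / τ *
      ((1 + s / τ) * heatProfile n τ s) := by ring
    _ ≤ 1 / τ * (C * (1 / √τ ^ n * (1 / (1 + s / τ) ^ n))) := by gcongr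
    _ = C * (1 / τ * (1 / √τ ^ n * (1 / (1 + s / τ) ^ n))) := by ring
    _ ≤ C * ((1 + 1 / δ ^ n) * (2 * (1 + τ ^ 2)⁻¹)) := by gcongr
    _ = _ := by ring

theorem sphereArea_eq (hn : 3 ≤ n) :
    sphereArea n = 2 * √Real.pi ^ n / Real.Gamma ((n : ℝ) / 2) := by
  have : Nonempty (Fin n) := ⟨⟨0, by omega⟩⟩
  have hn0 : (n : ℝ) / 2 ≠ 0 := by
    have : (3 : ℝ) ≤ n := by exact_mod_cast hn
    positivity
  have hΓ : 0 < Real.Gamma ((n : ℝ) / 2) := Real.Gamma_pos_of_pos (by positivity)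
  rw [sphereArea, Measure.real, EuclideanSpace.volume_ball, ENNReal.ofReal_one, one_pow, one_mul,
    Fintype.card_fin, Real.Gamma_add_one hn0, ENNReal.toReal_ofReal (by positivity)]
  field_simp

theorem rpow_mul_heatProfile {τ s : ℝ} (hτ : 0 < τ) (k : ℕ) :
    1 / τ ^ (k + 1) * heatProfile n τ s =
      1 / √(2 * Real.pi) ^ n * (τ ^ (-1 - ((n : ℝ) / 2 + k)) * Real.exp (-(s / 2 / τ))) := by
  have e1 : 1 / √(2 * Real.pi * τ) ^ n = 1 / √(2 * Real.pi) ^ n * τ ^ (-((n : ℝ) / 2)) := by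
    rw [Real.sqrt_mul (by positivity), mul_pow, one_div, mul_inv, one_div, Real.rpow_neg hτ.le,
      Real.sqrt_eq_rpow τ, ← Real.rpow_natCast (τ ^ (1 / 2 : ℝ)) n, ← Real.rpow_mul hτ.le]
    congr 3
    ring
  rw [heatProfile, e1, show -1 - ((n : ℝ) / 2 + k) = -((k + 1 : ℕ) : ℝ) + -((n : ℝ) / 2) by
    push_cast; ring, Real.rpow_add hτ, Real.rpow_neg hτ.le ((k + 1 : ℕ) : ℝ),
    Real.rpow_natCast τ (k + 1), neg_div, div_div,
    one_div (τ ^ (k + 1))]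
  ring

/-- Integrating the second derivatives of the heat kernel in time gives the second derivatives
of the Laplace kernel. -/
theorem setIntegral_heatHess (hn : 3 ≤ n) (e m : Space n) {z : Space n} (hz : z ≠ 0) :
    IntegrableOn (fun τ => heatHess τ e m z) (Ioi 0) ∧
      ∫ τ in Ioi (0 : ℝ), heatHess τ e m z = 2 * hessKernel e m z := by
  have hn0 : 0 < (n : ℝ) := by exact_mod_cast (by omega)
  have hr : 0 < ‖z‖ := norm_pos_iff.mpr hz
  have hs : 0 < ‖z‖ ^ 2 / 2 := by positivity
  have h1 := setIntegral_rpow_mul_exp_neg_div (a := (n : ℝ) / 2 + (0 : ℕ)) (by positivity) hs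
  have h2 := setIntegral_rpow_mul_exp_neg_div (a := (n : ℝ) / 2 + (1 : ℕ)) (by positivity) hs
  have hcongr : ∀ τ ∈ Ioi (0 : ℝ), heatHess τ e m z =
      ⟪m, e⟫ * (1 / √(2 * Real.pi) ^ n) *
        (τ ^ (-1 - ((n : ℝ) / 2 + (0 : ℕ))) * Real.exp (-(‖z‖ ^ 2 / 2 / τ))) -
      ⟪z, m⟫ * ⟪z, e⟫ * (1 / √(2 * Real.pi) ^ n) *
        (τ ^ (-1 - ((n : ℝ) / 2 + (1 : ℕ))) * Real.exp (-(‖z‖ ^ 2 / 2 / τ))) := by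
    intro τ hτ
    rw [mul_assoc, mul_assoc (⟪z, m⟫ * ⟪z, e⟫), ← rpow_mul_heatProfile hτ,
        ← rpow_mul_heatProfile hτ,
      heatHess]
    ring
  have hi1 := h1.1.const_mul (⟪m, e⟫ * (1 / √(2 * Real.pi) ^ n))
  have hi2 := h2.1.const_mul (⟪z, m⟫ * ⟪z, e⟫ * (1 / √(2 * Real.pi) ^ n))
  refine ⟨IntegrableOn.congr_fun (hi1.sub hi2) (fun τ hτ => (hcongr τ hτ).symm) measurableSet_Ioi,
      ?_⟩
  rw [setIntegral_congr_fun measurableSet_Ioi hcongr, integral_sub hi1 hi2, integral_const_mul,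
    integral_const_mul, h1.2, h2.2]
  have hΓ : 0 < Real.Gamma ((n : ℝ) / 2) := Real.Gamma_pos_of_pos (by positivity)
  have hpi : (0 : ℝ) < √Real.pi := Real.sqrt_pos.mpr Real.pi_pos
  -- the normalising constants agree
  have hc : (1 / √(2 * Real.pi) ^ n) * ((1 / (‖z‖ ^ 2 / 2)) ^ ((n : ℝ) / 2) *
      Real.Gamma ((n : ℝ) / 2)) = 2 / (sphereArea n * ‖z‖ ^ n) := by
    have e1 : (1 / (‖z‖ ^ 2 / 2)) ^ ((n : ℝ) / 2) = √2 ^ n / ‖z‖ ^ n := by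
      rw [show 1 / (‖z‖ ^ 2 / 2) = 2 / ‖z‖ ^ 2 by field_simp,
        Real.div_rpow two_pos.le (by positivity), ← Real.rpow_natCast ‖z‖ 2,
        ← Real.rpow_mul (norm_nonneg _), Real.sqrt_eq_rpow, ← Real.rpow_natCast (2 ^ (1 / 2 : ℝ)),
        ← Real.rpow_mul two_pos.le, ← Real.rpow_natCast ‖z‖ n]
      congr 2 <;> push_cast <;> ring
    rw [e1, sphereArea_eq hn, Real.sqrt_mul two_pos.le, mul_pow]
    have : (0 : ℝ) < √2 := Real.sqrt_pos.mpr two_pos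
    field_simp
  have e2 : (1 / (‖z‖ ^ 2 / 2)) ^ ((n : ℝ) / 2 + (1 : ℕ)) * Real.Gamma ((n : ℝ) / 2 + (1 : ℕ)) =
      n / ‖z‖ ^ 2 * ((1 / (‖z‖ ^ 2 / 2)) ^ ((n : ℝ) / 2) * Real.Gamma ((n : ℝ) / 2)) := by
    rw [Nat.cast_one, Real.rpow_add_one (by positivity), Real.Gamma_add_one (by positivity)]
    field_simp
  rw [e2, Nat.cast_zero, add_zero, mul_assoc, hc,
    show ⟪z, m⟫ * ⟪z, e⟫ * (1 / √(2 * Real.pi) ^ n) *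
      (n / ‖z‖ ^ 2 * ((1 / (‖z‖ ^ 2 / 2)) ^ ((n : ℝ) / 2) * Real.Gamma ((n : ℝ) / 2))) =
      ⟪z, m⟫ * ⟪z, e⟫ * (n / ‖z‖ ^ 2) * ((1 / √(2 * Real.pi) ^ n) *
        ((1 / (‖z‖ ^ 2 / 2)) ^ ((n : ℝ) / 2) * Real.Gamma ((n : ℝ) / 2))) by ring, hc, hessKernel,
    pow_add]
  have := (sphereArea_pos hn).ne'
  field_simp

variable {Ω : Set (Space n)}

/-- The boundary integral of the second derivatives of the heat kernel involves the normal only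
through its component in the direction `e`: by the divergence theorem, both sides are, up to sign,
the integral of `∂_e ΔΓ` over `Ω`. -/
theorem IsBoundedC2Domain.integral_heatHess (hΩ : IsBoundedC2Domain Ω) {τ : ℝ} (hτ : 0 < τ)
    (e x : Space n) :
    ∫ P, heatHess τ e (outwardNormal Ω P) (x - P) ∂(surfaceMeasure Ω) =
      ∫ P, (1 / τ * (n - ‖P - x‖ ^ 2 / τ) * heatProfile n τ (‖P - x‖ ^ 2)) *
        ⟪outwardNormal Ω P, e⟫ ∂(surfaceMeasure Ω) := by
  have hsm : ∀ k : WithTop ℕ∞, ContDiff ℝ k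
      fun y : Space n => heatProfile n τ (‖y - x‖ ^ 2) := by
    intro k
    unfold heatProfile
    exact contDiff_const.mul ((((contDiff_norm_sq ℝ).comp
      (contDiff_id.sub contDiff_const)).neg.div_const _).exp)
  have hd1 : ∀ s, HasDerivAt (fun s => 1 / τ * heatProfile n τ s)
      (-(1 / (2 * τ ^ 2)) * heatProfile n τ s) s := fun s => by
    refine ((hasDerivAt_heatProfile (n := n) τ s).const_mul (1 / τ)).congr_deriv ?_
    field_simp
  have hd2 : ∀ s, HasDerivAt (fun s => -(1 / (2 * τ ^ 2)) * heatProfile n τ s)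
      (1 / (4 * τ ^ 3) * heatProfile n τ s) s := fun s => by
    refine ((hasDerivAt_heatProfile (n := n) τ s).const_mul (-(1 / (2 * τ ^ 2)))).congr_deriv ?_
    field_simp
    ring
  have hd3 : ∀ s, HasDerivAt (fun s => 1 / τ * (n - s / τ) * heatProfile n τ s)
      (1 / τ * (-(1 / τ)) * heatProfile n τ s +
        1 / τ * (n - s / τ) * (-(1 / (2 * τ)) * heatProfile n τ s)) s := fun s => by
    have h1 : HasDerivAt (fun s : ℝ => 1 / τ * ((n : ℝ) - s / τ)) (1 / τ * (-(1 / τ))) s :=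
      (((hasDerivAt_id s).div_const τ).const_sub (n : ℝ)).const_mul (1 / τ)
    exact h1.mul (hasDerivAt_heatProfile (n := n) τ s)
  set v : Space n → ℝ := fun y => (0 + ⟪y - x, e⟫) * (1 / τ * heatProfile n τ (‖y - x‖ ^ 2)) with hv
  set F : Space n → ℝ := fun y =>
    (1 + ⟪y - x, (0 : Space n)⟫) * (1 / τ * (n - ‖y - x‖ ^ 2 / τ) * heatProfile n τ (‖y - x‖ ^ 2))
    with hF
  have hv2 : ContDiff ℝ 2 v := by
    refine (contDiff_const.add ?_).mul (contDiff_const.mul (hsm 2))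
    exact (contDiff_id.sub contDiff_const).inner ℝ contDiff_const
  have hF1 : ContDiff ℝ 1 F := by
    refine (contDiff_const.add ((contDiff_id.sub contDiff_const).inner ℝ contDiff_const)).mul
      ((contDiff_const.mul (contDiff_const.sub (ContDiff.div_const ?_ _))).mul (hsm 1))
    exact (contDiff_norm_sq ℝ).comp (contDiff_id.sub contDiff_const)
  have h1 := hΩ.green (u := fun _ => 1) contDiff_const hv2
  have h2 := hΩ.gauss_green hF1 e
  have hlap : ∀ y, lap v y = fderiv ℝ F y e := by
    intro y
    have e1 := lap_affine_mul_radial (c := 0) (m := e) (a := x) (y := y)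
      (g := fun s => 1 / τ * heatProfile n τ s) (g' := fun s => -(1 / (2 * τ ^ 2)) *
        heatProfile n τ s) (Eventually.of_forall hd1) (hd2 _)
    have e2 := (hasFDerivAt_affine_mul_radial (c := 1) (m := (0 : Space n)) (a := x) (z := y)
      (hd3 _)).fderiv
    rw [hv, e1, hF, e2]
    simp only [inner_zero_right, add_zero, zero_add, one_mul, map_zero, smul_zero, smul_apply,
      smul_eq_mul, innerSL_apply_apply]
    field_simp
    ring
  have h3 : ∀ P, (1 : ℝ) * fderiv ℝ v P (outwardNormal Ω P) - v P *
      fderiv ℝ (fun _ => (1 : ℝ)) P (outwardNormal Ω P) =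
      heatHess τ e (outwardNormal Ω P) (x - P) := by
    intro P
    rw [hv, (hasFDerivAt_affine_mul_radial (hd1 _)).fderiv, heatHess, ← neg_sub P x, norm_neg,
      inner_neg_left, inner_neg_left]
    simp only [zero_add, fderiv_fun_const, Pi.zero_apply, zero_apply, mul_zero, sub_zero, one_mul,
      add_apply, smul_apply, smul_eq_mul, innerSL_apply_apply]
    rw [real_inner_comm (outwardNormal Ω P) e]
    field_simp
    ring
  simp_rw [h3] at h1
  rw [h1]
  have h4 : ∀ y, (1 : ℝ) * lap v y - v y * lap (fun _ => 1) y = fderiv ℝ F y e := fun y => by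
    rw [hlap]
    simp [lap]
  simp_rw [h4]
  rw [← h2]
  simp only [hF, inner_zero_right, add_zero, one_mul]

end Heat

end Stokes

namespace Stokes

/-! ### The double heat layer of a single layer potential near the boundary -/

section Variable

variable {n : ℕ} {Ω : Set (Space n)}

/-- A Gaussian at scale `u`, with polynomial factors, is dominated by a Poisson-like kernel. -/
theorem exists_pow_mul_exp_neg_sq_le (n k : ℕ) {c : ℝ} (hc : 0 < c) :
    ∃ C : ℝ, 0 < C ∧ ∀ u r : ℝ, 0 < u → 0 ≤ r →
      1 / u ^ n * ((1 + r / u) ^ k * Real.exp (-(r ^ 2 / (c * u ^ 2)))) ≤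
        C * (1 / (u + r) ^ n) := by
  obtain ⟨C, hC, h⟩ := exists_pow_mul_exp_le (n + k) hc
  refine ⟨C * Real.exp (1 / c), by positivity, fun u r hu hr => ?_⟩
  have hw : 0 ≤ r / u := by positivity
  have h1 := h (r / u) hw
  have e1 : Real.exp (-(r ^ 2 / (c * u ^ 2))) ≤ Real.exp (1 / c) * Real.exp (-(r / u / c)) := by
    rw [← Real.exp_add, Real.exp_le_exp, show r ^ 2 / (c * u ^ 2) = (r / u) ^ 2 / c by field_simp,
      ← sub_eq_add_neg, ← sub_div, ← neg_div]
    gcongr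
    nlinarith [sq_nonneg (r / u - 1)]
  have e2 : (u + r) ^ n = u ^ n * (1 + r / u) ^ n := by
    rw [← mul_pow]
    congr 1
    field_simp
  calc _ ≤ 1 / u ^ n * ((1 + r / u) ^ k * (Real.exp (1 / c) * Real.exp (-(r / u / c)))) := by gcongr
    _ = Real.exp (1 / c) * ((1 + r / u) ^ (n + k) * Real.exp (-(r / u / c))) *
        (1 / (u + r) ^ n) := by
        rw [e2, pow_add]
        field_simp
    _ ≤ Real.exp (1 / c) * C * (1 / (u + r) ^ n) := by gcongr
    _ = _ := by ring

theorem mul_one_add_abs_log_le_sq {w : ℝ} (hw : 0 ≤ w) : w * (1 + |Real.log w|) ≤ (1 + w) ^ 2 := by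
  rcases hw.eq_or_lt with rfl | hw
  · norm_num
  rcases le_or_gt w 1 with h1 | h1
  · have h2 := Real.abs_log_mul_self_lt w hw h1
    rw [abs_mul, abs_of_pos hw] at h2
    nlinarith
  · rw [abs_of_pos (Real.log_pos h1)]
    nlinarith [Real.log_le_sub_one_of_pos hw]

/-- The log-Lipschitz modulus of continuity scales like a power, up to a logarithm of the scale. -/
theorem mul_one_add_abs_log_le_scale {u r : ℝ} (hu : 0 < u) (hr : 0 < r) :
    r * (1 + |Real.log r|) ≤ u * (1 + |Real.log u|) * (1 + r / u) ^ 2 := by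
  have hw : 0 < r / u := by positivity
  have h1 : |Real.log r| ≤ |Real.log u| + |Real.log (r / u)| := by
    rw [Real.log_div hr.ne' hu.ne']
    calc |Real.log r| = |Real.log u + (Real.log r - Real.log u)| := by congr 1; ring
      _ ≤ _ := abs_add_le _ _
  have h2 := mul_one_add_abs_log_le_sq hw.le
  calc r * (1 + |Real.log r|) ≤ r * ((1 + |Real.log u|) * (1 + |Real.log (r / u)|)) := by
        gcongr
        nlinarith [mul_nonneg (abs_nonneg (Real.log u)) (abs_nonneg (Real.log (r / u)))]
    _ = u * (1 + |Real.log u|) * (r / u * (1 + |Real.log (r / u)|)) := by field_simp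
    _ ≤ _ := by gcongr

theorem IsBoundedC2Domain.aestronglyMeasurable_heatHess (hΩ : IsBoundedC2Domain Ω)
    (τ : ℝ) (e x : Space n) : AEStronglyMeasurable
      (fun P => heatHess τ e (outwardNormal Ω P) (x - P)) (surfaceMeasure Ω) := by
  have hN := hΩ.aestronglyMeasurable_normal.aemeasurable
  unfold heatHess heatProfile
  refine AEMeasurable.aestronglyMeasurable ?_
  fun_prop

/-- For fixed time the second derivatives of the heat kernel are bounded. -/
theorem exists_heatHess_bound {τ : ℝ} (hτ : 0 < τ) (e : Space n) : ∃ K : ℝ, 0 < K ∧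
    ∀ m z : Space n, ‖m‖ ≤ 1 → ‖heatHess τ e m z‖ ≤ K := by
  obtain ⟨C, hC, h⟩ := exists_pow_mul_exp_le 1 two_pos
  refine ⟨(1 + ‖e‖) * (1 / τ * (1 / √τ ^ n * C)), by positivity, fun m z hm => ?_⟩
  refine (abs_heatHess_le hτ e z hm).trans ?_
  have hX : 0 ≤ ‖z‖ ^ 2 / τ := by positivity
  have h1 := h _ hX
  rw [pow_one, div_div, mul_comm τ 2] at h1
  calc _ ≤ ‖e‖ * (1 / τ * (1 + ‖z‖ ^ 2 / τ) *
        (1 / √τ ^ n * Real.exp (-(‖z‖ ^ 2 / (2 * τ))))) := by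
        gcongr
        exact heatProfile_le hτ
    _ = ‖e‖ * (1 / τ * (1 / √τ ^ n * ((1 + ‖z‖ ^ 2 / τ) *
        Real.exp (-(‖z‖ ^ 2 / (2 * τ)))))) := by ring
    _ ≤ (1 + ‖e‖) * (1 / τ * (1 / √τ ^ n * C)) := by
        gcongr
        linarith

/-- The second derivatives of the heat kernel at `x = p - d N(p)`, for tangential `e`. The first term
comes from the curvature of the boundary, and the second one from the distance of `x` to it; the time
is `u ^ 2`. -/
theorem IsBoundedC2Domain.exists_heatHess_near_le (hΩ : IsBoundedC2Domain Ω) :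
    ∃ C δ : ℝ, 0 < C ∧ 0 < δ ∧ ∀ p ∈ frontier Ω, ∀ d : ℝ, 0 < d → d ≤ δ →
      ∀ e : Space n, ⟪outwardNormal Ω p, e⟫ = 0 → ∀ P ∈ frontier Ω, ∀ u : ℝ, 0 < u →
      |heatHess (u ^ 2) e (outwardNormal Ω P) (p - d • outwardNormal Ω p - P)| ≤
        C * ‖e‖ * (1 / u + d / u ^ 3 * Real.exp (-(d ^ 2 / (4 * u ^ 2)))) *
          (1 / u ^ n * ((1 + ‖P - p‖ / u) ^ 3 * Real.exp (-(‖P - p‖ ^ 2 / (4 * u ^ 2))))) := by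
  obtain ⟨L, hL, hLip⟩ := hΩ.exists_lipschitz_normal
  obtain ⟨C₁, hC₁, hin⟩ := hΩ.exists_inner_normal_le
  obtain ⟨δ, hδ, hnear⟩ := hΩ.exists_norm_sub_normal
  refine ⟨L + C₁ + 1, δ, by positivity, hδ, fun p hp d hd hdδ e he P hP u hu => ?_⟩
  have h1 := hLip P hP p hp
  have h2 := hin P hP p hp
  have h3 := hnear P hP p hp (-d) (by rwa [abs_neg, abs_of_pos hd])
  have hNp := norm_outwardNormal_le Ω p
  have hNP := norm_outwardNormal_le Ω P
  rw [neg_smul, ← sub_eq_add_neg, neg_sq,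
    norm_sub_rev P (p - d • outwardNormal Ω p)] at h3
  rw [dist_eq_norm] at h1 h2
  have e1 : |⟪outwardNormal Ω P, e⟫| ≤ L * ‖P - p‖ * ‖e‖ := by
    have : ⟪outwardNormal Ω P, e⟫ = ⟪outwardNormal Ω P - outwardNormal Ω p, e⟫ := by
      rw [inner_sub_left, he, sub_zero]
    rw [this]
    exact (abs_real_inner_le_norm _ _).trans (mul_le_mul_of_nonneg_right h1 (norm_nonneg _))
  have e2 : |⟪p - d • outwardNormal Ω p - P, e⟫| ≤ ‖P - p‖ * ‖e‖ := by
    have : ⟪p - d • outwardNormal Ω p - P, e⟫ = ⟪p - P, e⟫ := by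
      rw [sub_right_comm, inner_sub_left, real_inner_smul_left, he, mul_zero, sub_zero]
    rw [this, norm_sub_rev]
    exact abs_real_inner_le_norm _ _
  have e3 : |⟪p - d • outwardNormal Ω p - P, outwardNormal Ω P⟫| ≤ C₁ * ‖P - p‖ ^ 2 + d := by
    rw [sub_right_comm, inner_sub_left, real_inner_smul_left]
    refine (abs_sub _ _).trans (add_le_add h2 ?_)
    rw [abs_mul, abs_of_pos hd]
    refine mul_le_of_le_one_right hd.le ((abs_real_inner_le_norm _ _).trans ?_)
    exact mul_le_one₀ hNp (norm_nonneg _) hNP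
  generalize p - d • outwardNormal Ω p - P = z at *
  have hr : 0 ≤ ‖P - p‖ := norm_nonneg _
  generalize ‖P - p‖ = r at *
  have e4 : heatProfile n (u ^ 2) (‖z‖ ^ 2) ≤ 1 / u ^ n *
      (Real.exp (-(d ^ 2 / (4 * u ^ 2))) * Real.exp (-(r ^ 2 / (4 * u ^ 2)))) := by
    refine (heatProfile_le (by positivity)).trans ?_
    rw [Real.sqrt_sq hu.le, ← Real.exp_add]
    gcongr
    calc -(‖z‖ ^ 2 / (2 * u ^ 2)) ≤ -((r ^ 2 + d ^ 2) / 2 / (2 * u ^ 2)) := by gcongr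
      _ = _ := by field_simp; ring
  rw [heatHess, abs_mul, abs_of_nonneg (heatProfile_nonneg _ _)]
  have hw : 0 ≤ r / u := by positivity
  have hD : Real.exp (-(d ^ 2 / (4 * u ^ 2))) ≤ 1 := by
    rw [Real.exp_le_one_iff]
    have : 0 ≤ d ^ 2 / (4 * u ^ 2) := by positivity
    linarith
  have hD0 := Real.exp_pos (-(d ^ 2 / (4 * u ^ 2)))
  have e5 : |⟪outwardNormal Ω P, e⟫ / u ^ 2 -
      ⟪z, outwardNormal Ω P⟫ * ⟪z, e⟫ / (u ^ 2) ^ 2| ≤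
      ‖e‖ * (((L + C₁) * (1 / u) + d / u ^ 3) * (1 + r / u) ^ 3) := by
    refine (abs_sub _ _).trans ?_
    rw [abs_div, abs_div, abs_mul, abs_of_pos (show 0 < u ^ 2 by positivity),
      abs_of_pos (show 0 < (u ^ 2) ^ 2 by positivity)]
    calc _ ≤ L * r * ‖e‖ / u ^ 2 + (C₁ * r ^ 2 + d) * (r * ‖e‖) / (u ^ 2) ^ 2 := by gcongr
      _ = ‖e‖ * (L * (1 / u) * (r / u) + C₁ * (1 / u) * (r / u) ^ 3 + d / u ^ 3 * (r / u)) := by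
          field_simp
          ring
      _ ≤ ‖e‖ * (L * (1 / u) * (1 + r / u) ^ 3 + C₁ * (1 / u) * (1 + r / u) ^ 3 +
          d / u ^ 3 * (1 + r / u) ^ 3) := by
          have h6 : r / u ≤ (1 + r / u) ^ 3 := by nlinarith [pow_nonneg hw 2, pow_nonneg hw 3]
          have h7 : (r / u) ^ 3 ≤ (1 + r / u) ^ 3 := by gcongr; linarith
          gcongr
      _ = _ := by ring
  generalize Real.exp (-(d ^ 2 / (4 * u ^ 2))) = X at *
  generalize Real.exp (-(r ^ 2 / (4 * u ^ 2))) = Y at *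
  have hY : 0 ≤ Y := by
    by_contra hc
    have := (heatProfile_nonneg (n := n) (u ^ 2) (‖z‖ ^ 2)).trans e4
    have h8 : 1 / u ^ n * (X * Y) < 0 :=
      mul_neg_of_pos_of_neg (by positivity) (mul_neg_of_pos_of_neg hD0 (not_le.mp hc))
    linarith
  calc _ ≤ ‖e‖ * (((L + C₁) * (1 / u) + d / u ^ 3) * (1 + r / u) ^ 3) *
        (1 / u ^ n * (X * Y)) := mul_le_mul e5 e4 (heatProfile_nonneg _ _) (by positivity)
    _ = ((L + C₁) * (1 / u) * X + d / u ^ 3 * X) *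
        (‖e‖ * (1 / u ^ n * ((1 + r / u) ^ 3 * Y))) := by ring
    _ ≤ (L + C₁ + 1) * (1 / u + d / u ^ 3 * X) *
        (‖e‖ * (1 / u ^ n * ((1 + r / u) ^ 3 * Y))) := by
        refine mul_le_mul_of_nonneg_right ?_ (by positivity)
        have h8 : (L + C₁) * (1 / u) * X ≤ (L + C₁) * (1 / u) :=
          mul_le_of_le_one_right (by positivity) hD
        have h9 : 0 ≤ (L + C₁) * (d / u ^ 3 * X) := by positivity
        have h10 : 0 < 1 / u := by positivity
        nlinarith
    _ = _ := by ring

/-- The mean of the second derivatives of the heat kernel over the boundary is of order `1 / τ`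
only, as tangential derivatives fall on the slowly varying normal. -/
theorem IsBoundedC2Domain.exists_integral_heatHess_le (hΩ : IsBoundedC2Domain Ω) (hn : 3 ≤ n) :
    ∃ C δ : ℝ, 0 < C ∧ 0 < δ ∧ ∀ p ∈ frontier Ω, ∀ d : ℝ, 0 < d → d ≤ δ →
      ∀ e : Space n, ⟪outwardNormal Ω p, e⟫ = 0 → ∀ u : ℝ, 0 < u →
      |∫ P, heatHess (u ^ 2) e (outwardNormal Ω P) (p - d • outwardNormal Ω p - P)
        ∂(surfaceMeasure Ω)| ≤ C * ‖e‖ / u ^ 2 := by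
  obtain ⟨L, hL, hLip⟩ := hΩ.exists_lipschitz_normal
  obtain ⟨δ, hδ, hnear⟩ := hΩ.exists_norm_sub_normal
  obtain ⟨C₁, hC₁, h1⟩ := exists_pow_mul_exp_neg_sq_le n 1 (c := 8) (by norm_num)
  obtain ⟨C₂, hC₂, h2⟩ := exists_pow_mul_exp_le 1 (c := 4) (by norm_num)
  obtain ⟨C₃, hC₃, h3⟩ := hΩ.exists_lintegral_add_pow_le hn
  have hn0 : 0 < (n : ℝ) := by exact_mod_cast (by omega)
  refine ⟨n * L * C₂ * C₁ * C₃, δ, by positivity, hδ, fun p hp d hd hdδ e he u hu => ?_⟩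
  rw [hΩ.integral_heatHess (by positivity), ← Real.norm_eq_abs]
  have hi := integrable_and_integral_le (μ := surfaceMeasure Ω) (f := fun P : Space n =>
    1 / (u + ‖P - p‖) ^ n) (Measurable.aestronglyMeasurable (by fun_prop))
    (Eventually.of_forall fun P => by positivity) (by positivity) (h3 p u hu)
  refine (norm_integral_le_of_norm_le (hi.1.const_mul (n * L * ‖e‖ * C₂ * C₁ / u)) ?_).trans ?_
  · filter_upwards [ae_mem_frontier Ω] with P hP
    have h4 := hLip P hP p hp
    have h5 := hnear P hP p hp (-d) (by rwa [abs_neg, abs_of_pos hd])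
    rw [neg_smul, ← sub_eq_add_neg, neg_sq] at h5
    rw [dist_eq_norm] at h4
    have e1 : |⟪outwardNormal Ω P, e⟫| ≤ L * ‖P - p‖ * ‖e‖ := by
      have : ⟪outwardNormal Ω P, e⟫ = ⟪outwardNormal Ω P - outwardNormal Ω p, e⟫ := by
        rw [inner_sub_left, he, sub_zero]
      rw [this]
      exact (abs_real_inner_le_norm _ _).trans (mul_le_mul_of_nonneg_right h4 (norm_nonneg _))
    generalize ‖P - (p - d • outwardNormal Ω p)‖ = s at *
    have hr : 0 ≤ ‖P - p‖ := norm_nonneg _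
    generalize ‖P - p‖ = r at *
    have hX : 0 ≤ s ^ 2 / u ^ 2 := by positivity
    have h6 := h2 _ hX
    rw [pow_one] at h6
    have e2 : |(n : ℝ) - s ^ 2 / u ^ 2| ≤ n * (1 + s ^ 2 / u ^ 2) := by
      have h7 : (1 : ℝ) ≤ n := by exact_mod_cast (by omega)
      rw [abs_le]
      constructor <;> nlinarith
    have e3 : heatProfile n (u ^ 2) (s ^ 2) ≤ 1 / u ^ n * (Real.exp (-(s ^ 2 / u ^ 2 / 4)) *
        Real.exp (-(r ^ 2 / (8 * u ^ 2)))) := by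
      refine (heatProfile_le (by positivity)).trans ?_
      rw [Real.sqrt_sq hu.le, ← Real.exp_add]
      gcongr
      have h8 : r ^ 2 ≤ 2 * s ^ 2 := by nlinarith
      calc -(s ^ 2 / (2 * u ^ 2)) = -(s ^ 2 / u ^ 2 / 4) + -((2 * s ^ 2) / (8 * u ^ 2)) := by
            field_simp; ring
        _ ≤ _ := by gcongr
    rw [norm_mul, norm_mul, norm_mul, Real.norm_of_nonneg (heatProfile_nonneg _ _),
      Real.norm_of_nonneg (show 0 ≤ 1 / u ^ 2 by positivity), Real.norm_eq_abs, Real.norm_eq_abs]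
    calc _ ≤ 1 / u ^ 2 * (n * (1 + s ^ 2 / u ^ 2)) * (1 / u ^ n *
          (Real.exp (-(s ^ 2 / u ^ 2 / 4)) * Real.exp (-(r ^ 2 / (8 * u ^ 2))))) *
          (L * r * ‖e‖) := by
          have := heatProfile_nonneg (n := n) (u ^ 2) (s ^ 2)
          gcongr
      _ = n * L * ‖e‖ / u * ((1 + s ^ 2 / u ^ 2) * Real.exp (-(s ^ 2 / u ^ 2 / 4))) *
          (1 / u ^ n * ((r / u) * Real.exp (-(r ^ 2 / (8 * u ^ 2))))) := by
          field_simp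
      _ ≤ n * L * ‖e‖ / u * C₂ *
          (1 / u ^ n * ((1 + r / u) ^ 1 * Real.exp (-(r ^ 2 / (8 * u ^ 2))))) := by
          gcongr
          rw [pow_one]
          linarith
      _ ≤ n * L * ‖e‖ / u * C₂ * (C₁ * (1 / (u + r) ^ n)) := by
          exact mul_le_mul_of_nonneg_left (h1 u r hu hr) (by positivity)
      _ = _ := by ring
  · rw [integral_const_mul]
    calc _ ≤ n * L * ‖e‖ * C₂ * C₁ / u * (C₃ / u) := by gcongr; exact hi.2
      _ = _ := by field_simp

/-- The key estimate for the time-dependent part, for densities at time lag `τ`. Integrated in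
time, the second term is harmless, and the first one is compensated by the Dini condition. -/
theorem IsBoundedC2Domain.exists_heatHess_singleLayer_le (hΩ : IsBoundedC2Domain Ω) (hn : 3 ≤ n) :
    ∃ C δ : ℝ, 0 < C ∧ 0 < δ ∧ ∀ p ∈ frontier Ω, ∀ d : ℝ, 0 < d → d ≤ δ →
      ∀ e : Space n, ⟪outwardNormal Ω p, e⟫ = 0 →
      ∀ (h : Space n → ℝ) (B : ℝ), 0 ≤ B → AEStronglyMeasurable h (surfaceMeasure Ω) →
      (∀ᵐ Q ∂(surfaceMeasure Ω), |h Q| ≤ B) → ∀ u : ℝ, 0 < u → u ≤ 1 →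
      |∫ P, heatHess (u ^ 2) e (outwardNormal Ω P) (p - d • outwardNormal Ω p - P) *
        singleLayer Ω h P ∂(surfaceMeasure Ω)| ≤ C * B * ‖e‖ *
          (1 / u ^ 2 + (1 + |Real.log u|) * (d / u ^ 3 * Real.exp (-(d ^ 2 / (4 * u ^ 2))))) := by
  obtain ⟨C₁, δ₁, hC₁, hδ₁, h1⟩ := hΩ.exists_heatHess_near_le
  obtain ⟨C₂, δ₂, hC₂, hδ₂, h2⟩ := hΩ.exists_integral_heatHess_le hn
  obtain ⟨C₃, hC₃, h3⟩ := hΩ.exists_lintegral_add_pow_le hn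
  obtain ⟨C₄, hC₄, hV⟩ := hΩ.exists_singleLayer_sub_le hn
  obtain ⟨C₅, hC₅, hVb⟩ := hΩ.exists_abs_singleLayer_le hn
  obtain ⟨C₆, hC₆, h6⟩ := exists_pow_mul_exp_neg_sq_le n 5 (c := 4) (by norm_num)
  have := hΩ.isFiniteMeasure
  refine ⟨C₁ * C₄ * C₆ * C₃ * 4 + C₅ * C₂, min δ₁ δ₂, by positivity, by positivity,
    fun p hp d hd hdδ e he h B hB0 hh hB u hu hu1 => ?_⟩
  have h1' := h1 p hp d hd (hdδ.trans (min_le_left _ _)) e he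
  have h2' := h2 p hp d hd (hdδ.trans (min_le_right _ _)) e he u hu
  obtain ⟨K, hK, hKb⟩ := exists_heatHess_bound (show 0 < u ^ 2 by positivity) e
  generalize p - d • outwardNormal Ω p = x at *
  set A : Space n → ℝ := fun P => heatHess (u ^ 2) e (outwardNormal Ω P) (x - P) with hA
  set V := singleLayer Ω h with hVdef
  have hVm : AEStronglyMeasurable V (surfaceMeasure Ω) :=
    hΩ.aestronglyMeasurable_singleLayer hn hh hB
  have hAi : Integrable A (surfaceMeasure Ω) :=
    Integrable.of_bound (hΩ.aestronglyMeasurable_heatHess _ e x) K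
      (Eventually.of_forall fun P => hKb _ _ (norm_outwardNormal_le Ω P))
  have hAV : Integrable (fun P => A P * V P) (surfaceMeasure Ω) :=
    hAi.mul_bdd hVm (Eventually.of_forall (hVb h B hB0 hB))
  have hAVp : Integrable (fun P => A P * V p) (surfaceMeasure Ω) := hAi.mul_const _
  have hsub : ∫ P, A P * V P ∂(surfaceMeasure Ω) =
      ∫ P, A P * (V P - V p) ∂(surfaceMeasure Ω) + (∫ P, A P ∂(surfaceMeasure Ω)) * V p := by
    rw [← integral_mul_const]
    simp only [mul_sub]
    rw [integral_sub hAV hAVp]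
    ring
  set X := d / u ^ 3 * Real.exp (-(d ^ 2 / (4 * u ^ 2))) with hX
  have hX0 : 0 ≤ X := by positivity
  have hmain : |∫ P, A P * (V P - V p) ∂(surfaceMeasure Ω)| ≤
      C₁ * C₄ * C₆ * C₃ * B * ‖e‖ * ((1 + |Real.log u|) * (1 / u + X)) := by
    have hi := integrable_and_integral_le (μ := surfaceMeasure Ω) (f := fun P : Space n =>
      1 / (u + ‖P - p‖) ^ n) (Measurable.aestronglyMeasurable (by fun_prop))
      (Eventually.of_forall fun P => by positivity) (by positivity) (h3 p u hu)
    rw [← Real.norm_eq_abs]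
    refine (norm_integral_le_of_norm_le (hi.1.const_mul (C₁ * ‖e‖ * (1 / u + X) *
      (C₄ * B * (u * (1 + |Real.log u|))) * C₆)) ?_).trans ?_
    · filter_upwards [ae_mem_frontier Ω, hΩ.ae_ne hn p] with P hP hPp
      have hr : 0 < ‖P - p‖ := norm_pos_iff.mpr (sub_ne_zero.mpr hPp)
      have e1 := h1' P hP u hu
      have e2 := hV h B hB0 hh hB P p hPp
      have e3 := mul_one_add_abs_log_le_scale hu hr
      have e4 := h6 u _ hu hr.le
      rw [norm_mul]
      calc _ ≤ (C₁ * ‖e‖ * (1 / u + X) * (1 / u ^ n * ((1 + ‖P - p‖ / u) ^ 3 *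
            Real.exp (-(‖P - p‖ ^ 2 / (4 * u ^ 2)))))) *
            (C₄ * B * (u * (1 + |Real.log u|) * (1 + ‖P - p‖ / u) ^ 2)) :=
            mul_le_mul e1 (e2.trans (mul_le_mul_of_nonneg_left e3 (by positivity)))
              (abs_nonneg _) (by positivity)
        _ = C₁ * ‖e‖ * (1 / u + X) * (C₄ * B * (u * (1 + |Real.log u|))) *
            (1 / u ^ n * ((1 + ‖P - p‖ / u) ^ 5 *
            Real.exp (-(‖P - p‖ ^ 2 / (4 * u ^ 2))))) := by ring
        _ ≤ C₁ * ‖e‖ * (1 / u + X) * (C₄ * B * (u * (1 + |Real.log u|))) *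
            (C₆ * (1 / (u + ‖P - p‖) ^ n)) := by gcongr
        _ = _ := by ring
    · rw [integral_const_mul]
      calc _ ≤ C₁ * ‖e‖ * (1 / u + X) * (C₄ * B * (u * (1 + |Real.log u|))) * C₆ * (C₃ / u) := by
            gcongr
            exact hi.2
        _ = _ := by field_simp
  have hlog : (1 + |Real.log u|) * (1 / u) ≤ 4 * (1 / u ^ 2) := by
    have h7 := mul_one_add_abs_log_le_sq hu.le
    calc (1 + |Real.log u|) * (1 / u) = u * (1 + |Real.log u|) * (1 / u ^ 2) := by field_simp
      _ ≤ (1 + u) ^ 2 * (1 / u ^ 2) := by gcongr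
      _ ≤ 4 * (1 / u ^ 2) := by
          gcongr
          nlinarith
  rw [hsub]
  refine (abs_add_le _ _).trans ?_
  rw [abs_mul]
  have hVp := hVb h B hB0 hB p
  have hl0 : 0 ≤ (1 + |Real.log u|) * X := by positivity
  have hu2 : 0 ≤ 1 / u ^ 2 := by positivity
  calc _ ≤ C₁ * C₄ * C₆ * C₃ * B * ‖e‖ * ((1 + |Real.log u|) * (1 / u + X)) +
        C₂ * ‖e‖ / u ^ 2 * (C₅ * B) := by gcongr
    _ ≤ C₁ * C₄ * C₆ * C₃ * B * ‖e‖ * (4 * (1 / u ^ 2) + 4 * ((1 + |Real.log u|) * X)) +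
        C₂ * ‖e‖ / u ^ 2 * (C₅ * B) + C₅ * C₂ * B * ‖e‖ * ((1 + |Real.log u|) * X) := by
        have : 0 ≤ C₅ * C₂ * B * ‖e‖ * ((1 + |Real.log u|) * X) := by positivity
        refine le_add_of_le_of_nonneg ?_ this
        gcongr
        linarith
    _ = _ := by ring

end Variable

end Stokes

namespace Stokes

/-! ### Boundary data -/

section Data

theorem isOpen_timeInterval (T : EReal) : IsOpen (timeInterval T) :=
  isOpen_Ioi.inter (isOpen_Iio.preimage continuous_coe_real_ereal)

theorem mem_timeInterval_of_le {T : EReal} {s t : ℝ} (ht : t ∈ timeInterval T) (hs : 0 < s)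
    (hst : s ≤ t) : s ∈ timeInterval T :=
  ⟨hs, lt_of_le_of_lt (EReal.coe_le_coe_iff.mpr hst) ht.2⟩

/-- The log-Dini condition makes the modulus of continuity `O(1 / ln² τ)`: as the modulus is
increasing, the part `τ < r < √τ` of the Dini integral is at least a quarter of `ln² τ` times the
modulus at `τ`. -/
theorem abs_sub_le_of_logDini_le {r₀ M τ t : ℝ} {T : EReal} {f : ℝ → ℝ} (hr₀ : 0 < r₀) (hM : 0 ≤ M)
    (h : logDini r₀ T f ≤ ENNReal.ofReal M) (ht : t ∈ timeInterval T) (hτ : 0 < τ) (hτ1 : τ < 1)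
    (hτr : τ ≤ r₀ ^ 2) : |f (t - τ) - f t| ≤ 4 * M / Real.log τ ^ 2 := by
  have hlog : Real.log τ < 0 := Real.log_neg hτ hτ1
  have hu : 0 < √τ := Real.sqrt_pos.mpr hτ
  have hsq : √τ * √τ = τ := Real.mul_self_sqrt hτ.le
  have hu1 : √τ < 1 := by
    rw [Real.sqrt_lt' one_pos]
    linarith
  have hle : τ ≤ √τ := by nlinarith
  have hur : √τ ≤ r₀ := (Real.sqrt_le_left hr₀.le).mpr hτr
  have hW : ∀ r ∈ Ioo τ √τ, ENNReal.ofReal |f (t - τ) - f t| ≤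
      ⨆ t ∈ timeInterval T, timeModulus T f r t := by
    intro r hr
    refine le_iSup₂_of_le t ht (le_iSup₂_of_le (t - τ) ⟨?_, ?_⟩ ?_)
    · rw [sub_sub_cancel_left, abs_neg, abs_of_pos hτ]
      exact hr.1
    · exact lt_of_le_of_lt (EReal.coe_le_coe_iff.mpr (by linarith)) ht.2
    · rw [Real.enorm_eq_ofReal_abs]
  have hint : IntegrableOn (fun r : ℝ => -Real.log τ / 2 * r⁻¹) (Ioo τ √τ) := by
    refine ContinuousOn.integrableOn_Icc (ContinuousOn.mul continuousOn_const
      (ContinuousOn.inv₀ continuousOn_id fun r hr => ?_)) |>.mono_set Ioo_subset_Icc_self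
    exact (hτ.trans_le hr.1).ne'
  have h1 : ∫⁻ r in Ioo τ √τ, ENNReal.ofReal (-Real.log τ / 2 * r⁻¹) =
      ENNReal.ofReal (Real.log τ ^ 2 / 4) := by
    rw [← ofReal_integral_eq_lintegral_ofReal hint]
    · rw [← integral_Ioc_eq_integral_Ioo, ← intervalIntegral.integral_of_le hle,
        intervalIntegral.integral_const_mul, integral_inv_of_pos hτ hu, Real.log_div hu.ne' hτ.ne',
        Real.log_sqrt hτ.le]
      congr 1
      ring
    · filter_upwards [ae_restrict_mem measurableSet_Ioo] with r hr
      have : 0 < r := hτ.trans hr.1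
      have : 0 < -Real.log τ / 2 := by linarith
      positivity
  have h2 : ENNReal.ofReal |f (t - τ) - f t| * ENNReal.ofReal (Real.log τ ^ 2 / 4) ≤
      ENNReal.ofReal M := by
    rw [← h1, ← lintegral_const_mul _ (by fun_prop)]
    refine le_trans ?_ h
    calc _ ≤ ∫⁻ r in Ioo τ √τ, (⨆ t ∈ timeInterval T, timeModulus T f r t) *
          ENNReal.ofReal (|Real.log r| / r) := by
          refine setLIntegral_mono' measurableSet_Ioo fun r hr => ?_
          have hr0 : 0 < r := hτ.trans hr.1
          refine mul_le_mul' (hW r hr) (ENNReal.ofReal_le_ofReal ?_)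
          rw [← div_eq_mul_inv]
          gcongr
          have h3 : Real.log r ≤ Real.log √τ := Real.log_le_log hr0 hr.2.le
          rw [Real.log_sqrt hτ.le] at h3
          rw [abs_of_nonpos (by linarith)]
          linarith
      _ ≤ _ := lintegral_mono_set (Ioo_subset_Ioo hτ.le hur)
  rw [← ENNReal.ofReal_mul (abs_nonneg _), ENNReal.ofReal_le_ofReal_iff hM] at h2
  rw [le_div_iff₀ (show 0 < Real.log τ ^ 2 by nlinarith)]
  linarith

theorem continuousOn_of_logDini_lt_top {r₀ : ℝ} {T : EReal} {f : ℝ → ℝ} (hr₀ : 0 < r₀)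
    (h : logDini r₀ T f < ∞) : ContinuousOn f (timeInterval T) := by
  intro s hs
  refine ContinuousAt.continuousWithinAt ?_
  set M := (logDini r₀ T f).toReal with hM
  have hM0 : 0 ≤ M := ENNReal.toReal_nonneg
  have hle : logDini r₀ T f ≤ ENNReal.ofReal M := (ENNReal.ofReal_toReal h.ne).ge
  have hlim : Tendsto (fun s' => 4 * M / Real.log (s' - s) ^ 2) (𝓝[≠] s) (𝓝 0) := by
    refine Tendsto.const_div_atTop ?_ _
    have h1 : Tendsto (fun s' => s' - s) (𝓝[≠] s) (𝓝[≠] 0) := by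
      refine tendsto_nhdsWithin_iff.mpr ⟨?_, ?_⟩
      · have : Continuous fun s' : ℝ => s' - s := by fun_prop
        have := this.tendsto s
        rw [sub_self] at this
        exact this.mono_left nhdsWithin_le_nhds
      · filter_upwards [self_mem_nhdsWithin] with s' hs' using sub_ne_zero.mpr hs'
    have h2 := tendsto_abs_atBot_atTop.comp (Real.tendsto_log_nhdsNE_zero.comp h1)
    refine ((tendsto_pow_atTop two_ne_zero).comp h2).congr fun s' => ?_
    simp only [Function.comp, sq_abs]
  rw [continuousAt_iff_punctured_nhds, tendsto_iff_dist_tendsto_zero]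
  refine squeeze_zero' (Eventually.of_forall fun _ => dist_nonneg) ?_ hlim
  have hδ : 0 < min 1 (r₀ ^ 2) := by positivity
  filter_upwards [self_mem_nhdsWithin,
    nhdsWithin_le_nhds ((isOpen_timeInterval T).mem_nhds hs),
    nhdsWithin_le_nhds (Metric.ball_mem_nhds s hδ)] with s' hne hs' hball
  rw [Metric.mem_ball, Real.dist_eq] at hball
  have hb1 := hball.trans_le (min_le_left _ _)
  have hb2 := (hball.trans_le (min_le_right _ _)).le
  rw [Real.dist_eq]
  rcases lt_or_gt_of_ne hne with hlt | hlt
  · rw [abs_sub_comm, abs_of_pos (by linarith)] at hb1 hb2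
    have h1 := abs_sub_le_of_logDini_le hr₀ hM0 hle hs (τ := s - s') (by linarith) hb1 hb2
    rwa [sub_sub_cancel, ← Real.log_abs, abs_sub_comm s s', Real.log_abs] at h1
  · rw [abs_of_pos (by linarith)] at hb1 hb2
    have h1 := abs_sub_le_of_logDini_le hr₀ hM0 hle hs' (τ := s' - s) (by linarith) hb1 hb2
    rwa [sub_sub_cancel, abs_sub_comm] at h1

variable {n : ℕ}

/-- Bounded scalar boundary data on `∂Ω × (0, T)`, continuous in time and vanishing for
nonpositive times. -/
structure IsBoundaryDatum (Ω : Set (Space n)) (T : EReal) (B : ℝ) (f : Space n → ℝ → ℝ) :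
    Prop where
  nonneg : 0 ≤ B
  continuousOn : ∀ Q ∈ frontier Ω, ContinuousOn (f Q) (timeInterval T)
  bound : ∀ᵐ Q ∂(surfaceMeasure Ω), ∀ s ∈ timeInterval T, |f Q s| ≤ B
  aestronglyMeasurable : ∀ s ∈ timeInterval T,
    AEStronglyMeasurable (fun Q => f Q s) (surfaceMeasure Ω)
  eq_zero : ∀ Q s, s ≤ 0 → f Q s = 0

variable {Ω : Set (Space n)}

theorem IsBoundedC2Domain.memLp_normalData (hΩ : IsBoundedC2Domain Ω) {T : EReal}
    {g : Space n → ℝ → Space n} (hg : MemLp (Function.uncurry g) ∞ (lateralMeasure Ω T)) :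
    MemLp (Function.uncurry (normalData Ω g)) ∞ (lateralMeasure Ω T) := by
  have := hΩ.isFiniteMeasure
  have hpos : ∀ᵐ z ∂(lateralMeasure Ω T), 0 < z.2 := by
    have h1 : ∀ᵐ s ∂(volume.restrict (timeInterval T)), 0 < s := by
      filter_upwards [ae_restrict_mem (isOpen_timeInterval T).measurableSet] with s hs using hs.1
    exact Measure.quasiMeasurePreserving_snd.ae h1
  have hN : AEStronglyMeasurable (fun z : Space n × ℝ => outwardNormal Ω z.1)
      (lateralMeasure Ω T) := hΩ.aestronglyMeasurable_normal.comp_fst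
  have hm : AEStronglyMeasurable (Function.uncurry (normalData Ω g)) (lateralMeasure Ω T) := by
    refine (hg.1.inner (𝕜 := ℝ) hN).congr ?_
    filter_upwards [hpos] with z hz
    rw [Function.uncurry, Function.uncurry, normalData, if_pos hz]
  refine hg.of_le hm ?_
  filter_upwards [hpos] with z hz
  rw [Function.uncurry, Function.uncurry, normalData, if_pos hz]
  exact (norm_inner_le_norm _ _).trans
    (mul_le_of_le_one_right (norm_nonneg _) (norm_outwardNormal_le _ _))

theorem IsBoundedC2Domain.isBoundaryDatum_normalData (hΩ : IsBoundedC2Domain Ω) {r₀ : ℝ}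
    (hr₀ : 0 < r₀) {T : EReal} {g : Space n → ℝ → Space n}
    (hg : MemLp (Function.uncurry g) ∞ (lateralMeasure Ω T))
    (hlog : ∀ Q ∈ frontier Ω, logDini r₀ T (normalData Ω g Q) < ∞) :
    IsBoundaryDatum Ω T
      (eLpNorm (Function.uncurry (normalData Ω g)) ∞ (lateralMeasure Ω T)).toReal
      (normalData Ω g) := by
  have := hΩ.isFiniteMeasure
  have hf := hΩ.memLp_normalData hg
  have hcont : ∀ Q ∈ frontier Ω, ContinuousOn (normalData Ω g Q) (timeInterval T) :=
    fun Q hQ => continuousOn_of_logDini_lt_top hr₀ (hlog Q hQ)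
  have hI := isOpen_timeInterval T
  -- statements for almost all times extend to all times
  have hdense : ∀ p : ℝ → Prop, (∀ᵐ s ∂(volume.restrict (timeInterval T)), p s) →
      ∀ s ∈ timeInterval T, ∃ u : ℕ → ℝ, (∀ j, u j ∈ timeInterval T ∧ p (u j)) ∧
        Tendsto u atTop (𝓝 s) := by
    intro p hp s hs
    rw [ae_restrict_iff' hI.measurableSet] at hp
    have h1 := (Measure.dense_of_ae hp).open_subset_closure_inter hI hs
    obtain ⟨u, hu, hlim⟩ := mem_closure_iff_seq_limit.mp h1
    exact ⟨u, fun j => ⟨(hu j).1, (hu j).2 (hu j).1⟩, hlim⟩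
  refine ⟨ENNReal.toReal_nonneg, hcont, ?_, ?_, fun Q s hs => if_neg (not_lt.mpr hs)⟩
  · have h1 : ∀ᵐ z ∂(lateralMeasure Ω T), |Function.uncurry (normalData Ω g) z| ≤
        (eLpNorm (Function.uncurry (normalData Ω g)) ∞ (lateralMeasure Ω T)).toReal := by
      have h2 := ae_le_eLpNormEssSup (f := Function.uncurry (normalData Ω g))
        (μ := lateralMeasure Ω T)
      rw [← eLpNorm_exponent_top] at h2
      filter_upwards [h2] with z hz
      rw [Real.enorm_eq_ofReal_abs] at hz
      exact (ENNReal.ofReal_le_iff_le_toReal hf.2.ne).mp hz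
    filter_upwards [Measure.ae_ae_of_ae_prod h1, ae_mem_frontier Ω] with Q hQ hQf s hs
    obtain ⟨u, hu, hlim⟩ := hdense _ hQ s hs
    have h3 := ((hcont Q hQf).continuousAt (hI.mem_nhds hs)).tendsto.comp hlim
    exact le_of_tendsto h3.abs (Eventually.of_forall fun j => (hu j).2)
  · intro s hs
    have h1 := hf.1.prod_swap.prodMk_left
    obtain ⟨u, hu, hlim⟩ := hdense _ h1 s hs
    refine aestronglyMeasurable_of_tendsto_ae atTop (fun j => (hu j).2) ?_
    filter_upwards [ae_mem_frontier Ω] with Q hQ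
    exact ((hcont Q hQ).continuousAt (hI.mem_nhds hs)).tendsto.comp hlim

end Data

/-! ### Differentiating the potentials -/

section Potentials

variable {n : ℕ} {Ω : Set (Space n)} {T : EReal} {B t : ℝ} {f : Space n → ℝ → ℝ}

namespace IsBoundaryDatum

theorem ae_abs_le (hf : IsBoundaryDatum Ω T B f) (ht : t ∈ timeInterval T) {τ : ℝ} (hτ : 0 ≤ τ) :
    ∀ᵐ Q ∂(surfaceMeasure Ω), |f Q (t - τ)| ≤ B := by
  filter_upwards [hf.bound] with Q hQ
  rcases le_or_gt (t - τ) 0 with h | h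
  · rw [hf.eq_zero Q _ h, abs_zero]
    exact hf.nonneg
  · exact hQ _ (mem_timeInterval_of_le ht h (by linarith))

theorem aestronglyMeasurable_sub (hf : IsBoundaryDatum Ω T B f) (ht : t ∈ timeInterval T) {τ : ℝ}
    (hτ : 0 ≤ τ) : AEStronglyMeasurable (fun Q => f Q (t - τ)) (surfaceMeasure Ω) := by
  rcases le_or_gt (t - τ) 0 with h | h
  · simp only [hf.eq_zero _ _ h]
    exact aestronglyMeasurable_const
  · exact hf.aestronglyMeasurable _ (mem_timeInterval_of_le ht h (by linarith))

theorem singleLayer_eq_zero (hf : IsBoundaryDatum Ω T B f) {s : ℝ} (hs : s ≤ 0) (P : Space n) :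
    singleLayer Ω (fun Q => f Q s) P = 0 := by
  simp [singleLayer, hf.eq_zero _ _ hs]

theorem continuousAt_singleLayer (hf : IsBoundaryDatum Ω T B f) (hΩ : IsBoundedC2Domain Ω)
    (hn : 3 ≤ n) {s : ℝ} (hs : s ∈ timeInterval T) (P : Space n) :
    ContinuousAt (fun s => singleLayer Ω (fun Q => f Q s) P) s := by
  have hI := (isOpen_timeInterval T).mem_nhds hs
  refine continuousAt_of_dominated (bound := fun Q => ‖laplaceKernel (P - Q)‖ * B) ?_ ?_
    ((hΩ.integrable_laplaceKernel hn P).norm.mul_const B) ?_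
  · filter_upwards [hI] with s' hs'
    exact (hΩ.integrable_laplaceKernel hn P).1.mul (hf.aestronglyMeasurable s' hs')
  · filter_upwards [hI] with s' hs'
    filter_upwards [hf.bound] with Q hQ
    rw [norm_mul]
    exact mul_le_mul_of_nonneg_left (hQ s' hs') (norm_nonneg _)
  · filter_upwards [ae_mem_frontier Ω] with Q hQ
    exact continuousAt_const.mul ((hf.continuousOn Q hQ).continuousAt hI)

end IsBoundaryDatum

end Potentials

end Stokes

namespace Stokes

section Potentials

variable {n : ℕ} {Ω : Set (Space n)} {T : EReal} {B C t : ℝ} {f : Space n → ℝ → ℝ}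
  {K : ℝ → Space n → ℝ}

theorem IsBoundedC2Domain.abs_integral_mul_le_of_bounded (hΩ : IsBoundedC2Domain Ω)
    {A V : Space n → ℝ} (hC : 0 ≤ C) (hA : ∀ P ∈ frontier Ω, |A P| ≤ C) (hV : ∀ P, |V P| ≤ B) :
    |∫ P, A P * V P ∂(surfaceMeasure Ω)| ≤ C * B * (surfaceMeasure Ω).real univ := by
  have := hΩ.isFiniteMeasure
  rw [← Real.norm_eq_abs]
  refine (norm_integral_le_of_norm_le (integrable_const (C * B)) ?_).trans ?_
  · filter_upwards [ae_mem_frontier Ω] with P hP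
    rw [norm_mul]
    exact mul_le_mul (hA P hP) (hV P) (norm_nonneg _) hC
  · rw [integral_const, smul_eq_mul, mul_comm]

/-- A kernel on `(0, ∞) × ∂Ω`, measurable in space, continuous in time, and integrable in time
uniformly in space. -/
structure IsTimeKernel (Ω : Set (Space n)) (C : ℝ) (K : ℝ → Space n → ℝ) : Prop where
  nonneg : 0 ≤ C
  aestronglyMeasurable : ∀ τ, AEStronglyMeasurable (K τ) (surfaceMeasure Ω)
  continuousOn : ∀ P ∈ frontier Ω, ContinuousOn (fun τ => K τ P) (Ioi 0)
  bound : ∀ τ, 0 < τ → ∀ P ∈ frontier Ω, |K τ P| ≤ C * (1 + τ ^ 2)⁻¹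

namespace IsTimeKernel

theorem ae_norm_le (hK : IsTimeKernel Ω C K) {τ : ℝ} (hτ : 0 < τ) :
    ∀ᵐ P ∂(surfaceMeasure Ω), ‖K τ P‖ ≤ C * (1 + τ ^ 2)⁻¹ := by
  filter_upwards [ae_mem_frontier Ω] with P hP using hK.bound τ hτ P hP

theorem abs_integral_mul_le (hK : IsTimeKernel Ω C K) (hΩ : IsBoundedC2Domain Ω) {τ B : ℝ}
    (hτ : 0 < τ) {V : Space n → ℝ} (hV : ∀ P, |V P| ≤ B) :
    |∫ P, K τ P * V P ∂(surfaceMeasure Ω)| ≤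
      C * B * (surfaceMeasure Ω).real univ * (1 + τ ^ 2)⁻¹ := by
  have hC := hK.nonneg
  exact (hΩ.abs_integral_mul_le_of_bounded (by positivity) (hK.bound τ hτ) hV).trans
    (le_of_eq (by ring))

theorem integrable_mul (hK : IsTimeKernel Ω C K) (hΩ : IsBoundedC2Domain Ω) {τ B : ℝ} (hτ : 0 < τ)
    {V : Space n → ℝ} (hVm : AEStronglyMeasurable V (surfaceMeasure Ω)) (hV : ∀ P, |V P| ≤ B) :
    Integrable (fun P => K τ P * V P) (surfaceMeasure Ω) := by
  have := hΩ.isFiniteMeasure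
  exact (Integrable.of_bound (hK.aestronglyMeasurable τ) _ (hK.ae_norm_le hτ)).mul_bdd (c := B)
    hVm (Eventually.of_forall hV)

theorem integrableOn (hK : IsTimeKernel Ω C K) (hΩ : IsBoundedC2Domain Ω) (hn : 3 ≤ n)
    (hf : IsBoundaryDatum Ω T B f) (ht : t ∈ timeInterval T) :
    IntegrableOn (fun τ => ∫ P, K τ P * singleLayer Ω (fun Q => f Q (t - τ)) P
      ∂(surfaceMeasure Ω)) (Ioi 0) := by
  have := hΩ.isFiniteMeasure
  obtain ⟨C₁, hC₁, hVb⟩ := hΩ.exists_abs_singleLayer_le hn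
  have hC := hK.nonneg
  have hB := hf.nonneg
  have hVb' : ∀ τ, 0 ≤ τ → ∀ P, |singleLayer Ω (fun Q => f Q (t - τ)) P| ≤ C₁ * B :=
    fun τ hτ => hVb _ B hB (hf.ae_abs_le ht hτ)
  refine Integrable.mono' (integrable_inv_one_add_sq.integrableOn.const_mul
    (C * (C₁ * B) * (surfaceMeasure Ω).real univ)) ?_ ?_
  · have ht0 : 0 < t := ht.1
    rw [← Ioo_union_Ici_eq_Ioi ht0, aestronglyMeasurable_union_iff]
    constructor
    · refine ContinuousOn.aestronglyMeasurable (fun τ hτ => ?_) measurableSet_Ioo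
      refine ContinuousAt.continuousWithinAt ?_
      have hI := isOpen_Ioo.mem_nhds hτ
      refine continuousAt_of_dominated (bound := fun _ => C * (C₁ * B)) ?_ ?_
        (integrable_const _) ?_
      · filter_upwards [hI] with τ' hτ'
        exact (hK.integrable_mul hΩ hτ'.1 (hΩ.aestronglyMeasurable_singleLayer hn
          (hf.aestronglyMeasurable_sub ht hτ'.1.le) (hf.ae_abs_le ht hτ'.1.le))
          (hVb' τ' hτ'.1.le)).1
      · filter_upwards [hI] with τ' hτ'
        filter_upwards [hK.ae_norm_le hτ'.1] with P hP
        rw [norm_mul]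
        refine mul_le_mul (hP.trans (mul_le_of_le_one_right hC ?_)) (hVb' τ' hτ'.1.le P)
          (norm_nonneg _) hC
        exact inv_le_one_of_one_le₀ (by nlinarith [sq_nonneg τ'])
      · filter_upwards [ae_mem_frontier Ω] with P hP
        refine ((hK.continuousOn P hP).continuousAt (Ioi_mem_nhds hτ.1)).mul ?_
        have h1 := hf.continuousAt_singleLayer hΩ hn (s := t - τ)
          (mem_timeInterval_of_le ht (by linarith [hτ.2]) (by linarith [hτ.1])) P
        exact ContinuousAt.comp (f := fun τ : ℝ => t - τ) h1
          (continuousAt_const.sub continuousAt_id)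
    · refine (aestronglyMeasurable_const (b := (0 : ℝ))).congr ?_
      filter_upwards [ae_restrict_mem measurableSet_Ici] with τ hτ
      have hτ : t ≤ τ := hτ
      simp [hf.singleLayer_eq_zero (show t - τ ≤ 0 by linarith)]
  · filter_upwards [ae_restrict_mem measurableSet_Ioi] with τ hτ
    exact hK.abs_integral_mul_le hΩ hτ (hVb' τ (le_of_lt hτ))

end IsTimeKernel

/-- The normal derivative of the heat kernel is a time kernel, away from the boundary. -/
theorem IsBoundedC2Domain.exists_isTimeKernel_normalDeriv (hΩ : IsBoundedC2Domain Ω) (hn : 3 ≤ n)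
    {ρ : ℝ} (hρ : 0 < ρ) : ∃ C : ℝ, 0 < C ∧ ∀ y : Space n, (∀ P ∈ frontier Ω, ρ ≤ ‖y - P‖) →
      ∀ D : ℝ, (∀ P ∈ frontier Ω, ‖y - P‖ ≤ D) → 0 ≤ D →
        IsTimeKernel Ω (D * C) (fun τ P => ⟪y - P, outwardNormal Ω P⟫ *
          (1 / τ * heatProfile n τ (‖y - P‖ ^ 2))) := by
  obtain ⟨C, hC, h⟩ := exists_heat_crude_le hn (show 0 < ρ ^ 2 by positivity)
  refine ⟨C, hC, fun y hy D hD hD0 => ⟨by positivity, fun τ => ?_, fun P hP => ?_,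
    fun τ hτ P hP => ?_⟩⟩
  · have hN := hΩ.aestronglyMeasurable_normal.aemeasurable
    unfold heatProfile
    refine AEMeasurable.aestronglyMeasurable ?_
    fun_prop
  · unfold heatProfile
    refine ContinuousOn.mul continuousOn_const (ContinuousOn.mul ?_ (ContinuousOn.mul ?_
      (ContinuousOn.rexp ?_)))
    · exact continuousOn_const.div continuousOn_id fun τ hτ => ne_of_gt hτ
    · refine continuousOn_const.div (by fun_prop) fun τ hτ => ?_
      have hτ : 0 < τ := hτ
      positivity
    · refine continuousOn_const.div (by fun_prop) fun τ hτ => ?_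
      have hτ : 0 < τ := hτ
      positivity
  · have h0 := heatProfile_nonneg (n := n) τ (‖y - P‖ ^ 2)
    have h1 := h τ (‖y - P‖ ^ 2) hτ (sq_nonneg _) (by
      have := hy P hP
      nlinarith)
    have h2 : |⟪y - P, outwardNormal Ω P⟫| ≤ D := (abs_real_inner_le_norm _ _).trans
      ((mul_le_of_le_one_right (norm_nonneg _) (norm_outwardNormal_le _ _)).trans (hD P hP))
    rw [abs_mul, abs_of_nonneg (show 0 ≤ 1 / τ * heatProfile n τ (‖y - P‖ ^ 2) by positivity),
      mul_assoc]
    refine mul_le_mul h2 (le_trans ?_ h1) (by positivity) hD0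
    refine mul_le_mul_of_nonneg_right ?_ h0
    refine le_mul_of_one_le_right (by positivity) ?_
    have : 0 ≤ ‖y - P‖ ^ 2 / τ := by positivity
    linarith

theorem IsBoundedC2Domain.isTimeKernel_heatHess_of_le (hΩ : IsBoundedC2Domain Ω) {y : Space n}
    (h : ∀ τ, 0 < τ → ∀ P ∈ frontier Ω,
      1 / τ * (1 + ‖y - P‖ ^ 2 / τ) * heatProfile n τ (‖y - P‖ ^ 2) ≤ C * (1 + τ ^ 2)⁻¹)
    (hC : 0 ≤ C) (e : Space n) :
    IsTimeKernel Ω (‖e‖ * C) (fun τ P => heatHess τ e (outwardNormal Ω P) (y - P)) := by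
  refine ⟨by positivity, fun τ => hΩ.aestronglyMeasurable_heatHess τ e y, fun P hP => ?_,
    fun τ hτ P hP => ?_⟩
  · unfold heatHess heatProfile
    refine ContinuousOn.mul (ContinuousOn.sub ?_ ?_) (ContinuousOn.mul ?_ (ContinuousOn.rexp ?_))
    · exact continuousOn_const.div continuousOn_id fun τ hτ => ne_of_gt hτ
    all_goals
      refine continuousOn_const.div (by fun_prop) fun τ hτ => ?_
      have hτ : 0 < τ := hτ
      positivity
  · refine (abs_heatHess_le hτ e _ (norm_outwardNormal_le Ω P)).trans ?_
    rw [mul_assoc ‖e‖]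
    exact mul_le_mul_of_nonneg_left (h τ hτ P hP) (norm_nonneg _)

theorem IsBoundedC2Domain.exists_isTimeKernel_heatHess (hΩ : IsBoundedC2Domain Ω) (hn : 3 ≤ n)
    {ρ : ℝ} (hρ : 0 < ρ) : ∃ C : ℝ, 0 < C ∧ ∀ y : Space n, (∀ P ∈ frontier Ω, ρ ≤ ‖y - P‖) →
      ∀ e : Space n,
        IsTimeKernel Ω (‖e‖ * C) (fun τ P => heatHess τ e (outwardNormal Ω P) (y - P)) := by
  obtain ⟨C, hC, h⟩ := exists_heat_crude_le hn (show 0 < ρ ^ 2 by positivity)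
  refine ⟨C, hC, fun y hy e => hΩ.isTimeKernel_heatHess_of_le (fun τ hτ P hP => ?_) hC.le e⟩
  refine h τ _ hτ (sq_nonneg _) ?_
  have := hy P hP
  nlinarith

/-- The heat potential as a double heat layer of single layer potentials, in terms of the time lag.
The integral extends over all lags since the density vanishes at nonpositive times. -/
theorem IsBoundedC2Domain.heatPotential_eq (hΩ : IsBoundedC2Domain Ω) (hn : 3 ≤ n)
    (hf : IsBoundaryDatum Ω T B f) (ht : t ∈ timeInterval T) {y : Space n}
    (hK : IsTimeKernel Ω C (fun τ P => ⟪y - P, outwardNormal Ω P⟫ *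
      (1 / τ * heatProfile n τ (‖y - P‖ ^ 2)))) :
    heatPotential Ω f y t = ∫ τ in Ioi (0 : ℝ), ∫ P, ⟪y - P, outwardNormal Ω P⟫ *
      (1 / τ * heatProfile n τ (‖y - P‖ ^ 2)) * singleLayer Ω (fun Q => f Q (t - τ)) P
        ∂(surfaceMeasure Ω) := by
  have ht0 : 0 < t := ht.1
  have h1 := intervalIntegral.integral_comp_sub_left (a := 0) (b := t) (fun τ =>
    ∫ Q, compositeKernel Ω Q y τ * f Q (t - τ) ∂(surfaceMeasure Ω)) t
  simp only [sub_sub_cancel, sub_self, sub_zero] at h1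
  rw [heatPotential, h1, intervalIntegral.integral_of_le ht0.le,
    setIntegral_eq_of_subset_of_forall_sdiff_eq_zero measurableSet_Ioi
      (show Ioc 0 t ⊆ Ioi (0 : ℝ) from Ioc_subset_Ioi_self)]
  · refine setIntegral_congr_fun measurableSet_Ioc fun τ hτ => ?_
    simp only [compositeKernel, fderiv_heatKernel hτ.1]
    exact (hΩ.integral_mul_singleLayer hn (hK.aestronglyMeasurable τ) (hK.ae_norm_le hτ.1)
      (hf.aestronglyMeasurable_sub ht hτ.1.le) (hf.ae_abs_le ht hτ.1.le)).symm
  · intro τ hτ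
    have : t - τ ≤ 0 := by
      by_contra hc
      exact hτ.2 ⟨hτ.1, by linarith⟩
    simp [hf.singleLayer_eq_zero this]

theorem clm_eq_sum_innerSL (L : Space n →L[ℝ] ℝ) : L = ∑ i,
    L (EuclideanSpace.basisFun (Fin n) ℝ i) • innerSL ℝ (EuclideanSpace.basisFun (Fin n) ℝ i) := by
  ext v
  conv_lhs => rw [← (EuclideanSpace.basisFun (Fin n) ℝ).sum_repr' v]
  simp only [map_sum, map_smul, sum_apply, smul_apply, smul_eq_mul, innerSL_apply_apply]
  exact Finset.sum_congr rfl fun i _ => mul_comm _ _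

theorem IsBoundedC2Domain.hasFDerivAt_heatPotential (hΩ : IsBoundedC2Domain Ω) (hn : 3 ≤ n)
    (hf : IsBoundaryDatum Ω T B f) (ht : t ∈ timeInterval T) {x : Space n}
    (hx : x ∉ frontier Ω) : ∃ F' : Space n →L[ℝ] ℝ,
      HasFDerivAt (fun y => heatPotential Ω f y t) F' x ∧
      ∀ e, F' e = ∫ τ in Ioi (0 : ℝ), ∫ P, heatHess τ e (outwardNormal Ω P) (x - P) *
        singleLayer Ω (fun Q => f Q (t - τ)) P ∂(surfaceMeasure Ω) := by
  have := hΩ.isFiniteMeasure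
  obtain ⟨ρ, hρ, hρx⟩ := exists_pos_le_norm_sub hx
  obtain ⟨R, hR⟩ := hΩ.isCompact_frontier.isBounded.subset_closedBall x
  obtain ⟨C₁, hC₁, h1⟩ := hΩ.exists_isTimeKernel_normalDeriv hn (half_pos hρ)
  obtain ⟨C₂, hC₂, h2⟩ := hΩ.exists_isTimeKernel_heatHess hn (half_pos hρ)
  obtain ⟨C₃, hC₃, hVb⟩ := hΩ.exists_abs_singleLayer_le hn
  have hB := hf.nonneg
  have hball : ∀ y ∈ Metric.ball x (ρ / 2), ∀ P ∈ frontier Ω,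
      ρ / 2 ≤ ‖y - P‖ ∧ ‖y - P‖ ≤ |R| + ρ := by
    intro y hy P hP
    rw [Metric.mem_ball, dist_eq_norm] at hy
    have e1 := hρx P hP
    have e2 : ‖P - x‖ ≤ |R| := by
      rw [← dist_eq_norm]
      exact (Metric.mem_closedBall.mp (hR hP)).trans (le_abs_self R)
    have e3 := norm_sub_le_norm_sub_add_norm_sub x y P
    have e4 := norm_sub_le_norm_sub_add_norm_sub y x P
    rw [norm_sub_rev x y] at e3
    rw [norm_sub_rev x P] at e4
    constructor <;> linarith
  have hk := fun y (hy : y ∈ Metric.ball x (ρ / 2)) => h1 y (fun P hP => (hball y hy P hP).1)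
    (|R| + ρ) (fun P hP => (hball y hy P hP).2) (by positivity)
  have hh := fun y (hy : y ∈ Metric.ball x (ρ / 2)) => h2 y (fun P hP => (hball y hy P hP).1)
  set J : Space n → ℝ → ℝ := fun y τ => ∫ P, ⟪y - P, outwardNormal Ω P⟫ *
    (1 / τ * heatProfile n τ (‖y - P‖ ^ 2)) * singleLayer Ω (fun Q => f Q (t - τ)) P
      ∂(surfaceMeasure Ω) with hJ
  have hVb' : ∀ τ, 0 ≤ τ → ∀ P, |singleLayer Ω (fun Q => f Q (t - τ)) P| ≤ C₃ * B :=
    fun τ hτ => hVb _ B hB (hf.ae_abs_le ht hτ)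
  have hJd : ∀ y ∈ Metric.ball x (ρ / 2), ∀ τ, 0 < τ →
      HasFDerivAt (fun y => J y τ) (fderiv ℝ (fun y => J y τ) y) y ∧
      ∀ e, fderiv ℝ (fun y => J y τ) y e = ∫ P, heatHess τ e (outwardNormal Ω P) (y - P) *
        singleLayer Ω (fun Q => f Q (t - τ)) P ∂(surfaceMeasure Ω) := by
    intro y hy τ hτ
    have hyf : y ∉ frontier Ω := fun hy' => by
      have := (hball y hy y hy').1
      rw [sub_self, norm_zero] at this
      linarith
    have hVm := hΩ.aestronglyMeasurable_singleLayer hn (hf.aestronglyMeasurable_sub ht hτ.le)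
      (hf.ae_abs_le ht hτ.le)
    have hVi : Integrable (singleLayer Ω (fun Q => f Q (t - τ))) (surfaceMeasure Ω) :=
      Integrable.of_bound hVm (C₃ * B) (Eventually.of_forall (hVb' τ hτ.le))
    obtain ⟨-, F', hF', hF'e⟩ := hΩ.hasFDerivAt_integral_radial hyf hVi
      hΩ.aestronglyMeasurable_normal (norm_outwardNormal_le Ω) 0
      (g := fun s => 1 / τ * heatProfile n τ s)
      (g' := fun s => 1 / τ * (-(1 / (2 * τ)) * heatProfile n τ s))
      (fun s _ => (hasDerivAt_heatProfile τ s).const_mul (1 / τ)) (by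
        unfold heatProfile
        fun_prop)
    simp only [zero_add] at hF'
    refine ⟨hF'.differentiableAt.hasFDerivAt, fun e => ?_⟩
    rw [hF'.fderiv, hF'e]
    refine integral_congr_ae (Eventually.of_forall fun P => ?_)
    simp only [heatHess]
    field_simp
    ring
  have hae : ∀ᵐ τ ∂(volume.restrict (Ioi (0 : ℝ))), 0 < τ := by
    filter_upwards [ae_restrict_mem measurableSet_Ioi] with τ hτ using hτ
  have hxb : x ∈ Metric.ball x (ρ / 2) := Metric.mem_ball_self (half_pos hρ)
  have hF'm : AEStronglyMeasurable (fun τ => fderiv ℝ (fun y => J y τ) x)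
      (volume.restrict (Ioi 0)) := by
    -- measurability of the derivative is checked in coordinates
    have h3 : AEStronglyMeasurable (fun τ => ∑ i,
        (∫ P, heatHess τ (EuclideanSpace.basisFun (Fin n) ℝ i) (outwardNormal Ω P) (x - P) *
        singleLayer Ω (fun Q => f Q (t - τ)) P ∂(surfaceMeasure Ω)) •
        innerSL ℝ (EuclideanSpace.basisFun (Fin n) ℝ i)) (volume.restrict (Ioi 0)) :=
      Finset.aestronglyMeasurable_fun_sum _ fun i _ =>
        (((hh x hxb _).integrableOn hΩ hn hf ht).1).smul_const _
    refine h3.congr ?_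
    filter_upwards [hae] with τ hτ
    conv_rhs => rw [clm_eq_sum_innerSL (fderiv ℝ (fun y => J y τ) x)]
    simp only [(hJd x hxb τ hτ).2]
  have hF'b : ∀ᵐ τ ∂(volume.restrict (Ioi (0 : ℝ))), ∀ y ∈ Metric.ball x (ρ / 2),
      ‖fderiv ℝ (fun y => J y τ) y‖ ≤
        C₂ * (C₃ * B) * (surfaceMeasure Ω).real univ * (1 + τ ^ 2)⁻¹ := by
    filter_upwards [hae] with τ hτ y hy
    refine ContinuousLinearMap.opNorm_le_bound _ (by positivity) fun e => ?_
    rw [(hJd y hy τ hτ).2, Real.norm_eq_abs]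
    refine ((hh y hy e).abs_integral_mul_le hΩ hτ (hVb' τ hτ.le)).trans (le_of_eq ?_)
    ring
  have hbi : IntegrableOn (fun τ : ℝ => C₂ * (C₃ * B) * (surfaceMeasure Ω).real univ *
      (1 + τ ^ 2)⁻¹) (Ioi 0) := integrable_inv_one_add_sq.integrableOn.const_mul _
  have hmain := hasFDerivAt_integral_of_dominated_of_fderiv_le (𝕜 := ℝ)
    (μ := volume.restrict (Ioi (0 : ℝ))) (F := J) (F' := fun y τ => fderiv ℝ (fun y => J y τ) y)
    (Metric.ball_mem_nhds x (half_pos hρ))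
    (by
      filter_upwards [Metric.ball_mem_nhds x (half_pos hρ)] with y hy
      exact ((hk y hy).integrableOn hΩ hn hf ht).1)
    ((hk x hxb).integrableOn hΩ hn hf ht) hF'm hF'b hbi
    (by filter_upwards [hae] with τ hτ y hy using (hJd y hy τ hτ).1)
  refine ⟨_, hmain.congr_of_eventuallyEq ?_, fun e => ?_⟩
  · filter_upwards [Metric.ball_mem_nhds x (half_pos hρ)] with y hy
    exact hΩ.heatPotential_eq hn hf ht (hk y hy)
  · rw [ContinuousLinearMap.integral_apply (hbi.mono' hF'm (hF'b.mono fun τ h => h x hxb))]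
    exact setIntegral_congr_fun measurableSet_Ioi fun τ hτ => (hJd x hxb τ hτ).2 e

theorem IsBoundedC2Domain.hasFDerivAt_singleLayer (hΩ : IsBoundedC2Domain Ω) (hn : 3 ≤ n)
    {h : Space n → ℝ} (hh : Integrable h (surfaceMeasure Ω)) {x : Space n} (hx : x ∉ frontier Ω) :
    ∃ F' : Space n →L[ℝ] ℝ, HasFDerivAt (fun y => singleLayer Ω h y) F' x ∧
      ∀ e, F' e = ∫ Q, gradKernel e (x - Q) * h Q ∂(surfaceMeasure Ω) := by
  obtain ⟨-, F', hF', hF'e⟩ := hΩ.hasFDerivAt_integral_radial hx hh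
    (m := fun _ => 0) aestronglyMeasurable_const (fun _ => by simp) 1
    (g := laplaceProfile n 0) (g' := laplaceProfileDeriv n 0)
    (fun s hs => hasDerivAt_laplaceProfile hn (by simpa using hs))
    (fun s hs => (hasDerivAt_laplaceProfileDeriv hn
      (by simpa using hs)).continuousAt.continuousWithinAt)
  refine ⟨F', ?_, fun e => ?_⟩
  · simpa only [singleLayer, laplaceKernel_eq hn, inner_zero_right, add_zero, one_mul] using hF'
  · rw [hF'e]
    refine integral_congr_ae (Eventually.of_forall fun Q => ?_)
    simp only [gradKernel_eq, inner_zero_right, inner_zero_left]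
    ring

/-- For a density independent of time, the time integral of the double heat layer is twice the
double layer of the Laplace kernel. -/
theorem IsBoundedC2Domain.integral_heatHess_mul (hΩ : IsBoundedC2Domain Ω) (hn : 3 ≤ n)
    {x e : Space n} (hx : x ∉ frontier Ω)
    (hK : IsTimeKernel Ω C (fun τ P => heatHess τ e (outwardNormal Ω P) (x - P)))
    {V : Space n → ℝ} (hVm : AEStronglyMeasurable V (surfaceMeasure Ω)) (hV : ∀ P, |V P| ≤ B) :
    IntegrableOn (fun τ => ∫ P, heatHess τ e (outwardNormal Ω P) (x - P) * V P
      ∂(surfaceMeasure Ω)) (Ioi 0) ∧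
    ∫ τ in Ioi (0 : ℝ), ∫ P, heatHess τ e (outwardNormal Ω P) (x - P) * V P
      ∂(surfaceMeasure Ω) =
      2 * ∫ P, hessKernel e (outwardNormal Ω P) (x - P) * V P ∂(surfaceMeasure Ω) := by
  have := hΩ.isFiniteMeasure
  have hB : 0 ≤ B := (abs_nonneg _).trans (hV 0)
  have hC := hK.nonneg
  have hint : Integrable (fun z : ℝ × Space n =>
      heatHess z.1 e (outwardNormal Ω z.2) (x - z.2) * V z.2)
      ((volume.restrict (Ioi (0 : ℝ))).prod (surfaceMeasure Ω)) := by
    have hb : Integrable (fun z : ℝ × Space n => (1 + z.1 ^ 2)⁻¹ * (C * B))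
        ((volume.restrict (Ioi (0 : ℝ))).prod (surfaceMeasure Ω)) :=
      integrable_inv_one_add_sq.integrableOn.mul_prod (integrable_const (C * B))
    refine hb.mono' ?_ ?_
    · have hN : AEMeasurable (fun z : ℝ × Space n => outwardNormal Ω z.2)
          ((volume.restrict (Ioi (0 : ℝ))).prod (surfaceMeasure Ω)) :=
        hΩ.aestronglyMeasurable_normal.aemeasurable.comp_snd
      refine AEStronglyMeasurable.mul ?_ hVm.comp_snd
      unfold heatHess heatProfile
      refine AEMeasurable.aestronglyMeasurable ?_
      fun_prop
    · have h1 : ∀ᵐ z ∂((volume.restrict (Ioi (0 : ℝ))).prod (surfaceMeasure Ω)), 0 < z.1 :=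
        Measure.quasiMeasurePreserving_fst.ae (ae_restrict_mem measurableSet_Ioi)
      have h2 : ∀ᵐ z ∂((volume.restrict (Ioi (0 : ℝ))).prod (surfaceMeasure Ω)),
          z.2 ∈ frontier Ω := Measure.quasiMeasurePreserving_snd.ae (ae_mem_frontier Ω)
      filter_upwards [h1, h2] with z hz1 hz2
      rw [norm_mul]
      calc _ ≤ C * (1 + z.1 ^ 2)⁻¹ * B := mul_le_mul (hK.bound _ hz1 _ hz2) (hV _) (abs_nonneg _)
            (by positivity)
        _ = _ := by ring
  refine ⟨hint.integral_prod_left, ?_⟩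
  rw [integral_integral_swap hint, ← integral_const_mul]
  refine integral_congr_ae ?_
  filter_upwards [ae_mem_frontier Ω] with P hP
  have hne : x - P ≠ 0 := sub_ne_zero.mpr fun h => hx (h ▸ hP)
  rw [integral_mul_const, (setIntegral_heatHess hn e _ hne).2, mul_assoc]

end Potentials

end Stokes

namespace Stokes

/-! ### The tangential derivative estimate -/

section Estimate

theorem integrableOn_inv_mul_log_sq {b : ℝ} (hb1 : b < 1) :
    IntegrableOn (fun τ : ℝ => τ⁻¹ / Real.log τ ^ 2) (Ioc 0 b) := by
  have hlog : ∀ τ ∈ Ioc 0 b, Real.log τ ≠ 0 := fun τ hτ =>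
    (Real.log_neg hτ.1 (hτ.2.trans_lt hb1)).ne
  refine intervalIntegral.integrableOn_deriv_of_nonneg (g := fun τ => -(Real.log τ)⁻¹) ?_ ?_ ?_
  · intro τ hτ
    rcases hτ.1.eq_or_lt with rfl | h0
    · -- with the convention `log 0 = 0`, the primitive is continuous at `0`
      refine ContinuousAt.continuousWithinAt ?_
      rw [continuousAt_iff_punctured_nhds, Real.log_zero, inv_zero]
      exact (tendsto_inv_atBot_zero.comp Real.tendsto_log_nhdsNE_zero).neg
    · exact (((Real.continuousAt_log h0.ne').inv₀ (hlog τ ⟨h0, hτ.2⟩)).neg).continuousWithinAt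
  · intro τ hτ
    refine ((Real.hasDerivAt_log hτ.1.ne').inv (hlog τ ⟨hτ.1, hτ.2.le⟩)).neg.congr_deriv ?_
    ring
  · intro τ hτ
    have := hτ.1
    positivity

theorem one_div_sqrt_pow_three {τ : ℝ} (hτ : 0 < τ) : 1 / √τ ^ 3 = τ ^ (-1 - (1 / 2 : ℝ)) := by
  rw [show (-1 - (1 / 2 : ℝ)) = -(3 / 2) by norm_num, Real.rpow_neg hτ.le, one_div,
    Real.sqrt_eq_rpow, ← Real.rpow_natCast, ← Real.rpow_mul hτ.le]
  norm_num

variable {n : ℕ} {Ω : Set (Space n)}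

/-- Under the log-Dini condition, the part of the heat potential which is due to the variation of
the density in time has bounded tangential derivatives. -/
theorem IsBoundedC2Domain.exists_timeVariation_le (hΩ : IsBoundedC2Domain Ω) (hn : 3 ≤ n)
    {r₀ : ℝ} (hr₀ : 0 < r₀) :
    ∃ C δ : ℝ, 0 < C ∧ 0 < δ ∧ ∀ p ∈ frontier Ω, ∀ d : ℝ, 0 < d → d ≤ δ →
      ∀ e : Space n, ⟪outwardNormal Ω p, e⟫ = 0 →
      ∀ (T : EReal) (f : Space n → ℝ → ℝ) (B M t : ℝ), IsBoundaryDatum Ω T B f → 0 ≤ M →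
      (∀ Q ∈ frontier Ω, logDini r₀ T (f Q) ≤ ENNReal.ofReal M) → t ∈ timeInterval T →
      |∫ τ in Ioi (0 : ℝ), ∫ P, heatHess τ e (outwardNormal Ω P)
        (p - d • outwardNormal Ω p - P) * singleLayer Ω (fun Q => f Q (t - τ) - f Q t) P
          ∂(surfaceMeasure Ω)| ≤ C * (B + M) * ‖e‖ := by
  obtain ⟨C₁, δ, hC₁, hδ, h1⟩ := hΩ.exists_heatHess_singleLayer_le hn
  have hτ₀ : 0 < min (1 / 4) (r₀ ^ 2) := by positivity
  have hτ₁ : min (1 / 4) (r₀ ^ 2) ≤ 1 / 4 := min_le_left _ _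
  have hτ₂ : min (1 / 4) (r₀ ^ 2) ≤ r₀ ^ 2 := min_le_right _ _
  -- up to time `τ₀` the Dini condition applies and `|ln τ| ≥ 1`
  generalize min (1 / 4) (r₀ ^ 2) = τ₀ at *
  obtain ⟨C₂, hC₂, h2⟩ := exists_heat_crude_le hn hτ₀
  obtain ⟨C₃, hC₃, hVb⟩ := hΩ.exists_abs_singleLayer_le hn
  set S := (surfaceMeasure Ω).real univ with hS
  have hS0 : 0 ≤ S := measureReal_nonneg
  set b₁ : ℝ → ℝ := (Ioc 0 τ₀).indicator fun τ => τ⁻¹ / Real.log τ ^ 2 with hb₁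
  have hi₁ : IntegrableOn b₁ (Ioi 0) := ((integrable_indicator_iff measurableSet_Ioc).mpr
    (integrableOn_inv_mul_log_sq (by linarith))).integrableOn
  have hb₁0 : ∀ τ, 0 ≤ b₁ τ := fun τ => indicator_nonneg (fun τ hτ => by
    have := hτ.1
    positivity) τ
  have hi₃ : IntegrableOn (fun τ : ℝ => (1 + τ ^ 2)⁻¹) (Ioi 0) :=
    integrable_inv_one_add_sq.integrableOn
  have hK₁ : 0 ≤ ∫ τ in Ioi (0 : ℝ), b₁ τ := integral_nonneg hb₁0
  have hK₃ : 0 ≤ ∫ τ in Ioi (0 : ℝ), (1 + τ ^ 2)⁻¹ := integral_nonneg fun τ => by positivity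
  set K₁ := ∫ τ in Ioi (0 : ℝ), b₁ τ with hK₁def
  set K₃ := ∫ τ in Ioi (0 : ℝ), (1 + τ ^ 2)⁻¹ with hK₃def
  refine ⟨C₁ * 4 * K₁ + C₁ * 6 * (2 * √Real.pi) + C₂ * C₃ * 2 * S * K₃, δ, by positivity, hδ,
    fun p hp d hd hdδ e he T f B M t hf hM hlog ht => ?_⟩
  have hB := hf.nonneg
  have h1' := h1 p hp d hd hdδ e he
  generalize p - d • outwardNormal Ω p = x at *
  obtain ⟨hi₂, hint₂⟩ := setIntegral_rpow_mul_exp_neg_div (a := 1 / 2) (r := d ^ 2 / 4)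
    (by norm_num) (by positivity)
  have hint₂' : d * ∫ τ in Ioi (0 : ℝ), τ ^ (-1 - (1 / 2 : ℝ)) * Real.exp (-(d ^ 2 / 4 / τ)) =
      2 * √Real.pi := by
    rw [hint₂, Real.Gamma_one_half_eq, ← Real.sqrt_eq_rpow,
      show 1 / (d ^ 2 / 4) = (2 / d) ^ 2 by field_simp; norm_num, Real.sqrt_sq (by positivity)]
    field_simp
  have hfin := ((hi₁.const_mul (C₁ * 4 * M * ‖e‖)).add
    (hi₂.const_mul (C₁ * 6 * M * ‖e‖ * d))).add (hi₃.const_mul (C₂ * C₃ * (2 * B) * ‖e‖ * S))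
  rw [← Real.norm_eq_abs]
  refine (norm_integral_le_of_norm_le hfin ?_).trans ?_
  · filter_upwards [ae_restrict_mem measurableSet_Ioi] with τ hτ
    have hτ : 0 < τ := hτ
    have hm : AEStronglyMeasurable (fun Q => f Q (t - τ) - f Q t) (surfaceMeasure Ω) :=
      (hf.aestronglyMeasurable_sub ht hτ.le).sub (hf.aestronglyMeasurable t ht)
    simp only [Pi.add_apply]
    have hp₂ : 0 ≤ C₁ * 6 * M * ‖e‖ * d *
        (τ ^ (-1 - (1 / 2 : ℝ)) * Real.exp (-(d ^ 2 / 4 / τ))) := by positivity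
    have hp₃ : 0 ≤ C₂ * C₃ * (2 * B) * ‖e‖ * S * (1 + τ ^ 2)⁻¹ := by positivity
    have hp₁ : 0 ≤ C₁ * 4 * M * ‖e‖ * b₁ τ := mul_nonneg (by positivity) (hb₁0 τ)
    rcases le_or_gt τ τ₀ with hτ' | hτ'
    · -- small times: the Dini condition
      have hlogτ : Real.log τ ≤ -1 := by
        rw [← Real.log_exp (-1)]
        exact Real.log_le_log hτ (by linarith [Real.exp_neg_one_gt_d9])
      have hQ : ∀ᵐ Q ∂(surfaceMeasure Ω), |f Q (t - τ) - f Q t| ≤ 4 * M / Real.log τ ^ 2 := by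
        filter_upwards [ae_mem_frontier Ω] with Q hQ
        exact abs_sub_le_of_logDini_le hr₀ hM (hlog Q hQ) ht hτ (by linarith) (hτ'.trans hτ₂)
      have h3 := h1' _ _ (by positivity) hm hQ (√τ) (Real.sqrt_pos.mpr hτ)
        (Real.sqrt_le_one.mpr (by linarith))
      rw [Real.sq_sqrt hτ.le, Real.log_sqrt hτ.le] at h3
      refine h3.trans (le_trans ?_ (le_add_of_nonneg_right hp₃))
      have e1 : b₁ τ = τ⁻¹ / Real.log τ ^ 2 := indicator_of_mem (show τ ∈ Ioc 0 τ₀ from ⟨hτ, hτ'⟩) _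
      have e2 : d / √τ ^ 3 * Real.exp (-(d ^ 2 / (4 * τ))) =
          d * (τ ^ (-1 - (1 / 2 : ℝ)) * Real.exp (-(d ^ 2 / 4 / τ))) := by
        rw [← one_div_sqrt_pow_three hτ, div_div]
        ring
      rw [e1, e2]
      have hY : 0 ≤ τ ^ (-1 - (1 / 2 : ℝ)) * Real.exp (-(d ^ 2 / 4 / τ)) := by positivity
      generalize τ ^ (-1 - (1 / 2 : ℝ)) * Real.exp (-(d ^ 2 / 4 / τ)) = Y at *
      have e3 : (1 + |Real.log τ / 2|) * (1 / Real.log τ ^ 2) ≤ 3 / 2 := by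
        rw [abs_of_neg (by linarith), mul_one_div, div_le_iff₀ (by nlinarith)]
        nlinarith
      calc C₁ * (4 * M / Real.log τ ^ 2) * ‖e‖ * (1 / τ + (1 + |Real.log τ / 2|) * (d * Y))
          = C₁ * 4 * M * ‖e‖ * (τ⁻¹ / Real.log τ ^ 2) + C₁ * 4 * M * ‖e‖ * d *
            ((1 + |Real.log τ / 2|) * (1 / Real.log τ ^ 2)) * Y := by ring
        _ ≤ C₁ * 4 * M * ‖e‖ * (τ⁻¹ / Real.log τ ^ 2) + C₁ * 4 * M * ‖e‖ * d * (3 / 2) * Y := by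
            gcongr
        _ = _ := by ring
    · -- large times: the kernel is bounded
      have hQ : ∀ᵐ Q ∂(surfaceMeasure Ω), |f Q (t - τ) - f Q t| ≤ 2 * B := by
        have := hf.ae_abs_le ht (le_refl (0 : ℝ))
        rw [sub_zero] at this
        filter_upwards [hf.ae_abs_le ht hτ.le, this] with Q h3 h4
        exact (abs_sub _ _).trans (by linarith)
      have h3 := hΩ.abs_integral_mul_le_of_bounded (C := ‖e‖ * (C₂ * (1 + τ ^ 2)⁻¹))
        (A := fun P => heatHess τ e (outwardNormal Ω P) (x - P)) (by positivity)
        (fun P _ => (abs_heatHess_le hτ e _ (norm_outwardNormal_le Ω P)).trans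
          (mul_le_mul_of_nonneg_left (h2 τ _ hτ (sq_nonneg _)
            (by nlinarith [sq_nonneg ‖x - P‖])) (norm_nonneg _)))
        (hVb _ (2 * B) (by positivity) hQ)
      refine h3.trans ((le_of_eq ?_).trans (le_add_of_nonneg_left (add_nonneg hp₁ hp₂)))
      ring
  · have hi₁₂ : Integrable (fun τ => C₁ * 4 * M * ‖e‖ * b₁ τ + C₁ * 6 * M * ‖e‖ * d *
        (τ ^ (-1 - (1 / 2 : ℝ)) * Real.exp (-(d ^ 2 / 4 / τ)))) (volume.restrict (Ioi 0)) :=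
      (hi₁.const_mul (C₁ * 4 * M * ‖e‖)).add (hi₂.const_mul (C₁ * 6 * M * ‖e‖ * d))
    simp only [Pi.add_apply]
    rw [integral_add hi₁₂ (hi₃.const_mul _), integral_add (hi₁.const_mul _) (hi₂.const_mul _),
      integral_const_mul, integral_const_mul, integral_const_mul, mul_assoc (C₁ * 6 * M * ‖e‖),
      hint₂']
    have e1 : C₁ * 4 * M * ‖e‖ * K₁ ≤ C₁ * 4 * (B + M) * ‖e‖ * K₁ := by gcongr; linarith
    have e2 : C₁ * 6 * M * ‖e‖ * (2 * √Real.pi) ≤ C₁ * 6 * (B + M) * ‖e‖ * (2 * √Real.pi) := by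
      gcongr
      linarith
    have e3 : C₂ * C₃ * (2 * B) * ‖e‖ * S * K₃ ≤ C₂ * C₃ * (2 * (B + M)) * ‖e‖ * S * K₃ := by
      gcongr
      linarith
    calc _ ≤ _ := add_le_add (add_le_add e1 e2) e3
      _ = _ := by ring

/-- The derivatives `∂_e S(f) + ∂_e T(f)` near the boundary, for tangential directions `e`. -/
theorem IsBoundedC2Domain.exists_near_le (hΩ : IsBoundedC2Domain Ω) (hn : 3 ≤ n)
    {r₀ : ℝ} (hr₀ : 0 < r₀) :
    ∃ C δ : ℝ, 0 < C ∧ 0 < δ ∧ ∀ p ∈ frontier Ω, ∀ d : ℝ, 0 < d → d ≤ δ →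
      p - d • outwardNormal Ω p ∈ Ω → ∀ e : Space n, ⟪outwardNormal Ω p, e⟫ = 0 →
      ∀ (T : EReal) (f : Space n → ℝ → ℝ) (B M t : ℝ), IsBoundaryDatum Ω T B f → 0 ≤ M →
      (∀ Q ∈ frontier Ω, logDini r₀ T (f Q) ≤ ENNReal.ofReal M) → t ∈ timeInterval T →
      |∫ Q, gradKernel e (p - d • outwardNormal Ω p - Q) * f Q t ∂(surfaceMeasure Ω) +
        ∫ τ in Ioi (0 : ℝ), ∫ P, heatHess τ e (outwardNormal Ω P)
          (p - d • outwardNormal Ω p - P) * singleLayer Ω (fun Q => f Q (t - τ)) P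
            ∂(surfaceMeasure Ω)| ≤ C * (B + M) * ‖e‖ := by
  obtain ⟨C₁, δ₁, hC₁, hδ₁, h1⟩ := hΩ.exists_stationary_le hn
  obtain ⟨C₂, δ₂, hC₂, hδ₂, h2⟩ := hΩ.exists_timeVariation_le hn hr₀
  obtain ⟨C₃, hC₃, hVb⟩ := hΩ.exists_abs_singleLayer_le hn
  refine ⟨C₁ + C₂, min δ₁ δ₂, by positivity, by positivity,
    fun p hp d hd hdδ hx e he T f B M t hf hM hlog ht => ?_⟩
  have hB := hf.nonneg
  have hft := hf.aestronglyMeasurable t ht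
  have hfb : ∀ᵐ Q ∂(surfaceMeasure Ω), |f Q t| ≤ B := by
    filter_upwards [hf.bound] with Q hQ using hQ t ht
  have h1' := h1 p hp d hd (hdδ.trans (min_le_left _ _)) hx e he _ B hB hft hfb
  have h2' := h2 p hp d hd (hdδ.trans (min_le_right _ _)) e he T f B M t hf hM hlog ht
  generalize p - d • outwardNormal Ω p = x at *
  have hxf : x ∉ frontier Ω := fun h => by
    rw [hΩ.isOpen.frontier_eq] at h
    exact h.2 hx
  obtain ⟨ρ, hρ, hρx⟩ := exists_pos_le_norm_sub hxf
  obtain ⟨C₄, hC₄, hK⟩ := hΩ.exists_isTimeKernel_heatHess hn hρ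
  have hKx := hK x hρx e
  obtain ⟨hi, hstat⟩ := hΩ.integral_heatHess_mul hn hxf hKx
    (hΩ.aestronglyMeasurable_singleLayer hn hft hfb) (hVb _ B hB hfb)
  have hsplit : ∫ τ in Ioi (0 : ℝ), ∫ P, heatHess τ e (outwardNormal Ω P) (x - P) *
      singleLayer Ω (fun Q => f Q (t - τ) - f Q t) P ∂(surfaceMeasure Ω) =
      (∫ τ in Ioi (0 : ℝ), ∫ P, heatHess τ e (outwardNormal Ω P) (x - P) *
        singleLayer Ω (fun Q => f Q (t - τ)) P ∂(surfaceMeasure Ω)) -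
      ∫ τ in Ioi (0 : ℝ), ∫ P, heatHess τ e (outwardNormal Ω P) (x - P) *
        singleLayer Ω (fun Q => f Q t) P ∂(surfaceMeasure Ω) := by
    rw [← integral_sub (hKx.integrableOn hΩ hn hf ht) hi]
    refine setIntegral_congr_fun measurableSet_Ioi fun τ hτ => ?_
    have hτ : 0 < τ := hτ
    have hm := hf.aestronglyMeasurable_sub ht hτ.le
    have hb := hf.ae_abs_le ht hτ.le
    rw [← integral_sub (hKx.integrable_mul hΩ hτ
      (hΩ.aestronglyMeasurable_singleLayer hn hm hb) (hVb _ B hB hb)) (hKx.integrable_mul hΩ hτ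
      (hΩ.aestronglyMeasurable_singleLayer hn hft hfb) (hVb _ B hB hfb))]
    congr 1
    funext P
    rw [← mul_sub]
    congr 1
    simp only [singleLayer, mul_sub]
    exact integral_sub (hΩ.integrable_laplaceKernel_mul hn hm hb P)
      (hΩ.integrable_laplaceKernel_mul hn hft hfb P)
  rw [hsplit, hstat] at h2'
  set I₁ := ∫ τ in Ioi (0 : ℝ), ∫ P, heatHess τ e (outwardNormal Ω P) (x - P) *
        singleLayer Ω (fun Q => f Q (t - τ)) P ∂(surfaceMeasure Ω) with hI₁
  set I₂ := ∫ P, hessKernel e (outwardNormal Ω P) (x - P) * singleLayer Ω (fun Q => f Q t) P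
    ∂(surfaceMeasure Ω) with hI₂
  set I₃ := ∫ Q, gradKernel e (x - Q) * f Q t ∂(surfaceMeasure Ω) with hI₃
  calc |I₃ + I₁| = |(I₃ + 2 * I₂) + (I₁ - 2 * I₂)| := by congr 1; ring
    _ ≤ C₁ * B * ‖e‖ + C₂ * (B + M) * ‖e‖ := (abs_add_le _ _).trans (add_le_add h1' h2')
    _ ≤ C₁ * (B + M) * ‖e‖ + C₂ * (B + M) * ‖e‖ := by gcongr; linarith
    _ = _ := by ring

/-- The derivatives of `S(f)` and `T(f)` at a positive distance from the boundary. -/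
theorem IsBoundedC2Domain.exists_far_le (hΩ : IsBoundedC2Domain Ω) (hn : 3 ≤ n) {ρ : ℝ}
    (hρ : 0 < ρ) : ∃ C : ℝ, 0 < C ∧ ∀ x : Space n, (∀ P ∈ frontier Ω, ρ ≤ ‖x - P‖) →
      ∀ (e : Space n) (T : EReal) (f : Space n → ℝ → ℝ) (B t : ℝ), IsBoundaryDatum Ω T B f →
      t ∈ timeInterval T →
      |∫ Q, gradKernel e (x - Q) * f Q t ∂(surfaceMeasure Ω) +
        ∫ τ in Ioi (0 : ℝ), ∫ P, heatHess τ e (outwardNormal Ω P) (x - P) *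
          singleLayer Ω (fun Q => f Q (t - τ)) P ∂(surfaceMeasure Ω)| ≤ C * B * ‖e‖ := by
  obtain ⟨C₁, hC₁, hVb⟩ := hΩ.exists_abs_singleLayer_le hn
  obtain ⟨C₂, hC₂, hK⟩ := hΩ.exists_isTimeKernel_heatHess hn hρ
  have := hΩ.isFiniteMeasure
  have hω := sphereArea_pos hn
  set S := (surfaceMeasure Ω).real univ with hS
  have hS0 : 0 ≤ S := measureReal_nonneg
  have hi₃ : IntegrableOn (fun τ : ℝ => (1 + τ ^ 2)⁻¹) (Ioi 0) :=
    integrable_inv_one_add_sq.integrableOn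
  have hK₃ : 0 ≤ ∫ τ in Ioi (0 : ℝ), (1 + τ ^ 2)⁻¹ := integral_nonneg fun τ => by positivity
  set K₃ := ∫ τ in Ioi (0 : ℝ), (1 + τ ^ 2)⁻¹ with hK₃def
  refine ⟨1 + 1 / (sphereArea n * ρ ^ (n - 1)) * S + C₂ * C₁ * S * K₃, by positivity,
    fun x hx e T f B t hf ht => ?_⟩
  have hB := hf.nonneg
  have e1 : |∫ Q, gradKernel e (x - Q) * f Q t ∂(surfaceMeasure Ω)| ≤
      1 / (sphereArea n * ρ ^ (n - 1)) * S * B * ‖e‖ := by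
    rw [← Real.norm_eq_abs]
    refine (norm_integral_le_of_norm_le (integrable_const
      (‖e‖ / (sphereArea n * ρ ^ (n - 1)) * B)) ?_).trans ?_
    · filter_upwards [ae_mem_frontier Ω, hf.bound] with Q hQ hQb
      rw [norm_mul]
      refine mul_le_mul ((abs_gradKernel_le hn e _).trans ?_) (hQb t ht) (norm_nonneg _)
        (by positivity)
      have := hx Q hQ
      gcongr
    · rw [integral_const, smul_eq_mul]
      exact le_of_eq (by ring)
  have e2 : |∫ τ in Ioi (0 : ℝ), ∫ P, heatHess τ e (outwardNormal Ω P) (x - P) *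
      singleLayer Ω (fun Q => f Q (t - τ)) P ∂(surfaceMeasure Ω)| ≤
      C₂ * C₁ * S * K₃ * B * ‖e‖ := by
    rw [← Real.norm_eq_abs]
    refine (norm_integral_le_of_norm_le
      (hi₃.const_mul (‖e‖ * C₂ * (C₁ * B) * S)) ?_).trans ?_
    · filter_upwards [ae_restrict_mem measurableSet_Ioi] with τ hτ
      have hτ : 0 < τ := hτ
      exact (hK x hx e).abs_integral_mul_le hΩ hτ (hVb _ B hB (hf.ae_abs_le ht hτ.le))
    · rw [integral_const_mul]
      exact le_of_eq (by ring)
  refine (abs_add_le _ _).trans ((add_le_add e1 e2).trans ?_)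
  have : 0 ≤ B * ‖e‖ := by positivity
  linarith

/-- The estimate of `∂_e S(f) + ∂_e T(f)` at an arbitrary point of `Ω`, for directions `e` tangential
at a nearest boundary point. -/
theorem IsBoundedC2Domain.exists_tangential_le (hΩ : IsBoundedC2Domain Ω) (hn : 3 ≤ n)
    {r₀ : ℝ} (hr₀ : 0 < r₀) :
    ∃ C : ℝ, 0 < C ∧ ∀ x ∈ Ω, ∀ P ∈ frontier Ω, dist x P = Metric.infDist x (frontier Ω) →
      ∀ e : Space n, ⟪outwardNormal Ω P, e⟫ = 0 →
      ∀ (T : EReal) (f : Space n → ℝ → ℝ) (B M t : ℝ), IsBoundaryDatum Ω T B f → 0 ≤ M →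
      (∀ Q ∈ frontier Ω, logDini r₀ T (f Q) ≤ ENNReal.ofReal M) → t ∈ timeInterval T →
      |∫ Q, gradKernel e (x - Q) * f Q t ∂(surfaceMeasure Ω) +
        ∫ τ in Ioi (0 : ℝ), ∫ P, heatHess τ e (outwardNormal Ω P) (x - P) *
          singleLayer Ω (fun Q => f Q (t - τ)) P ∂(surfaceMeasure Ω)| ≤
        C * (B + M) * ‖e‖ := by
  obtain ⟨C₁, δ, hC₁, hδ, h1⟩ := hΩ.exists_near_le hn hr₀
  obtain ⟨C₂, hC₂, h2⟩ := hΩ.exists_far_le hn hδ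
  refine ⟨C₁ + C₂, by positivity, fun x hx P hP hd e he T f B M t hf hM hlog ht => ?_⟩
  have hB := hf.nonneg
  have hBM : 0 ≤ (B + M) * ‖e‖ := by positivity
  rcases le_or_gt (dist x P) δ with hle | hlt
  · have hpos : 0 < dist x P := by
      refine dist_pos.mpr fun h => ?_
      rw [hΩ.isOpen.frontier_eq] at hP
      exact hP.2 (h ▸ hx)
    have hxeq := hΩ.sub_eq_smul_normal hx hP hd
    have h3 := h1 P hP (dist x P) hpos hle (by rwa [← hxeq]) e he T f B M t hf hM hlog ht
    rw [← hxeq] at h3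
    refine h3.trans ?_
    nlinarith
  · refine (h2 x (fun Q hQ => ?_) e T f B t hf ht).trans ?_
    · rw [← dist_eq_norm]
      exact hlt.le.trans (hd.trans_le (Metric.infDist_le_dist_of_mem hQ))
    · calc C₂ * B * ‖e‖ ≤ C₂ * (B + M) * ‖e‖ := by gcongr; linarith
        _ ≤ _ := by nlinarith

theorem norm_tangentialPart_le {ν v : Space n} (hν : ‖ν‖ = 1) {A : ℝ} (hA : 0 ≤ A)
    (h : ∀ e : Space n, ⟪ν, e⟫ = 0 → |⟪v, e⟫| ≤ A * ‖e‖) : ‖tangentialPart ν v‖ ≤ A := by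
  have h1 : ⟪ν, tangentialPart ν v⟫ = 0 := by
    rw [tangentialPart, inner_sub_right, real_inner_smul_right, inner_self_of_norm_one hν, mul_one,
      real_inner_comm, sub_self]
  have h2 : ⟪v, tangentialPart ν v⟫ = ‖tangentialPart ν v‖ ^ 2 := by
    rw [← real_inner_self_eq_norm_sq]
    nth_rw 2 [tangentialPart]
    rw [inner_sub_left, real_inner_smul_left, h1, mul_zero, sub_zero]
  have h3 := h _ h1
  rw [h2, abs_of_nonneg (sq_nonneg _)] at h3
  rcases (norm_nonneg (tangentialPart ν v)).eq_or_lt with h0 | h0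
  · rwa [← h0]
  · nlinarith

end Estimate

end Stokes

theorem mainTheorem2 (n : ℕ) (hn : 3 ≤ n) (Ω : Set (Space n)) (hΩ : Stokes.IsBoundedC2Domain Ω)
    (r₀ : ℝ) (hr₀ : 0 < r₀) :
    ∃ C : ℝ≥0, ∀ (T : EReal) (g : Space n → ℝ → Space n), 0 < T →
      MemLp (Function.uncurry g) ∞ (Stokes.lateralMeasure Ω T) →
      (∀ Q ∈ frontier Ω, Stokes.logDini r₀ T (Stokes.normalData Ω g Q) < ∞) →
      ∀ x ∈ Ω, ∀ t ∈ Stokes.timeInterval T,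
        DifferentiableAt ℝ
          (fun y => Stokes.singleLayer Ω (fun Q => Stokes.normalData Ω g Q t) y) x ∧
        DifferentiableAt ℝ
          (fun y => Stokes.heatPotential Ω (Stokes.normalData Ω g) y t) x ∧
        ∀ P ∈ frontier Ω, dist x P = Metric.infDist x (frontier Ω) →
          ‖Stokes.tangentialPart (Stokes.outwardNormal Ω P)
              (gradient (fun y => Stokes.singleLayer Ω (fun Q => Stokes.normalData Ω g Q t) y) x) +
            Stokes.tangentialPart (Stokes.outwardNormal Ω P)
              (gradient (fun y => Stokes.heatPotential Ω (Stokes.normalData Ω g) y t) x)‖ₑ ≤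
          C * (eLpNorm (Function.uncurry (Stokes.normalData Ω g)) ∞ (Stokes.lateralMeasure Ω T) +
            ⨆ Q ∈ frontier Ω, Stokes.logDini r₀ T (Stokes.normalData Ω g Q)) := by
  obtain ⟨C, hC, hmain⟩ := hΩ.exists_tangential_le hn hr₀
  refine ⟨C.toNNReal, fun T g _ hg hlog x hx t ht => ?_⟩
  have := hΩ.isFiniteMeasure
  have hf := hΩ.isBoundaryDatum_normalData hr₀ hg hlog
  have hfin := (hΩ.memLp_normalData hg).2.ne
  have hxf : x ∉ frontier Ω := fun h => by
    rw [hΩ.isOpen.frontier_eq] at h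
    exact h.2 hx
  have hfb : ∀ᵐ Q ∂(Stokes.surfaceMeasure Ω), ‖Stokes.normalData Ω g Q t‖ ≤
      (eLpNorm (Function.uncurry (Stokes.normalData Ω g)) ∞
          (Stokes.lateralMeasure Ω T)).toReal := by
    filter_upwards [hf.bound] with Q hQ using hQ t ht
  obtain ⟨S', hS, hSe⟩ := hΩ.hasFDerivAt_singleLayer hn
    (Integrable.of_bound (hf.aestronglyMeasurable t ht) _ hfb) hxf
  obtain ⟨T', hT, hTe⟩ := hΩ.hasFDerivAt_heatPotential hn hf ht hxf
  refine ⟨hS.differentiableAt, hT.differentiableAt, fun P hP hd => ?_⟩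
  set A := ⨆ Q ∈ frontier Ω, Stokes.logDini r₀ T (Stokes.normalData Ω g Q) with hA
  rcases eq_or_ne A ∞ with hAtop | hAtop
  · rw [hAtop, add_top, ENNReal.mul_top (by simpa using hC)]
    exact le_top
  have hlogA : ∀ Q ∈ frontier Ω,
      Stokes.logDini r₀ T (Stokes.normalData Ω g Q) ≤ ENNReal.ofReal A.toReal := by
    intro Q hQ
    rw [ENNReal.ofReal_toReal hAtop]
    exact le_iSup₂_of_le Q hQ le_rfl
  have hadd : ∀ ν v w : Space n, Stokes.tangentialPart ν v + Stokes.tangentialPart ν w =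
      Stokes.tangentialPart ν (v + w) := by
    intro ν v w
    simp only [Stokes.tangentialPart, inner_add_left, add_smul]
    abel
  have hB := hf.nonneg
  have hkey := Stokes.norm_tangentialPart_le (hΩ.norm_outwardNormal hP)
    (v := gradient (fun y => Stokes.singleLayer Ω (fun Q => Stokes.normalData Ω g Q t) y) x +
      gradient (fun y => Stokes.heatPotential Ω (Stokes.normalData Ω g) y t) x)
    (A := C * ((eLpNorm (Function.uncurry (Stokes.normalData Ω g)) ∞
      (Stokes.lateralMeasure Ω T)).toReal + A.toReal)) (by positivity) (fun e he => by
      rw [inner_add_left, Stokes.inner_gradient_left', Stokes.inner_gradient_left', hS.fderiv,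
        hT.fderiv, hSe, hTe]
      exact hmain x hx P hP hd e he T _ _ _ t hf ENNReal.toReal_nonneg hlogA ht)
  rw [hadd, ← ofReal_norm]
  refine (ENNReal.ofReal_le_ofReal hkey).trans (le_of_eq ?_)
  rw [ENNReal.ofReal_mul hC.le, ENNReal.ofReal_add hB ENNReal.toReal_nonneg,
    ENNReal.ofReal_toReal hfin, ENNReal.ofReal_toReal hAtop]
  rfl
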